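/- Let $F$ be a non-archimedean local field of characteristic $0$ (a completion $K_{\mathfrak p}$ of a number field) with valuation ring $\mathfrak o$ and maximal ideal $\mathfrak p\subset\mathfrak o$, and let $n\ge 1$. **Hecke algebras.** Let $G$ be a subgroup of a group and $H\supseteq G$ a submonoid of that group such that $G$ and $hGh^{-1}$ are commensurable for all $h\in H$. The Hecke algebra $\mathcal H(G,H)$ is the free $\mathbb Z$-module with basis the double cosets $GhG$, $h\in H$, with the product of $D_1=\dot\bigcup_i Gh_i$ and $D_2=\dot\bigcup_j Gk_j$ given by $D_1D_2=\sum_D c_D\,D$, where for $D=GdG$ the coefficient $c_D$ is the number of pairs $(i,j)$ with $Gh_ik_j=Gd$. **Matrices.** For an $\mathfrak o$-order $\Lambda$ in a finite-dimensional $F$-algebra $A$, let $\mathrm{Inv}_k(\Lambda)$ be the monoid of $k\times k$ matrices over $\Lambda$ that are invertible over $A$, with unit group $\mathrm{GL}_k(\Lambda)$. If $A$ has an involution $\bar{\ }$ that fixes $F$ elementwise, put $M^*=\overline M^{\mathrm{tr}}$, $J=\begin{pmatrix}0&I_n\\-I_n&0\end{pmatrix}$; let $\Delta_n(\Lambda)$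 be the monoid of $M\in\mathrm{Mat}_{2n}(\Lambda)$ with $M^*JM=mJ$ for some $m\in\mathfrak o\setminus\{0\}$ (the similitude of $M$), and let $\mathrm{Sp}_n(\Lambda)$ be the group of those with $m\in\mathfrak o^\times$. We write $[B_1,\dots,B_k]$ for a block diagonal matrix. A prime element of the valuation ring of a finite-dimensional division algebra over $F$ is a generator of its maximal ideal. In each of the following cases the pair $(G,H)$ satisfies the commensurability condition above, the Hecke algebra $\mathcal H(G,H)$ is commutative, it is generated as a $\mathbb Z$-algebra by the listed double cosets, and these are algebraically independent over $\mathbb Z$. A) (Unimodular.) Let $\Lambda$ be a maximal $\mathfrak o$-order in a finite-dimensional central simple $F$-algebra $A$. Identify $A=\mathrm{Mat}_r(D)$, $\Lambda=\mathrm{Mat}_r(\mathfrak o_D)$ with a division algebra $D$ with valuation ring (maximal order) $\mathfrak o_D$, and let $\pi_D$ be a prime element of $\mathfrak o_D$. The generators of $\mathcal H(\mathrm{GL}_n(\Lambda),\mathrm{Inv}_n(\Lambda))$ are the double cosets $T_i$, $1\le i\le rn$, of $[I_{rn-i},\pi_DI_i]\in\mathrm{Mat}_{rn}(\mathfrak o_D)=\mathrm{Mat}_n(\Lambda)$.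 B) (Inert hermitian.) Let $E/F$ be an unramified quadratic field extension with Galois conjugation $\bar{\ }$ and valuation ring $\Lambda$, and let $\pi_D$ be a prime element of $\Lambda$ with $\overline{\pi_D}=\pi_D$. The generators of $\mathcal H(\mathrm{Sp}_n(\Lambda),\Delta_n(\Lambda))$ are the double cosets $T_0$ of $[I_n,\pi_DI_n]$ and $T_i$, $1\le i\le n$, of $[I_{n-i},\pi_DI_i,\pi_D^2I_{n-i},\pi_DI_i]$. C) (Ramified hermitian and ramified quaternionic.) Let either $E/F$ be a ramified quadratic field extension with Galois conjugation $\bar{\ }$ and valuation ring $\Lambda$, or let $D$ be a quaternion division algebra over $F$ with canonical involution $\bar{\ }$ and valuation ring $\Lambda$; let $\pi_D$ be a prime element of $\Lambda$. The generators of $\mathcal H(\mathrm{Sp}_n(\Lambda),\Delta_n(\Lambda))$ are the double cosets $T_i$, $0\le i\le n$, of $[I_{n-i},\pi_DI_i,\pi_D\overline{\pi_D}I_{n-i},\pi_DI_i]$. D) (Split hermitian.) Let $\pi$ be a prime element of $\mathfrak o$ and let $\mathrm{RInv}_{2n}(\mathfrak o)$ be the monoid of all pairs $(M,l)\in\mathrm{Inv}_{2n}(\mathfrak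 o)\times\mathbb N_0$ such that $\mathfrak p^lM^{-1}$ is integral, on which $\mathrm{GL}_{2n}(\mathfrak o)$ acts trivially in the second component (that is, $g$ is identified with $(g,0)$). The generators of $\mathcal H(\mathrm{GL}_{2n}(\mathfrak o),\mathrm{RInv}_{2n}(\mathfrak o))$ are the double cosets $T_i$, $0\le i\le 2n$, of $([I_{2n-i},\pi I_i],1)$. E) (Split quaternionic.) Let $\Lambda=\mathrm{Mat}_2(\mathfrak o)$ in $A=\mathrm{Mat}_2(F)$ with its canonical involution (the adjugate), let $\pi$ be a prime element of $\mathfrak o$, and identify $\mathrm{Mat}_{2n}(\Lambda)=\mathrm{Mat}_{4n}(\mathfrak o)$ in the obvious way. Let $\Delta_n^+(\Lambda)\subseteq\Delta_n(\Lambda)$ and $\mathrm{Sp}_n^+(\Lambda)\subseteq\mathrm{Sp}_n(\Lambda)$ consist of the proper similitudes, i.e. of the $M$ whose reduced norm (the determinant of $M$ as a $4n\times4n$ matrix) is $m^{2n}$, where $m$ is the similitude of $M$. The generators of $\mathcal H(\mathrm{Sp}_n^+(\Lambda),\Delta_n^+(\Lambda))$ are the double cosets $S,S',R_2,\dots,R_{2n}$,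 where $S$ is generated by $[I_{2n},\pi I_{2n}]$, $S'$ by $[I_{2n-1},\pi,\pi I_{2n-2},1,\pi]$, $R_{2i}$ ($1\le i\le n$) by $[I_{2n-2i},\pi I_{2i},\pi^2I_{2n-2i},\pi I_{2i}]$ and $R_{2i-1}$ ($2\le i\le n$) by $[I_{2n-2i+1},\pi I_{2i-1},\pi^2I_{2n-2i},\pi,\pi^2,\pi I_{2i-2}]$. -/

import Mathlib

open scoped Matrix HeckeCosetModule

/-! ## The Hecke algebra of a group `G` and a monoid `Δ ⊇ G`

Mathlib's `HeckeRing Δ G ℤ` is the free `ℤ`-module with basis the double cosets `G h G`, `h ∈ Δ`.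
We equip it with the multiplication that counts right cosets `G h_i h'_j`. -/

namespace HeckeAlg

variable {𝒢 : Type*} [Group 𝒢] {Δ : Submonoid 𝒢} {G : Subgroup 𝒢}

/-- The set of right cosets `G x` of the ambient group. -/
abbrev RightCosets (G : Subgroup 𝒢) := Quotient (QuotientGroup.rightRel G)

/-- The right coset `G x`. -/
def rc (G : Subgroup 𝒢) (x : 𝒢) : RightCosets G := Quotient.mk _ x

/-- The right cosets that are contained in a double coset. -/
def cosetsIn (D : HeckeCoset Δ G G) : Set (RightCosets G) :=
  {c | ∃ x : Δ, HeckeCoset.mk G G x = D ∧ rc G (x : 𝒢) = c}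

/-- The coefficient of the double coset `D = G d G` in the product of `D₁ = ⋃ᵢ G hᵢ` and
`D₂ = ⋃ⱼ G kⱼ`: the multiplicity of the right coset `G d` among the right cosets `G hᵢ kⱼ`. -/
noncomputable def coeff (D₁ D₂ D : HeckeCoset Δ G G) : ℕ :=
  {p : RightCosets G × RightCosets G | p.1 ∈ cosetsIn D₁ ∧ p.2 ∈ cosetsIn D₂ ∧
    rc G (p.1.out * p.2.out) = rc G ((Quotient.out D : Δ) : 𝒢)}.ncard

lemma rc_eq {x y : 𝒢} : rc G x = rc G y ↔ y * x⁻¹ ∈ G := by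
  rw [rc, rc, Quotient.eq, QuotientGroup.rightRel_apply]

lemma rc_out (c : RightCosets G) : rc G c.out = c := Quotient.out_eq c

lemma rc_mul_left {g : 𝒢} (hg : g ∈ G) (x : 𝒢) : rc G (g * x) = rc G x := by
  rw [rc_eq]; simpa using hg

lemma mk_eq {x y : Δ} : HeckeCoset.mk G G x = HeckeCoset.mk G G y ↔
    ∃ a ∈ G, ∃ b ∈ G, (y : 𝒢) = a * x * b := by
  exact Quotient.eq.trans DoubleCoset.rel_iff

lemma mk_out (D : HeckeCoset Δ G G) : HeckeCoset.mk G G (Quotient.out D : Δ) = D :=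
  Quotient.out_eq D

/-- Right translation of right cosets. -/
def tr (G : Subgroup 𝒢) (z : 𝒢) : RightCosets G → RightCosets G :=
  Quotient.map (fun x => x * z) fun x y h => by
    change QuotientGroup.rightRel G _ _
    have h' : QuotientGroup.rightRel G x y := h
    rw [QuotientGroup.rightRel_apply] at h' ⊢
    simpa [mul_assoc] using h'

@[simp] lemma tr_rc (z x : 𝒢) : tr G z (rc G x) = rc G (x * z) := rfl

lemma tr_tr (z w : 𝒢) (c : RightCosets G) : tr G w (tr G z c) = tr G (z * w) c := by
  induction c using Quotient.inductionOn with
  | h x => change rc G (x * z * w) = rc G (x * (z * w)); rw [mul_assoc]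

lemma tr_injective (z : 𝒢) : Function.Injective (tr G z) := by
  intro c d h
  have := congrArg (tr G z⁻¹) h
  rw [tr_tr, tr_tr, mul_inv_cancel] at this
  induction c using Quotient.inductionOn with
  | h x => induction d using Quotient.inductionOn with
    | h y =>
      change rc G x = rc G y
      change rc G (x * 1) = rc G (y * 1) at this
      simpa using this

section
variable [IsHeckeTriple Δ G G]

lemma mem_of_mem {g : 𝒢} (hg : g ∈ G) : g ∈ Δ :=
  IsHeckeTriple.mem_of_mem_left (Δ := Δ) (H₁ := G) G hg

lemma mem_of_rc {x y : 𝒢} (hx : x ∈ Δ) (h : rc G x = rc G y) : y ∈ Δ := by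
  rw [rc_eq] at h
  have := Δ.mul_mem (mem_of_mem (Δ := Δ) h) hx
  simpa using this

lemma rc_mem {x : 𝒢} {D : HeckeCoset Δ G G} :
    rc G x ∈ cosetsIn D ↔ ∃ hx : x ∈ Δ, HeckeCoset.mk G G ⟨x, hx⟩ = D := by
  constructor
  · rintro ⟨y, rfl, hy⟩
    refine ⟨mem_of_rc y.2 hy, ?_⟩
    rw [rc_eq] at hy
    rw [mk_eq]
    exact ⟨_, G.inv_mem hy, 1, G.one_mem, by simp⟩
  · rintro ⟨hx, h⟩
    exact ⟨⟨x, hx⟩, h, rfl⟩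

lemma tr_mem {g : 𝒢} (hg : g ∈ G) {c : RightCosets G} {D : HeckeCoset Δ G G}
    (hc : c ∈ cosetsIn D) : tr G g c ∈ cosetsIn D := by
  obtain ⟨x, rfl, rfl⟩ := hc
  rw [tr_rc, rc_mem]
  refine ⟨Δ.mul_mem x.2 (mem_of_mem hg), ?_⟩
  rw [mk_eq]
  exact ⟨1, G.one_mem, g⁻¹, G.inv_mem hg, by simp⟩

open scoped Pointwise in
lemma finite_cosetsIn (D : HeckeCoset Δ G G) : (cosetsIn D).Finite := by
  set x : Δ := Quotient.out D with hx
  have hD : HeckeCoset.mk G G x = D := mk_out D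
  have hc : (x : 𝒢)⁻¹ ∈ Subgroup.Commensurable.commensurator G :=
    Subgroup.inv_mem _ (IsHeckeTriple.mem_commensurator_right (Δ := Δ) (H₂ := G) G x)
  rw [Subgroup.Commensurable.commensurator_mem_iff] at hc
  have h1 := hc.1
  set K := (ConjAct.toConjAct (x : 𝒢)⁻¹ • G).subgroupOf G with hK
  have : K.FiniteIndex := ⟨h1⟩
  have hfin : Finite (Quotient (QuotientGroup.rightRel K)) :=
    Finite.of_equiv _ (QuotientGroup.quotientRightRelEquivQuotientLeftRel K).symm
  let F : Quotient (QuotientGroup.rightRel K) → RightCosets G :=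
    fun q => rc G (x * (q.out : 𝒢))
  refine (Set.finite_range F).subset ?_
  rintro c ⟨y, hy, rfl⟩
  rw [← hD, mk_eq] at hy
  obtain ⟨a, ha, b, hb, hy⟩ := hy
  have hy' : (y : 𝒢) = a⁻¹ * x * b⁻¹ := by rw [hy]; group
  refine ⟨Quotient.mk _ ⟨b⁻¹, G.inv_mem hb⟩, ?_⟩
  change rc G _ = rc G _
  rw [hy', mul_assoc, rc_mul_left (G.inv_mem ha), rc_eq]
  have hq : QuotientGroup.rightRel K (Quotient.out (Quotient.mk (QuotientGroup.rightRel K)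
      (⟨b⁻¹, G.inv_mem hb⟩ : G))) ⟨b⁻¹, G.inv_mem hb⟩ := Quotient.mk_out _
  rw [QuotientGroup.rightRel_apply, hK, Subgroup.mem_subgroupOf,
    Subgroup.mem_pointwise_smul_iff_inv_smul_mem, ← ConjAct.toConjAct_inv, inv_inv,
    ConjAct.toConjAct_smul] at hq
  simp only [Subgroup.coe_mul, Subgroup.coe_inv, mul_inv_rev, mul_assoc] at hq ⊢
  exact hq

lemma finite_pairs (D₁ D₂ : HeckeCoset Δ G G) (P : RightCosets G × RightCosets G → Prop) :
    {p : RightCosets G × RightCosets G | p.1 ∈ cosetsIn D₁ ∧ p.2 ∈ cosetsIn D₂ ∧ P p}.Finite :=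
  ((finite_cosetsIn D₁).prod (finite_cosetsIn D₂)).subset fun _ h => ⟨h.1, h.2.1⟩

lemma finite_coeff (D₁ D₂ : HeckeCoset Δ G G) :
    (Function.support (coeff D₁ D₂)).Finite := by
  have h := ((finite_pairs D₁ D₂ fun _ => True).image
    fun p => rc G (p.1.out * p.2.out)).preimage
      (f := fun D : HeckeCoset Δ G G => rc G ((Quotient.out D : Δ) : 𝒢)) ?_
  · refine h.subset ?_
    intro D hD
    rw [Function.mem_support, coeff] at hD
    obtain ⟨p, hp1, hp2, hp3⟩ := Set.nonempty_of_ncard_ne_zero hD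
    exact ⟨p, ⟨hp1, hp2, trivial⟩, hp3⟩
  · intro D _ D' _ h
    simp only at h
    have h2 := (rc_mem (D := D)).1 (by rw [rc_mem]; exact ⟨(Quotient.out D : Δ).2, mk_out D⟩)
    have h3 : rc G ((Quotient.out D : Δ) : 𝒢) ∈ cosetsIn D' := by
      rw [h, rc_mem]; exact ⟨(Quotient.out D' : Δ).2, mk_out D'⟩
    obtain ⟨_, h4⟩ := rc_mem.1 h3
    exact (mk_out D).symm.trans h4

/-- The product of two double cosets. -/
noncomputable def cosetMul (D₁ D₂ : HeckeCoset Δ G G) : HeckeCoset Δ G G →₀ ℤ :=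
  Finsupp.ofSupportFinite (fun D => (coeff D₁ D₂ D : ℤ)) <|
    (finite_coeff D₁ D₂).subset fun D hD => by
      simpa [Function.mem_support] using hD

/-- The product on the Hecke algebra: the biadditive extension of the product of double cosets. -/
noncomputable def mul (f g : HeckeCoset Δ G G →₀ ℤ) : HeckeCoset Δ G G →₀ ℤ :=
  f.sum fun D₁ a => g.sum fun D₂ b => (a * b) • cosetMul D₁ D₂

lemma zero_mul' (g : HeckeCoset Δ G G →₀ ℤ) : mul 0 g = 0 := by simp [mul]

lemma mul_zero' (f : HeckeCoset Δ G G →₀ ℤ) : mul f 0 = 0 := by simp [mul]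

lemma add_mul' (f f' g : HeckeCoset Δ G G →₀ ℤ) : mul (f + f') g = mul f g + mul f' g := by
  rw [mul, Finsupp.sum_add_index']
  · rfl
  · intro D; simp
  · intro D a b; simp only [add_mul, add_smul]; rw [Finsupp.sum_add]

lemma mul_add' (f g g' : HeckeCoset Δ G G →₀ ℤ) : mul f (g + g') = mul f g + mul f g' := by
  rw [mul, mul, mul, ← Finsupp.sum_add]
  congr 1
  funext D a
  rw [Finsupp.sum_add_index']
  · intro D; simp
  · intro D a b; simp only [mul_add, add_smul]

lemma single_mul_single (D₁ D₂ : HeckeCoset Δ G G) (a b : ℤ) :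
    mul (Finsupp.single D₁ a) (Finsupp.single D₂ b) = (a * b) • cosetMul D₁ D₂ := by
  simp [mul]

/-- The sum of the right cosets contained in a double coset. -/
noncomputable def cosetSum (D : HeckeCoset Δ G G) : RightCosets G →₀ ℤ :=
  ∑ c ∈ (finite_cosetsIn D).toFinset, Finsupp.single c 1

/-- The embedding of the Hecke algebra into the free module on right cosets. -/
noncomputable def toC : (HeckeCoset Δ G G →₀ ℤ) →ₗ[ℤ] (RightCosets G →₀ ℤ) :=
  Finsupp.linearCombination ℤ cosetSum

lemma ext_rc {A B : (RightCosets G →₀ ℤ) →ₗ[ℤ] (RightCosets G →₀ ℤ)}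
    (h : ∀ x : 𝒢, A (Finsupp.single (rc G x) 1) = B (Finsupp.single (rc G x) 1)) : A = B := by
  refine Finsupp.lhom_ext' fun c => LinearMap.ext_ring ?_
  induction c using Quotient.inductionOn with
  | h x => exact h x

/-- Left multiplication on the free module on right cosets. -/
noncomputable def lmul (v : RightCosets G →₀ ℤ) :
    (RightCosets G →₀ ℤ) →ₗ[ℤ] (RightCosets G →₀ ℤ) :=
  Finsupp.linearCombination ℤ fun c => Finsupp.lmapDomain ℤ ℤ (tr G c.out) v

open scoped Classical in
lemma cosetSum_apply (D : HeckeCoset Δ G G) (c : RightCosets G) :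
    cosetSum D c = if c ∈ cosetsIn D then 1 else 0 := by
  simp [cosetSum, Finsupp.finsetSum_apply, Finsupp.single_apply]

open scoped Classical in
lemma toC_apply (f : HeckeCoset Δ G G →₀ ℤ) (x : 𝒢) :
    toC f (rc G x) = if h : x ∈ Δ then f (HeckeCoset.mk G G ⟨x, h⟩) else 0 := by
  induction f using Finsupp.induction_linear with
  | zero => simp
  | add f g hf hg => rw [map_add, Finsupp.add_apply, hf, hg]; split_ifs <;> simp
  | single D a =>
    rw [toC, Finsupp.linearCombination_single, Finsupp.smul_apply, cosetSum_apply, rc_mem]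
    by_cases h : x ∈ Δ
    · simp [h, Finsupp.single_apply, eq_comm]
    · simp [h]

lemma toC_injective : Function.Injective (toC (Δ := Δ) (G := G)) := by
  intro f g h
  ext D
  have := DFunLike.congr_fun h (rc G ((Quotient.out D : Δ) : 𝒢))
  rw [toC_apply, toC_apply, dif_pos (Quotient.out D : Δ).2, dif_pos (Quotient.out D : Δ).2] at this
  have e : HeckeCoset.mk G G ⟨((Quotient.out D : Δ) : 𝒢), (Quotient.out D : Δ).2⟩ = D := mk_out D
  rwa [e] at this

lemma tr_toC {g : 𝒢} (hg : g ∈ G) (f : HeckeCoset Δ G G →₀ ℤ) :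
    Finsupp.lmapDomain ℤ ℤ (tr G g) (toC f) = toC f := by
  ext c
  induction c using Quotient.inductionOn with
  | h x =>
    have h1 : (Quotient.mk _ x : RightCosets G) = tr G g (rc G (x * g⁻¹)) := by
      rw [tr_rc]; simp [rc]
    change Finsupp.mapDomain _ _ _ = toC f (rc G x)
    rw [h1, Finsupp.mapDomain_apply (tr_injective g), toC_apply, toC_apply]
    have hiff : x * g⁻¹ ∈ Δ ↔ x ∈ Δ :=
      ⟨fun h => by simpa using Δ.mul_mem h (mem_of_mem (Δ := Δ) hg),
        fun h => Δ.mul_mem h (mem_of_mem (G.inv_mem hg))⟩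
    by_cases h : x ∈ Δ
    · rw [dif_pos h, dif_pos (hiff.2 h)]
      congr 1
      rw [mk_eq]
      exact ⟨1, G.one_mem, g, hg, by simp⟩
    · rw [dif_neg h, dif_neg (mt hiff.1 h)]

lemma lmul_single (f : HeckeCoset Δ G G →₀ ℤ) (z : 𝒢) :
    lmul (toC f) (Finsupp.single (rc G z) 1) = Finsupp.lmapDomain ℤ ℤ (tr G z) (toC f) := by
  rw [lmul, Finsupp.linearCombination_single, one_smul]
  have h := rc_out (rc G z)
  rw [eq_comm, rc_eq] at h
  have e : tr G (rc G z).out = tr G z ∘ tr G ((rc G z).out * z⁻¹) := by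
    funext c; rw [Function.comp, tr_tr]; simp
  rw [e, Finsupp.lmapDomain_comp, LinearMap.comp_apply, tr_toC h]

lemma lmul_tr (f : HeckeCoset Δ G G →₀ ℤ) (w : 𝒢) (v : RightCosets G →₀ ℤ) :
    lmul (toC f) (Finsupp.lmapDomain ℤ ℤ (tr G w) v) =
      Finsupp.lmapDomain ℤ ℤ (tr G w) (lmul (toC f) v) := by
  suffices key : lmul (toC f) ∘ₗ Finsupp.lmapDomain ℤ ℤ (tr G w) =
      Finsupp.lmapDomain ℤ ℤ (tr G w) ∘ₗ lmul (toC f) from LinearMap.congr_fun key v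
  refine ext_rc fun x => ?_
  change lmul (toC f) (Finsupp.mapDomain (tr G w) (Finsupp.single (rc G x) 1)) =
    Finsupp.lmapDomain ℤ ℤ (tr G w) (lmul (toC f) (Finsupp.single (rc G x) 1))
  rw [Finsupp.mapDomain_single, tr_rc, lmul_single, lmul_single,
    ← LinearMap.comp_apply (Finsupp.lmapDomain ℤ ℤ (tr G w)), ← Finsupp.lmapDomain_comp]
  congr 2
  funext c
  exact (tr_tr x w c).symm

lemma toC_single (D : HeckeCoset Δ G G) : toC (Finsupp.single D 1) = cosetSum D := by
  rw [toC, Finsupp.linearCombination_single, one_smul]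

lemma lmul_cosetSum_apply (D₁ D₂ : HeckeCoset Δ G G) (c : RightCosets G) :
    lmul (cosetSum D₁) (cosetSum D₂) c =
      ({p : RightCosets G × RightCosets G | p.1 ∈ cosetsIn D₁ ∧ p.2 ∈ cosetsIn D₂ ∧
        rc G (p.1.out * p.2.out) = c}.ncard : ℤ) := by
  classical
  have h1 : lmul (cosetSum D₁) (cosetSum D₂) =
      ∑ p ∈ (finite_cosetsIn D₁).toFinset ×ˢ (finite_cosetsIn D₂).toFinset,
        Finsupp.single (rc G (p.1.out * p.2.out)) (1 : ℤ) := by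
    rw [Finset.sum_product_right]
    conv_lhs => rw [cosetSum.eq_1 D₂, map_sum]
    refine Finset.sum_congr rfl fun k _ => ?_
    rw [lmul, Finsupp.linearCombination_single, one_smul, cosetSum, map_sum]
    refine Finset.sum_congr rfl fun h _ => ?_
    change Finsupp.mapDomain _ _ = _
    rw [Finsupp.mapDomain_single]
    conv_lhs => rw [← rc_out h, tr_rc]
  rw [h1, Finsupp.finsetSum_apply]
  simp only [Finsupp.single_apply]
  rw [Finset.sum_boole, Set.ncard_eq_toFinset_card _ (finite_pairs D₁ D₂ _)]
  congr 2
  ext p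
  simp [and_assoc]

lemma toC_cosetMul (D₁ D₂ : HeckeCoset Δ G G) :
    toC (cosetMul D₁ D₂) = lmul (cosetSum D₁) (cosetSum D₂) := by
  ext c
  induction c using Quotient.inductionOn with
  | h x =>
    change toC (cosetMul D₁ D₂) (rc G x) = lmul (cosetSum D₁) (cosetSum D₂) (rc G x)
    rw [toC_apply]
    split_ifs with hx
    · set D := HeckeCoset.mk G G ⟨x, hx⟩ with hD
      set d : Δ := Quotient.out D with hd
      change (coeff D₁ D₂ D : ℤ) = _
      rw [coeff, ← lmul_cosetSum_apply]
      have hdx : HeckeCoset.mk G G d = HeckeCoset.mk G G ⟨x, hx⟩ := mk_out D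
      rw [mk_eq] at hdx
      obtain ⟨a, ha, b, hb, hab⟩ := hdx
      change x = a * d * b at hab
      have h2 : rc G x = tr G b (rc G (d : 𝒢)) := by
        rw [tr_rc, hab, mul_assoc, rc_mul_left ha]
      have h3 : Finsupp.lmapDomain ℤ ℤ (tr G b) (lmul (cosetSum D₁) (cosetSum D₂)) =
          lmul (cosetSum D₁) (cosetSum D₂) := by
        rw [← toC_single, ← toC_single, ← lmul_tr, tr_toC hb]
      rw [h2]
      conv_rhs => rw [← h3]
      exact (Finsupp.mapDomain_apply (tr_injective b) _ _).symm
    · rw [lmul_cosetSum_apply, eq_comm, Nat.cast_eq_zero,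
        Set.ncard_eq_zero (finite_pairs D₁ D₂ _), Set.eq_empty_iff_forall_notMem]
      rintro ⟨h, k⟩ ⟨h1, h2, h3⟩
      apply hx
      simp only at h1 h2 h3
      rw [← rc_out h] at h1
      rw [← rc_out k] at h2
      exact mem_of_rc (Δ.mul_mem (rc_mem.1 h1).1 (rc_mem.1 h2).1) h3

lemma lmul_add (v w u : RightCosets G →₀ ℤ) : lmul (v + w) u = lmul v u + lmul w u := by
  simp only [lmul, Finsupp.linearCombination_apply, map_add, smul_add, Finsupp.sum_add]

lemma lmul_smul (a : ℤ) (v u : RightCosets G →₀ ℤ) : lmul (a • v) u = a • lmul v u := by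
  simp only [lmul, Finsupp.linearCombination_apply, map_smul, Finsupp.smul_sum]
  refine Finsupp.sum_congr fun c _ => ?_
  rw [smul_comm]

lemma toC_mul (f g : HeckeCoset Δ G G →₀ ℤ) : toC (mul f g) = lmul (toC f) (toC g) := by
  induction f using Finsupp.induction_linear with
  | zero =>
    have h0 : lmul (G := G) 0 = 0 := ext_rc fun x => by simp [lmul]
    rw [zero_mul', map_zero, h0, LinearMap.zero_apply]
  | add f f' hf hf' => rw [add_mul', map_add, hf, hf', map_add, lmul_add]
  | single D a =>
    induction g using Finsupp.induction_linear with
    | zero => simp [mul_zero']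
    | add g g' hg hg' => rw [mul_add', map_add, hg, hg', map_add, map_add]
    | single D' b =>
      rw [single_mul_single, map_smul, toC_cosetMul, ← mul_one a, ← mul_one b,
        ← smul_eq_mul a 1, ← smul_eq_mul b 1, ← Finsupp.smul_single, ← Finsupp.smul_single,
        map_smul, map_smul, toC_single, toC_single, lmul_smul, map_smul]
      simp [mul_smul]

lemma mul_assoc' (f g h : HeckeCoset Δ G G →₀ ℤ) : mul (mul f g) h = mul f (mul g h) := by
  apply toC_injective
  rw [toC_mul (mul f g) h, toC_mul f (mul g h), toC_mul g h]
  suffices key : lmul (toC (mul f g)) = lmul (toC f) ∘ₗ lmul (toC g) from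
    LinearMap.congr_fun key (toC h)
  refine ext_rc fun x => ?_
  rw [LinearMap.comp_apply, lmul_single, lmul_single, lmul_tr, toC_mul]

lemma toC_one : toC (Finsupp.single (1 : HeckeCoset Δ G G) 1) = Finsupp.single (rc G 1) 1 := by
  classical
  rw [toC_single]
  ext c
  rw [cosetSum_apply, Finsupp.single_apply]
  congr 1
  apply propext
  constructor
  · rintro ⟨x, hx, rfl⟩
    rw [eq_comm, HeckeCoset.one_def, mk_eq] at hx
    obtain ⟨a, ha, b, hb, hx⟩ := hx
    rw [rc_eq, hx]
    simpa using G.mul_mem ha hb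
  · rintro rfl
    exact ⟨1, rfl, rfl⟩

lemma one_mul' (f : HeckeCoset Δ G G →₀ ℤ) :
    mul (Finsupp.single (1 : HeckeCoset Δ G G) 1) f = f := by
  apply toC_injective
  rw [toC_mul]
  suffices key : lmul (toC (Finsupp.single (1 : HeckeCoset Δ G G) 1)) = LinearMap.id from
    LinearMap.congr_fun key (toC f)
  refine ext_rc fun x => ?_
  rw [lmul_single, toC_one]
  change Finsupp.mapDomain _ _ = _
  rw [Finsupp.mapDomain_single, tr_rc, one_mul, LinearMap.id_apply]

lemma mul_one' (f : HeckeCoset Δ G G →₀ ℤ) :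
    mul f (Finsupp.single (1 : HeckeCoset Δ G G) 1) = f := by
  apply toC_injective
  rw [toC_mul, toC_one, lmul_single, tr_toC G.one_mem]

/-- The ring structure of the Hecke algebra. -/
noncomputable instance instRing : Ring (𝕋 Δ G ℤ) where
  __ := (inferInstance : AddCommGroup (HeckeCosetModule Δ G G ℤ))
  mul f g := HeckeCosetModule.of (mul f g)
  one := HeckeCosetModule.of (Finsupp.single 1 1)
  mul_assoc := mul_assoc'
  one_mul := one_mul'
  mul_one := mul_one'
  zero_mul := zero_mul'
  mul_zero := mul_zero'
  left_distrib := mul_add'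
  right_distrib := add_mul'
  zsmul := fun n f => n • f
  zsmul_zero' := zero_smul ℤ
  zsmul_succ' := fun n f => SubNegMonoid.zsmul_succ' n f
  zsmul_neg' := fun n f => SubNegMonoid.zsmul_neg' n f

end

/-- The double coset `G h G` as a basis element of the Hecke algebra. -/
noncomputable def dcoset (G : Subgroup 𝒢) (h : Δ) : 𝕋 Δ G ℤ :=
  HeckeCosetModule.of (Finsupp.single (HeckeCoset.mk G G h) 1)

/-- The ring `A` is commutative, and the `T i` generate it as a `ℤ`-algebra and are algebraically
independent over `ℤ`. -/
def IsAlgIndepGenerators {A : Type*} [Ring A] {ι : Type*} (T : ι → A) : Prop :=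
  ∃ hcomm : ∀ x y : A, x * y = y * x,
    Algebra.adjoin ℤ (Set.range T) = ⊤ ∧
    (letI : CommRing A := { (inferInstance : Ring A) with mul_comm := hcomm }
     AlgebraicIndependent ℤ T)

end HeckeAlg

/-! ## Maximal orders, prime elements, involutions -/

namespace LocalHecke

section orders

variable {𝔬 : Type*} [CommRing 𝔬] {A : Type*} [Ring A] [Algebra 𝔬 A]

/-- `Λ` is a maximal `𝔬`-order of the `F`-algebra `A`: it is maximal among the `𝔬`-subalgebras that
are finitely generated `𝔬`-modules and span `A` over `F`. -/
def IsMaximalOrder (F : Type*) [Field F] [Algebra F A] (Λ : Subalgebra 𝔬 A) : Prop :=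
  Maximal (fun Λ' : Subalgebra 𝔬 A =>
    (Subalgebra.toSubmodule Λ').FG ∧ Submodule.span F (Λ' : Set A) = ⊤) Λ

/-- `π` is a prime element of `Λ`, the valuation ring of a local division algebra:
the non-units of `Λ` are exactly the elements of `π Λ`. -/
def IsPrimeElement (Λ : Subalgebra 𝔬 A) (π : A) : Prop :=
  π ∈ Λ ∧ ∀ x ∈ Λ, (¬ ∃ y ∈ Λ, x * y = 1) ↔ ∃ y ∈ Λ, x = π * y

/-- For the valuation ring `Λ` of a quadratic extension: uniformizers of `𝔬` stay prime in `Λ`. -/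
def IsInert (Λ : Subalgebra 𝔬 A) : Prop :=
  ∀ ϖ : 𝔬, Irreducible ϖ → IsPrimeElement Λ (algebraMap 𝔬 A ϖ)

/-- For the valuation ring `Λ` of a quadratic extension: uniformizers of `𝔬` are associated to
squares of prime elements of `Λ`. -/
def IsRamified (Λ : Subalgebra 𝔬 A) : Prop :=
  ∀ (ϖ : 𝔬) (π : A), Irreducible ϖ → IsPrimeElement Λ π →
    ∃ u ∈ Λ, (∃ v ∈ Λ, u * v = 1) ∧ algebraMap 𝔬 A ϖ = π ^ 2 * u

end orders

section involutions

variable (F : Type*) [Field F] (A : Type*) [Ring A] [Algebra F A] [StarRing A]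

/-- For a quadratic field extension `A` of `F`: `star` is the nontrivial `F`-automorphism. -/
def StarIsConj : Prop :=
  (∀ a : F, star (algebraMap F A a) = algebraMap F A a) ∧ ∃ x : A, star x ≠ x

/-- For a quaternion algebra `A` over `F`: `star` is the canonical involution, that is, the
anti-automorphism over `F` with `x * star x ∈ F` for all `x`. -/
def StarIsCanonical : Prop :=
  (∀ a : F, star (algebraMap F A a) = algebraMap F A a) ∧
    ∀ x : A, ∃ a : F, x * star x = algebraMap F A a

end involutions

/-! ## Groups and monoids of matrices -/

/-- The diagonal matrix with diagonal `l`, where `pos` gives the order of the indices. -/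
def blockDiag {R ι : Type*} [Zero R] [DecidableEq ι] (pos : ι → ℕ) (l : List R) : Matrix ι ι R :=
  Matrix.diagonal fun j => l.getD (pos j) 0

/-- The position of an index in the `2 × 2` block form of size `2 n`. -/
def sumPos (n : ℕ) (j : Fin n ⊕ Fin n) : ℕ := (finSumFinEquiv j : Fin (n + n))

/-- The position of an index of a `k × k` matrix with entries `r × r` matrices, read as a
matrix of size `k r`, where `pos` gives the order of the blocks. -/
def prodPos {ι : Type*} (pos : ι → ℕ) (r : ℕ) (j : ι × Fin r) : ℕ := r * pos j.1 + j.2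

section matrices

variable {𝔬 : Type*} [CommRing 𝔬] {A : Type*} [Ring A] [Algebra 𝔬 A]

section unimodular

lemma mul_entries {ι : Type*} [Fintype ι] {Λ : Subalgebra 𝔬 A} {M N : Matrix ι ι A} (hM : ∀ i j, M i j ∈ Λ)
    (hN : ∀ i j, N i j ∈ Λ) (i j : ι) : (M * N) i j ∈ Λ := by
  rw [Matrix.mul_apply]
  exact Subalgebra.sum_mem _ fun k _ => Subalgebra.mul_mem _ (hM i k) (hN k j)

lemma one_entries {ι : Type*} [DecidableEq ι] (Λ : Subalgebra 𝔬 A) (i j : ι) : (1 : Matrix ι ι A) i j ∈ Λ := by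
  rw [Matrix.one_apply]
  split_ifs
  · exact Subalgebra.one_mem _
  · exact Subalgebra.zero_mem _

/-- The monoid of matrices with entries in `Λ` that are invertible over `A`. -/
def Inv (Λ : Subalgebra 𝔬 A) (ι : Type*) [Fintype ι] [DecidableEq ι] :
    Submonoid (Matrix ι ι A)ˣ where
  carrier := {M | ∀ i j, (M : Matrix ι ι A) i j ∈ Λ}
  one_mem' := one_entries Λ
  mul_mem' hM hN := mul_entries hM hN

/-- The general linear group of `Λ`. -/
def GLn (Λ : Subalgebra 𝔬 A) (ι : Type*) [Fintype ι] [DecidableEq ι] :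
    Subgroup (Matrix ι ι A)ˣ where
  carrier := {M | M ∈ Inv Λ ι ∧ M⁻¹ ∈ Inv Λ ι}
  one_mem' := ⟨one_mem _, by rw [inv_one]; exact one_mem _⟩
  mul_mem' hM hN := ⟨mul_mem hM.1 hN.1, by rw [mul_inv_rev]; exact mul_mem hN.2 hM.2⟩
  inv_mem' hM := ⟨hM.2, by rw [inv_inv]; exact hM.1⟩

end unimodular

section restricted

variable [IsLocalRing 𝔬]

/-- The monoid of pairs `(M, l)`, `M ∈ Inv Λ`, `l ∈ ℕ`, with `𝔭 ^ l M⁻¹` integral, where `𝔭` is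
the maximal ideal of `𝔬`. The second component is written multiplicatively. -/
def RInv (Λ : Subalgebra 𝔬 A) (ι : Type*) [Fintype ι] [DecidableEq ι] :
    Submonoid ((Matrix ι ι A)ˣ × Multiplicative ℤ) where
  carrier := {x | x.1 ∈ Inv Λ ι ∧ ∃ l : ℕ, x.2 = Multiplicative.ofAdd (l : ℤ) ∧
    ∀ c ∈ IsLocalRing.maximalIdeal 𝔬 ^ l, ∀ i j,
      (c • ((x.1⁻¹ : (Matrix ι ι A)ˣ) : Matrix ι ι A)) i j ∈ Λ}
  one_mem' := by
    refine ⟨one_mem _, 0, rfl, fun c _ i j => ?_⟩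
    rw [Prod.fst_one, inv_one, Units.val_one]
    exact Subalgebra.smul_mem _ (one_entries Λ i j) c
  mul_mem' := by
    rintro ⟨M, _⟩ ⟨N, _⟩ ⟨hM, l, rfl, hl⟩ ⟨hN, k, rfl, hk⟩
    refine ⟨mul_mem hM hN, l + k, by simp, fun c hc => ?_⟩
    rw [pow_add] at hc
    refine Submodule.mul_induction_on hc (fun a ha b hb i j => ?_) (fun a b ha hb i j => ?_)
    · have h := mul_entries (hk b hb) (hl a ha) i j
      rw [Matrix.smul_mul, Matrix.mul_smul, smul_smul, mul_comm b a] at h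
      simpa using h
    · rw [add_smul]
      exact Subalgebra.add_mem _ (ha i j) (hb i j)

end restricted

section modular

variable [StarRing A]

/-- The matrix `J`, with blocks `0, 1, -1, 0`. -/
def J (A : Type*) [Ring A] (n : ℕ) : Matrix (Fin n ⊕ Fin n) (Fin n ⊕ Fin n) A :=
  Matrix.fromBlocks 0 1 (-1) 0

/-- `M` has similitude `m`: `M* J M = m J`, where `M*` is the conjugate transpose. -/
def HasSimilitude {n : ℕ} (M : Matrix (Fin n ⊕ Fin n) (Fin n ⊕ Fin n) A) (m : 𝔬) : Prop :=
  Mᴴ * J A n * M = m • J A n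

lemma HasSimilitude.mul {n : ℕ} {M N : Matrix (Fin n ⊕ Fin n) (Fin n ⊕ Fin n) A} {m k : 𝔬}
    (hM : HasSimilitude M m) (hN : HasSimilitude N k) : HasSimilitude (M * N) (m * k) := by
  unfold HasSimilitude at *
  calc (M * N)ᴴ * J A n * (M * N) = Nᴴ * (Mᴴ * J A n * M) * N := by
        rw [Matrix.conjTranspose_mul]; simp only [Matrix.mul_assoc]
    _ = (m * k) • J A n := by rw [hM, Matrix.mul_smul, Matrix.smul_mul, hN, smul_smul]

lemma HasSimilitude.one {n : ℕ} :
    HasSimilitude (1 : Matrix (Fin n ⊕ Fin n) (Fin n ⊕ Fin n) A) (1 : 𝔬) := by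
  simp [HasSimilitude]

lemma HasSimilitude.inv {n : ℕ} {M : (Matrix (Fin n ⊕ Fin n) (Fin n ⊕ Fin n) A)ˣ} {m : 𝔬ˣ}
    (hM : HasSimilitude (M : Matrix (Fin n ⊕ Fin n) (Fin n ⊕ Fin n) A) (m : 𝔬)) :
    HasSimilitude ((M⁻¹ : (Matrix (Fin n ⊕ Fin n) (Fin n ⊕ Fin n) A)ˣ) :
      Matrix (Fin n ⊕ Fin n) (Fin n ⊕ Fin n) A) ((m⁻¹ : 𝔬ˣ) : 𝔬) := by
  unfold HasSimilitude at *
  set N : Matrix (Fin n ⊕ Fin n) (Fin n ⊕ Fin n) A :=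
    ((M⁻¹ : (Matrix (Fin n ⊕ Fin n) (Fin n ⊕ Fin n) A)ˣ) :
      Matrix (Fin n ⊕ Fin n) (Fin n ⊕ Fin n) A) with hN
  have h1 : (M : Matrix (Fin n ⊕ Fin n) (Fin n ⊕ Fin n) A) * N = 1 := M.mul_inv
  have h2 : Nᴴ * (M : Matrix (Fin n ⊕ Fin n) (Fin n ⊕ Fin n) A)ᴴ = 1 := by
    rw [← Matrix.conjTranspose_mul, h1, Matrix.conjTranspose_one]
  have h3 : J A n = (m : 𝔬) • (Nᴴ * J A n * N) := by
    calc J A n = (Nᴴ * (M : Matrix (Fin n ⊕ Fin n) (Fin n ⊕ Fin n) A)ᴴ) * J A n *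
          ((M : Matrix (Fin n ⊕ Fin n) (Fin n ⊕ Fin n) A) * N) := by simp [h1, h2]
      _ = Nᴴ * ((M : Matrix (Fin n ⊕ Fin n) (Fin n ⊕ Fin n) A)ᴴ * J A n * M) * N := by
          simp only [Matrix.mul_assoc]
      _ = (m : 𝔬) • (Nᴴ * J A n * N) := by rw [hM, Matrix.mul_smul, Matrix.smul_mul]
  conv_rhs => rw [h3, smul_smul, Units.inv_mul, one_smul]

/-- The monoid `Δ_n(Λ)` of matrices over `Λ` with nonzero similitude in `𝔬`. -/
def Delta [IsDomain 𝔬] (Λ : Subalgebra 𝔬 A) (n : ℕ) :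
    Submonoid (Matrix (Fin n ⊕ Fin n) (Fin n ⊕ Fin n) A)ˣ where
  carrier := {M | M ∈ Inv Λ (Fin n ⊕ Fin n) ∧
    ∃ m : 𝔬, m ≠ 0 ∧ HasSimilitude (M : Matrix (Fin n ⊕ Fin n) (Fin n ⊕ Fin n) A) m}
  one_mem' := ⟨one_mem _, 1, one_ne_zero, HasSimilitude.one⟩
  mul_mem' := by
    rintro M N ⟨hM, m, hm, hm'⟩ ⟨hN, k, hk, hk'⟩
    exact ⟨mul_mem hM hN, m * k, mul_ne_zero hm hk, hm'.mul hk'⟩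

/-- The modular group `Sp_n(Λ)` of matrices over `Λ` with similitude in `𝔬ˣ`. -/
def Spn (Λ : Subalgebra 𝔬 A) (n : ℕ) :
    Subgroup (Matrix (Fin n ⊕ Fin n) (Fin n ⊕ Fin n) A)ˣ where
  carrier := {M | M ∈ GLn Λ (Fin n ⊕ Fin n) ∧
    ∃ m : 𝔬ˣ, HasSimilitude (M : Matrix (Fin n ⊕ Fin n) (Fin n ⊕ Fin n) A) (m : 𝔬)}
  one_mem' := ⟨one_mem _, 1, HasSimilitude.one⟩
  mul_mem' := by
    rintro M N ⟨hM, m, hm⟩ ⟨hN, k, hk⟩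
    exact ⟨mul_mem hM hN, m * k, hm.mul hk⟩
  inv_mem' := by
    rintro M ⟨hM, m, hm⟩
    exact ⟨inv_mem hM, m⁻¹, hm.inv⟩

section proper

variable {F : Type*} [Field F] [Algebra F A] [Algebra 𝔬 F] {r : ℕ}

/-- The matrix over `F` of size `|ι| r` given by a matrix of size `|ι|` over an algebra `A` that is
identified with the `r × r` matrices over `F`. -/
def flatten {D ι : Type*} [Ring D] [Algebra F D] [Fintype ι] [DecidableEq ι]
    (φ : A ≃ₐ[F] Matrix (Fin r) (Fin r) D) :
    Matrix ι ι A →* Matrix (ι × Fin r) (ι × Fin r) D :=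
  ((Matrix.compRingEquiv ι (Fin r) D).toRingHom.comp
    (φ.toRingEquiv.toRingHom.mapMatrix : Matrix ι ι A →+* _)).toMonoidHom

/-- The reduced norm of matrices over a split central simple algebra `A`. -/
def redNorm {ι : Type*} [Fintype ι] [DecidableEq ι] (φ : A ≃ₐ[F] Matrix (Fin r) (Fin r) F) :
    Matrix ι ι A →* F :=
  Matrix.detMonoidHom.comp (flatten φ)

/-- The monoid of proper similitudes in `Δ_n(Λ)`, for a split quaternion algebra `A`: the
matrices with reduced norm `m ^ (2 n)`, where `m` is the similitude. -/
def properDelta [IsDomain 𝔬] (Λ : Subalgebra 𝔬 A) (φ : A ≃ₐ[F] Matrix (Fin 2) (Fin 2) F) (n : ℕ) :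
    Submonoid (Matrix (Fin n ⊕ Fin n) (Fin n ⊕ Fin n) A)ˣ where
  carrier := {M | M ∈ Inv Λ (Fin n ⊕ Fin n) ∧
    ∃ m : 𝔬, m ≠ 0 ∧ HasSimilitude (M : Matrix (Fin n ⊕ Fin n) (Fin n ⊕ Fin n) A) m ∧
      redNorm φ (M : Matrix (Fin n ⊕ Fin n) (Fin n ⊕ Fin n) A) = algebraMap 𝔬 F m ^ (2 * n)}
  one_mem' := ⟨one_mem _, 1, one_ne_zero, HasSimilitude.one, by simp⟩
  mul_mem' := by
    rintro M N ⟨hM, m, hm, hm', hm2⟩ ⟨hN, k, hk, hk', hk2⟩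
    exact ⟨mul_mem hM hN, m * k, mul_ne_zero hm hk, hm'.mul hk', by
      rw [Units.val_mul, map_mul, hm2, hk2, map_mul, mul_pow]⟩

/-- The group of proper similitudes in `Sp_n(Λ)`, for a split quaternion algebra `A`. -/
def properSp (Λ : Subalgebra 𝔬 A) (φ : A ≃ₐ[F] Matrix (Fin 2) (Fin 2) F) (n : ℕ) :
    Subgroup (Matrix (Fin n ⊕ Fin n) (Fin n ⊕ Fin n) A)ˣ where
  carrier := {M | M ∈ GLn Λ (Fin n ⊕ Fin n) ∧
    ∃ m : 𝔬ˣ, HasSimilitude (M : Matrix (Fin n ⊕ Fin n) (Fin n ⊕ Fin n) A) (m : 𝔬) ∧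
      redNorm φ (M : Matrix (Fin n ⊕ Fin n) (Fin n ⊕ Fin n) A) = algebraMap 𝔬 F m ^ (2 * n)}
  one_mem' := ⟨one_mem _, 1, HasSimilitude.one, by simp⟩
  mul_mem' := by
    rintro M N ⟨hM, m, hm, hm2⟩ ⟨hN, k, hk, hk2⟩
    exact ⟨mul_mem hM hN, m * k, hm.mul hk, by
      rw [Units.val_mul, map_mul, hm2, hk2, Units.val_mul, map_mul, mul_pow]⟩
  inv_mem' := by
    rintro M ⟨hM, m, hm, hm2⟩
    refine ⟨inv_mem hM, m⁻¹, hm.inv, ?_⟩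
    have h1 : redNorm φ (M : Matrix (Fin n ⊕ Fin n) (Fin n ⊕ Fin n) A) *
        redNorm φ ((M⁻¹ : (Matrix (Fin n ⊕ Fin n) (Fin n ⊕ Fin n) A)ˣ) :
          Matrix (Fin n ⊕ Fin n) (Fin n ⊕ Fin n) A) = 1 := by
      rw [← map_mul, Units.mul_inv, map_one]
    have h2 : algebraMap 𝔬 F m * algebraMap 𝔬 F ((m⁻¹ : 𝔬ˣ) : 𝔬) = 1 := by
      rw [← map_mul, Units.mul_inv, map_one]
    have h3 : algebraMap 𝔬 F m ^ (2 * n) ≠ 0 := pow_ne_zero _ (left_ne_zero_of_mul_eq_one h2)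
    rw [hm2] at h1
    apply mul_left_cancel₀ h3
    rw [h1, ← mul_pow, h2, one_pow]

end proper

end modular

end matrices

end LocalHecke

/-!
All the Hecke algebras here are polynomial rings for one reason. Let `G ⊆ Δ` be the given group and
monoid of matrices over a division ring `K` with a discrete valuation `v`. By Gaussian elimination
with integral matrices, every right coset of `G` in `Δ` contains a lower triangular matrix
(`gl_iwasawa`, `IsSiegelGroup.iwasawa`), and the values of its diagonal entries depend on the coset
only. Sending a double coset to the sum, over its right cosets, of the monomials with these
exponents is a ring homomorphism into the group algebra of `ℤ ^ d`
(`HeckeAlg.Triangular.spherical`). Order `ℤ ^ d` lexicographically. Elimination on both sides shows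
that every double coset contains a "dominant" diagonal matrix (`Elimination.cartan`), and that the
exponent of this matrix is the least one in the image of the double coset, where it has the
coefficient `1` (`Elimination.tri`). Double cosets are determined by these least exponents, so the
homomorphism is injective, and the Hecke algebra is commutative since the group algebra is.

The listed double cosets have least exponents that freely generate the monoid of all dominant
exponents; this is checked with dual coordinates, which are essentially the differences of
consecutive exponents. Freeness gives algebraic independence, by comparison of least monomials
(`HeckeAlg.algebraicIndependent_of_hasLead`). Generation is a rewriting argument: the product of
generators with the same least exponent as a given double coset differs from it by double cosets
with larger least exponents. This terminates because all matrices involved have inverses with the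
same bound on denominators, which leaves finitely many exponents
(`HeckeAlg.Triangular.isAlgIndepGenerators`, `Elimination.isAlgIndepGenerators`).

What remains is to provide `v` and the elimination, case by case.

* The valuation of a division algebra is constructed from a prime element `π` of its order: every
  nonzero element is a power of `π` times a unit of the order, and conjugation by `π` preserves the
  order (`IsPrimeOrder.exists_valuation`). The elements of the order are those integral over the
  base ring, whence an involution fixing the base field preserves `v` (`IsPrimeOrder.v_star`).
* For `GL`, one clears rows and columns with transvections (`gl_elimination`). Keeping track of the
  second component `l` in the restricted case only adds a grading (`HeckeAlg.Triangular.prod`).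
* The modular groups are ordered such that the form has an antidiagonal matrix of signs (`Signs`);
  Siegel transvections then map any isotropic vector to a multiple of a basis vector, and a pivot
  and its partner are cleared together (`IsSiegelGroup`). The values of similitudes are those of the
  base field. They are all the integers in the inert case and the even integers in the ramified
  cases (`ev_dvd_ev_algebraMap`), where the quaternionic case needs that a quaternion division
  algebra over `F` is ramified (`finrank_le_two_of_unramified`).
* A form over `Mat₂` that is skew with respect to the canonical involution, which is the adjugate,
  becomes a symmetric form of twice the size (`StarIsCanonical.sim_flattenEquiv`). Here elimination
  stops at a central hyperbolic plane, whose proper similitudes are diagonal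
  (`lower_of_lowerOff`). The exponents of its two basis vectors are not ordered, so that there are two
  generators `S` and `S'`, which are conjugate under an improper isometry but not under proper ones
  (`Signs.not_double_coset_swap`).

The least exponents of the listed double cosets themselves are those of their diagonal matrices by
the uniqueness of elementary divisors (`exps_eq_of_double_coset`). Commensurability holds because
the congruence subgroups have finite index (`mem_commensurator`).
-/


set_option linter.unusedSectionVars false

/-! ### Leading monomials in the group algebra of an ordered group -/

namespace HeckeAlg

section lead

variable {X : Type*} [AddCommGroup X] [LinearOrder X] [IsOrderedAddMonoid X]

/-- `x` is the least exponent that occurs in `f`, and it occurs with coefficient `1`. -/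
def HasLead (f : AddMonoidAlgebra ℤ X) (x : X) : Prop :=
  f.coeff x = 1 ∧ ∀ y, f.coeff y ≠ 0 → x ≤ y

lemma HasLead.one : HasLead (1 : AddMonoidAlgebra ℤ X) 0 := by
  rw [AddMonoidAlgebra.one_def]
  refine ⟨by simp, fun y hy => ?_⟩
  rw [AddMonoidAlgebra.coeff_single, Finsupp.single_apply] at hy
  by_contra h
  exact hy (if_neg fun h0 => h h0.le)

lemma HasLead.mul {f g : AddMonoidAlgebra ℤ X} {x y : X} (hf : HasLead f x) (hg : HasLead g y) :
    HasLead (f * g) (x + y) := by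
  classical
  constructor
  · rw [AddMonoidAlgebra.coeff_mul, Finsupp.sum, Finset.sum_eq_single x, Finsupp.sum,
      Finset.sum_eq_single y]
    · rw [if_pos rfl, hf.1, hg.1, one_mul]
    · intro b _ hb
      rw [if_neg fun h => hb (add_left_cancel h)]
    · intro h
      rw [Finsupp.notMem_support_iff] at h
      simp [h]
    · intro a ha hax
      refine Finset.sum_eq_zero fun b hb => ?_
      rw [Finsupp.mem_support_iff] at ha hb
      have h1 := lt_of_le_of_ne (hf.2 a ha) (Ne.symm hax)
      exact if_neg (add_lt_add_of_lt_of_le h1 (hg.2 b hb)).ne'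
    · intro h
      rw [Finsupp.notMem_support_iff] at h
      simp [hf.1] at h
  · intro z hz
    by_contra hlt
    apply hz
    rw [AddMonoidAlgebra.coeff_mul]
    refine Finset.sum_eq_zero fun a ha => Finset.sum_eq_zero fun b hb => if_neg ?_
    rw [Finsupp.mem_support_iff] at ha hb
    rintro rfl
    exact hlt (add_le_add (hf.2 a ha) (hg.2 b hb))

lemma HasLead.pow {f : AddMonoidAlgebra ℤ X} {x : X} (hf : HasLead f x) (k : ℕ) :
    HasLead (f ^ k) (k • x) := by
  induction k with
  | zero => simpa using HasLead.one
  | succ k ih => rw [pow_succ, succ_nsmul]; exact ih.mul hf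

lemma HasLead.prod {ι : Type*} (s : Finset ι) {f : ι → AddMonoidAlgebra ℤ X} {w : ι → X}
    (h : ∀ i ∈ s, HasLead (f i) (w i)) : HasLead (∏ i ∈ s, f i) (∑ i ∈ s, w i) := by
  classical
  induction s using Finset.induction_on with
  | empty => simpa using HasLead.one
  | insert a s ha ih =>
    rw [Finset.prod_insert ha, Finset.sum_insert ha]
    exact (h a (Finset.mem_insert_self a s)).mul
      (ih fun i hi => h i (Finset.mem_insert_of_mem hi))

/-- Elements with additively independent leading exponents are algebraically independent. -/
lemma algebraicIndependent_of_hasLead {ι : Type*} {f : ι → AddMonoidAlgebra ℤ X} {w : ι → X}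
    (h : ∀ i, HasLead (f i) (w i))
    (hw : Function.Injective fun c : ι →₀ ℕ => c.sum fun i k => k • w i) :
    AlgebraicIndependent ℤ f := by
  rw [algebraicIndependent_iff]
  intro p hp
  by_contra hne
  obtain ⟨c, hc, hmin⟩ := Finset.exists_min_image p.support
    (fun c : ι →₀ ℕ => c.sum fun i k => k • w i)
    (Finset.nonempty_iff_ne_empty.2 fun h0 => hne (MvPolynomial.support_eq_empty.1 h0))
  have hl : ∀ c : ι →₀ ℕ, HasLead (∏ i ∈ c.support, f i ^ c i) (c.sum fun i k => k • w i) :=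
    fun c => HasLead.prod _ fun i _ => (h i).pow _
  rw [MvPolynomial.aeval_def, MvPolynomial.eval₂_eq] at hp
  have h0 := congrArg (fun q => q.coeff (c.sum fun i k => k • w i)) hp
  simp only [AddMonoidAlgebra.coeff_sum, AddMonoidAlgebra.coeff_zero, Finsupp.finsetSum_apply,
    ← Algebra.smul_def, AddMonoidAlgebra.coeff_smul, Finsupp.smul_apply, smul_eq_mul,
    Finsupp.coe_zero, Pi.zero_apply] at h0
  rw [Finset.sum_eq_single c, (hl c).1, mul_one] at h0
  · exact MvPolynomial.mem_support_iff.1 hc h0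
  · intro b hb hbc
    by_contra hne0
    have h1 := (hl b).2 _ (right_ne_zero_of_mul hne0)
    exact hbc (hw (le_antisymm h1 (hmin b hb)))
  · intro h1; exact absurd hc h1

end lead

/-! ### A spherical map and triangularity -/

section spherical

variable {𝒢 : Type*} [Group 𝒢] {Δ : Submonoid 𝒢} {G : Subgroup 𝒢}
variable {X : Type*} [AddCommGroup X] [LinearOrder X] [IsOrderedAddMonoid X]

open scoped Classical in
/-- The exponent of a right coset that meets `B`: the value of `e` at any element of `B` in it. -/
noncomputable def expo (G : Subgroup 𝒢) (B : Subgroup 𝒢) (e : 𝒢 → X) (c : RightCosets G) : X :=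
  if h : ∃ b ∈ B, rc G b = c then e h.choose else 0

/-- The linear map that sends a right coset `G b`, `b ∈ B`, to the monomial of exponent `e b`. -/
noncomputable def monom (G : Subgroup 𝒢) (B : Subgroup 𝒢) (e : 𝒢 → X) :
    (RightCosets G →₀ ℤ) →ₗ[ℤ] AddMonoidAlgebra ℤ X :=
  Finsupp.linearCombination ℤ fun c => AddMonoidAlgebra.single (expo G B e c) 1

/-- The data that make the Hecke algebra of `G` and `Δ` triangular with respect to a subgroup `B`
with `Δ ⊆ G B`, on which `e` is an additive exponent with values in an ordered group: every
`b ∈ B ∩ Δ` has an element `d` satisfying `Dom` ("dominant") in its double coset, with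
`e d ≤ e b`, and with equality only if `G b = G d`. -/
structure Triangular (Δ : Submonoid 𝒢) (G : Subgroup 𝒢) (B : Subgroup 𝒢) (e : 𝒢 → X)
    (Dom : 𝒢 → Prop) : Prop where
  e_mul : ∀ b ∈ B, ∀ c ∈ B, e (b * c) = e b + e c
  e_unit : ∀ b ∈ B, b ∈ G → e b = 0
  iwasawa : ∀ x ∈ Δ, ∃ b ∈ B, rc G x = rc G b
  dom_mem : ∀ d, Dom d → d ∈ B
  tri : ∀ b ∈ B, b ∈ Δ → ∃ d, Dom d ∧ (∃ g ∈ G, ∃ g' ∈ G, d = g * b * g') ∧ e d ≤ e b ∧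
    (e d = e b → rc G b = rc G d)
  dom_inj : ∀ d d', Dom d → Dom d' → d ∈ Δ → d' ∈ Δ → e d = e d' → rc G d = rc G d'

namespace Triangular

variable {B : Subgroup 𝒢} {e : 𝒢 → X} {Dom : 𝒢 → Prop} (hT : Triangular Δ G B e Dom)
include hT

lemma e_eq_of_rc {b c : 𝒢} (hb : b ∈ B) (hc : c ∈ B) (h : rc G b = rc G c) : e b = e c := by
  rw [rc_eq] at h
  have h1 : e (c * b⁻¹) = 0 := hT.e_unit _ (B.mul_mem hc (B.inv_mem hb)) h
  have h2 := hT.e_mul (c * b⁻¹) (B.mul_mem hc (B.inv_mem hb)) b hb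
  rw [inv_mul_cancel_right, h1, zero_add] at h2
  exact h2.symm

lemma expo_rc {b : 𝒢} (hb : b ∈ B) : expo G B e (rc G b) = e b := by
  have h : ∃ b' ∈ B, rc G b' = rc G b := ⟨b, hb, rfl⟩
  rw [expo, dif_pos h]
  exact hT.e_eq_of_rc h.choose_spec.1 hb h.choose_spec.2

lemma monom_single {b : 𝒢} (hb : b ∈ B) :
    monom G B e (Finsupp.single (rc G b) 1) = AddMonoidAlgebra.single (e b) 1 := by
  rw [monom, Finsupp.linearCombination_single, one_smul, hT.expo_rc hb]

variable [IsHeckeTriple Δ G G]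

lemma toC_mem_span (f : HeckeCoset Δ G G →₀ ℤ) :
    toC f ∈ Submodule.span ℤ {u : RightCosets G →₀ ℤ | ∃ b ∈ B, u = Finsupp.single (rc G b) 1} := by
  rw [toC, Finsupp.linearCombination_apply]
  refine Submodule.sum_mem _ fun D _ => Submodule.smul_mem _ _ ?_
  refine Submodule.sum_mem _ fun c hc => Submodule.subset_span ?_
  rw [Set.Finite.mem_toFinset] at hc
  obtain ⟨x, -, rfl⟩ := hc
  obtain ⟨b, hb, h⟩ := hT.iwasawa x x.2
  exact ⟨b, hb, by rw [h]⟩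

lemma monom_lmul (f g : HeckeCoset Δ G G →₀ ℤ) :
    monom G B e (lmul (toC f) (toC g)) = monom G B e (toC f) * monom G B e (toC g) := by
  have h1 : ∀ b ∈ B, ∀ u ∈ Submodule.span ℤ
      {u : RightCosets G →₀ ℤ | ∃ b ∈ B, u = Finsupp.single (rc G b) 1},
      monom G B e (Finsupp.lmapDomain ℤ ℤ (tr G b) u) =
        monom G B e u * AddMonoidAlgebra.single (e b) 1 := by
    intro b hb u hu
    induction hu using Submodule.span_induction with
    | mem u hu =>
      obtain ⟨c, hc, rfl⟩ := hu
      rw [Finsupp.lmapDomain_apply, Finsupp.mapDomain_single, tr_rc,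
        hT.monom_single (B.mul_mem hc hb), hT.monom_single hc, hT.e_mul c hc b hb,
        AddMonoidAlgebra.single_mul_single, one_mul]
    | zero => simp
    | add u v _ _ hu hv => rw [map_add, map_add, hu, hv, map_add, add_mul]
    | smul a u _ hu => rw [map_smul, map_smul, hu, map_smul, smul_mul_assoc]
  have h2 := hT.toC_mem_span g
  generalize toC g = w at h2
  induction h2 using Submodule.span_induction with
  | mem u hu =>
    obtain ⟨b, hb, rfl⟩ := hu
    rw [lmul_single, h1 b hb _ (hT.toC_mem_span f), hT.monom_single hb]
  | zero => simp
  | add u v _ _ hu hv => rw [map_add, map_add, hu, hv, map_add, mul_add]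
  | smul a u _ hu => rw [map_smul, map_smul, hu, map_smul, mul_smul_comm]

/-- The spherical map: the double coset `D` goes to the sum of the monomials of the right cosets
in `D`. -/
noncomputable def spherical : 𝕋 Δ G ℤ →+* AddMonoidAlgebra ℤ X where
  toFun f := monom G B e (toC f)
  map_one' := by
    change monom G B e (toC (Finsupp.single 1 1)) = _
    rw [toC_one, hT.monom_single B.one_mem, hT.e_unit 1 B.one_mem G.one_mem]
    rfl
  map_mul' f g := by
    exact (congrArg (monom G B e) (toC_mul _ _)).trans (hT.monom_lmul _ _)
  map_zero' := by
    change monom G B e (toC 0) = 0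
    simp
  map_add' f g := by
    exact (congrArg (monom G B e) (map_add toC _ _)).trans (map_add _ _ _)

lemma spherical_apply (f : HeckeCoset Δ G G →₀ ℤ) :
    hT.spherical f = f.sum fun D a => a • hT.spherical (Finsupp.single D 1 : _ →₀ ℤ) := by
  change monom G B e (toC f) = f.sum fun D a => a • monom G B e (toC (Finsupp.single D 1))
  conv_lhs => rw [← Finsupp.sum_single f]
  rw [Finsupp.sum, map_sum, map_sum]
  refine Finset.sum_congr rfl fun D _ => ?_
  change _ = f D • monom G B e (toC (Finsupp.single D 1))
  rw [← map_smul, ← map_smul, Finsupp.smul_single_one]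

/-- Every double coset has a dominant element whose exponent is the leading exponent of its
spherical image. -/
lemma exists_lead (D : HeckeCoset Δ G G) : ∃ d, Dom d ∧ rc G d ∈ cosetsIn D ∧
    HasLead (hT.spherical (Finsupp.single D 1 : _ →₀ ℤ)) (e d) := by
  classical
  have hne : (finite_cosetsIn D).toFinset.Nonempty := by
    rw [Set.Finite.toFinset_nonempty]
    exact ⟨_, Quotient.out D, mk_out D, rfl⟩
  obtain ⟨c, hc, hmin⟩ := Finset.exists_min_image _ (expo G B e) hne
  simp only [Set.Finite.mem_toFinset] at hc hmin
  have hB : ∀ c ∈ cosetsIn D, ∃ b ∈ B, c = rc G b := by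
    rintro _ ⟨x, -, rfl⟩
    exact hT.iwasawa x x.2
  have key : ∀ b ∈ B, rc G b ∈ cosetsIn D → ∃ d, Dom d ∧ rc G d ∈ cosetsIn D ∧ e d ≤ e b ∧
      (e d = e b → rc G b = rc G d) := by
    intro b hb hbD
    obtain ⟨hbΔ, hmk⟩ := rc_mem.1 hbD
    obtain ⟨d, hd, ⟨g, hg, g', hg', hdg⟩, hle, heq⟩ := hT.tri b hb hbΔ
    have hdΔ : d ∈ Δ := by
      rw [hdg]; exact Δ.mul_mem (Δ.mul_mem (mem_of_mem hg) hbΔ) (mem_of_mem hg')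
    refine ⟨d, hd, rc_mem.2 ⟨hdΔ, ?_⟩, hle, heq⟩
    rw [← hmk, eq_comm, mk_eq]
    exact ⟨g, hg, g', hg', hdg⟩
  obtain ⟨b, hb, rfl⟩ := hB c hc
  obtain ⟨d, hd, hdD, hle, -⟩ := key b hb hc
  have hmin' : ∀ b ∈ B, rc G b ∈ cosetsIn D → e d ≤ e b := by
    intro b' hb' h'
    have := hmin _ h'
    rw [hT.expo_rc hb, hT.expo_rc hb'] at this
    exact hle.trans this
  refine ⟨d, hd, hdD, ?_⟩
  have hΦ : hT.spherical (Finsupp.single D 1 : _ →₀ ℤ) =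
      ∑ c ∈ (finite_cosetsIn D).toFinset, AddMonoidAlgebra.single (expo G B e c) 1 := by
    change monom G B e (toC (Finsupp.single D 1)) = _
    rw [toC_single, cosetSum, map_sum]
    refine Finset.sum_congr rfl fun c _ => ?_
    rw [monom, Finsupp.linearCombination_single, one_smul]
  rw [hΦ]
  constructor
  · rw [AddMonoidAlgebra.coeff_sum, Finsupp.finsetSum_apply, Finset.sum_eq_single (rc G d)]
    · rw [AddMonoidAlgebra.coeff_single, hT.expo_rc (hT.dom_mem d hd), Finsupp.single_eq_same]
    · intro c hc hne
      rw [Set.Finite.mem_toFinset] at hc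
      obtain ⟨b', hb', rfl⟩ := hB c hc
      rw [AddMonoidAlgebra.coeff_single, hT.expo_rc hb', Finsupp.single_apply, if_neg]
      intro h
      obtain ⟨d', hd', hdD', hle', heq'⟩ := key b' hb' hc
      have h3 : e d' = e d :=
        le_antisymm (hle'.trans h.le) (hmin' d' (hT.dom_mem d' hd') hdD')
      exact hne ((heq' (h3.trans h.symm)).trans
        (hT.dom_inj d' d hd' hd (rc_mem.1 hdD').1 (rc_mem.1 hdD).1 h3))
    · intro h
      exact absurd ((Set.Finite.mem_toFinset _).2 hdD) h
  · intro y hy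
    rw [AddMonoidAlgebra.coeff_sum, Finsupp.finsetSum_apply] at hy
    obtain ⟨c, hc, hcy⟩ := Finset.exists_ne_zero_of_sum_ne_zero hy
    rw [Set.Finite.mem_toFinset] at hc
    obtain ⟨b', hb', rfl⟩ := hB c hc
    rw [AddMonoidAlgebra.coeff_single, hT.expo_rc hb', Finsupp.single_apply] at hcy
    have : e b' = y := by by_contra h; exact hcy (if_neg h)
    rw [← this]
    exact hmin' b' hb' hc

/-- A dominant element that carries the leading exponent of a double coset. -/
noncomputable def domOf (D : HeckeCoset Δ G G) : 𝒢 := (hT.exists_lead D).choose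

lemma domOf_spec (D : HeckeCoset Δ G G) : Dom (hT.domOf D) ∧ rc G (hT.domOf D) ∈ cosetsIn D ∧
    HasLead (hT.spherical (Finsupp.single D 1 : _ →₀ ℤ)) (e (hT.domOf D)) :=
  (hT.exists_lead D).choose_spec

lemma domOf_injective {D D' : HeckeCoset Δ G G} (h : e (hT.domOf D) = e (hT.domOf D')) :
    D = D' := by
  obtain ⟨h1, h2, -⟩ := hT.domOf_spec D
  obtain ⟨h1', h2', -⟩ := hT.domOf_spec D'
  have h3 := hT.dom_inj _ _ h1 h1' (rc_mem.1 h2).1 (rc_mem.1 h2').1 h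
  rw [h3] at h2
  exact (rc_mem.1 h2).2.symm.trans (rc_mem.1 h2').2

/-- The double coset in `f` of least leading exponent keeps its coefficient in the spherical image,
since the others do not contribute to that monomial. -/
lemma exists_min_coeff (f : HeckeCoset Δ G G →₀ ℤ) (hf : f ≠ 0) : ∃ D, f D ≠ 0 ∧
    (hT.spherical f).coeff (e (hT.domOf D)) = f D ∧
    ∀ D', f D' ≠ 0 → e (hT.domOf D) ≤ e (hT.domOf D') := by
  obtain ⟨D, hD, hmin⟩ := Finset.exists_min_image f.support (fun D => e (hT.domOf D))
    (Finsupp.support_nonempty_iff.2 hf)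
  simp only [Finsupp.mem_support_iff] at hD hmin
  refine ⟨D, hD, ?_, hmin⟩
  rw [spherical_apply, Finsupp.sum, AddMonoidAlgebra.coeff_sum, Finsupp.finsetSum_apply,
    Finset.sum_eq_single D]
  · rw [AddMonoidAlgebra.coeff_smul, Finsupp.smul_apply, (hT.domOf_spec D).2.2.1, smul_eq_mul,
      mul_one]
  · intro D' hD' hne
    rw [AddMonoidAlgebra.coeff_smul, Finsupp.smul_apply]
    by_contra h
    have h1 := (hT.domOf_spec D').2.2.2 _ (right_ne_zero_of_smul h)
    exact hne (hT.domOf_injective (le_antisymm h1 (hmin D' (Finsupp.mem_support_iff.1 hD'))))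
  · intro h
    rw [Finsupp.notMem_support_iff] at h
    exact absurd h hD

lemma exists_le_of_coeff_ne_zero {f : HeckeCoset Δ G G →₀ ℤ} {y : X}
    (hy : (hT.spherical f).coeff y ≠ 0) : ∃ D, f D ≠ 0 ∧ e (hT.domOf D) ≤ y := by
  rw [spherical_apply, Finsupp.sum, AddMonoidAlgebra.coeff_sum, Finsupp.finsetSum_apply] at hy
  obtain ⟨D, hD, h⟩ := Finset.exists_ne_zero_of_sum_ne_zero hy
  rw [AddMonoidAlgebra.coeff_smul, Finsupp.smul_apply] at h
  exact ⟨D, Finsupp.mem_support_iff.1 hD, (hT.domOf_spec D).2.2.2 _ (right_ne_zero_of_smul h)⟩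

lemma spherical_injective : Function.Injective hT.spherical := by
  rw [injective_iff_map_eq_zero]
  intro f hf
  by_contra hne
  obtain ⟨D, hD, h, -⟩ := hT.exists_min_coeff f hne
  rw [hf] at h
  exact hD h.symm

end Triangular

end spherical

end HeckeAlg

/-! ### Generation by leading exponents -/

namespace HeckeAlg

section generation

variable {𝒢 : Type*} [Group 𝒢] {Δ : Submonoid 𝒢} {G : Subgroup 𝒢} [IsHeckeTriple Δ G G]
variable {X : Type*} [AddCommGroup X] [LinearOrder X] [IsOrderedAddMonoid X]

/-- The double cosets that occur in `f` consist of elements of `S`. -/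
def SuppIn (S : Set 𝒢) (f : HeckeCoset Δ G G →₀ ℤ) : Prop :=
  ∀ D, f D ≠ 0 → ∀ x, rc G x ∈ cosetsIn D → x ∈ S

lemma SuppIn.sub {S : Set 𝒢} {f g : HeckeCoset Δ G G →₀ ℤ} (hf : SuppIn S f) (hg : SuppIn S g) :
    SuppIn S (f - g) := by
  intro D hD
  by_cases h : f D = 0
  · refine hg D fun h' => hD ?_
    rw [Finsupp.sub_apply, h, h', sub_zero]
  · exact hf D h

lemma SuppIn.mul {S S' S'' : Set 𝒢} (hmul : ∀ x ∈ S, ∀ y ∈ S', x * y ∈ S'')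
    (hG : ∀ g ∈ G, ∀ x ∈ S'', g * x ∈ S'') (hG' : ∀ g ∈ G, ∀ x ∈ S'', x * g ∈ S'')
    {f g : HeckeCoset Δ G G →₀ ℤ} (hf : SuppIn S f) (hg : SuppIn S' g) :
    SuppIn S'' (HeckeAlg.mul f g) := by
  classical
  intro D hD x hx
  rw [HeckeAlg.mul, Finsupp.sum, Finsupp.finsetSum_apply] at hD
  obtain ⟨D₁, hD₁, h1⟩ := Finset.exists_ne_zero_of_sum_ne_zero hD
  rw [Finsupp.sum, Finsupp.finsetSum_apply] at h1
  obtain ⟨D₂, hD₂, h2⟩ := Finset.exists_ne_zero_of_sum_ne_zero h1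
  rw [Finsupp.smul_apply] at h2
  have h3 : coeff D₁ D₂ D ≠ 0 := by
    have := right_ne_zero_of_smul h2
    change (coeff D₁ D₂ D : ℤ) ≠ 0 at this
    exact_mod_cast this
  obtain ⟨⟨c₁, c₂⟩, hc₁, hc₂, hc⟩ := Set.nonempty_of_ncard_ne_zero h3
  simp only at hc₁ hc₂ hc
  have h4 : c₁.out * c₂.out ∈ S'' := hmul _
    (hf D₁ (Finsupp.mem_support_iff.1 hD₁) _ (by rwa [rc_out])) _
    (hg D₂ (Finsupp.mem_support_iff.1 hD₂) _ (by rwa [rc_out]))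
  rw [rc_eq] at hc
  have h5 := hG _ hc _ h4
  rw [inv_mul_cancel_right] at h5
  obtain ⟨hxΔ, hmk⟩ := rc_mem.1 hx
  rw [← mk_out D, mk_eq] at hmk
  obtain ⟨a, ha, b, hb, h⟩ := hmk
  have h6 : x = a⁻¹ * (Quotient.out D : Δ) * b⁻¹ := by rw [h]; group
  rw [h6]
  exact hG' _ (G.inv_mem hb) _ (hG _ (G.inv_mem ha) _ h5)

lemma suppIn_single {S : Set 𝒢} {D : HeckeCoset Δ G G} (h : ∀ x, rc G x ∈ cosetsIn D → x ∈ S)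
    (a : ℤ) : SuppIn S (Finsupp.single D a) := by
  classical
  intro D' hD'
  rw [Finsupp.single_apply] at hD'
  have : D = D' := by by_contra hne; exact hD' (if_neg hne)
  rwa [← this]

lemma finsupp_nat_induction {ι : Type*} {P : (ι →₀ ℕ) → Prop} (zero : P 0)
    (add_single : ∀ c i, P c → P (c + Finsupp.single i 1)) (c : ι →₀ ℕ) : P c := by
  suffices h : ∀ c' c : ι →₀ ℕ, P c → P (c + c') by simpa using h c 0 zero
  intro c'
  induction c' using Finsupp.induction_linear with
  | zero => intro c h; simpa using h
  | add a b ha hb => intro c h; rw [← add_assoc]; exact hb _ (ha _ h)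
  | single i k =>
    induction k with
    | zero => intro c h; simpa using h
    | succ k ih =>
      intro c h
      rw [Finsupp.single_add, ← add_assoc]
      exact add_single _ i (ih c h)

variable {B : Subgroup 𝒢} {e : 𝒢 → X} {Dom : 𝒢 → Prop}

/-- In a triangular situation, double cosets `T i` whose leading exponents `w i` freely generate the
monoid of dominant exponents are algebraically independent generators of the Hecke algebra. The
sets `N k` filter the monoid; they ensure that the rewriting of a double coset by products of
the `T i` with smaller remainders terminates. -/
theorem Triangular.isAlgIndepGenerators (hT : Triangular Δ G B e Dom) {ι : Type*} [Finite ι]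
    (T : ι → Δ) (w : ι → X)
    (hwT : ∀ i d, Dom d → rc G d ∈ cosetsIn (HeckeCoset.mk G G (T i)) →
      (∀ b ∈ B, rc G b ∈ cosetsIn (HeckeCoset.mk G G (T i)) → e d ≤ e b) → e d = w i)
    (hinj : Function.Injective fun c : ι →₀ ℕ => c.sum fun i k => k • w i)
    (hsurj : ∀ d, Dom d → d ∈ Δ → ∃ c : ι →₀ ℕ, e d = c.sum fun i k => k • w i)
    (N : ℕ → Set 𝒢) (hNmono : Monotone N) (hNmul : ∀ k l, ∀ x ∈ N k, ∀ y ∈ N l, x * y ∈ N (k + l))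
    (hNtop : ∀ x : Δ, ∃ k, (x : 𝒢) ∈ N k)
    (hNG : ∀ g ∈ G, g ∈ N 0) (n : ι → ℕ) (hn : ∀ i, 0 < n i) (hNT : ∀ i, (T i : 𝒢) ∈ N (n i))
    (hNc : ∀ k d, Dom d → d ∈ Δ → d ∈ N k → ∀ c : ι →₀ ℕ, (e d = c.sum fun i k => k • w i) →
      (c.sum fun i m => m * n i) ≤ k) :
    IsAlgIndepGenerators fun i => dcoset G (T i) := by
  classical
  have hcomm : ∀ x y : 𝕋 Δ G ℤ, x * y = y * x := fun x y =>
    hT.spherical_injective (by rw [map_mul, map_mul, mul_comm])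
  have hGN : ∀ k, ∀ g ∈ G, ∀ x ∈ N k, g * x ∈ N k := fun k g hg x hx => by
    simpa using hNmul 0 k g (hNG g hg) x hx
  have hGN' : ∀ k, ∀ g ∈ G, ∀ x ∈ N k, x * g ∈ N k := fun k g hg x hx => by
    simpa using hNmul k 0 x hx g (hNG g hg)
  have hNmk : ∀ k (x : Δ), (x : 𝒢) ∈ N k → ∀ y, rc G y ∈ cosetsIn (HeckeCoset.mk G G x) →
      y ∈ N k := by
    intro k x hx y hy
    obtain ⟨hyΔ, hmk⟩ := rc_mem.1 hy
    rw [eq_comm, mk_eq] at hmk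
    obtain ⟨a, ha, b, hb, h⟩ := hmk
    change y = a * x * b at h
    rw [h]
    exact hGN' _ _ hb _ (hGN _ _ ha _ hx)
  have hTlead : ∀ i, HasLead (hT.spherical (dcoset G (T i))) (w i) := by
    intro i
    obtain ⟨h1, h2, h3⟩ := hT.domOf_spec (HeckeCoset.mk G G (T i))
    have h4 := hwT i _ h1 h2 fun b hb hbD => by
      obtain ⟨hbΔ, hmk⟩ := rc_mem.1 hbD
      refine h3.2 _ ?_
      have hfin := hT.spherical_apply (Finsupp.single (HeckeCoset.mk G G (T i)) 1)
      have hc : hT.spherical (Finsupp.single (HeckeCoset.mk G G (T i)) 1 : _ →₀ ℤ) =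
          ∑ c ∈ (finite_cosetsIn (HeckeCoset.mk G G (T i))).toFinset,
            AddMonoidAlgebra.single (expo G B e c) 1 := by
        change monom G B e (toC (Finsupp.single _ 1)) = _
        rw [toC_single, cosetSum, map_sum]
        refine Finset.sum_congr rfl fun c _ => ?_
        rw [monom, Finsupp.linearCombination_single, one_smul]
      rw [hc, AddMonoidAlgebra.coeff_sum, Finsupp.finsetSum_apply]
      refine (Finset.sum_pos' (fun c _ => ?_) ⟨rc G b, (Set.Finite.mem_toFinset _).2 hbD, ?_⟩).ne'
      · rw [AddMonoidAlgebra.coeff_single, Finsupp.single_apply]; split_ifs <;> norm_num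
      · rw [AddMonoidAlgebra.coeff_single, hT.expo_rc hb, Finsupp.single_eq_same]; norm_num
    rw [h4] at h3
    exact h3
  refine ⟨hcomm, ?_, ?_⟩
  · -- every exponent vector `c` is the leading exponent of a product of generators
    have hmon : ∀ c : ι →₀ ℕ, ∃ f : 𝕋 Δ G ℤ, f ∈ Algebra.adjoin ℤ
        (Set.range fun i => dcoset G (T i)) ∧ HasLead (hT.spherical f) (c.sum fun i k => k • w i) ∧
        SuppIn (N (c.sum fun i m => m * n i)) (f : HeckeCoset Δ G G →₀ ℤ) := by
      have hstep : ∀ (c : ι →₀ ℕ) (i : ι), (∃ f : 𝕋 Δ G ℤ, f ∈ Algebra.adjoin ℤ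
          (Set.range fun i => dcoset G (T i)) ∧
          HasLead (hT.spherical f) (c.sum fun i k => k • w i) ∧
          SuppIn (N (c.sum fun i m => m * n i)) (f : HeckeCoset Δ G G →₀ ℤ)) →
          ∃ f : 𝕋 Δ G ℤ, f ∈ Algebra.adjoin ℤ
          (Set.range fun i => dcoset G (T i)) ∧
          HasLead (hT.spherical f) ((c + Finsupp.single i 1).sum fun i k => k • w i) ∧
          SuppIn (N ((c + Finsupp.single i 1).sum fun i m => m * n i))
            (f : HeckeCoset Δ G G →₀ ℤ) := by
        rintro c i ⟨f, hf, hl, hs⟩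
        refine ⟨f * dcoset G (T i), Subalgebra.mul_mem _ hf (Algebra.subset_adjoin ⟨i, rfl⟩), ?_, ?_⟩
        · rw [map_mul, Finsupp.sum_add_index' (by simp) (by intros; rw [add_smul]),
            Finsupp.sum_single_index (by simp), one_smul]
          exact hl.mul (hTlead i)
        · rw [Finsupp.sum_add_index' (by simp) (by intros; rw [add_mul]),
            Finsupp.sum_single_index (by simp), one_mul]
          exact SuppIn.mul (hNmul _ _) (hGN _) (hGN' _) hs
            (suppIn_single (hNmk _ _ (hNT i)) 1)
      intro c
      induction c using finsupp_nat_induction with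
      | zero =>
        refine ⟨1, one_mem _, by simpa using HasLead.one, ?_⟩
        refine suppIn_single (fun x hx => ?_) 1
        exact hNmk 0 1 (hNG 1 G.one_mem) x hx
      | add_single c i h => exact hstep c i h
    have hfin : ∀ k, {c : ι →₀ ℕ | (c.sum fun i m => m * n i) ≤ k}.Finite := by
      intro k
      have : Fintype ι := Fintype.ofFinite ι
      refine Set.Finite.subset (Set.finite_Iic (Finsupp.equivFunOnFinite.symm fun _ => k)) ?_
      intro c hc i
      simp only [Set.mem_ofPred_eq] at hc
      rw [Finsupp.sum_fintype _ _ (by simp)] at hc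
      calc c i ≤ c i * n i := Nat.le_mul_of_pos_right _ (hn i)
        _ ≤ ∑ i, c i * n i := Finset.single_le_sum (f := fun i => c i * n i)
            (fun _ _ => Nat.zero_le _) (Finset.mem_univ i)
        _ ≤ k := hc
    have hNlead : ∀ k (D : HeckeCoset Δ G G), (∀ x, rc G x ∈ cosetsIn D → x ∈ N k) →
        ∃ c : ι →₀ ℕ, (c.sum fun i m => m * n i) ≤ k ∧
          e (hT.domOf D) = c.sum fun i k => k • w i := by
      intro k D hD
      obtain ⟨h1, h2, -⟩ := hT.domOf_spec D
      obtain ⟨c, hc⟩ := hsurj _ h1 (rc_mem.1 h2).1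
      exact ⟨c, hNc k _ h1 (rc_mem.1 h2).1 (hD _ h2) c hc, hc⟩
    -- descent on the number of exponent vectors of bounded level above the leading one
    have hdesc : ∀ (k m : ℕ) (f : 𝕋 Δ G ℤ), SuppIn (N k) (f : HeckeCoset Δ G G →₀ ℤ) →
        {c : ι →₀ ℕ | (c.sum fun i m => m * n i) ≤ k ∧ ∃ D, (f : HeckeCoset Δ G G →₀ ℤ) D ≠ 0 ∧
          e (hT.domOf D) ≤ c.sum fun i k => k • w i}.ncard < m →
        f ∈ Algebra.adjoin ℤ (Set.range fun i => dcoset G (T i)) := by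
      intro k m
      induction m with
      | zero => intro f _ h; exact absurd h (Nat.not_lt_zero _)
      | succ m ih =>
        intro f hf hm
        by_cases hf0 : f = 0
        · rw [hf0]; exact zero_mem _
        obtain ⟨D, hD, hcoef, hmin⟩ := hT.exists_min_coeff f hf0
        obtain ⟨c, hck, hc⟩ := hNlead k D (hf D hD)
        obtain ⟨g, hg, hgl, hgs⟩ := hmon c
        rw [← hc] at hgl
        have hsub : SuppIn (N k) (f - (f : HeckeCoset Δ G G →₀ ℤ) D • g :
            HeckeCoset Δ G G →₀ ℤ) := by
          refine hf.sub fun D' hD' x hx => hNmono hck (hgs D' ?_ x hx)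
          exact right_ne_zero_of_smul (a := (f : HeckeCoset Δ G G →₀ ℤ) D) hD'
        have hmem : (f - (f : HeckeCoset Δ G G →₀ ℤ) D • g : 𝕋 Δ G ℤ) ∈
            Algebra.adjoin ℤ (Set.range fun i => dcoset G (T i)) := by
          refine ih _ hsub ?_
          have hgt : ∀ D', (f - (f : HeckeCoset Δ G G →₀ ℤ) D • g : HeckeCoset Δ G G →₀ ℤ) D' ≠ 0 →
              e (hT.domOf D) < e (hT.domOf D') := by
            intro D' hD'
            have hne : (f - (f : HeckeCoset Δ G G →₀ ℤ) D • g : HeckeCoset Δ G G →₀ ℤ) ≠ 0 := by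
              intro h0; rw [h0] at hD'; exact hD' rfl
            obtain ⟨D₁, hD₁, hcoef₁, hmin₁⟩ := hT.exists_min_coeff _ hne
            refine lt_of_lt_of_le ?_ (hmin₁ D' hD')
            rw [← hcoef₁] at hD₁
            have hΦ : hT.spherical (f - (f : HeckeCoset Δ G G →₀ ℤ) D • g :
                HeckeCoset Δ G G →₀ ℤ) =
                hT.spherical f - (f : HeckeCoset Δ G G →₀ ℤ) D • hT.spherical g := by
              rw [← map_zsmul, ← map_sub]
            rw [hΦ, AddMonoidAlgebra.coeff_sub, AddMonoidAlgebra.coeff_smul, Finsupp.sub_apply,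
              Finsupp.smul_apply] at hD₁
            refine lt_of_le_of_ne ?_ fun h => ?_
            · by_cases h1 : (hT.spherical f).coeff (e (hT.domOf D₁)) = 0
              · rw [h1, zero_sub] at hD₁
                exact hgl.2 _ (right_ne_zero_of_smul (neg_ne_zero.1 hD₁))
              · obtain ⟨D₂, hD₂, hle⟩ := hT.exists_le_of_coeff_ne_zero h1
                exact (hmin D₂ hD₂).trans hle
            · rw [← h, hcoef, hgl.1, smul_eq_mul, mul_one] at hD₁
              exact hD₁ (sub_self _)
          refine lt_of_lt_of_le (Set.ncard_lt_ncard ?_ ((hfin k).subset fun c h => h.1))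
            (Nat.lt_succ_iff.1 hm)
          rw [Set.ssubset_iff_of_subset]
          · refine ⟨c, ⟨hck, D, hD, hc.le⟩, ?_⟩
            rintro ⟨-, D', hD', hle⟩
            exact absurd (hgt D' hD') (not_lt.2 (hle.trans hc.ge))
          · rintro c' ⟨h1, D', hD', hle⟩
            exact ⟨h1, D, hD, (hgt D' hD').le.trans hle⟩
        have := Subalgebra.add_mem _ hmem
          (Subalgebra.smul_mem _ hg ((f : HeckeCoset Δ G G →₀ ℤ) D))
        rwa [sub_add_cancel] at this
    rw [eq_top_iff]
    intro f _
    have hsup : ∃ k, SuppIn (N k) (f : HeckeCoset Δ G G →₀ ℤ) := by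
      have hD : ∀ D : HeckeCoset Δ G G, ∃ k, ∀ x, rc G x ∈ cosetsIn D → x ∈ N k := by
        intro D
        obtain ⟨k, hk⟩ := hNtop (Quotient.out D : Δ)
        refine ⟨k, fun x hx => hNmk k _ hk x ?_⟩
        rwa [mk_out]
      choose k hk using hD
      refine ⟨(f : HeckeCoset Δ G G →₀ ℤ).support.sup k, fun D hD x hx => ?_⟩
      exact hNmono (Finset.le_sup (f := k) (Finsupp.mem_support_iff.2 hD)) (hk D x hx)
    obtain ⟨k, hk⟩ := hsup
    exact hdesc k _ f hk (Nat.lt_succ_self _)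
  · let : CommRing (𝕋 Δ G ℤ) := { (inferInstance : Ring (𝕋 Δ G ℤ)) with mul_comm := hcomm }
    have := algebraicIndependent_of_hasLead hTlead hinj
    exact AlgebraicIndependent.of_comp (R := ℤ) (A := 𝕋 Δ G ℤ) hT.spherical.toIntAlgHom this

end generation

end HeckeAlg

/-! ### Matrices over a valued division ring -/

namespace LocalHecke

section valued

variable {K : Type*} [DivisionRing K] (v : AddValuation K (WithTop ℤ))

/-- The integer value of a nonzero element (and `0` for the zero element). -/
noncomputable def ev (x : K) : ℤ := (v x).untopD 0

lemma v_ne_top {x : K} (hx : x ≠ 0) : v x ≠ ⊤ := fun h => hx ((AddValuation.top_iff v).1 h)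

lemma coe_ev {x : K} (hx : x ≠ 0) : ((ev v x : ℤ) : WithTop ℤ) = v x := by
  obtain ⟨k, hk⟩ := WithTop.ne_top_iff_exists.1 (v_ne_top v hx)
  rw [ev, ← hk, WithTop.untopD_coe]

lemma ev_mul {x y : K} (hx : x ≠ 0) (hy : y ≠ 0) : ev v (x * y) = ev v x + ev v y := by
  have h := coe_ev v (mul_ne_zero hx hy)
  rw [AddValuation.map_mul, ← coe_ev v hx, ← coe_ev v hy] at h
  exact_mod_cast h

lemma ev_one : ev v (1 : K) = 0 := by
  rw [ev, AddValuation.map_one]; rfl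

lemma ev_inv {x : K} (hx : x ≠ 0) : ev v x⁻¹ = - ev v x := by
  have h := ev_mul v hx (inv_ne_zero hx)
  rw [mul_inv_cancel₀ hx, ev_one] at h
  omega

lemma ev_pow {x : K} (hx : x ≠ 0) (k : ℕ) : ev v (x ^ k) = k * ev v x := by
  induction k with
  | zero => simp [ev_one]
  | succ k ih => rw [pow_succ, ev_mul v (pow_ne_zero _ hx) hx, ih]; push_cast; ring

lemma le_v_iff {x : K} (hx : x ≠ 0) (k : ℤ) : (k : WithTop ℤ) ≤ v x ↔ k ≤ ev v x := by
  rw [← coe_ev v hx]; exact WithTop.coe_le_coe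

lemma v_le_v_iff {x y : K} (hx : x ≠ 0) (hy : y ≠ 0) : v x ≤ v y ↔ ev v x ≤ ev v y := by
  rw [← coe_ev v hx]; exact le_v_iff v hy _

lemma v_mul_inv_nonneg {x p : K} (hp : p ≠ 0) (h : v p ≤ v x) : 0 ≤ v (x * p⁻¹) := by
  by_cases hx : x = 0
  · simp [hx]
  · rw [v_le_v_iff v hp hx] at h
    refine (le_v_iff v (mul_ne_zero hx (inv_ne_zero hp)) 0).2 ?_
    rw [ev_mul v hx (inv_ne_zero hp), ev_inv v hp]
    omega

lemma v_inv_mul_nonneg {x p : K} (hp : p ≠ 0) (h : v p ≤ v x) : 0 ≤ v (p⁻¹ * x) := by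
  by_cases hx : x = 0
  · simp [hx]
  · rw [v_le_v_iff v hp hx] at h
    refine (le_v_iff v (mul_ne_zero (inv_ne_zero hp) hx) 0).2 ?_
    rw [ev_mul v (inv_ne_zero hp) hx, ev_inv v hp]
    omega

lemma le_v_mul_left {x y : K} (hx : 0 ≤ v x) : v y ≤ v (x * y) := by
  rw [AddValuation.map_mul]; exact le_add_of_nonneg_left hx

lemma le_v_mul_right {x y : K} (hx : 0 ≤ v x) : v y ≤ v (y * x) := by
  rw [AddValuation.map_mul]; exact le_add_of_nonneg_right hx

end valued

section matrices

variable {K : Type*} [DivisionRing K] (v : AddValuation K (WithTop ℤ)) {d : ℕ}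

/-- The entries of the matrix are integral. -/
def IntMat {ι : Type*} (M : Matrix ι ι K) : Prop := ∀ i j, 0 ≤ v (M i j)

variable {v} in
lemma IntMat.mul {ι : Type*} [Fintype ι] {M N : Matrix ι ι K} (hM : IntMat v M)
    (hN : IntMat v N) : IntMat v (M * N) := fun i j => by
  rw [Matrix.mul_apply]
  exact v.map_le_sum fun k _ => (hN k j).trans (le_v_mul_left v (hM i k))

lemma IntMat.one {ι : Type*} [DecidableEq ι] : IntMat v (1 : Matrix ι ι K) := fun i j => by
  rw [Matrix.one_apply]; split_ifs <;> simp

/-- The matrix is lower triangular. -/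
def IsLower (M : Matrix (Fin d) (Fin d) K) : Prop := ∀ i j, i < j → M i j = 0

lemma IsLower.mul {M N : Matrix (Fin d) (Fin d) K} (hM : IsLower M) (hN : IsLower N) :
    IsLower (M * N) := fun i j hij => by
  rw [Matrix.mul_apply]
  refine Finset.sum_eq_zero fun k _ => ?_
  rcases lt_or_ge i k with h | h
  · rw [hM i k h, zero_mul]
  · rw [hN k j (h.trans_lt hij), mul_zero]

lemma IsLower.mul_diag {M N : Matrix (Fin d) (Fin d) K} (hM : IsLower M) (hN : IsLower N)
    (i : Fin d) : (M * N) i i = M i i * N i i := by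
  rw [Matrix.mul_apply, Finset.sum_eq_single i]
  · intro k _ hk
    rcases lt_or_gt_of_ne hk with h | h
    · rw [hN k i h, mul_zero]
    · rw [hM i k h, zero_mul]
  · simp

lemma IsLower.of_diag {M : Matrix (Fin d) (Fin d) K} (hM : ∀ i j, i ≠ j → M i j = 0) :
    IsLower M := fun i j h => hM i j h.ne

/-- A right inverse of a lower triangular matrix is lower triangular and the diagonal entries are
invertible, by induction on the row. -/
lemma IsLower.inv_aux {M N : Matrix (Fin d) (Fin d) K} (hM : IsLower M) (h : M * N = 1)
    (i : Fin d) : M i i ≠ 0 ∧ ∀ j, i < j → N i j = 0 := by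
  induction i using WellFoundedLT.induction with
  | _ i ih =>
    have hsum : ∀ j, (∀ k < i, N k j = 0) → (1 : Matrix (Fin d) (Fin d) K) i j = M i i * N i j := by
      intro j hj
      rw [← h, Matrix.mul_apply, Finset.sum_eq_single i]
      · intro k _ hk
        rcases lt_or_gt_of_ne hk with h' | h'
        · rw [hj k h', mul_zero]
        · rw [hM i k h', zero_mul]
      · simp
    have h1 := hsum i fun k hk => (ih k hk).2 i hk
    rw [Matrix.one_apply_eq] at h1
    have h2 := left_ne_zero_of_mul_eq_one h1.symm
    refine ⟨h2, fun j hj => ?_⟩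
    have h3 := hsum j fun k hk => (ih k hk).2 j (hk.trans hj)
    rw [Matrix.one_apply_ne hj.ne] at h3
    exact (mul_eq_zero.1 h3.symm).resolve_left h2

variable (K d) in
/-- The group of invertible lower triangular matrices. -/
def lowerGroup : Subgroup (Matrix (Fin d) (Fin d) K)ˣ where
  carrier := {M | IsLower (M : Matrix (Fin d) (Fin d) K)}
  one_mem' := IsLower.of_diag fun _ _ h => Matrix.one_apply_ne h
  mul_mem' hM hN := hM.mul hN
  inv_mem' {M} hM i j hij := (IsLower.inv_aux hM M.mul_inv i).2 j hij

lemma lowerGroup_diag_ne {M : (Matrix (Fin d) (Fin d) K)ˣ} (hM : M ∈ lowerGroup K d) (i : Fin d) :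
    (M : Matrix (Fin d) (Fin d) K) i i ≠ 0 := (IsLower.inv_aux hM M.mul_inv i).1

/-- The values of the diagonal entries, ordered lexicographically. -/
noncomputable def exps (M : Matrix (Fin d) (Fin d) K) : Lex (Fin d → ℤ) :=
  toLex fun i => ev v (M i i)

lemma exps_apply (M : Matrix (Fin d) (Fin d) K) (i : Fin d) : exps v M i = ev v (M i i) := rfl

lemma exps_mul {M N : (Matrix (Fin d) (Fin d) K)ˣ} (hM : M ∈ lowerGroup K d)
    (hN : N ∈ lowerGroup K d) :
    exps v ((M * N : (Matrix (Fin d) (Fin d) K)ˣ) : Matrix (Fin d) (Fin d) K) =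
      exps v (M : Matrix (Fin d) (Fin d) K) + exps v (N : Matrix (Fin d) (Fin d) K) := by
  funext i
  change ev v _ = ev v _ + ev v _
  rw [Units.val_mul, IsLower.mul_diag hM hN,
    ev_mul v (lowerGroup_diag_ne hM i) (lowerGroup_diag_ne hN i)]

/-- Off the indices in `P`, the matrix is the identity. -/
def IdOff (P : Fin d → Prop) (M : Matrix (Fin d) (Fin d) K) : Prop :=
  ∀ i j, ¬ (P i ∧ P j) → M i j = (1 : Matrix (Fin d) (Fin d) K) i j

/-- Off the indices in `P`, the matrix is diagonal. -/
def DiagOff (P : Fin d → Prop) (M : Matrix (Fin d) (Fin d) K) : Prop :=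
  ∀ i j, i ≠ j → ¬ (P i ∧ P j) → M i j = 0

variable {P Q : Fin d → Prop} {M N g : Matrix (Fin d) (Fin d) K}

lemma IdOff.mono (h : ∀ i, P i → Q i) (hM : IdOff P M) : IdOff Q M :=
  fun i j hij => hM i j fun h' => hij ⟨h i h'.1, h j h'.2⟩

lemma IdOff.mul_apply (hg : IdOff P g) {i : Fin d} (hi : ¬ P i) (j : Fin d) :
    (g * M) i j = M i j := by
  rw [Matrix.mul_apply, Finset.sum_eq_single i]
  · rw [hg i i fun h => hi h.1, Matrix.one_apply_eq, one_mul]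
  · intro k _ hk
    rw [hg i k fun h => hi h.1, Matrix.one_apply_ne (Ne.symm hk), zero_mul]
  · simp

lemma IdOff.apply_mul (hg : IdOff P g) (i : Fin d) {j : Fin d} (hj : ¬ P j) :
    (M * g) i j = M i j := by
  rw [Matrix.mul_apply, Finset.sum_eq_single j]
  · rw [hg j j fun h => hj h.1, Matrix.one_apply_eq, mul_one]
  · intro k _ hk
    rw [hg k j fun h => hj h.2, Matrix.one_apply_ne hk, mul_zero]
  · simp

lemma IdOff.mul (hM : IdOff P M) (hN : IdOff P N) : IdOff P (M * N) := by
  intro i j hij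
  by_cases hi : P i
  · have hj : ¬ P j := fun hj => hij ⟨hi, hj⟩
    rw [hN.apply_mul i hj, hM i j hij]
  · rw [hM.mul_apply hi, hN i j hij]

lemma DiagOff.mul_left (hM : DiagOff P M) (hg : IdOff P g) : DiagOff P (g * M) := by
  intro i j hij h
  by_cases hi : P i
  · have hj : ¬ P j := fun hj => h ⟨hi, hj⟩
    rw [Matrix.mul_apply]
    refine Finset.sum_eq_zero fun k _ => ?_
    by_cases hk : k = j
    · rw [hk, hg i j h, Matrix.one_apply_ne hij, zero_mul]
    · rw [hM k j hk fun h => hj h.2, mul_zero]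
  · rw [hg.mul_apply hi, hM i j hij h]

lemma DiagOff.mul_right (hM : DiagOff P M) (hg : IdOff P g) : DiagOff P (M * g) := by
  intro i j hij h
  by_cases hj : P j
  · have hi : ¬ P i := fun hi => h ⟨hi, hj⟩
    rw [Matrix.mul_apply]
    refine Finset.sum_eq_zero fun k _ => ?_
    by_cases hk : k = i
    · rw [hk, hg i j h, Matrix.one_apply_ne hij, mul_zero]
    · rw [hM i k (Ne.symm hk) fun h => hi h.1, zero_mul]
  · rw [hg.apply_mul i hj, hM i j hij h]

lemma IdOff.le_v_mul_left (hg : IdOff P g) (hgi : IntMat v g) {c : WithTop ℤ}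
    (hM : ∀ i j, P i → P j → c ≤ v (M i j)) (i j : Fin d) (hi : P i) (hj : P j) :
    c ≤ v ((g * M) i j) := by
  rw [Matrix.mul_apply]
  refine v.map_le_sum fun k _ => ?_
  by_cases hk : P k
  · exact (hM k j hk hj).trans (LocalHecke.le_v_mul_left v (hgi i k))
  · rw [hg i k fun h => hk h.2, Matrix.one_apply_ne (by rintro rfl; exact hk hi)]; simp

lemma IdOff.le_v_mul_right (hg : IdOff P g) (hgi : IntMat v g) {c : WithTop ℤ}
    (hM : ∀ i j, P i → P j → c ≤ v (M i j)) (i j : Fin d) (hi : P i) (hj : P j) :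
    c ≤ v ((M * g) i j) := by
  rw [Matrix.mul_apply]
  refine v.map_le_sum fun k _ => ?_
  by_cases hk : P k
  · exact (hM i k hi hk).trans (LocalHecke.le_v_mul_right v (hgi k j))
  · rw [hg k j fun h => hk h.1, Matrix.one_apply_ne (by rintro rfl; exact hk hj)]; simp

/-- The elements of `Γ` that are integral with integral inverse and are the identity off the
indices in `P`. -/
def intGroup (Γ : Subgroup (Matrix (Fin d) (Fin d) K)ˣ) (P : Fin d → Prop) :
    Subgroup (Matrix (Fin d) (Fin d) K)ˣ where
  carrier := {g | g ∈ Γ ∧ (IntMat v (g : Matrix (Fin d) (Fin d) K) ∧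
    IntMat v ((g⁻¹ : (Matrix (Fin d) (Fin d) K)ˣ) : Matrix (Fin d) (Fin d) K)) ∧
    IdOff P (g : Matrix (Fin d) (Fin d) K) ∧
    IdOff P ((g⁻¹ : (Matrix (Fin d) (Fin d) K)ˣ) : Matrix (Fin d) (Fin d) K)}
  one_mem' := by
    refine ⟨one_mem _, ⟨IntMat.one v, ?_⟩, fun _ _ _ => rfl, fun _ _ _ => ?_⟩
    · rw [inv_one]; exact IntMat.one v
    · rw [inv_one]; rfl
  mul_mem' := by
    rintro g h ⟨hg, ⟨hg1, hg2⟩, hg3, hg4⟩ ⟨hh, ⟨hh1, hh2⟩, hh3, hh4⟩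
    refine ⟨mul_mem hg hh, ⟨hg1.mul hh1, ?_⟩, hg3.mul hh3, ?_⟩
    · rw [mul_inv_rev]; exact hh2.mul hg2
    · rw [mul_inv_rev]; exact hh4.mul hg4
  inv_mem' := by
    rintro g ⟨hg, ⟨hg1, hg2⟩, hg3, hg4⟩
    exact ⟨inv_mem hg, ⟨hg2, by rwa [inv_inv]⟩, hg4, by rwa [inv_inv]⟩

lemma intGroup_mono {Γ : Subgroup (Matrix (Fin d) (Fin d) K)ˣ} (h : ∀ i, P i → Q i) :
    intGroup v Γ P ≤ intGroup v Γ Q := by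
  rintro g ⟨hg, hg1, hg3, hg4⟩
  exact ⟨hg, hg1, hg3.mono h, hg4.mono h⟩

end matrices

end LocalHecke

/-! ### Elimination -/

namespace LocalHecke

section elimination

variable {K : Type*} [DivisionRing K] (v : AddValuation K (WithTop ℤ)) {d : ℕ}

/-- What a matrix group `Γ` needs for Gaussian elimination with integral elements. In step `k`,
the matrix is already diagonal off a set `P k` of active indices, and row and column
of the least active index `piv k` are cleared. After `t` steps, membership in `Γ` forces the matrix
to be diagonal. -/
structure Elimination (Γ : Subgroup (Matrix (Fin d) (Fin d) K)ˣ) (t : ℕ) (P : ℕ → Fin d → Prop)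
    (piv : ℕ → Fin d) : Prop where
  zero : ∀ i, P 0 i
  anti : ∀ k i, P (k + 1) i → P k i
  piv_mem : ∀ k < t, P k (piv k)
  piv_le : ∀ k < t, ∀ j, P k j → piv k ≤ j
  piv_not : ∀ k < t, ¬ P (k + 1) (piv k)
  col : ∀ k < t, ∀ M ∈ Γ, DiagOff (P k) (M : Matrix (Fin d) (Fin d) K) → ∀ j, P k j →
    ∃ g ∈ intGroup v Γ (P k), ∀ a, a ≠ piv k →
      ((g * M : (Matrix (Fin d) (Fin d) K)ˣ) : Matrix (Fin d) (Fin d) K) a j = 0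
  row : ∀ k < t, ∀ M ∈ Γ, DiagOff (P k) (M : Matrix (Fin d) (Fin d) K) → ∀ i, P k i →
    ∃ g ∈ intGroup v Γ (P k), ∀ b, b ≠ piv k →
      ((M * g : (Matrix (Fin d) (Fin d) K)ˣ) : Matrix (Fin d) (Fin d) K) i b = 0
  clearCol : ∀ k < t, ∀ M ∈ Γ, DiagOff (P k) (M : Matrix (Fin d) (Fin d) K) →
    (∀ a, P k a → v ((M : Matrix (Fin d) (Fin d) K) (piv k) (piv k)) ≤
      v ((M : Matrix (Fin d) (Fin d) K) a (piv k))) →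
    ∃ g ∈ intGroup v Γ (P k), g ∈ lowerGroup K d ∧
      (∀ i, (g : Matrix (Fin d) (Fin d) K) i i = 1) ∧ ∀ a, a ≠ piv k →
      ((g * M : (Matrix (Fin d) (Fin d) K)ˣ) : Matrix (Fin d) (Fin d) K) a (piv k) = 0
  clearRow : ∀ k < t, ∀ M ∈ Γ, DiagOff (P k) (M : Matrix (Fin d) (Fin d) K) →
    (∀ b, P k b → v ((M : Matrix (Fin d) (Fin d) K) (piv k) (piv k)) ≤
      v ((M : Matrix (Fin d) (Fin d) K) (piv k) b)) →
    ∃ g ∈ intGroup v Γ (P k), (∀ a, (g : Matrix (Fin d) (Fin d) K) a (piv k) =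
        (1 : Matrix (Fin d) (Fin d) K) a (piv k)) ∧ ∀ b, b ≠ piv k →
      ((M * g : (Matrix (Fin d) (Fin d) K)ˣ) : Matrix (Fin d) (Fin d) K) (piv k) b = 0
  orth : ∀ k < t, ∀ M ∈ Γ, DiagOff (P k) (M : Matrix (Fin d) (Fin d) K) →
    (∀ a, a ≠ piv k → (M : Matrix (Fin d) (Fin d) K) a (piv k) = 0) →
    (∀ b, b ≠ piv k → (M : Matrix (Fin d) (Fin d) K) (piv k) b = 0) →
    DiagOff (P (k + 1)) (M : Matrix (Fin d) (Fin d) K)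
  term : ∀ M ∈ Γ, DiagOff (P t) (M : Matrix (Fin d) (Fin d) K) →
    ∀ i j, i ≠ j → (M : Matrix (Fin d) (Fin d) K) i j = 0

/-- Diagonal matrices in `Γ` each of whose pivot entries, from the `k`-th on, divides the diagonal
entries that are active when it is chosen. -/
def DomFrom (Γ : Subgroup (Matrix (Fin d) (Fin d) K)ˣ) (t : ℕ) (P : ℕ → Fin d → Prop)
    (piv : ℕ → Fin d) (k : ℕ) (D : (Matrix (Fin d) (Fin d) K)ˣ) : Prop :=
  D ∈ Γ ∧ (∀ i j, i ≠ j → (D : Matrix (Fin d) (Fin d) K) i j = 0) ∧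
    ∀ l, k ≤ l → l < t → ∀ j, P l j →
      v ((D : Matrix (Fin d) (Fin d) K) (piv l) (piv l)) ≤ v ((D : Matrix (Fin d) (Fin d) K) j j)

namespace Elimination

variable {v} {Γ : Subgroup (Matrix (Fin d) (Fin d) K)ˣ} {t : ℕ} {P : ℕ → Fin d → Prop}
  {piv : ℕ → Fin d} (H : Elimination v Γ t P piv)
include H

/-- Elementary divisors: elimination by integral elements on both sides makes a matrix diagonal,
and a pivot of least value can be chosen in each step. -/
lemma cartan (m : ℕ) : ∀ k, k + m = t → ∀ M ∈ Γ, DiagOff (P k) (M : Matrix (Fin d) (Fin d) K) →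
    ∃ D, ∃ g ∈ intGroup v Γ (P k), ∃ g' ∈ intGroup v Γ (P k), D = g * M * g' ∧
      DomFrom v Γ t P piv k D ∧ (k < t → ∀ i j, P k i → P k j →
        v ((D : Matrix (Fin d) (Fin d) K) (piv k) (piv k)) ≤
          v ((M : Matrix (Fin d) (Fin d) K) i j)) := by
  induction m with
  | zero =>
    intro k hk M hM hoff
    obtain rfl : k = t := by omega
    exact ⟨M, 1, one_mem _, 1, one_mem _, by simp, ⟨hM, H.term M hM hoff, fun l h1 h2 => by omega⟩,
      fun h => by omega⟩
  | succ m ih =>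
    intro k hk M hM hoff
    have hkt : k < t := by omega
    set p := piv k with hp
    have hPp : P k p := H.piv_mem k hkt
    classical
    obtain ⟨⟨i₀, j₀⟩, h0, hmin⟩ := Finset.exists_min_image
      (Finset.univ.filter fun q : Fin d × Fin d => P k q.1 ∧ P k q.2)
      (fun q => v ((M : Matrix (Fin d) (Fin d) K) q.1 q.2)) ⟨(p, p), by simp [hPp]⟩
    simp only [Finset.mem_filter, Finset.mem_univ, true_and, Prod.forall, and_imp] at h0 hmin
    set c := v ((M : Matrix (Fin d) (Fin d) K) i₀ j₀) with hc
    obtain ⟨g₁, hg₁, hrow⟩ := H.row k hkt M hM hoff i₀ h0.1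
    have hoff₁ : DiagOff (P k) ((M * g₁ : (Matrix (Fin d) (Fin d) K)ˣ) :
        Matrix (Fin d) (Fin d) K) := by
      rw [Units.val_mul]; exact hoff.mul_right hg₁.2.2.1
    have hlow₁ : ∀ i j, P k i → P k j → c ≤ v (((M * g₁ : (Matrix (Fin d) (Fin d) K)ˣ) :
        Matrix (Fin d) (Fin d) K) i j) := by
      rw [Units.val_mul]; exact hg₁.2.2.1.le_v_mul_right v hg₁.2.1.1 hmin
    have hM₁ : M * g₁ ∈ Γ := mul_mem hM hg₁.1
    have hup₁ : v (((M * g₁ : (Matrix (Fin d) (Fin d) K)ˣ) : Matrix (Fin d) (Fin d) K) i₀ p) ≤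
        c := by
      have e : (M : Matrix (Fin d) (Fin d) K) =
          ((M * g₁ : (Matrix (Fin d) (Fin d) K)ˣ) : Matrix (Fin d) (Fin d) K) *
          ((g₁⁻¹ : (Matrix (Fin d) (Fin d) K)ˣ) : Matrix (Fin d) (Fin d) K) := by
        rw [← Units.val_mul, mul_inv_cancel_right]
      rw [hc, e, Matrix.mul_apply, Finset.sum_eq_single p]
      · exact le_v_mul_right v (hg₁.2.1.2 _ _)
      · intro b _ hb
        rw [hrow b hb, zero_mul]
      · simp
    obtain ⟨M₁, hM₁def⟩ : ∃ M₁, M₁ = M * g₁ := ⟨_, rfl⟩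
    rw [← hM₁def] at hoff₁ hlow₁ hM₁ hup₁ hrow
    obtain ⟨g₂, hg₂, hcol⟩ := H.col k hkt M₁ hM₁ hoff₁ p hPp
    have hoff₂ : DiagOff (P k) ((g₂ * M₁ : (Matrix (Fin d) (Fin d) K)ˣ) :
        Matrix (Fin d) (Fin d) K) := by
      rw [Units.val_mul]; exact hoff₁.mul_left hg₂.2.2.1
    have hlow₂ : ∀ i j, P k i → P k j → c ≤ v (((g₂ * M₁ : (Matrix (Fin d) (Fin d) K)ˣ) :
        Matrix (Fin d) (Fin d) K) i j) := by
      rw [Units.val_mul]; exact hg₂.2.2.1.le_v_mul_left v hg₂.2.1.1 hlow₁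
    have hM₂ : g₂ * M₁ ∈ Γ := mul_mem hg₂.1 hM₁
    have hup₂ : v (((g₂ * M₁ : (Matrix (Fin d) (Fin d) K)ˣ) : Matrix (Fin d) (Fin d) K) p p) ≤
        c := by
      have e : (M₁ : Matrix (Fin d) (Fin d) K) =
          ((g₂⁻¹ : (Matrix (Fin d) (Fin d) K)ˣ) : Matrix (Fin d) (Fin d) K) *
          ((g₂ * M₁ : (Matrix (Fin d) (Fin d) K)ˣ) : Matrix (Fin d) (Fin d) K) := by
        rw [← Units.val_mul, inv_mul_cancel_left]
      refine le_trans ?_ hup₁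
      conv_rhs => rw [e, Matrix.mul_apply, Finset.sum_eq_single p
        (fun a _ ha => by rw [hcol a ha, mul_zero]) (by simp)]
      exact le_v_mul_left v (hg₂.2.1.2 _ _)
    obtain ⟨M₂, hM₂def⟩ : ∃ M₂, M₂ = g₂ * M₁ := ⟨_, rfl⟩
    rw [← hM₂def] at hoff₂ hlow₂ hM₂ hup₂ hcol
    obtain ⟨g₃, hg₃, hg₃col, hrow₃⟩ := H.clearRow k hkt M₂ hM₂ hoff₂
      fun b hb => hup₂.trans (hlow₂ p b hPp hb)
    have hoff₃ : DiagOff (P k) ((M₂ * g₃ : (Matrix (Fin d) (Fin d) K)ˣ) :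
        Matrix (Fin d) (Fin d) K) := by
      rw [Units.val_mul]; exact hoff₂.mul_right hg₃.2.2.1
    have hlow₃ : ∀ i j, P k i → P k j → c ≤ v (((M₂ * g₃ : (Matrix (Fin d) (Fin d) K)ˣ) :
        Matrix (Fin d) (Fin d) K) i j) := by
      rw [Units.val_mul]; exact hg₃.2.2.1.le_v_mul_right v hg₃.2.1.1 hlow₂
    have hM₃ : M₂ * g₃ ∈ Γ := mul_mem hM₂ hg₃.1
    have hcol₃ : ∀ a, ((M₂ * g₃ : (Matrix (Fin d) (Fin d) K)ˣ) : Matrix (Fin d) (Fin d) K) a p =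
        (M₂ : Matrix (Fin d) (Fin d) K) a p := by
      intro a
      rw [Units.val_mul, Matrix.mul_apply, Finset.sum_eq_single p]
      · rw [hg₃col, Matrix.one_apply_eq, mul_one]
      · intro b _ hb
        rw [hg₃col, Matrix.one_apply_ne hb, mul_zero]
      · simp
    obtain ⟨M₃, hM₃def⟩ : ∃ M₃, M₃ = M₂ * g₃ := ⟨_, rfl⟩
    rw [← hM₃def] at hoff₃ hlow₃ hM₃ hcol₃ hrow₃
    have hoff' := H.orth k hkt M₃ hM₃ hoff₃ (fun a ha => by rw [hcol₃, hcol a ha]) hrow₃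
    obtain ⟨D, g, hg, g', hg', hD, ⟨hDΓ, hDd, hDc⟩, -⟩ := ih (k + 1) (by omega) M₃ hM₃ hoff'
    have hDp : ∀ i, ¬ P (k + 1) i → (D : Matrix (Fin d) (Fin d) K) i i =
        (M₃ : Matrix (Fin d) (Fin d) K) i i := by
      intro i hi
      rw [hD, Units.val_mul, hg'.2.2.1.apply_mul i hi, Units.val_mul, hg.2.2.1.mul_apply hi]
    have hDpp : v ((D : Matrix (Fin d) (Fin d) K) p p) ≤ c := by
      rw [hDp p (H.piv_not k hkt), hcol₃]; exact hup₂
    have hm := intGroup_mono v (Γ := Γ) (H.anti k)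
    refine ⟨D, g * g₂, mul_mem (hm hg) hg₂, g₁ * g₃ * g', mul_mem (mul_mem hg₁ hg₃) (hm hg'), ?_,
      ⟨hDΓ, hDd, ?_⟩, fun _ i j hi hj => hDpp.trans (hmin i j hi hj)⟩
    · rw [hD, hM₃def, hM₂def, hM₁def]; group
    · intro l hl hlt j hj
      rcases Nat.eq_or_lt_of_le hl with rfl | hl
      · refine hDpp.trans ?_
        by_cases hj' : P (k + 1) j
        · rw [hD, Units.val_mul, Units.val_mul]
          exact hg'.2.2.1.le_v_mul_right v hg'.2.1.1
            (hg.2.2.1.le_v_mul_left v hg.2.1.1 fun i j hi hj =>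
              hlow₃ i j (H.anti k i hi) (H.anti k j hj)) j j hj' hj'
        · rw [hDp j hj']
          exact hlow₃ j j hj hj
      · exact hDc l hl hlt j hj

/-- A lower triangular matrix has a dominant diagonal matrix in its double coset whose exponents
are lexicographically at most those of the matrix; in case of equality, already the coset
agrees, since then the elimination needs row operations only. -/
lemma tri (m : ℕ) : ∀ k, k + m = t → ∀ h ∈ Γ, h ∈ lowerGroup K d →
    DiagOff (P k) (h : Matrix (Fin d) (Fin d) K) →
    ∃ D, ∃ g ∈ intGroup v Γ (P k), ∃ g' ∈ intGroup v Γ (P k), D = g * h * g' ∧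
      DomFrom v Γ t P piv k D ∧
      exps v (D : Matrix (Fin d) (Fin d) K) ≤ exps v (h : Matrix (Fin d) (Fin d) K) ∧
      (exps v (D : Matrix (Fin d) (Fin d) K) = exps v (h : Matrix (Fin d) (Fin d) K) →
        ∃ g ∈ intGroup v Γ (P k), D = g * h) := by
  induction m with
  | zero =>
    intro k hk h hh hhl hoff
    obtain rfl : k = t := by omega
    exact ⟨h, 1, one_mem _, 1, one_mem _, by simp, ⟨hh, H.term h hh hoff, fun l h1 h2 => by omega⟩,
      le_rfl, fun _ => ⟨1, one_mem _, by simp⟩⟩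
  | succ m ih =>
    intro k hk h hh hhl hoff
    have hkt : k < t := by omega
    set p := piv k with hp
    have hPp : P k p := H.piv_mem k hkt
    by_cases hmin : ∀ i j, P k i → P k j → v ((h : Matrix (Fin d) (Fin d) K) p p) ≤
        v ((h : Matrix (Fin d) (Fin d) K) i j)
    · obtain ⟨g₁, hg₁, hg₁l, hg₁d, hcol⟩ := H.clearCol k hkt h hh hoff fun a ha => hmin a p ha hPp
      have hoff₁ : DiagOff (P k) ((g₁ * h : (Matrix (Fin d) (Fin d) K)ˣ) :
          Matrix (Fin d) (Fin d) K) := by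
        rw [Units.val_mul]; exact hoff.mul_left hg₁.2.2.1
      have hl₁ : g₁ * h ∈ lowerGroup K d := mul_mem hg₁l hhl
      have hM₁ : g₁ * h ∈ Γ := mul_mem hg₁.1 hh
      have hdiag : ∀ i, ((g₁ * h : (Matrix (Fin d) (Fin d) K)ˣ) : Matrix (Fin d) (Fin d) K) i i =
          (h : Matrix (Fin d) (Fin d) K) i i := by
        intro i
        rw [Units.val_mul, IsLower.mul_diag hg₁l hhl, hg₁d, one_mul]
      have hexp : exps v ((g₁ * h : (Matrix (Fin d) (Fin d) K)ˣ) : Matrix (Fin d) (Fin d) K) =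
          exps v (h : Matrix (Fin d) (Fin d) K) := by
        funext i
        exact congrArg (ev v) (hdiag i)
      have hrow : ∀ b, b ≠ p → ((g₁ * h : (Matrix (Fin d) (Fin d) K)ˣ) :
          Matrix (Fin d) (Fin d) K) p b = 0 := by
        intro b hb
        rcases lt_or_gt_of_ne hb with hlt | hgt
        · refine hoff₁ p b (Ne.symm hb) fun h' => ?_
          exact absurd (H.piv_le k hkt b h'.2) (not_le.2 hlt)
        · exact hl₁ p b hgt
      have hoff' := H.orth k hkt _ hM₁ hoff₁ hcol hrow
      obtain ⟨D, g, hg, g', hg', hD, ⟨hDΓ, hDd, hDc⟩, hle, heq⟩ :=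
        ih (k + 1) (by omega) _ hM₁ hl₁ hoff'
      have hDp : (D : Matrix (Fin d) (Fin d) K) p p = (h : Matrix (Fin d) (Fin d) K) p p := by
        have hi := H.piv_not k hkt
        rw [← hdiag, hD, Units.val_mul, hg'.2.2.1.apply_mul p hi, Units.val_mul,
          hg.2.2.1.mul_apply hi]
      have hm := intGroup_mono v (Γ := Γ) (H.anti k)
      have hgg := mul_mem (hm hg) hg₁
      have hD' : D = (g * g₁) * h * g' := by rw [hD]; group
      refine ⟨D, g * g₁, hgg, g', hm hg', hD', ⟨hDΓ, hDd, ?_⟩, hexp ▸ hle, fun he => ?_⟩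
      · intro l hl hlt j hj
        rcases Nat.eq_or_lt_of_le hl with rfl | hl
        · rw [← hp, hDp, hD', Units.val_mul, Units.val_mul]
          exact (hm hg').2.2.1.le_v_mul_right v hg'.2.1.1
            (hgg.2.2.1.le_v_mul_left v hgg.2.1.1 hmin) j j hj hj
        · exact hDc l hl hlt j hj
      · rw [← hexp] at he
        obtain ⟨g₂, hg₂, h2⟩ := heq he
        exact ⟨g₂ * g₁, mul_mem (hm hg₂) hg₁, by rw [h2, mul_assoc]⟩
    · push Not at hmin
      obtain ⟨i, j, hi, hj, hij⟩ := hmin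
      obtain ⟨D, g, hg, g', hg', hD, hdom, hDle⟩ := H.cartan (m + 1) k hk h hh hoff
      have hDl : D ∈ lowerGroup K d := IsLower.of_diag hdom.2.1
      have hlt : exps v (D : Matrix (Fin d) (Fin d) K) < exps v (h : Matrix (Fin d) (Fin d) K) := by
        refine ⟨p, fun q hq => ?_, ?_⟩
        · have hqP : ¬ P k q := fun h' => absurd (H.piv_le k hkt q h') (not_le.2 hq)
          change ev v _ = ev v _
          rw [hD, Units.val_mul, hg'.2.2.1.apply_mul q hqP, Units.val_mul,
            hg.2.2.1.mul_apply hqP]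
        · change ev v _ < ev v _
          have h1 := (hDle hkt i j hi hj).trans_lt hij
          rw [← coe_ev v (lowerGroup_diag_ne hDl p), ← coe_ev v (lowerGroup_diag_ne hhl p)] at h1
          exact WithTop.coe_lt_coe.1 h1
      exact ⟨D, g, hg, g', hg', hD, hdom, hlt.le, fun he => absurd he hlt.ne⟩

end Elimination

end elimination

end LocalHecke

/-! ### Elimination in the general linear group -/

namespace LocalHecke

section gl

variable {K : Type*} [DivisionRing K] (v : AddValuation K (WithTop ℤ)) {d : ℕ}

/-- The unit `1 + N` for a matrix `N` of square zero. -/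
def oneAddUnit (N : Matrix (Fin d) (Fin d) K) (h : N * N = 0) : (Matrix (Fin d) (Fin d) K)ˣ where
  val := 1 + N
  inv := 1 - N
  val_inv := by rw [mul_sub, mul_one, add_mul, one_mul, h, add_zero, add_sub_cancel_right]
  inv_val := by rw [mul_add, mul_one, sub_mul, one_mul, h, sub_zero, sub_add_cancel]

lemma oneAddUnit_mem_intGroup {N : Matrix (Fin d) (Fin d) K} (h : N * N = 0) {P : Fin d → Prop}
    (hN : IntMat v N) (hP : ∀ i j, ¬ (P i ∧ P j) → N i j = 0) :
    oneAddUnit N h ∈ intGroup v ⊤ P := by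
  refine ⟨trivial, ⟨fun i j => ?_, fun i j => ?_⟩, fun i j hij => ?_, fun i j hij => ?_⟩
  · exact (le_min (IntMat.one v i j) (hN i j)).trans (v.map_add _ _)
  · exact (le_min (IntMat.one v i j) (hN i j)).trans (v.map_sub _ _)
  · change (1 : Matrix (Fin d) (Fin d) K) i j + N i j = _
    rw [hP i j hij, add_zero]
  · change (1 : Matrix (Fin d) (Fin d) K) i j - N i j = _
    rw [hP i j hij, sub_zero]

/-- The matrix with column `a` equal to `z` and zeros elsewhere. -/
def colMat (a : Fin d) (z : Fin d → K) : Matrix (Fin d) (Fin d) K :=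
  fun i j => if j = a then z i else 0

/-- The matrix with row `a` equal to `z` and zeros elsewhere. -/
def rowMat (a : Fin d) (z : Fin d → K) : Matrix (Fin d) (Fin d) K :=
  fun i j => if i = a then z j else 0

lemma colMat_sq {a : Fin d} {z : Fin d → K} (h : z a = 0) : colMat a z * colMat a z = 0 := by
  ext i j
  rw [Matrix.mul_apply, Matrix.zero_apply]
  refine Finset.sum_eq_zero fun k _ => ?_
  by_cases hk : k = a
  · subst hk; simp [colMat, h]
  · simp [colMat, hk]

lemma rowMat_sq {a : Fin d} {z : Fin d → K} (h : z a = 0) : rowMat a z * rowMat a z = 0 := by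
  ext i j
  rw [Matrix.mul_apply, Matrix.zero_apply]
  refine Finset.sum_eq_zero fun k _ => ?_
  by_cases hk : k = a
  · subst hk; simp [rowMat, h]
  · simp [rowMat, hk]

lemma oneAdd_colMat_mul {a : Fin d} {z : Fin d → K} (h : z a = 0) (M : Matrix (Fin d) (Fin d) K)
    (i j : Fin d) : ((oneAddUnit _ (colMat_sq h) : Matrix (Fin d) (Fin d) K) * M) i j =
      M i j + z i * M a j := by
  change ((1 + colMat a z) * M) i j = _
  rw [add_mul, one_mul, Matrix.add_apply, Matrix.mul_apply, Finset.sum_eq_single a]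
  · simp [colMat]
  · intro k _ hk; simp [colMat, hk]
  · simp

lemma mul_oneAdd_rowMat {a : Fin d} {z : Fin d → K} (h : z a = 0) (M : Matrix (Fin d) (Fin d) K)
    (i j : Fin d) : (M * (oneAddUnit _ (rowMat_sq h) : Matrix (Fin d) (Fin d) K)) i j =
      M i j + M i a * z j := by
  change (M * (1 + rowMat a z)) i j = _
  rw [mul_add, mul_one, Matrix.add_apply, Matrix.mul_apply, Finset.sum_eq_single a]
  · simp [rowMat]
  · intro k _ hk; simp [rowMat, hk]
  · simp

lemma add_neg_mul_inv_mul {x p : K} (h : v p ≤ v x) : x + -(x * p⁻¹) * p = 0 := by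
  by_cases hp : p = 0
  · have : x = 0 := by
      rw [hp, AddValuation.map_zero, top_le_iff] at h
      exact (AddValuation.top_iff v).1 h
    simp [this, hp]
  · rw [neg_mul, inv_mul_cancel_right₀ hp, add_neg_cancel]

lemma add_mul_neg_inv_mul {x p : K} (h : v p ≤ v x) : x + p * -(p⁻¹ * x) = 0 := by
  by_cases hp : p = 0
  · have : x = 0 := by
      rw [hp, AddValuation.map_zero, top_le_iff] at h
      exact (AddValuation.top_iff v).1 h
    simp [this, hp]
  · rw [mul_neg, mul_inv_cancel_left₀ hp, add_neg_cancel]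

lemma v_neg_mul_inv_nonneg {x p : K} (h : v p ≤ v x) : 0 ≤ v (-(x * p⁻¹)) := by
  rw [AddValuation.map_neg]
  by_cases hp : p = 0
  · simp [hp]
  · exact v_mul_inv_nonneg v hp h

lemma v_neg_inv_mul_nonneg {x p : K} (h : v p ≤ v x) : 0 ≤ v (-(p⁻¹ * x)) := by
  rw [AddValuation.map_neg]
  by_cases hp : p = 0
  · simp [hp]
  · exact v_inv_mul_nonneg v hp h

open scoped Classical in
/-- A unipotent integral matrix clears an active column by a pivot of least value; it is lower
triangular if the pivot is the first active index. -/
lemma gl_clearCol (P : Fin d → Prop) {p : Fin d} (hp : P p) (M : Matrix (Fin d) (Fin d) K)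
    (c : Fin d) (hmin : ∀ a, P a → v (M p c) ≤ v (M a c)) :
    ∃ g ∈ intGroup v ⊤ P, ((∀ a, P a → p ≤ a) → g ∈ lowerGroup K d) ∧
      (∀ i, (g : Matrix (Fin d) (Fin d) K) i i = 1) ∧
      ∀ a, P a → a ≠ p → ((g : Matrix (Fin d) (Fin d) K) * M) a c = 0 := by
  set z : Fin d → K := fun a => if P a ∧ a ≠ p then -(M a c * (M p c)⁻¹) else 0 with hz
  have hza : z p = 0 := by simp [hz]
  refine ⟨oneAddUnit _ (colMat_sq hza), oneAddUnit_mem_intGroup v _ (fun i j => ?_)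
    (fun i j hij => ?_), fun hle i j hij => ?_, fun i => ?_, fun a ha hap => ?_⟩
  · rw [colMat]
    split_ifs with h
    · simp only [hz]
      split_ifs with h'
      · exact v_neg_mul_inv_nonneg v (hmin i h'.1)
      · simp
    · simp
  · rw [colMat]
    split_ifs with h
    · subst h
      simp only [hz]
      rw [if_neg fun h => hij ⟨h.1, hp⟩]
    · rfl
  · change (1 : Matrix (Fin d) (Fin d) K) i j + colMat p z i j = 0
    rw [Matrix.one_apply_ne hij.ne, zero_add, colMat]
    split_ifs with h
    · subst h
      simp only [hz]
      rw [if_neg fun h => absurd (hle i h.1) (not_le.2 hij)]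
    · rfl
  · change (1 : Matrix (Fin d) (Fin d) K) i i + colMat p z i i = 1
    rw [Matrix.one_apply_eq, colMat]
    split_ifs with h
    · rw [h, hza, add_zero]
    · rw [add_zero]
  · rw [oneAdd_colMat_mul hza]
    simp only [hz]
    rw [if_pos ⟨ha, hap⟩, add_neg_mul_inv_mul v (hmin a ha)]

open scoped Classical in
/-- A unipotent integral matrix clears an active row by a pivot of least value without changing the
column of the pivot. -/
lemma gl_clearRow (P : Fin d → Prop) {p : Fin d} (hp : P p) (M : Matrix (Fin d) (Fin d) K)
    (r : Fin d) (hmin : ∀ a, P a → v (M r p) ≤ v (M r a)) :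
    ∃ g ∈ intGroup v ⊤ P, (∀ a, (g : Matrix (Fin d) (Fin d) K) a p =
        (1 : Matrix (Fin d) (Fin d) K) a p) ∧
      ∀ a, P a → a ≠ p → (M * (g : Matrix (Fin d) (Fin d) K)) r a = 0 := by
  set z : Fin d → K := fun a => if P a ∧ a ≠ p then -((M r p)⁻¹ * M r a) else 0 with hz
  have hza : z p = 0 := by simp [hz]
  refine ⟨oneAddUnit _ (rowMat_sq hza), oneAddUnit_mem_intGroup v _ (fun i j => ?_)
    (fun i j hij => ?_), fun i => ?_, fun a ha hap => ?_⟩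
  · rw [rowMat]
    split_ifs with h
    · simp only [hz]
      split_ifs with h'
      · exact v_neg_inv_mul_nonneg v (hmin j h'.1)
      · simp
    · simp
  · rw [rowMat]
    split_ifs with h
    · subst h
      simp only [hz]
      rw [if_neg fun h => hij ⟨hp, h.1⟩]
    · rfl
  · change (1 : Matrix (Fin d) (Fin d) K) i p + rowMat p z i p = _
    rw [rowMat, hza, ite_self, add_zero]
  · rw [mul_oneAdd_rowMat hza]
    simp only [hz]
    rw [if_pos ⟨ha, hap⟩, add_mul_neg_inv_mul v (hmin a ha)]

lemma v_add_of_lt {x y : K} (h : v x < v y) : v (y + x) = v x := by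
  rw [add_comm]; exact v.map_add_eq_of_lt_left h

/-- A column can be cleared by integral row operations, except for one prescribed entry. -/
lemma gl_col (P : Fin d → Prop) {p : Fin d} (hp : P p) (M : Matrix (Fin d) (Fin d) K) (c : Fin d) :
    ∃ g ∈ intGroup v ⊤ P, ∀ a, P a → a ≠ p → ((g : Matrix (Fin d) (Fin d) K) * M) a c = 0 := by
  classical
  obtain ⟨i, hi, hmin⟩ := Finset.exists_min_image (Finset.univ.filter P) (fun a => v (M a c))
    ⟨p, by simpa using hp⟩
  simp only [Finset.mem_filter, Finset.mem_univ, true_and] at hi hmin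
  rcases (hmin p hp).eq_or_lt with heq | hlt
  · obtain ⟨g, hg, -, -, h⟩ := gl_clearCol v P hp M c fun a ha => heq ▸ hmin a ha
    exact ⟨g, hg, h⟩
  · -- adding row `i` to row `p` makes the value of the entry in row `p` minimal
    have hip : i ≠ p := by rintro rfl; exact lt_irrefl _ hlt
    have hza : (Pi.single p 1 : Fin d → K) i = 0 := by simp [hip]
    have hu : oneAddUnit _ (colMat_sq hza) ∈ intGroup v ⊤ P := by
      refine oneAddUnit_mem_intGroup v _ (fun a b => ?_) (fun a b hab => ?_)
      · rw [colMat, Pi.single_apply]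
        split_ifs <;> simp
      · rw [colMat, Pi.single_apply]
        split_ifs with h1 h2
        · subst h1 h2; exact absurd ⟨hp, hi⟩ hab
        · rfl
        · rfl
    obtain ⟨g, hg, -, -, h⟩ := gl_clearCol v P hp
      ((oneAddUnit _ (colMat_sq hza) : Matrix (Fin d) (Fin d) K) * M) c fun a ha => by
        rw [oneAdd_colMat_mul hza, oneAdd_colMat_mul hza, Pi.single_eq_same, one_mul, v_add_of_lt v hlt]
        refine (le_min (hmin a ha) ?_).trans (v.map_add _ _)
        rw [Pi.single_apply]; split_ifs <;> simp
    refine ⟨g * oneAddUnit _ (colMat_sq hza), mul_mem hg hu, fun a ha hap => ?_⟩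
    rw [Units.val_mul, mul_assoc]
    exact h a ha hap

lemma gl_row (P : Fin d → Prop) {p : Fin d} (hp : P p) (M : Matrix (Fin d) (Fin d) K) (r : Fin d) :
    ∃ g ∈ intGroup v ⊤ P, ∀ a, P a → a ≠ p → (M * (g : Matrix (Fin d) (Fin d) K)) r a = 0 := by
  classical
  obtain ⟨i, hi, hmin⟩ := Finset.exists_min_image (Finset.univ.filter P) (fun a => v (M r a))
    ⟨p, by simpa using hp⟩
  simp only [Finset.mem_filter, Finset.mem_univ, true_and] at hi hmin
  rcases (hmin p hp).eq_or_lt with heq | hlt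
  · obtain ⟨g, hg, -, h⟩ := gl_clearRow v P hp M r fun a ha => heq ▸ hmin a ha
    exact ⟨g, hg, h⟩
  · have hip : i ≠ p := by rintro rfl; exact lt_irrefl _ hlt
    have hza : (Pi.single p 1 : Fin d → K) i = 0 := by simp [hip]
    have hu : oneAddUnit _ (rowMat_sq hza) ∈ intGroup v ⊤ P := by
      refine oneAddUnit_mem_intGroup v _ (fun a b => ?_) (fun a b hab => ?_)
      · rw [rowMat, Pi.single_apply]
        split_ifs <;> simp
      · rw [rowMat, Pi.single_apply]
        split_ifs with h1 h2
        · subst h1 h2; exact absurd ⟨hi, hp⟩ hab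
        · rfl
        · rfl
    obtain ⟨g, hg, -, h⟩ := gl_clearRow v P hp
      (M * (oneAddUnit _ (rowMat_sq hza) : Matrix (Fin d) (Fin d) K)) r fun a ha => by
        rw [mul_oneAdd_rowMat hza, mul_oneAdd_rowMat hza, Pi.single_eq_same, mul_one, v_add_of_lt v hlt]
        refine (le_min (hmin a ha) ?_).trans (v.map_add _ _)
        rw [Pi.single_apply]; split_ifs <;> simp
    refine ⟨oneAddUnit _ (rowMat_sq hza) * g, mul_mem hu hg, fun a ha hap => ?_⟩
    rw [Units.val_mul, ← mul_assoc]
    exact h a ha hap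

/-- Gaussian elimination: in step `k` the active indices are those from `k` on, and `k` is the
pivot. -/
lemma gl_elimination (hd : 0 < d) :
    Elimination v (⊤ : Subgroup (Matrix (Fin d) (Fin d) K)ˣ) d (fun k i => k ≤ (i : ℕ))
      (fun k => ⟨min k (d - 1), by omega⟩) where
  zero i := Nat.zero_le _
  anti k i h := Nat.le_of_succ_le h
  piv_mem k hk := by simp only; omega
  piv_le k hk j hj := by simp only [Fin.le_def] at *; omega
  piv_not k hk := by simp only; omega
  col k hk M _ hoff j hj := by
    obtain ⟨g, hg, h⟩ := gl_col v (fun i : Fin d => k ≤ (i : ℕ)) (p := ⟨min k (d - 1), by omega⟩)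
      (by simp only; omega) (M : Matrix (Fin d) (Fin d) K) j
    refine ⟨g, hg, fun a ha => ?_⟩
    by_cases hPa : k ≤ (a : ℕ)
    · exact h a hPa ha
    · rw [Units.val_mul, hg.2.2.1.mul_apply hPa]
      exact hoff a j (by rintro rfl; exact hPa hj) fun h => hPa h.1
  row k hk M _ hoff i hi := by
    obtain ⟨g, hg, h⟩ := gl_row v (fun i : Fin d => k ≤ (i : ℕ)) (p := ⟨min k (d - 1), by omega⟩)
      (by simp only; omega) (M : Matrix (Fin d) (Fin d) K) i
    refine ⟨g, hg, fun a ha => ?_⟩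
    by_cases hPa : k ≤ (a : ℕ)
    · exact h a hPa ha
    · rw [Units.val_mul, hg.2.2.1.apply_mul i hPa]
      exact hoff i a (by rintro rfl; exact hPa hi) fun h => hPa h.2
  clearCol k hk M _ hoff hmin := by
    obtain ⟨g, hg, hgl, hgd, h⟩ := gl_clearCol v (fun i : Fin d => k ≤ (i : ℕ))
      (p := ⟨min k (d - 1), by omega⟩) (by simp only; omega) (M : Matrix (Fin d) (Fin d) K) _ hmin
    refine ⟨g, hg, hgl fun a ha => by simp only [Fin.le_def]; omega, hgd, fun a ha => ?_⟩
    by_cases hPa : k ≤ (a : ℕ)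
    · exact h a hPa ha
    · rw [Units.val_mul, hg.2.2.1.mul_apply hPa]
      exact hoff a _ ha fun h => hPa h.1
  clearRow k hk M _ hoff hmin := by
    obtain ⟨g, hg, hgc, h⟩ := gl_clearRow v (fun i : Fin d => k ≤ (i : ℕ))
      (p := ⟨min k (d - 1), by omega⟩) (by simp only; omega) (M : Matrix (Fin d) (Fin d) K) _ hmin
    refine ⟨g, hg, hgc, fun a ha => ?_⟩
    by_cases hPa : k ≤ (a : ℕ)
    · exact h a hPa ha
    · rw [Units.val_mul, hg.2.2.1.apply_mul _ hPa]
      exact hoff _ a (Ne.symm ha) fun h => hPa h.2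
  orth k hk M _ hoff hcol hrow i j hij h := by
    by_cases h' : k ≤ (i : ℕ) ∧ k ≤ (j : ℕ)
    · by_cases hi : i = ⟨min k (d - 1), by omega⟩
      · rw [hi]; exact hrow j fun h => hij (hi.trans h.symm)
      · by_cases hj : j = ⟨min k (d - 1), by omega⟩
        · rw [hj]; exact hcol i hi
        · exfalso
          simp only [Fin.ext_iff] at hi hj
          omega
    · exact hoff i j hij h'
  term M _ hoff i j hij := hoff i j hij fun h => by omega

/-- Row operations with integral coefficients make an invertible matrix lower triangular. -/
lemma gl_iwasawa (M : (Matrix (Fin d) (Fin d) K)ˣ) :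
    ∃ g ∈ intGroup v ⊤ (fun _ : Fin d => True), g * M ∈ lowerGroup K d := by
  suffices h : ∀ k, k ≤ d → ∃ g ∈ intGroup v ⊤ (fun _ : Fin d => True), ∀ i j : Fin d, i < j →
      d ≤ j + k → ((g * M : (Matrix (Fin d) (Fin d) K)ˣ) : Matrix (Fin d) (Fin d) K) i j = 0 by
    obtain ⟨g, hg, h'⟩ := h d le_rfl
    exact ⟨g, hg, fun i j hij => h' i j hij (by omega)⟩
  intro k
  induction k with
  | zero => intro _; exact ⟨1, one_mem _, fun i j _ h => by omega⟩
  | succ k ih =>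
    intro hk
    obtain ⟨g, hg, h⟩ := ih (by omega)
    set c : Fin d := ⟨d - 1 - k, by omega⟩ with hc
    have hcv : (c : ℕ) = d - 1 - k := rfl
    obtain ⟨g', hg', h'⟩ := gl_col v (fun i : Fin d => i ≤ c) (p := c) le_rfl
      ((g * M : (Matrix (Fin d) (Fin d) K)ˣ) : Matrix (Fin d) (Fin d) K) c
    refine ⟨g' * g, mul_mem (intGroup_mono v (fun _ _ => trivial) hg') hg, fun i j hij hj => ?_⟩
    rw [mul_assoc, Units.val_mul]
    by_cases hi : i ≤ c
    · by_cases hjc : j = c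
      · subst hjc; exact h' i hi hij.ne
      · have hcj : c < j := by
          rw [Fin.lt_def]
          have : (j : ℕ) ≠ c := fun h => hjc (Fin.ext h)
          omega
        rw [Matrix.mul_apply]
        refine Finset.sum_eq_zero fun b _ => ?_
        by_cases hb : b ≤ c
        · rw [h b j (hb.trans_lt hcj) (by rw [Fin.lt_def] at hcj; omega), mul_zero]
        · rw [hg'.2.2.1 i b fun h => hb h.2,
            Matrix.one_apply_ne (by rintro rfl; exact hb hi), zero_mul]
    · rw [hg'.2.2.1.mul_apply hi]
      refine h i j hij ?_
      rw [not_le, Fin.lt_def] at hi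
      rw [Fin.lt_def] at hij
      omega

end gl

end LocalHecke

/-! ### The Hecke algebra of a matrix group with elimination -/

namespace LocalHecke

section coords

variable {X ι : Type*} [DecidableEq ι] [AddCommGroup X] {w : ι → X} {coord : ι → X →+ ℤ} {nz : ι → ℤ}

lemma coord_sum (hdual : ∀ i j, coord i (w j) = if i = j then nz i else 0) (c : ι →₀ ℕ) (i : ι) :
    coord i (c.sum fun i k => k • w i) = c i * nz i := by
  rw [Finsupp.sum, map_sum]
  simp only [map_nsmul, hdual]
  rw [Finset.sum_eq_single i]
  · simp
  · intro j _ hj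
    rw [if_neg (Ne.symm hj), smul_zero]
  · intro h
    rw [Finsupp.notMem_support_iff] at h
    simp [h]

lemma sum_injective_of_coord (hdual : ∀ i j, coord i (w j) = if i = j then nz i else 0)
    (hnz : ∀ i, nz i ≠ 0) :
    Function.Injective fun c : ι →₀ ℕ => c.sum fun i k => k • w i := by
  intro c c' h
  ext i
  have h1 := congrArg (coord i) h
  simp only [coord_sum hdual] at h1
  exact_mod_cast mul_right_cancel₀ (hnz i) h1

/-- An element on which the dual coordinates are natural multiples of their values on the weights is
a combination of the weights with natural coefficients. -/
lemma exists_sum_of_coord [Finite ι] (hdual : ∀ i j, coord i (w j) = if i = j then nz i else 0)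
    (X₀ : AddSubgroup X) (hw₀ : ∀ i, w i ∈ X₀) (hinj : ∀ x ∈ X₀, (∀ i, coord i x = 0) → x = 0)
    {x : X} (hx : x ∈ X₀) (hpos : ∀ i, ∃ k : ℕ, coord i x = k * nz i) :
    ∃ c : ι →₀ ℕ, x = c.sum fun i k => k • w i := by
  choose k hk using hpos
  refine ⟨Finsupp.equivFunOnFinite.symm k, sub_eq_zero.1 (hinj _ (X₀.sub_mem hx ?_) fun i => ?_)⟩
  · exact X₀.sum_mem fun i _ => X₀.nsmul_mem (hw₀ i) _
  · rw [map_sub, coord_sum hdual, hk]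
    simp

end coords

section bounded

variable {K : Type*} [DivisionRing K] (v : AddValuation K (WithTop ℤ)) {d : ℕ}

/-- The matrices whose inverse has entries of value at least `-k`. -/
def invBounded (k : ℕ) : Set (Matrix (Fin d) (Fin d) K)ˣ :=
  {M | ∀ i j, ((-k : ℤ) : WithTop ℤ) ≤
    v (((M⁻¹ : (Matrix (Fin d) (Fin d) K)ˣ) : Matrix (Fin d) (Fin d) K) i j)}

lemma invBounded_mono : Monotone (invBounded v : ℕ → Set (Matrix (Fin d) (Fin d) K)ˣ) := by
  intro k l hkl M hM i j
  exact (WithTop.coe_le_coe.2 (by omega)).trans (hM i j)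

lemma invBounded_mul {k l : ℕ} {M N : (Matrix (Fin d) (Fin d) K)ˣ} (hM : M ∈ invBounded v k)
    (hN : N ∈ invBounded v l) : M * N ∈ invBounded v (k + l) := by
  intro i j
  rw [mul_inv_rev, Units.val_mul, Matrix.mul_apply]
  refine v.map_le_sum fun a _ => ?_
  rw [AddValuation.map_mul]
  refine le_trans ?_ (add_le_add (hN i a) (hM a j))
  rw [← WithTop.coe_add]
  exact WithTop.coe_le_coe.2 (by push_cast; omega)

lemma exists_invBounded (M : (Matrix (Fin d) (Fin d) K)ˣ) : ∃ k, M ∈ invBounded v k := by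
  refine ⟨∑ i, ∑ j, (ev v (((M⁻¹ : (Matrix (Fin d) (Fin d) K)ˣ) :
    Matrix (Fin d) (Fin d) K) i j)).natAbs, fun i j => ?_⟩
  by_cases h : ((M⁻¹ : (Matrix (Fin d) (Fin d) K)ˣ) : Matrix (Fin d) (Fin d) K) i j = 0
  · rw [h]; simp
  · rw [le_v_iff v h]
    have h1 := Finset.single_le_sum (f := fun i => ∑ j, (ev v (((M⁻¹ :
      (Matrix (Fin d) (Fin d) K)ˣ) : Matrix (Fin d) (Fin d) K) i j)).natAbs)
      (fun _ _ => Nat.zero_le _) (Finset.mem_univ i)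
    have h2 := Finset.single_le_sum (f := fun j => (ev v (((M⁻¹ :
      (Matrix (Fin d) (Fin d) K)ˣ) : Matrix (Fin d) (Fin d) K) i j)).natAbs)
      (fun _ _ => Nat.zero_le _) (Finset.mem_univ j)
    omega

lemma mem_invBounded_zero {Γ : Subgroup (Matrix (Fin d) (Fin d) K)ˣ} {P : Fin d → Prop}
    {g : (Matrix (Fin d) (Fin d) K)ˣ} (hg : g ∈ intGroup v Γ P) : g ∈ invBounded v 0 := by
  intro i j
  simpa using hg.2.1.2 i j

lemma inv_apply_of_diag {D : (Matrix (Fin d) (Fin d) K)ˣ}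
    (hD : ∀ i j, i ≠ j → (D : Matrix (Fin d) (Fin d) K) i j = 0) (i j : Fin d) :
    ((D⁻¹ : (Matrix (Fin d) (Fin d) K)ˣ) : Matrix (Fin d) (Fin d) K) i j =
      if i = j then ((D : Matrix (Fin d) (Fin d) K) i i)⁻¹ else 0 := by
  have h := congrFun (congrFun D.mul_inv i) j
  rw [Matrix.mul_apply, Finset.sum_eq_single i (fun k _ hk => by rw [hD i k (Ne.symm hk), zero_mul])
    (by simp), Matrix.one_apply] at h
  have hne : (D : Matrix (Fin d) (Fin d) K) i i ≠ 0 :=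
    lowerGroup_diag_ne (IsLower.of_diag hD : D ∈ lowerGroup K d) i
  rw [eq_comm, ← mul_right_inj' hne, h]
  split_ifs
  · exact mul_inv_cancel₀ hne
  · exact mul_zero _

lemma mul_inv_intMat_of_exps_eq {D D' : (Matrix (Fin d) (Fin d) K)ˣ}
    (hD : ∀ i j, i ≠ j → (D : Matrix (Fin d) (Fin d) K) i j = 0)
    (hD' : ∀ i j, i ≠ j → (D' : Matrix (Fin d) (Fin d) K) i j = 0)
    (h : exps v (D : Matrix (Fin d) (Fin d) K) = exps v (D' : Matrix (Fin d) (Fin d) K)) :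
    IntMat v ((D * D'⁻¹ : (Matrix (Fin d) (Fin d) K)ˣ) : Matrix (Fin d) (Fin d) K) := by
  intro i j
  rw [Units.val_mul, Matrix.mul_apply,
    Finset.sum_eq_single i (fun k _ hk => by rw [hD i k (Ne.symm hk), zero_mul]) (by simp),
    inv_apply_of_diag hD']
  split_ifs with hij
  · have hne := lowerGroup_diag_ne (IsLower.of_diag hD : D ∈ lowerGroup K d) i
    have hne' := lowerGroup_diag_ne (IsLower.of_diag hD' : D' ∈ lowerGroup K d) i
    refine v_mul_inv_nonneg v hne' ((v_le_v_iff v hne' hne).2 ?_)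
    exact (congrFun h i).ge
  · simp

/-- Diagonal matrices with the same exponents differ by an integral unit. -/
lemma mul_inv_mem_intGroup {Γ : Subgroup (Matrix (Fin d) (Fin d) K)ˣ}
    {D D' : (Matrix (Fin d) (Fin d) K)ˣ} (hDΓ : D ∈ Γ) (hDΓ' : D' ∈ Γ)
    (hD : ∀ i j, i ≠ j → (D : Matrix (Fin d) (Fin d) K) i j = 0)
    (hD' : ∀ i j, i ≠ j → (D' : Matrix (Fin d) (Fin d) K) i j = 0)
    (h : exps v (D : Matrix (Fin d) (Fin d) K) = exps v (D' : Matrix (Fin d) (Fin d) K)) :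
    D' * D⁻¹ ∈ intGroup v Γ (fun _ : Fin d => True) := by
  refine ⟨mul_mem hDΓ' (inv_mem hDΓ), ⟨mul_inv_intMat_of_exps_eq v hD' hD h.symm, ?_⟩,
    fun i j h => absurd ⟨trivial, trivial⟩ h, fun i j h => absurd ⟨trivial, trivial⟩ h⟩
  rw [mul_inv_rev, inv_inv]
  exact mul_inv_intMat_of_exps_eq v hD hD' h

lemma diag_mem_invBounded {D : (Matrix (Fin d) (Fin d) K)ˣ}
    (hD : ∀ i j, i ≠ j → (D : Matrix (Fin d) (Fin d) K) i j = 0) {k : ℕ} :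
    D ∈ invBounded v k ↔ ∀ i, exps v (D : Matrix (Fin d) (Fin d) K) i ≤ k := by
  have hne := lowerGroup_diag_ne (IsLower.of_diag hD : D ∈ lowerGroup K d)
  have key : ∀ i, ((-k : ℤ) : WithTop ℤ) ≤ v ((D : Matrix (Fin d) (Fin d) K) i i)⁻¹ ↔
      exps v (D : Matrix (Fin d) (Fin d) K) i ≤ k := by
    intro i
    rw [le_v_iff v (inv_ne_zero (hne i)), ev_inv v (hne i), exps_apply]
    omega
  constructor
  · intro h i
    have := h i i
    rwa [inv_apply_of_diag hD, if_pos rfl, key] at this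
  · intro h i j
    rw [inv_apply_of_diag hD]
    split_ifs
    · exact (key i).2 (h i)
    · simp

end bounded

section main

variable {K : Type*} [DivisionRing K] {v : AddValuation K (WithTop ℤ)} {d : ℕ}
  {Γ : Subgroup (Matrix (Fin d) (Fin d) K)ˣ} {t : ℕ} {P : ℕ → Fin d → Prop} {piv : ℕ → Fin d}
variable {𝒢 : Type*} [Group 𝒢] {Δ : Submonoid 𝒢} {G : Subgroup 𝒢} [IsHeckeTriple Δ G G]

/-- A matrix group with elimination and triangular representatives is triangular with respect to the
exponents of the diagonal. -/
lemma Elimination.triangular (H : Elimination v Γ t P piv)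
    (iw : ∀ M ∈ Γ, ∃ g ∈ intGroup v Γ (fun _ : Fin d => True), g * M ∈ lowerGroup K d)
    (ρ : 𝒢 ≃* (Matrix (Fin d) (Fin d) K)ˣ)
    (hG : ∀ x, x ∈ G ↔ ρ x ∈ intGroup v Γ (fun _ : Fin d => True))
    (hΔ : ∀ x, x ∈ Δ ↔ ρ x ∈ Γ ∧ IntMat v (ρ x : Matrix (Fin d) (Fin d) K)) :
    HeckeAlg.Triangular Δ G ((lowerGroup K d).comap (ρ : 𝒢 →* (Matrix (Fin d) (Fin d) K)ˣ))
      (fun x => exps v (ρ x : Matrix (Fin d) (Fin d) K)) (fun x => DomFrom v Γ t P piv 0 (ρ x)) := by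
  have hrc : ∀ x y, (∃ g ∈ intGroup v Γ (fun _ : Fin d => True), ρ y = g * ρ x) →
      HeckeAlg.rc G x = HeckeAlg.rc G y := by
    rintro x y ⟨g, hg, h⟩
    rw [HeckeAlg.rc_eq, hG, map_mul, map_inv, h, mul_inv_cancel_right]
    exact hg
  refine ⟨fun b hb c hc => ?_, fun b hb hbG => ?_, fun x hx => ?_, fun D hD => ?_,
    fun b hb hbΔ => ?_, fun D D' hD hD' hDΔ hDΔ' h => ?_⟩
  · rw [map_mul]; exact exps_mul v hb hc
  · rw [hG] at hbG
    have hb' : ρ b ∈ lowerGroup K d := hb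
    funext i
    change ev v _ = 0
    have h1 := (le_v_iff v (lowerGroup_diag_ne hb' i) 0).1 (hbG.2.1.1 i i)
    have h2 := (le_v_iff v (lowerGroup_diag_ne (inv_mem hb') i) 0).1 (hbG.2.1.2 i i)
    have h3 := congrFun (exps_mul v hb' (inv_mem hb')) i
    rw [mul_inv_cancel] at h3
    have h4 : ev v ((1 : Matrix (Fin d) (Fin d) K) i i) =
      ev v ((ρ b : Matrix (Fin d) (Fin d) K) i i) +
      ev v (((ρ b)⁻¹ : (Matrix (Fin d) (Fin d) K)ˣ) i i) := h3
    rw [Matrix.one_apply_eq, ev_one] at h4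
    omega
  · obtain ⟨g, hg, h⟩ := iw (ρ x) ((hΔ x).1 hx).1
    refine ⟨ρ.symm (g * ρ x), ?_, hrc _ _ ⟨g, hg, by simp⟩⟩
    change ρ _ ∈ lowerGroup K d
    rwa [MulEquiv.apply_symm_apply]
  · exact IsLower.of_diag hD.2.1
  · obtain ⟨D, g, hg, g', hg', hD, hdom, hle, heq⟩ := H.tri t 0 (by omega) (ρ b)
      ((hΔ b).1 hbΔ).1 hb fun i j _ h => absurd ⟨H.zero i, H.zero j⟩ h
    have hm := intGroup_mono v (Γ := Γ) (P := P 0) (Q := fun _ => True) fun _ _ => trivial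
    refine ⟨ρ.symm D, by rwa [MulEquiv.apply_symm_apply], ⟨ρ.symm g, ?_, ρ.symm g', ?_, ?_⟩,
      ?_, fun h => ?_⟩
    · rw [hG, MulEquiv.apply_symm_apply]; exact hm hg
    · rw [hG, MulEquiv.apply_symm_apply]; exact hm hg'
    · rw [hD]; simp
    · rwa [MulEquiv.apply_symm_apply]
    · rw [MulEquiv.apply_symm_apply] at h
      obtain ⟨g, hg, h'⟩ := heq h
      exact hrc _ _ ⟨g, hm hg, by rw [MulEquiv.apply_symm_apply, h']⟩
  · refine hrc _ _ ⟨ρ D' * (ρ D)⁻¹, ?_, by simp⟩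
    exact mul_inv_mem_intGroup v hD.1 hD'.1 hD.2.1 hD'.2.1 h

/-- The Hecke algebra of a matrix group with elimination is a polynomial ring in double cosets
of diagonal matrices, provided that their exponents `w i` freely generate the dominant exponents:
this is expressed by additive functions `coord i` dual to the `w i` up to factors `nz i`. -/
theorem Elimination.isAlgIndepGenerators (H : Elimination v Γ t P piv)
    (iw : ∀ M ∈ Γ, ∃ g ∈ intGroup v Γ (fun _ : Fin d => True), g * M ∈ lowerGroup K d)
    (ρ : 𝒢 ≃* (Matrix (Fin d) (Fin d) K)ˣ)
    (hG : ∀ x, x ∈ G ↔ ρ x ∈ intGroup v Γ (fun _ : Fin d => True))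
    (hΔ : ∀ x, x ∈ Δ ↔ ρ x ∈ Γ ∧ IntMat v (ρ x : Matrix (Fin d) (Fin d) K))
    {ι : Type*} [Finite ι] [DecidableEq ι] (T : ι → Δ) (w : ι → Lex (Fin d → ℤ))
    (hTd : ∀ l, ∀ i j, i ≠ j → (ρ (T l) : Matrix (Fin d) (Fin d) K) i j = 0)
    (hTw : ∀ l, exps v (ρ (T l) : Matrix (Fin d) (Fin d) K) = w l)
    (huniq : ∀ l D, DomFrom v Γ t P piv 0 D →
      (∃ g ∈ intGroup v Γ (fun _ : Fin d => True), ∃ g' ∈ intGroup v Γ (fun _ : Fin d => True),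
        D = g * ρ (T l) * g') → exps v (D : Matrix (Fin d) (Fin d) K) ≤ w l →
      exps v (D : Matrix (Fin d) (Fin d) K) = w l)
    (coord : ι → Lex (Fin d → ℤ) →+ ℤ) (nz : ι → ℤ) (hnz : ∀ i, nz i ≠ 0)
    (hdual : ∀ i j, coord i (w j) = if i = j then nz i else 0)
    (X₀ : AddSubgroup (Lex (Fin d → ℤ))) (hw₀ : ∀ i, w i ∈ X₀)
    (hD₀ : ∀ D ∈ Γ, (∀ i j, i ≠ j → (D : Matrix (Fin d) (Fin d) K) i j = 0) →
      exps v (D : Matrix (Fin d) (Fin d) K) ∈ X₀)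
    (hinj : ∀ x ∈ X₀, (∀ i, coord i x = 0) → x = 0)
    (hpos : ∀ D, DomFrom v Γ t P piv 0 D → IntMat v (D : Matrix (Fin d) (Fin d) K) →
      ∀ i, ∃ k : ℕ, coord i (exps v (D : Matrix (Fin d) (Fin d) K)) = k * nz i)
    (last : Fin d) (hlast : ∀ i j, w i j ≤ w i last) (hlast' : ∀ i, 0 < w i last) :
    HeckeAlg.IsAlgIndepGenerators fun i => HeckeAlg.dcoset G (T i) := by
  refine (H.triangular iw ρ hG hΔ).isAlgIndepGenerators T w (fun l D hD hDT hle => ?_)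
    (sum_injective_of_coord hdual hnz) (fun D hD hDΔ => ?_)
    (fun k => ρ ⁻¹' invBounded v k) (fun k l hkl => Set.preimage_mono (invBounded_mono v hkl))
    (fun k l x hx y hy => ?_) (fun x => exists_invBounded v _) (fun g hg => ?_)
    (fun i => (w i last).toNat) (fun i => by have := hlast' i; omega) (fun i => ?_)
    (fun k D hD hDΔ hDN c hc => ?_)
  · obtain ⟨hDΔ, hmk⟩ := HeckeAlg.rc_mem.1 hDT
    rw [eq_comm, HeckeAlg.mk_eq] at hmk
    obtain ⟨a, ha, b, hb, h⟩ := hmk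
    change D = a * T l * b at h
    refine huniq l (ρ D) hD ⟨ρ a, (hG a).1 ha, ρ b, (hG b).1 hb, by rw [h, map_mul, map_mul]⟩ ?_
    rw [← hTw l]
    exact hle _ (IsLower.of_diag (hTd l)) (HeckeAlg.rc_mem.2 ⟨(T l).2, rfl⟩)
  · exact exists_sum_of_coord hdual X₀ hw₀ hinj (hD₀ _ hD.1 hD.2.1)
      (hpos _ hD ((hΔ D).1 hDΔ).2)
  · change ρ (x * y) ∈ invBounded v _
    rw [map_mul]
    exact invBounded_mul v hx hy
  · exact mem_invBounded_zero v ((hG g).1 hg)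
  · change ρ (T i) ∈ invBounded v _
    rw [diag_mem_invBounded v (hTd i)]
    intro j
    rw [hTw]
    have h1 := hlast i j
    have h2 := hlast' i
    omega
  · have h1 := (diag_mem_invBounded v hD.2.1).1 hDN last
    have h2 : exps v (ρ D : Matrix (Fin d) (Fin d) K) last =
        ((c.sum fun i m => m * (w i last).toNat : ℕ) : ℤ) := by
      have h3 := congrFun hc last
      change exps v (ρ D : Matrix (Fin d) (Fin d) K) last = _ at h3
      rw [h3, Finsupp.sum, Finsupp.sum]
      have h4 : ∀ (s : Finset ι), (∑ i ∈ s, c i • w i) last = ∑ i ∈ s, (c i • w i) last := by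
        intro s
        induction s using Finset.induction_on with
        | empty => rfl
        | insert a s ha ih => rw [Finset.sum_insert ha, Finset.sum_insert ha, ← ih]; rfl
      rw [h4, Nat.cast_sum]
      refine Finset.sum_congr rfl fun i _ => ?_
      change c i • w i last = _
      have := hlast' i
      rw [nsmul_eq_mul, Nat.cast_mul, Int.toNat_of_nonneg this.le]
    rw [h2] at h1
    exact_mod_cast h1

end main

end LocalHecke

/-! ### Similitudes of sesquilinear forms and Siegel transvections -/

namespace LocalHecke

/-- Signs `s i` for an `ε`-hermitian form that pairs the index `i` with the index `Fin.rev i`. -/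
structure Signs (K : Type*) [Ring K] (d : ℕ) where
  /-- The sign of the pairing of `i` with its partner. -/
  s : Fin d → K
  /-- The symmetry sign. -/
  ε : K
  s_eq : ∀ i, s i = 1 ∨ s i = -1
  ε_eq : ε = 1 ∨ ε = -1
  s_rev : ∀ i, s i.rev = ε * s i
  rev_ne : ∀ i : Fin d, i.rev ≠ i

namespace Signs

section ring

variable {K : Type*} [Ring K] {d : ℕ} (σ : Signs K d)

lemma s_mul_s (i : Fin d) : σ.s i * σ.s i = 1 := by
  rcases σ.s_eq i with h | h <;> simp [h]

lemma ε_mul_ε : σ.ε * σ.ε = 1 := by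
  rcases σ.ε_eq with h | h <;> simp [h]

lemma s_comm (i : Fin d) (x : K) : σ.s i * x = x * σ.s i := by
  rcases σ.s_eq i with h | h <;> simp [h]

lemma ε_comm (x : K) : σ.ε * x = x * σ.ε := by
  rcases σ.ε_eq with h | h <;> simp [h]

lemma star_s [StarRing K] (i : Fin d) : star (σ.s i) = σ.s i := by
  rcases σ.s_eq i with h | h <;> simp [h]

lemma s_mul_s_rev (i : Fin d) : σ.s i * σ.s i.rev = σ.ε := by
  rw [s_rev, σ.ε_comm, ← mul_assoc, s_mul_s, one_mul]

/-- The matrix of the form. -/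
def J : Matrix (Fin d) (Fin d) K := fun i j => if j = i.rev then σ.s i else 0

lemma J_mul_apply (M : Matrix (Fin d) (Fin d) K) (i j : Fin d) :
    (σ.J * M) i j = σ.s i * M i.rev j := by
  rw [Matrix.mul_apply, Finset.sum_eq_single i.rev]
  · simp [J]
  · intro b _ hb; simp [J, hb]
  · simp

lemma mul_J_apply (M : Matrix (Fin d) (Fin d) K) (i j : Fin d) :
    (M * σ.J) i j = M i j.rev * σ.s j.rev := by
  rw [Matrix.mul_apply, Finset.sum_eq_single j.rev]
  · simp [J]
  · intro b _ hb
    have : j ≠ b.rev := by rintro rfl; simp at hb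
    simp [J, this]
  · simp

lemma J_mul_J : σ.J * σ.J = σ.ε • (1 : Matrix (Fin d) (Fin d) K) := by
  ext i j
  rw [J_mul_apply, Matrix.smul_apply, Matrix.one_apply, J, Fin.rev_rev]
  by_cases h : i = j
  · simp [h, s_mul_s_rev]
  · simp [h, Ne.symm h]

variable [StarRing K]

/-- The sesquilinear form. -/
def form (x y : Fin d → K) : K := ∑ i, star (x i) * σ.s i * y i.rev

lemma conj_J_mul_apply (M N : Matrix (Fin d) (Fin d) K) (a b : Fin d) :
    (Mᴴ * σ.J * N) a b = σ.form (fun i => M i a) (fun i => N i b) := by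
  rw [mul_assoc, Matrix.mul_apply, form]
  refine Finset.sum_congr rfl fun i _ => ?_
  rw [J_mul_apply, Matrix.conjTranspose_apply, mul_assoc]

lemma J_conj_J_apply (M : Matrix (Fin d) (Fin d) K) (i j : Fin d) :
    (σ.J * Mᴴ * σ.J) i j = σ.s i * star (M j.rev i.rev) * σ.s j.rev := by
  rw [mul_J_apply, J_mul_apply, Matrix.conjTranspose_apply]

lemma form_add_left (x x' y : Fin d → K) : σ.form (x + x') y = σ.form x y + σ.form x' y := by
  simp [form, add_mul, Finset.sum_add_distrib]

lemma form_add_right (x y y' : Fin d → K) : σ.form x (y + y') = σ.form x y + σ.form x y' := by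
  simp [form, mul_add, Finset.sum_add_distrib]

lemma form_smul (x y : Fin d → K) (a b : K) :
    σ.form (fun i => x i * a) (fun i => y i * b) = star a * σ.form x y * b := by
  simp only [form, star_mul, Finset.mul_sum, Finset.sum_mul, mul_assoc]

lemma form_single_left (p : Fin d) (a : K) (y : Fin d → K) :
    σ.form (Pi.single p a) y = star a * σ.s p * y p.rev := by
  rw [form, Finset.sum_eq_single p]
  · simp
  · intro b _ hb; simp [hb]
  · simp

lemma form_single_right (x : Fin d → K) (q : Fin d) (b : K) :
    σ.form x (Pi.single q b) = star (x q.rev) * σ.s q.rev * b := by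
  rw [form, Finset.sum_eq_single q.rev]
  · simp
  · intro i _ hi
    have : i.rev ≠ q := by rintro rfl; simp at hi
    simp [this]
  · simp

/-- The columns of the Siegel transvection, up to a multiple of the basis vector `a.rev`. -/
def siegelX (a : Fin d) (u : Fin d → K) (b : Fin d) : Fin d → K :=
  if b = a then u else Pi.single b 1

/-- The coefficients of the basis vector `a.rev` that are subtracted in the Siegel
transvection. -/
def siegelC (a : Fin d) (u : Fin d → K) (b : Fin d) : K :=
  if b = a ∨ b = a.rev then 0 else σ.s a * star (u b.rev) * σ.s b.rev

/-- The Siegel transvection for an isotropic vector `u` with `u a = 1`: the isometry that sends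
the basis vector `a` to `u`, fixes the basis vector `a.rev`, and changes the other basis vectors
by multiples of the latter. -/
def siegel (a : Fin d) (u : Fin d → K) : Matrix (Fin d) (Fin d) K :=
  fun i b => siegelX a u b i - if i = a.rev then σ.siegelC a u b else 0

lemma form_siegel_aux (x y : Fin d → K) (r : Fin d) (c c' : K) :
    σ.form (fun i => x i - if i = r then c else 0) (fun i => y i - if i = r then c' else 0) =
      σ.form x y - star (x r.rev) * σ.s r.rev * c' - star c * σ.s r * y r.rev := by
  have h1 : (fun i => x i - if i = r then c else 0) = x + Pi.single r (-c) := by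
    funext i; simp [Pi.single_apply, sub_eq_add_neg]; split_ifs <;> simp
  have h2 : (fun i => y i - if i = r then c' else 0) = y + Pi.single r (-c') := by
    funext i; simp [Pi.single_apply, sub_eq_add_neg]; split_ifs <;> simp
  rw [h1, h2, form_add_left, form_add_right, form_add_right, form_single_left, form_single_left,
    form_single_right, Pi.single_eq_of_ne (σ.rev_ne r)]
  simp [sub_eq_add_neg]

/-- The Siegel transvection of an isotropic vector with coordinate `1` at `a` is an isometry. -/
lemma siegel_isometry {a : Fin d} {u : Fin d → K} (ha : u a = 1) (hu : σ.form u u = 0) :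
    (σ.siegel a u)ᴴ * σ.J * σ.siegel a u = σ.J := by
  have har := σ.rev_ne a
  ext p q
  rw [conj_J_mul_apply]
  change σ.form (fun i => siegelX a u p i - if i = a.rev then σ.siegelC a u p else 0)
    (fun i => siegelX a u q i - if i = a.rev then σ.siegelC a u q else 0) = _
  rw [form_siegel_aux, Fin.rev_rev, J]
  by_cases hp : p = a
  · subst hp
    by_cases hq : q = p
    · subst hq
      simp [siegelX, siegelC, hu, Ne.symm har]
    · by_cases hq' : q = p.rev
      · subst hq'
        simp [siegelX, siegelC, har, form_single_right, ha]
      · simp only [siegelX, siegelC, if_true, form_single_right, ha, star_one, one_mul,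
          mul_one, hq, hq', or_self, if_false, true_or, star_zero, zero_mul, sub_zero]
        rw [← mul_assoc, ← mul_assoc, s_mul_s, one_mul, sub_self]
  · have hXa : siegelX a u p a = 0 := by simp [siegelX, hp, Ne.symm hp]
    rw [hXa]
    by_cases hq : q = a
    · subst hq
      by_cases hp' : p = q.rev
      · subst hp'
        simp [siegelX, siegelC, hp, form_single_left, ha]
      · have hpr : q ≠ p.rev := by rintro rfl; simp at hp'
        simp only [siegelX, siegelC, if_true, form_single_left, star_one, one_mul, hp,
          hp', hpr, or_self, if_false, star_zero, zero_mul, sub_zero, ha, mul_one, true_or,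
          mul_zero, star_mul, star_star, star_s]
        rw [mul_assoc, mul_assoc, s_mul_s_rev, s_rev, σ.ε_comm (σ.s p), mul_assoc,
          ← σ.ε_comm (u p.rev), ← mul_assoc σ.ε, ε_mul_ε, one_mul, sub_self]
    · have hXa' : siegelX a u q a = 0 := by simp [siegelX, hq, Ne.symm hq]
      rw [hXa']
      simp only [siegelX, if_neg hp, if_neg hq, form_single_left, star_one, one_mul, star_zero,
        zero_mul, mul_zero, sub_zero, Pi.single_apply]
      by_cases h : q = p.rev <;> simp [h, eq_comm]

end ring

section division

variable {K : Type*} [DivisionRing K] [StarRing K] {d : ℕ} (σ : Signs K d)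

/-- An isometry as a unit. -/
def isoUnit (M : Matrix (Fin d) (Fin d) K) (h : Mᴴ * σ.J * M = σ.J) :
    (Matrix (Fin d) (Fin d) K)ˣ where
  val := M
  inv := σ.ε • (σ.J * Mᴴ * σ.J)
  val_inv := by
    rw [mul_eq_one_comm, Matrix.smul_mul, mul_assoc, mul_assoc, ← mul_assoc Mᴴ, h, J_mul_J,
      smul_smul, ε_mul_ε, one_smul]
  inv_val := by
    rw [Matrix.smul_mul, mul_assoc, mul_assoc, ← mul_assoc Mᴴ, h, J_mul_J,
      smul_smul, ε_mul_ε, one_smul]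

lemma isoUnit_inv_apply (M : Matrix (Fin d) (Fin d) K) (h : Mᴴ * σ.J * M = σ.J) (i j : Fin d) :
    (((σ.isoUnit M h)⁻¹ : (Matrix (Fin d) (Fin d) K)ˣ) : Matrix (Fin d) (Fin d) K) i j =
      σ.ε * (σ.s i * star (M j.rev i.rev) * σ.s j.rev) := by
  change (σ.ε • (σ.J * Mᴴ * σ.J)) i j = _
  rw [Matrix.smul_apply, J_conj_J_apply, smul_eq_mul]

/-- The Siegel transvection as a unit. -/
def siegelUnit {a : Fin d} {u : Fin d → K} (ha : u a = 1) (hu : σ.form u u = 0) :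
    (Matrix (Fin d) (Fin d) K)ˣ := σ.isoUnit _ (σ.siegel_isometry ha hu)

variable (F : Type*) [Field F] [Algebra F K]

/-- The group of similitudes of the form with factor in `F`. -/
def simGroup : Subgroup (Matrix (Fin d) (Fin d) K)ˣ where
  carrier := {M | ∃ m : F, m ≠ 0 ∧
    (M : Matrix (Fin d) (Fin d) K)ᴴ * σ.J * (M : Matrix (Fin d) (Fin d) K) = m • σ.J}
  one_mem' := ⟨1, one_ne_zero, by simp⟩
  mul_mem' := by
    rintro M N ⟨m, hm, hM⟩ ⟨k, hk, hN⟩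
    refine ⟨m * k, mul_ne_zero hm hk, ?_⟩
    rw [Units.val_mul, Matrix.conjTranspose_mul]
    calc _ = (N : Matrix (Fin d) (Fin d) K)ᴴ * ((M : Matrix (Fin d) (Fin d) K)ᴴ * σ.J *
          (M : Matrix (Fin d) (Fin d) K)) * (N : Matrix (Fin d) (Fin d) K) := by
            simp only [mul_assoc]
      _ = _ := by rw [hM, Matrix.mul_smul, Matrix.smul_mul, hN, smul_smul]
  inv_mem' := by
    rintro M ⟨m, hm, hM⟩
    refine ⟨m⁻¹, inv_ne_zero hm, ?_⟩
    have h1 : (M : Matrix (Fin d) (Fin d) K) * ((M⁻¹ : (Matrix (Fin d) (Fin d) K)ˣ) :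
      Matrix (Fin d) (Fin d) K) = 1 := M.mul_inv
    have h2 : ((M⁻¹ : (Matrix (Fin d) (Fin d) K)ˣ) : Matrix (Fin d) (Fin d) K)ᴴ *
        (M : Matrix (Fin d) (Fin d) K)ᴴ = 1 := by
      rw [← Matrix.conjTranspose_mul, h1, Matrix.conjTranspose_one]
    rw [eq_inv_smul_iff₀ hm, ← Matrix.smul_mul, ← Matrix.mul_smul, ← hM]
    calc _ = (((M⁻¹ : (Matrix (Fin d) (Fin d) K)ˣ) : Matrix (Fin d) (Fin d) K)ᴴ *
        (M : Matrix (Fin d) (Fin d) K)ᴴ) * σ.J * ((M : Matrix (Fin d) (Fin d) K) *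
        ((M⁻¹ : (Matrix (Fin d) (Fin d) K)ˣ) : Matrix (Fin d) (Fin d) K)) := by
          simp only [mul_assoc]
      _ = _ := by rw [h1, h2, one_mul, mul_one]

variable {F} {σ}

/-- The adjoint of a similitude is a similitude. -/
lemma sim_star {M : Matrix (Fin d) (Fin d) K} {m : F} (hm : m ≠ 0) (h : Mᴴ * σ.J * M = m • σ.J) :
    M * σ.J * Mᴴ = m • σ.J := by
  have h1 : (m⁻¹ • σ.ε • (σ.J * Mᴴ * σ.J)) * M = 1 := by
    rw [Matrix.smul_mul, Matrix.smul_mul, mul_assoc, mul_assoc, ← mul_assoc Mᴴ, h,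
      Matrix.mul_smul, J_mul_J, smul_comm σ.ε m, smul_smul, inv_mul_cancel₀ hm, smul_smul,
      ε_mul_ε, one_smul, one_smul]
  rw [mul_eq_one_comm] at h1
  have h2 : ∀ A : Matrix (Fin d) (Fin d) K, M * (σ.ε • A) = σ.ε • (M * A) := by
    intro A
    rcases σ.ε_eq with h | h <;> simp [h]
  rw [Matrix.mul_smul, h2] at h1
  have h3 : M * σ.J * Mᴴ * σ.J = m • (σ.ε • (1 : Matrix (Fin d) (Fin d) K)) := by
    rw [← h1, smul_comm σ.ε m⁻¹, smul_smul, mul_inv_cancel₀ hm, smul_smul, ε_mul_ε, one_smul,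
      one_smul]
    simp only [mul_assoc]
  have h4 := congrArg (· * σ.J) h3
  rw [mul_assoc _ σ.J σ.J, J_mul_J, Matrix.smul_mul, Matrix.smul_mul, one_mul] at h4
  have h5 : M * σ.J * Mᴴ * σ.ε • (1 : Matrix (Fin d) (Fin d) K) = σ.ε • (M * σ.J * Mᴴ) := by
    rcases σ.ε_eq with h | h <;> simp [h]
  rw [h5, smul_comm m] at h4
  have h6 := congrArg (σ.ε • ·) h4
  simpa only [smul_smul, ε_mul_ε, one_smul] using h6

lemma star_mem_simGroup {M : (Matrix (Fin d) (Fin d) K)ˣ} (h : M ∈ σ.simGroup F) :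
    star M ∈ σ.simGroup F := by
  obtain ⟨m, hm, hM⟩ := h
  refine ⟨m, hm, ?_⟩
  rw [Units.coe_star, Matrix.star_eq_conjTranspose, Matrix.conjTranspose_conjTranspose]
  exact sim_star hm hM

end division

end Signs

end LocalHecke

/-! ### Elimination in groups of similitudes -/

namespace LocalHecke

variable {K : Type*} [DivisionRing K] [StarRing K] {d : ℕ}

/-- A star-closed group of similitudes that contains the Siegel transvections; the involution
is assumed to preserve the valuation. -/
structure IsSiegelGroup (v : AddValuation K (WithTop ℤ)) (σ : Signs K d) (F : Type*) [Field F]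
    [Algebra F K] (Γ : Subgroup (Matrix (Fin d) (Fin d) K)ˣ) : Prop where
  v_star : ∀ x, v (star x) = v x
  le : Γ ≤ σ.simGroup F
  star_mem : ∀ M ∈ Γ, star M ∈ Γ
  siegel_mem : ∀ (a : Fin d) (u : Fin d → K) (ha : u a = 1) (hu : σ.form u u = 0),
    σ.siegelUnit ha hu ∈ Γ

namespace Signs

variable (σ : Signs K d)

lemma siegel_apply_self (a : Fin d) (u : Fin d → K) (i : Fin d) : σ.siegel a u i a = u i := by
  simp [siegel, siegelX, siegelC]

lemma siegel_apply_rev (a : Fin d) (u : Fin d → K) (i : Fin d) :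
    σ.siegel a u i a.rev = (1 : Matrix (Fin d) (Fin d) K) i a.rev := by
  simp [siegel, siegelX, siegelC, σ.rev_ne a, Matrix.one_apply, Pi.single_apply]

lemma siegel_idOff {P : Fin d → Prop} (hP : ∀ i, P i → P i.rev) {a : Fin d} (ha : P a)
    {u : Fin d → K} (hu : ∀ i, ¬ P i → u i = 0) : IdOff P (σ.siegel a u) := by
  intro i b hib
  have h0 : i = a.rev → σ.siegelC a u b = 0 := by
    rintro rfl
    have hb : ¬ P b.rev := fun h => hib ⟨hP a ha, by simpa using hP _ h⟩
    simp [siegelC, hu _ hb]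
  rw [siegel, Matrix.one_apply]
  have h1 : (if i = a.rev then σ.siegelC a u b else 0) = 0 := by
    split_ifs with h
    · exact h0 h
    · rfl
  rw [h1, sub_zero, siegelX]
  split_ifs with h2 h3 h3
  · subst h2 h3; exact absurd ⟨ha, ha⟩ hib
  · subst h2; exact hu i fun h => hib ⟨h, ha⟩
  · subst h3; simp
  · simp [h3]

lemma siegel_intMat {v : AddValuation K (WithTop ℤ)} (hv : ∀ x, v (star x) = v x) {a : Fin d}
    {u : Fin d → K} (hu : ∀ i, 0 ≤ v (u i)) : IntMat v (σ.siegel a u) := by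
  have hs : ∀ i, v (σ.s i) = 0 := fun i => by
    rcases σ.s_eq i with h | h <;> simp [h]
  intro i b
  refine (le_min ?_ ?_).trans (v.map_sub _ _)
  · rw [siegelX]
    split_ifs
    · exact hu i
    · rw [Pi.single_apply]; split_ifs <;> simp
  · split_ifs
    · rw [siegelC]
      split_ifs
      · simp
      · rw [AddValuation.map_mul, AddValuation.map_mul, hs, hs, hv, zero_add, add_zero]
        exact hu _
    · simp

lemma siegel_isLower {P : Fin d → Prop} {a : Fin d}
    (hle : ∀ i, P i → a ≤ i) {u : Fin d → K} (hu : ∀ i, ¬ P i → u i = 0) :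
    IsLower (σ.siegel a u) := by
  intro i b hib
  have h1 : (if i = a.rev then σ.siegelC a u b else 0) = 0 := by
    split_ifs with h
    · subst h
      have hb : ¬ P b.rev := fun h => absurd (hle _ h) (by
        rw [not_le, ← Fin.rev_lt_rev, Fin.rev_rev]; exact hib)
      simp [siegelC, hu _ hb]
    · rfl
  rw [siegel, h1, sub_zero, siegelX]
  split_ifs with h2
  · subst h2; exact hu i fun h => absurd (hle i h) (not_le.2 hib)
  · exact Pi.single_eq_of_ne hib.ne 1

lemma inv_idOff {P : Fin d → Prop} (hP : ∀ i, P i → P i.rev) {M : Matrix (Fin d) (Fin d) K}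
    (h : Mᴴ * σ.J * M = σ.J) (hM : IdOff P M) :
    IdOff P (((σ.isoUnit M h)⁻¹ : (Matrix (Fin d) (Fin d) K)ˣ) : Matrix (Fin d) (Fin d) K) := by
  intro i j hij
  rw [isoUnit_inv_apply, hM _ _ fun h => hij ⟨by simpa using hP _ h.2, by simpa using hP _ h.1⟩,
    Matrix.one_apply, Matrix.one_apply]
  by_cases h : i = j
  · subst h
    simp [s_mul_s_rev, ε_mul_ε]
  · have : j.rev ≠ i.rev := fun h' => h (Fin.rev_injective h').symm
    simp [h, this]

lemma inv_intMat {v : AddValuation K (WithTop ℤ)} (hv : ∀ x, v (star x) = v x)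
    {M : Matrix (Fin d) (Fin d) K} (h : Mᴴ * σ.J * M = σ.J) (hM : IntMat v M) :
    IntMat v (((σ.isoUnit M h)⁻¹ : (Matrix (Fin d) (Fin d) K)ˣ) : Matrix (Fin d) (Fin d) K) := by
  have hs : ∀ i, v (σ.s i) = 0 := fun i => by
    rcases σ.s_eq i with h | h <;> simp [h]
  have hε : v σ.ε = 0 := by rcases σ.ε_eq with h | h <;> simp [h]
  intro i j
  rw [isoUnit_inv_apply, AddValuation.map_mul, AddValuation.map_mul, AddValuation.map_mul, hs, hs,
    hε, hv, zero_add, zero_add, add_zero]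
  exact hM _ _

variable {F : Type*} [Field F] [Algebra F K] {σ}

lemma form_mulVec_self {g : (Matrix (Fin d) (Fin d) K)ˣ} (hg : g ∈ σ.simGroup F) {y : Fin d → K}
    (hy : σ.form y y = 0) : σ.form ((g : Matrix (Fin d) (Fin d) K) *ᵥ y)
      ((g : Matrix (Fin d) (Fin d) K) *ᵥ y) = 0 := by
  obtain ⟨m, -, hm⟩ := hg
  rcases isEmpty_or_nonempty (Fin d) with he | ⟨⟨c⟩⟩
  · simp [form]
  · set Y : Matrix (Fin d) (Fin d) K := fun i _ => y i with hY
    have h1 := σ.conj_J_mul_apply ((g : Matrix (Fin d) (Fin d) K) * Y)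
      ((g : Matrix (Fin d) (Fin d) K) * Y) c c
    have h2 := σ.conj_J_mul_apply Y Y c c
    have h3 : (fun i => ((g : Matrix (Fin d) (Fin d) K) * Y) i c) =
        (g : Matrix (Fin d) (Fin d) K) *ᵥ y := rfl
    have h4 : ((g : Matrix (Fin d) (Fin d) K) * Y)ᴴ * σ.J * ((g : Matrix (Fin d) (Fin d) K) * Y) =
        m • (Yᴴ * σ.J * Y) := by
      rw [← Matrix.smul_mul, ← Matrix.mul_smul, ← hm, Matrix.conjTranspose_mul]
      simp only [Matrix.mul_assoc]
    rw [h3, h4, Matrix.smul_apply, h2] at h1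
    rw [← h1]
    change m • σ.form y y = 0
    rw [hy, smul_zero]

lemma form_col_self {M : (Matrix (Fin d) (Fin d) K)ˣ} (hM : M ∈ σ.simGroup F) (c : Fin d) :
    σ.form (fun i => (M : Matrix (Fin d) (Fin d) K) i c)
      (fun i => (M : Matrix (Fin d) (Fin d) K) i c) = 0 := by
  obtain ⟨m, -, hm⟩ := hM
  rw [← conj_J_mul_apply, hm, Matrix.smul_apply, J, if_neg (Ne.symm (σ.rev_ne c)), smul_zero]

/-- If column `p` of a similitude is concentrated in row `q`, then row `q.rev` is concentrated in
column `p.rev`. -/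
lemma row_rev_of_col {M : (Matrix (Fin d) (Fin d) K)ˣ} (hM : M ∈ σ.simGroup F) {p q : Fin d}
    (h : ∀ i, i ≠ q → (M : Matrix (Fin d) (Fin d) K) i p = 0) :
    ∀ j, j ≠ p.rev → (M : Matrix (Fin d) (Fin d) K) q.rev j = 0 := by
  obtain ⟨m, hm0, hm⟩ := hM
  have key : ∀ j, star ((M : Matrix (Fin d) (Fin d) K) q p) *
      (σ.s q * (M : Matrix (Fin d) (Fin d) K) q.rev j) = m • σ.J p j := by
    intro j
    rw [← Matrix.smul_apply, ← hm, conj_J_mul_apply, form, Finset.sum_eq_single q, mul_assoc]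
    · intro b _ hb
      rw [h b hb, star_zero, zero_mul, zero_mul]
    · simp
  have hs : ∀ i, σ.s i ≠ 0 := fun i hi => by simpa [hi] using σ.s_mul_s i
  have h0 : star ((M : Matrix (Fin d) (Fin d) K) q p) ≠ 0 := by
    intro h0
    have := key p.rev
    rw [h0, zero_mul, J, if_pos rfl, eq_comm, smul_eq_zero] at this
    exact this.elim hm0 (hs p)
  intro j hj
  have := key j
  rw [J, if_neg hj, smul_zero] at this
  exact ((mul_eq_zero.1 ((mul_eq_zero.1 this).resolve_left h0))).resolve_left (hs q)

end Signs

namespace IsSiegelGroup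

variable {v : AddValuation K (WithTop ℤ)} {σ : Signs K d} {F : Type*} [Field F] [Algebra F K]
  {Γ : Subgroup (Matrix (Fin d) (Fin d) K)ˣ} (S : IsSiegelGroup v σ F Γ)
include S

lemma siegelUnit_mem {P : Fin d → Prop} (hP : ∀ i, P i → P i.rev) {a : Fin d} (haP : P a)
    {u : Fin d → K} (hu : ∀ i, ¬ P i → u i = 0) (huv : ∀ i, 0 ≤ v (u i)) (ha : u a = 1)
    (huu : σ.form u u = 0) : σ.siegelUnit ha huu ∈ intGroup v Γ P :=
  ⟨S.siegel_mem a u ha huu, ⟨σ.siegel_intMat S.v_star huv,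
    σ.inv_intMat S.v_star _ (σ.siegel_intMat S.v_star huv)⟩, σ.siegel_idOff hP haP hu,
    σ.inv_idOff hP _ (σ.siegel_idOff hP haP hu)⟩

lemma star_mem_intGroup {P : Fin d → Prop} {g : (Matrix (Fin d) (Fin d) K)ˣ}
    (hg : g ∈ intGroup v Γ P) : star g ∈ intGroup v Γ P := by
  have hone : ∀ i j, star ((1 : Matrix (Fin d) (Fin d) K) j i) =
      (1 : Matrix (Fin d) (Fin d) K) i j := fun i j => by
    rw [Matrix.one_apply, Matrix.one_apply]
    by_cases h : i = j
    · simp [h]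
    · simp [h, Ne.symm h]
  obtain ⟨h1, ⟨h2, h3⟩, h4, h5⟩ := hg
  have e1 : ∀ i j, ((star g : (Matrix (Fin d) (Fin d) K)ˣ) : Matrix (Fin d) (Fin d) K) i j =
      star ((g : Matrix (Fin d) (Fin d) K) j i) := fun i j => rfl
  have e2 : ∀ i j, (((star g)⁻¹ : (Matrix (Fin d) (Fin d) K)ˣ) : Matrix (Fin d) (Fin d) K) i j =
      star (((g⁻¹ : (Matrix (Fin d) (Fin d) K)ˣ) : Matrix (Fin d) (Fin d) K) j i) :=
    fun i j => rfl
  refine ⟨S.star_mem g h1, ⟨fun i j => ?_, fun i j => ?_⟩, fun i j h => ?_, fun i j h => ?_⟩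
  · rw [e1, S.v_star]; exact h2 j i
  · rw [e2, S.v_star]; exact h3 j i
  · rw [e1, h4 j i fun h' => h ⟨h'.2, h'.1⟩, hone]
  · rw [e2, h5 j i fun h' => h ⟨h'.2, h'.1⟩, hone]

/-- An isotropic vector is sent to a multiple of the basis vector `p` if its `p`-th coordinate
has least value: the Siegel transvection of the normalized vector does the converse. -/
lemma clear {P : Fin d → Prop} (hP : ∀ i, P i → P i.rev) {p : Fin d} (hp : P p) {y : Fin d → K}
    (hy : ∀ i, ¬ P i → y i = 0) (hyy : σ.form y y = 0) (hmin : ∀ a, P a → v (y p) ≤ v (y a)) :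
    ∃ g ∈ intGroup v Γ P, (∀ i, i ≠ p → ((g : Matrix (Fin d) (Fin d) K) *ᵥ y) i = 0) ∧
      (∀ j, (g : Matrix (Fin d) (Fin d) K) p j = (1 : Matrix (Fin d) (Fin d) K) p j) ∧
      ((∀ a, P a → p ≤ a) → g ∈ lowerGroup K d ∧
        ∀ i, (g : Matrix (Fin d) (Fin d) K) i i = 1) := by
  by_cases h0 : y p = 0
  · have hy0 : y = 0 := by
      funext i
      by_cases hi : P i
      · have := hmin i hi
        rw [h0, AddValuation.map_zero, top_le_iff] at this
        exact (AddValuation.top_iff v).1 this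
      · exact hy i hi
    refine ⟨1, one_mem _, fun i _ => by simp [hy0], fun j => rfl, fun _ => ⟨one_mem _, fun i => ?_⟩⟩
    exact Matrix.one_apply_eq i
  · set u : Fin d → K := fun i => y i * (y p)⁻¹ with hu
    have hup : u p = 1 := mul_inv_cancel₀ h0
    have huu : σ.form u u = 0 := by rw [hu, Signs.form_smul, hyy, mul_zero, zero_mul]
    have hu0 : ∀ i, ¬ P i → u i = 0 := fun i hi => by simp [hu, hy i hi]
    have huv : ∀ i, 0 ≤ v (u i) := fun i => by
      by_cases hi : P i
      · exact v_mul_inv_nonneg v h0 (hmin i hi)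
      · simp [hu0 i hi]
    have hmem := S.siegelUnit_mem hP hp hu0 huv hup huu
    have hval : (σ.siegelUnit hup huu : Matrix (Fin d) (Fin d) K) = σ.siegel p u := rfl
    have hinv : ∀ i j, (((σ.siegelUnit hup huu)⁻¹ : (Matrix (Fin d) (Fin d) K)ˣ) :
        Matrix (Fin d) (Fin d) K) i j =
        σ.ε * (σ.s i * star (σ.siegel p u j.rev i.rev) * σ.s j.rev) :=
      σ.isoUnit_inv_apply _ (σ.siegel_isometry hup huu)
    refine ⟨(σ.siegelUnit hup huu)⁻¹, inv_mem hmem, fun i hi => ?_, fun j => ?_, fun hle => ?_⟩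
    · have h1 : y = (σ.siegelUnit hup huu : Matrix (Fin d) (Fin d) K) *ᵥ (Pi.single p (y p)) := by
        funext i
        rw [Matrix.mulVec, dotProduct, Finset.sum_eq_single p]
        · rw [Pi.single_eq_same, hval, Signs.siegel_apply_self, hu, inv_mul_cancel_right₀ h0]
        · intro b _ hb
          rw [Pi.single_eq_of_ne hb, mul_zero]
        · simp
      have h2 : (((σ.siegelUnit hup huu)⁻¹ : (Matrix (Fin d) (Fin d) K)ˣ) :
          Matrix (Fin d) (Fin d) K) *ᵥ y = Pi.single p (y p) := by
        conv_lhs => rw [h1, Matrix.mulVec_mulVec, ← Units.val_mul, inv_mul_cancel, Units.val_one,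
          Matrix.one_mulVec]
      rw [h2, Pi.single_eq_of_ne hi]
    · rw [hinv, Signs.siegel_apply_rev, Matrix.one_apply, Matrix.one_apply]
      by_cases h : p = j
      · subst h; simp [Signs.s_mul_s_rev, Signs.ε_mul_ε]
      · have : j.rev ≠ p.rev := fun h' => h (Fin.rev_injective h').symm
        simp [h, this]
    · refine ⟨inv_mem (σ.siegel_isLower hle hu0), fun i => ?_⟩
      have h1 : σ.siegel p u i.rev i.rev = 1 := by
        have h2 : (if i.rev = p.rev then σ.siegelC p u i.rev else 0) = 0 := by
          split_ifs with h
          · simp [Signs.siegelC, h]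
          · rfl
        rw [Signs.siegel, h2, sub_zero, Signs.siegelX]
        split_ifs with h
        · rw [h, hup]
        · simp
      rw [hinv, h1, star_one, mul_one, Signs.s_mul_s_rev, Signs.ε_mul_ε]

/-- A Siegel transvection adds a coordinate of least value to the `p`-th coordinate. -/
lemma spread {P : Fin d → Prop} (hP : ∀ i, P i → P i.rev) {p i : Fin d} (hp : P p) (hi : P i)
    (hip : i ≠ p) (hε : i ≠ p.rev ∨ σ.ε = -1) {y : Fin d → K}
    (hy : ∀ i, ¬ P i → y i = 0) (hlt : v (y i) < v (y p)) (hmin : ∀ a, P a → v (y i) ≤ v (y a)) :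
    ∃ g ∈ intGroup v Γ P, ∀ a,
      v (((g : Matrix (Fin d) (Fin d) K) *ᵥ y) p) ≤ v (((g : Matrix (Fin d) (Fin d) K) *ᵥ y) a) := by
  set u : Fin d → K := Pi.single i 1 + Pi.single p 1 with hu
  have hui : u i = 1 := by simp [hu, hip]
  have hup : u p = 1 := by simp [hu, Ne.symm hip]
  have huj : ∀ j, j ≠ i → j ≠ p → u j = 0 := fun j h1 h2 => by simp [hu, h1, h2]
  have hirev : i = p.rev → p = i.rev := by rintro rfl; simp
  have huu : σ.form u u = 0 := by
    conv_lhs => rw [hu]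
    rw [Signs.form_add_left, Signs.form_single_left, Signs.form_single_left, star_one, one_mul,
      one_mul, ← hu]
    by_cases h : i = p.rev
    · rw [← hirev h, ← h, hup, hui, h, Signs.s_rev, hε.resolve_left (not_not_intro h)]
      simp
    · rw [huj _ (σ.rev_ne i) fun h' => h (by rw [← h']; simp),
        huj _ (Ne.symm h) (σ.rev_ne p)]
      simp
  have hmem := S.siegelUnit_mem hP hi (u := u) (fun j hj => huj j (by rintro rfl; exact hj hi)
    (by rintro rfl; exact hj hp)) (fun j => by
      by_cases h1 : j = i
      · simp [h1, hui]
      · by_cases h2 : j = p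
        · simp [h2, hup]
        · simp [huj j h1 h2]) hui huu
  have hC : ∀ b, p = i.rev → σ.siegelC i u b = 0 := by
    intro b h
    rw [Signs.siegelC]
    split_ifs with hb
    · rfl
    · rw [huj b.rev (fun h' => hb (Or.inr (by rw [← h']; simp)))
        (fun h' => hb (Or.inl (Fin.rev_injective (h'.trans h)))), star_zero, mul_zero, zero_mul]
  have hrow : ((σ.siegelUnit hui huu : Matrix (Fin d) (Fin d) K) *ᵥ y) p = y p + y i := by
    have h1 : ∀ b, (σ.siegelUnit hui huu : Matrix (Fin d) (Fin d) K) p b = u b := by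
      intro b
      change Signs.siegelX i u b p - (if p = i.rev then σ.siegelC i u b else 0) = u b
      have h2 : (if p = i.rev then σ.siegelC i u b else 0) = 0 := by
        split_ifs with h
        · exact hC b h
        · rfl
      rw [h2, sub_zero, Signs.siegelX]
      split_ifs with hb
      · rw [hb, hup, hui]
      · by_cases hbp : b = p
        · rw [hbp, hup, Pi.single_eq_same]
        · rw [huj b hb hbp, Pi.single_eq_of_ne (Ne.symm hbp)]
    rw [Matrix.mulVec, dotProduct]
    simp only [h1]
    simp only [hu, Pi.add_apply, Pi.single_apply, add_mul, ite_mul, one_mul, zero_mul,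
      Finset.sum_add_distrib, Finset.sum_ite_eq', Finset.mem_univ, if_true, add_comm]
  refine ⟨σ.siegelUnit hui huu, hmem, fun a => ?_⟩
  rw [hrow, v_add_of_lt v hlt, Matrix.mulVec, dotProduct]
  refine v.map_le_sum fun b _ => ?_
  by_cases hb : P b
  · exact (hmin b hb).trans (le_v_mul_left v (hmem.2.1.1 a b))
  · simp [hy b hb]

lemma mulVec_off {P : Fin d → Prop} {g : (Matrix (Fin d) (Fin d) K)ˣ} (hg : g ∈ intGroup v Γ P)
    {y : Fin d → K} (hy : ∀ i, ¬ P i → y i = 0) (i : Fin d) (hi : ¬ P i) :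
    ((g : Matrix (Fin d) (Fin d) K) *ᵥ y) i = 0 := by
  have := hg.2.2.1.mul_apply (M := fun k _ => y k) hi i
  exact this.trans (hy i hi)

/-- Integral elements send an isotropic vector to a multiple of a prescribed basis vector. -/
lemma col {P : Fin d → Prop} (hP : ∀ i, P i → P i.rev) {p : Fin d} (hp : P p)
    (hε : σ.ε = -1 ∨ ∃ c, P c ∧ c ≠ p ∧ c ≠ p.rev) {y : Fin d → K}
    (hy : ∀ i, ¬ P i → y i = 0) (hyy : σ.form y y = 0) :
    ∃ g ∈ intGroup v Γ P, ∀ i, i ≠ p → ((g : Matrix (Fin d) (Fin d) K) *ᵥ y) i = 0 := by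
  classical
  -- one transvection suffices unless the coordinate of least value is that of the partner of `p`
  have main : ∀ y : Fin d → K, (∀ i, ¬ P i → y i = 0) → σ.form y y = 0 → ∀ i, P i →
      (i ≠ p.rev ∨ σ.ε = -1) → (∀ a, P a → v (y i) ≤ v (y a)) →
      ∃ g ∈ intGroup v Γ P, ∀ i, i ≠ p → ((g : Matrix (Fin d) (Fin d) K) *ᵥ y) i = 0 := by
    intro y hy hyy i hi hie hmin
    rcases (hmin p hp).eq_or_lt with heq | hlt
    · obtain ⟨g, hg, h, -⟩ := S.clear hP hp hy hyy fun a ha => heq ▸ hmin a ha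
      exact ⟨g, hg, h⟩
    · obtain ⟨h, hh, hh'⟩ := S.spread hP hp hi (by rintro rfl; exact lt_irrefl _ hlt) hie hy hlt hmin
      obtain ⟨g, hg, hg', -⟩ := S.clear hP hp (S.mulVec_off hh hy)
        (Signs.form_mulVec_self (S.le hh.1) hyy) fun a _ => hh' a
      refine ⟨g * h, mul_mem hg hh, fun i hi => ?_⟩
      rw [Units.val_mul, ← Matrix.mulVec_mulVec]
      exact hg' i hi
  obtain ⟨i, hi, hmin⟩ := Finset.exists_min_image (Finset.univ.filter P) (fun a => v (y a))
    ⟨p, by simpa using hp⟩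
  simp only [Finset.mem_filter, Finset.mem_univ, true_and] at hi hmin
  by_cases hie : i ≠ p.rev ∨ σ.ε = -1
  · exact main y hy hyy i hi hie hmin
  · push Not at hie
    obtain ⟨c, hc, hcp, hcp'⟩ := hε.resolve_left hie.2
    rcases (hmin c hc).eq_or_lt with heq | hlt
    · exact main y hy hyy c hc (Or.inl hcp') fun a ha => heq ▸ hmin a ha
    · obtain ⟨h, hh, hh'⟩ := S.spread hP hc hi (by rintro rfl; exact lt_irrefl _ hlt)
        (Or.inl fun h => hcp (Fin.rev_injective (h.symm.trans hie.1))) hy hlt hmin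
      obtain ⟨g, hg, hg'⟩ := main _ (S.mulVec_off hh hy) (Signs.form_mulVec_self (S.le hh.1) hyy) c hc
        (Or.inl hcp') fun a _ => hh' a
      refine ⟨g * h, mul_mem hg hh, fun i hi => ?_⟩
      rw [Units.val_mul, ← Matrix.mulVec_mulVec]
      exact hg' i hi

end IsSiegelGroup

end LocalHecke

namespace LocalHecke

/-- The indices between `k` and `k.rev`. -/
def Inner {d : ℕ} (k : ℕ) (i : Fin d) : Prop := k ≤ (i : ℕ) ∧ k ≤ (i.rev : ℕ)

lemma Inner.rev {d k : ℕ} {i : Fin d} (h : Inner k i) : Inner k i.rev :=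
  ⟨h.2, by rw [Fin.rev_rev]; exact h.1⟩

/-- The matrix has no entries above the diagonal off the indices between `k` and `k.rev`. -/
def LowerOff {K : Type*} [Zero K] {d : ℕ} (k : ℕ) (M : Matrix (Fin d) (Fin d) K) : Prop :=
  ∀ i j, i < j → ¬ (Inner k i ∧ Inner k j) → M i j = 0

namespace IsSiegelGroup

variable {K : Type*} [DivisionRing K] [StarRing K] {N : ℕ}
variable {v : AddValuation K (WithTop ℤ)} {σ : Signs K (N + N)} {F : Type*} [Field F] [Algebra F K]
  {Γ : Subgroup (Matrix (Fin (N + N)) (Fin (N + N)) K)ˣ} (S : IsSiegelGroup v σ F Γ)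
include S

/-- Elimination for a Siegel group: step `k` removes the pivot `k` together with its partner. A
symmetric form needs a further pair of active indices in each step, hence `k + 1 < N`. -/
lemma elimination {t : ℕ} (hN : 0 < N) (htN : t ≤ N) (ht : ∀ k < t, σ.ε = -1 ∨ k + 1 < N)
    (hterm : ∀ M ∈ Γ, DiagOff (Inner t) (M : Matrix (Fin (N + N)) (Fin (N + N)) K) →
      ∀ i j, i ≠ j → (M : Matrix (Fin (N + N)) (Fin (N + N)) K) i j = 0) :
    Elimination v Γ t Inner (fun k => ⟨min k (N + N - 1), by omega⟩) := by
  have hpiv : ∀ k < t, Inner k (⟨min k (N + N - 1), by omega⟩ : Fin (N + N)) := fun k hk => by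
    simp only [Inner, Fin.val_rev]; omega
  have hε : ∀ k < t, σ.ε = -1 ∨ ∃ c : Fin (N + N), Inner k c ∧
      c ≠ ⟨min k (N + N - 1), by omega⟩ ∧ c ≠ Fin.rev ⟨min k (N + N - 1), by omega⟩ := by
    intro k hk
    refine (ht k hk).imp_right fun h => ⟨⟨k + 1, by omega⟩, ?_⟩
    simp only [Inner, Fin.val_rev, ne_eq, Fin.ext_iff]
    omega
  have hcol : ∀ k < t, ∀ M ∈ Γ, DiagOff (Inner k) (M : Matrix (Fin (N + N)) (Fin (N + N)) K) →
      ∀ j, Inner k j → ∃ g ∈ intGroup v Γ (Inner k), ∀ a, a ≠ ⟨min k (N + N - 1), by omega⟩ →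
      ((g * M : (Matrix (Fin (N + N)) (Fin (N + N)) K)ˣ) :
        Matrix (Fin (N + N)) (Fin (N + N)) K) a j = 0 := by
    intro k hk M hM hoff j hj
    exact S.col (P := Inner k) (fun i => Inner.rev) (hpiv k hk) (hε k hk)
      (fun i hi => hoff i j (by rintro rfl; exact hi hj) fun h => hi h.1)
      (Signs.form_col_self (S.le hM) j)
  have hclear : ∀ k < t, ∀ M ∈ Γ, DiagOff (Inner k) (M : Matrix (Fin (N + N)) (Fin (N + N)) K) →
      (∀ a, Inner k a → v ((M : Matrix (Fin (N + N)) (Fin (N + N)) K)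
        ⟨min k (N + N - 1), by omega⟩ ⟨min k (N + N - 1), by omega⟩) ≤
        v ((M : Matrix (Fin (N + N)) (Fin (N + N)) K) a ⟨min k (N + N - 1), by omega⟩)) →
      ∃ g ∈ intGroup v Γ (Inner k), (g ∈ lowerGroup K (N + N) ∧
        ∀ i, (g : Matrix (Fin (N + N)) (Fin (N + N)) K) i i = 1) ∧
      (∀ b, (g : Matrix (Fin (N + N)) (Fin (N + N)) K) ⟨min k (N + N - 1), by omega⟩ b =
        (1 : Matrix (Fin (N + N)) (Fin (N + N)) K) ⟨min k (N + N - 1), by omega⟩ b) ∧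
      ∀ a, a ≠ ⟨min k (N + N - 1), by omega⟩ →
      ((g * M : (Matrix (Fin (N + N)) (Fin (N + N)) K)ˣ) :
        Matrix (Fin (N + N)) (Fin (N + N)) K) a ⟨min k (N + N - 1), by omega⟩ = 0 := by
    intro k hk M hM hoff hmin
    obtain ⟨g, hg, h1, h2, h3⟩ := S.clear (P := Inner k) (fun i => Inner.rev) (hpiv k hk)
      (fun i hi => hoff i _ (by rintro rfl; exact hi (hpiv k hk)) fun h => hi h.1)
      (Signs.form_col_self (S.le hM) _) hmin
    exact ⟨g, hg, h3 fun a ha => by simp only [Inner, Fin.le_def] at *; omega, h2, h1⟩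
  have hstar : ∀ k M, DiagOff (Inner k) (M : Matrix (Fin (N + N)) (Fin (N + N)) K) →
      DiagOff (Inner k) (star M) := fun k M h i j hij h' => by
    rw [Matrix.star_apply, h j i (Ne.symm hij) fun h => h' ⟨h.2, h.1⟩, star_zero]
  refine ⟨fun i => ⟨Nat.zero_le _, Nat.zero_le _⟩,
    fun k i h => ⟨Nat.le_of_succ_le h.1, Nat.le_of_succ_le h.2⟩, hpiv, fun k hk j hj => ?_,
    fun k hk h => ?_, hcol, fun k hk M hM hoff i hi => ?_, fun k hk M hM hoff hmin => ?_,
    fun k hk M hM hoff hmin => ?_, fun k hk M hM hoff hc hr i j hij h => ?_, hterm⟩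
  · simp only [Inner, Fin.le_def] at *; omega
  · simp only [Inner] at h; omega
  · obtain ⟨g, hg, h⟩ := hcol k hk (star M) (S.star_mem M hM) (hstar k _ hoff) i hi
    refine ⟨star g, S.star_mem_intGroup hg, fun b hb => ?_⟩
    have := congrArg star (h b hb)
    rwa [star_zero, ← Matrix.star_apply, ← Units.coe_star, star_mul, star_star] at this
  · obtain ⟨g, hg, h1, -, h2⟩ := hclear k hk M hM hoff hmin
    exact ⟨g, hg, h1.1, h1.2, h2⟩
  · obtain ⟨g, hg, -, h2, h⟩ := hclear k hk (star M) (S.star_mem M hM) (hstar k _ hoff)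
      fun a ha => by
        rw [Units.coe_star, Matrix.star_apply, Matrix.star_apply, S.v_star, S.v_star]
        exact hmin a ha
    refine ⟨star g, S.star_mem_intGroup hg, fun a => ?_, fun b hb => ?_⟩
    · rw [Units.coe_star, Matrix.star_apply, h2, ← Matrix.star_apply, star_one]
    · have := congrArg star (h b hb)
      rwa [star_zero, ← Matrix.star_apply, ← Units.coe_star, star_mul, star_star] at this
  · by_cases h' : Inner k i ∧ Inner k j
    · have hrow := Signs.row_rev_of_col (S.le hM) hc
      have hcol : ∀ i, i ≠ Fin.rev ⟨min k (N + N - 1), by omega⟩ →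
          (M : Matrix (Fin (N + N)) (Fin (N + N)) K) i
            (Fin.rev ⟨min k (N + N - 1), by omega⟩) = 0 := by
        intro i hi
        have h1 := Signs.row_rev_of_col (S.le (S.star_mem M hM))
          (p := ⟨min k (N + N - 1), by omega⟩) (q := ⟨min k (N + N - 1), by omega⟩)
          (fun b hb => by
            rw [Units.coe_star, Matrix.star_apply, hr b hb, star_zero]) i hi
        rw [Units.coe_star, Matrix.star_apply] at h1
        exact star_eq_zero.1 h1
      by_cases h1 : i = ⟨min k (N + N - 1), by omega⟩
      · rw [h1]; exact hr j fun h => hij (h1.trans h.symm)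
      by_cases h2 : j = ⟨min k (N + N - 1), by omega⟩
      · rw [h2]; exact hc i h1
      by_cases h3 : i = Fin.rev ⟨min k (N + N - 1), by omega⟩
      · rw [h3]; exact hrow j fun h => hij (h3.trans h.symm)
      by_cases h4 : j = Fin.rev ⟨min k (N + N - 1), by omega⟩
      · rw [h4]; exact hcol i h3
      exfalso
      simp only [Inner, Fin.ext_iff, Fin.val_rev] at *
      omega
    · exact hoff i j hij h'

/-- Integral row operations in the group make its elements lower triangular up to a central block:
the column of the greatest index between `k` and `k.rev` is isotropic after truncation, and if it
is cleared then so is the row of the least index. -/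
lemma iwasawa_aux (hN : 0 < N) {t : ℕ} (htN : t ≤ N) (ht : ∀ k < t, σ.ε = -1 ∨ k + 1 < N)
    {M : (Matrix (Fin (N + N)) (Fin (N + N)) K)ˣ} (hM : M ∈ Γ) : ∀ k ≤ t,
    ∃ g ∈ intGroup v Γ (fun _ => True), LowerOff k
      ((g * M : (Matrix (Fin (N + N)) (Fin (N + N)) K)ˣ) :
        Matrix (Fin (N + N)) (Fin (N + N)) K) := by
  classical
  intro k
  induction k with
  | zero => exact fun _ => ⟨1, one_mem _, fun i j _ h =>
      absurd ⟨⟨Nat.zero_le _, Nat.zero_le _⟩, ⟨Nat.zero_le _, Nat.zero_le _⟩⟩ h⟩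
  | succ k ih =>
    intro hk
    obtain ⟨g₀, hg₀, hlow⟩ := ih (by omega)
    obtain ⟨L, hL⟩ : ∃ L, L = g₀ * M := ⟨_, rfl⟩
    rw [← hL] at hlow
    have hLΓ : L ∈ Γ := hL ▸ mul_mem hg₀.1 hM
    set p : Fin (N + N) := ⟨k, by omega⟩ with hp
    have hpv : (p : ℕ) = k := rfl
    set c : Fin (N + N) := p.rev with hc
    have hcv : (c : ℕ) = N + N - (k + 1) := by rw [hc, Fin.val_rev]
    have hcP : Inner k c := by simp only [Inner, hc, Fin.rev_rev, Fin.val_rev, hp]; omega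
    have hout : ∀ i : Fin (N + N), ¬ Inner k i → i < p ∨ c < i := fun i hi => by
      rw [Fin.lt_def, Fin.lt_def, hcv, hpv]
      simp only [Inner, Fin.val_rev] at hi; omega
    have hin : ∀ i : Fin (N + N), Inner k i → p ≤ i ∧ i ≤ c := fun i hi => by
      rw [Fin.le_def, Fin.le_def, hcv, hpv]
      simp only [Inner, Fin.val_rev] at hi; omega
    have hpc : p < c := by rw [Fin.lt_def, hcv]; simp only [hp]; omega
    set y : Fin (N + N) → K := fun i =>
      if Inner k i then (L : Matrix (Fin (N + N)) (Fin (N + N)) K) i c else 0 with hy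
    have hrevlt : ∀ i : Fin (N + N), c < i → i.rev < p := fun i hi => by
      rw [← Fin.rev_lt_rev, Fin.rev_rev]; exact hi
    have hyy : σ.form y y = 0 := by
      rw [← Signs.form_col_self (S.le hLΓ) c, Signs.form, Signs.form]
      refine Finset.sum_congr rfl fun i _ => ?_
      by_cases hi : Inner k i
      · simp only [hy, if_pos hi, if_pos hi.rev]
      · have hi' : ¬ Inner k i.rev := fun h => hi (by simpa using h.rev)
        simp only [hy, if_neg hi, if_neg hi', mul_zero]
        rcases hout i hi with h | h
        · rw [hlow i c (h.trans hpc) fun h => hi h.1, star_zero, zero_mul, zero_mul]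
        · rw [hlow i.rev c ((hrevlt i h).trans hpc) fun h => hi' h.1, mul_zero]
    obtain ⟨g, hg, hgy⟩ := S.col (P := Inner k) (fun i => Inner.rev) hcP
      ((ht k (by omega)).imp_right fun h => ⟨⟨k + 1, by omega⟩, by
        simp only [Inner, ne_eq, Fin.ext_iff, Fin.val_rev]; omega⟩)
      (fun i hi => by simp only [hy, if_neg hi]) hyy
    obtain ⟨L', hL'⟩ : ∃ L', L' = g * L := ⟨_, rfl⟩
    have hL'Γ : L' ∈ Γ := hL' ▸ mul_mem hg.1 hLΓ
    have hlow' : LowerOff k (L' : Matrix (Fin (N + N)) (Fin (N + N)) K) := by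
      intro i j hij h
      by_cases hi : Inner k i
      · have hj : ¬ Inner k j := fun hj => h ⟨hi, hj⟩
        rw [hL', Units.val_mul, Matrix.mul_apply]
        refine Finset.sum_eq_zero fun b _ => ?_
        by_cases hb : Inner k b
        · have hcj : c < j := (hout j hj).resolve_left
            (not_lt.2 (((hin i hi).1.trans_lt hij).le))
          rw [hlow b j ((hin b hb).2.trans_lt hcj) fun h => hj h.2, mul_zero]
        · rw [hg.2.2.1 i b fun h => hb h.2, Matrix.one_apply_ne (by rintro rfl; exact hb hi),
            zero_mul]
      · rw [hL', Units.val_mul, hg.2.2.1.mul_apply hi]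
        exact hlow i j hij h
    have hcol : ∀ i < c, (L' : Matrix (Fin (N + N)) (Fin (N + N)) K) i c = 0 := by
      intro i hi
      by_cases hiP : Inner k i
      · rw [← hgy i hi.ne, hL', Units.val_mul, Matrix.mul_apply, Matrix.mulVec, dotProduct]
        refine Finset.sum_congr rfl fun b _ => ?_
        by_cases hb : Inner k b
        · simp only [hy, if_pos hb]
        · rw [hg.2.2.1 i b fun h => hb h.2, Matrix.one_apply_ne (by rintro rfl; exact hb hiP),
            zero_mul, zero_mul]
      · exact hlow' i c hi fun h => hiP h.1
    have hrow : ∀ j, p < j → (L' : Matrix (Fin (N + N)) (Fin (N + N)) K) p j = 0 := by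
      obtain ⟨m, hm0, hm⟩ := S.le hL'Γ
      have key : ∀ j, p ≤ j → star ((L' : Matrix (Fin (N + N)) (Fin (N + N)) K) c c) *
          (σ.s c * (L' : Matrix (Fin (N + N)) (Fin (N + N)) K) p j) = m • σ.J c j := by
        intro j hj
        rw [← Matrix.smul_apply, ← hm, Signs.conj_J_mul_apply, Signs.form,
          Finset.sum_eq_single c, mul_assoc, hc, Fin.rev_rev]
        · intro b _ hb
          rcases lt_or_gt_of_ne hb with h | h
          · rw [hcol b h, star_zero, zero_mul, zero_mul]
          · have hb' := hrevlt b h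
            rw [hlow' b.rev j (hb'.trans_le hj) fun h => absurd (hin _ h.1).1 (not_le.2 hb'),
              mul_zero]
        · simp
      have hs : ∀ i, σ.s i ≠ 0 := fun i hi => by simpa [hi] using σ.s_mul_s i
      have h0 : star ((L' : Matrix (Fin (N + N)) (Fin (N + N)) K) c c) ≠ 0 := by
        intro h0
        have := key p le_rfl
        rw [h0, zero_mul, Signs.J, if_pos (by rw [hc, Fin.rev_rev]), eq_comm, smul_eq_zero] at this
        exact this.elim hm0 (hs c)
      intro j hj
      have := key j hj.le
      rw [Signs.J, if_neg (by rw [hc, Fin.rev_rev]; exact hj.ne'), smul_zero] at this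
      exact ((mul_eq_zero.1 ((mul_eq_zero.1 this).resolve_left h0))).resolve_left (hs c)
    refine ⟨g * g₀, mul_mem (intGroup_mono v (fun _ _ => trivial) hg) hg₀, ?_⟩
    rw [mul_assoc, ← hL, ← hL']
    intro i j hij h
    by_cases h' : Inner k i ∧ Inner k j
    · by_cases hi : i = p
      · rw [hi]; exact hrow j (hi ▸ hij)
      · have hj : j = c := by
          have h1 := hin i h'.1
          have h2 := hin j h'.2
          simp only [Inner, Fin.val_rev] at h h'
          rw [Fin.ext_iff, hpv] at hi
          rw [Fin.le_def, Fin.le_def, hcv, hpv] at h1 h2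
          rw [Fin.ext_iff, hcv]
          omega
        rw [hj]; exact hcol i (hj ▸ hij)
    · exact hlow' i j hij h'

/-- Triangular representatives for the right cosets of the integral elements of a Siegel group. The
hypothesis `hlow` is about the part of the matrix that the elimination does not reach. -/
lemma iwasawa (hN : 0 < N) {t : ℕ} (htN : t ≤ N) (ht : ∀ k < t, σ.ε = -1 ∨ k + 1 < N)
    (hlow : ∀ M ∈ Γ, LowerOff t (M : Matrix (Fin (N + N)) (Fin (N + N)) K) →
      M ∈ lowerGroup K (N + N)) (M : (Matrix (Fin (N + N)) (Fin (N + N)) K)ˣ) (hM : M ∈ Γ) :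
    ∃ g ∈ intGroup v Γ (fun _ => True), g * M ∈ lowerGroup K (N + N) := by
  obtain ⟨g, hg, h⟩ := S.iwasawa_aux hN htN ht hM t le_rfl
  exact ⟨g, hg, hlow _ (mul_mem hg.1 hM) h⟩

end IsSiegelGroup

end LocalHecke

/-! ### Skew and symmetric forms -/

namespace LocalHecke

section skew

variable {K : Type*} [DivisionRing K] [StarRing K] {N : ℕ} {v : AddValuation K (WithTop ℤ)}
  {σ : Signs K (N + N)} (F : Type*) [Field F] [Algebra F K]

lemma Signs.siegelUnit_mem_simGroup {d : ℕ} (σ : Signs K d) {a : Fin d} {u : Fin d → K}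
    (ha : u a = 1) (hu : σ.form u u = 0) : σ.siegelUnit ha hu ∈ σ.simGroup F :=
  ⟨1, one_ne_zero, (σ.siegel_isometry ha hu).trans (one_smul _ _).symm⟩

lemma isSiegelGroup_simGroup {d : ℕ} (σ : Signs K d) (hv : ∀ x, v (star x) = v x) :
    IsSiegelGroup v σ F (σ.simGroup F) :=
  ⟨hv, le_rfl, fun _ h => Signs.star_mem_simGroup h, fun _ _ => σ.siegelUnit_mem_simGroup F⟩

lemma not_inner_half (i : Fin (N + N)) : ¬ Inner N i := fun h => by
  simp only [Inner, Fin.val_rev] at h; omega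

/-- For a skew form, the elimination runs through all `N` pairs of indices. -/
lemma skew_elimination (hN : 0 < N) (hε : σ.ε = -1) (hv : ∀ x, v (star x) = v x) :
    Elimination v (σ.simGroup F) N Inner (fun k => ⟨min k (N + N - 1), by omega⟩) :=
  (isSiegelGroup_simGroup F σ hv).elimination hN le_rfl (fun _ _ => Or.inl hε)
    fun _ _ h i j hij => h i j hij fun h' => not_inner_half i h'.1

lemma skew_iwasawa (hN : 0 < N) (hε : σ.ε = -1) (hv : ∀ x, v (star x) = v x) :
    ∀ M ∈ σ.simGroup F, ∃ g ∈ intGroup v (σ.simGroup F) (fun _ => True),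
      g * M ∈ lowerGroup K (N + N) :=
  (isSiegelGroup_simGroup F σ hv).iwasawa hN le_rfl (fun _ _ => Or.inl hε)
    fun _ _ h i j hij => h i j hij fun h' => not_inner_half i h'.1

end skew

section diagonal

variable {K : Type*} [DivisionRing K] [StarRing K] {d : ℕ} {σ : Signs K d} {F : Type*} [Field F]
  [Algebra F K]

/-- The diagonal entries of a lower triangular similitude at partners multiply to the similitude. -/
lemma Signs.star_mul_rev_of_lower {M : Matrix (Fin d) (Fin d) K} {m : F}
    (hM : Mᴴ * σ.J * M = m • σ.J) (hl : IsLower M) (i : Fin d) :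
    star (M i i) * M i.rev i.rev = algebraMap F K m := by
  have h := congrFun (congrFun hM i) i.rev
  rw [conj_J_mul_apply, form, Finset.sum_eq_single i, Matrix.smul_apply, J, if_pos rfl, mul_assoc,
    σ.s_comm, ← mul_assoc] at h
  · have h2 := congrArg (· * σ.s i) h
    rwa [mul_assoc, σ.s_mul_s, mul_one, Algebra.smul_mul_assoc, σ.s_mul_s,
      ← Algebra.algebraMap_eq_smul_one] at h2
  · intro k _ hk
    rcases lt_or_gt_of_ne hk with h' | h'
    · rw [hl k i h', star_zero, zero_mul, zero_mul]
    · rw [hl k.rev i.rev (by rwa [Fin.rev_lt_rev]), mul_zero]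
  · simp

/-- The exponents with constant sums over pairs of partners. -/
def pairedExps (d : ℕ) : AddSubgroup (Lex (Fin d → ℤ)) where
  carrier := {x | ∃ c : ℤ, ∀ i : Fin d, x i + x i.rev = c}
  zero_mem' := ⟨0, fun i => by change (0 : ℤ) + 0 = 0; simp⟩
  add_mem' := by
    rintro x y ⟨c, hc⟩ ⟨c', hc'⟩
    refine ⟨c + c', fun i => ?_⟩
    change x i + y i + (x i.rev + y i.rev) = _
    rw [← hc i, ← hc' i]; ring
  neg_mem' := by
    rintro x ⟨c, hc⟩
    refine ⟨-c, fun i => ?_⟩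
    change -x i + -x i.rev = _
    rw [← hc i]; ring

lemma Signs.exps_add_rev {v : AddValuation K (WithTop ℤ)} (hv : ∀ x, v (star x) = v x)
    {D : (Matrix (Fin d) (Fin d) K)ˣ} {m : F}
    (hm : (D : Matrix (Fin d) (Fin d) K)ᴴ * σ.J * (D : Matrix (Fin d) (Fin d) K) = m • σ.J)
    (hdiag : ∀ i j, i ≠ j → (D : Matrix (Fin d) (Fin d) K) i j = 0) (i : Fin d) :
    exps v (D : Matrix (Fin d) (Fin d) K) i + exps v (D : Matrix (Fin d) (Fin d) K) i.rev =
      ev v (algebraMap F K m) := by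
  have h := star_mul_rev_of_lower hm (IsLower.of_diag hdiag) i
  have hne := lowerGroup_diag_ne (IsLower.of_diag hdiag : D ∈ lowerGroup K d)
  have h1 : ev v (star ((D : Matrix (Fin d) (Fin d) K) i i)) =
      ev v ((D : Matrix (Fin d) (Fin d) K) i i) := by rw [ev, ev, hv]
  rw [← h, ev_mul v (star_ne_zero.2 (hne i)) (hne _), h1]
  rfl

lemma Signs.exps_mem_pairedExps {v : AddValuation K (WithTop ℤ)} (hv : ∀ x, v (star x) = v x)
    {D : (Matrix (Fin d) (Fin d) K)ˣ} (hD : D ∈ σ.simGroup F)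
    (hdiag : ∀ i j, i ≠ j → (D : Matrix (Fin d) (Fin d) K) i j = 0) :
    exps v (D : Matrix (Fin d) (Fin d) K) ∈ pairedExps d := by
  obtain ⟨m, -, hm⟩ := hD
  exact ⟨_, exps_add_rev hv hm hdiag⟩

end diagonal

section symmetric

variable {K : Type*} [Field K] [StarRing K] {N : ℕ} (σ : Signs K (N + N))

/-- Lower triangular similitudes of a form over a field are proper. -/
lemma Signs.det_of_lower (hst : ∀ x : K, star x = x) {M : Matrix (Fin (N + N)) (Fin (N + N)) K}
    {m : K} (hM : Mᴴ * σ.J * M = m • σ.J) (hl : IsLower M) : M.det = m ^ N := by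
  have h1 : ∀ i, M i i * M i.rev i.rev = m := fun i => by
    have := σ.star_mul_rev_of_lower hM hl i
    rwa [hst] at this
  rw [Matrix.det_of_isLowerTriangular M fun i j hij => hl i j (OrderDual.toDual_lt_toDual.1 hij),
    Fin.prod_univ_add, ← Equiv.prod_comp Fin.revPerm fun i => M (Fin.natAdd N i) (Fin.natAdd N i),
    ← Finset.prod_mul_distrib, Finset.prod_congr rfl fun i _ => ?_, Finset.prod_const,
    Finset.card_univ, Fintype.card_fin]
  have h2 : Fin.natAdd N (Fin.revPerm i) = (Fin.castAdd N i).rev := by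
    ext; simp only [Fin.val_natAdd, Fin.revPerm_apply, Fin.val_rev, Fin.val_castAdd]; omega
  rw [h2]
  exact h1 _

lemma Signs.det_siegel {d : ℕ} (σ : Signs K d) (a : Fin d) {u : Fin d → K} (ha : u a = 1) :
    (σ.siegel a u).det = 1 := by
  have har := σ.rev_ne a
  have hcol : ∀ (a : Fin d) (z : Fin d → K), z a = 0 →
      (1 + Matrix.vecMulVec z (Pi.single a 1) : Matrix (Fin d) (Fin d) K).det = 1 := by
    intro a z hz
    rw [Matrix.vecMulVec_eq Unit, Matrix.det_one_add_replicateCol_mul_replicateRow]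
    simp [hz]
  have hrow : ∀ (a : Fin d) (z : Fin d → K), z a = 0 →
      (1 + Matrix.vecMulVec (Pi.single a 1) z : Matrix (Fin d) (Fin d) K).det = 1 := by
    intro a z hz
    rw [Matrix.vecMulVec_eq Unit, Matrix.det_one_add_replicateCol_mul_replicateRow]
    simp [hz]
  have hS : σ.siegel a u = (1 + Matrix.vecMulVec (u - Pi.single a 1) (Pi.single a 1)) *
      (1 + Matrix.vecMulVec (Pi.single a.rev 1) (-σ.siegelC a u)) := by
    have h0 : Matrix.vecMulVec (u - Pi.single a 1) (Pi.single a (1 : K)) *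
        Matrix.vecMulVec (Pi.single a.rev 1) (-σ.siegelC a u) = 0 := by
      rw [Matrix.vecMulVec_mul_vecMulVec]
      simp [Ne.symm har]
    rw [mul_add, mul_one, add_mul, one_mul, h0, add_zero]
    ext i b
    simp only [siegel, siegelX, Matrix.add_apply, Matrix.vecMulVec_apply, Matrix.one_apply,
      Pi.single_apply, Pi.sub_apply, Pi.neg_apply]
    by_cases hb : b = a <;> by_cases hi : i = a.rev <;> 
      simp [hb, hi, har, sub_eq_add_neg, Pi.single_apply]
  rw [hS, Matrix.det_mul, hcol _ _ (by simp [ha]), hrow _ _ (by simp [siegelC]), one_mul]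

/-- The group of proper similitudes. -/
def Signs.properGroup : Subgroup (Matrix (Fin (N + N)) (Fin (N + N)) K)ˣ where
  carrier := {M | ∃ m : K, m ≠ 0 ∧
    (M : Matrix (Fin (N + N)) (Fin (N + N)) K)ᴴ * σ.J * (M : Matrix (Fin (N + N)) (Fin (N + N)) K) =
      m • σ.J ∧ (M : Matrix (Fin (N + N)) (Fin (N + N)) K).det = m ^ N}
  one_mem' := ⟨1, one_ne_zero, by simp, by simp⟩
  mul_mem' := by
    rintro M M' ⟨m, hm, hM, hM'⟩ ⟨k, hk, hN, hN'⟩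
    refine ⟨m * k, mul_ne_zero hm hk, ?_, by
      rw [Units.val_mul, Matrix.det_mul, hM', hN', mul_pow]⟩
    rw [Units.val_mul, Matrix.conjTranspose_mul]
    calc _ = (M' : Matrix (Fin (N + N)) (Fin (N + N)) K)ᴴ *
          ((M : Matrix (Fin (N + N)) (Fin (N + N)) K)ᴴ * σ.J *
          (M : Matrix (Fin (N + N)) (Fin (N + N)) K)) * (M' : Matrix (Fin (N + N)) (Fin (N + N)) K) := by
            simp only [mul_assoc]
      _ = _ := by rw [hM, Matrix.mul_smul, Matrix.smul_mul, hN, smul_smul]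
  inv_mem' := by
    rintro M ⟨m, hm, hM, hM'⟩
    have h1 : (M : Matrix (Fin (N + N)) (Fin (N + N)) K) *
      ((M⁻¹ : (Matrix (Fin (N + N)) (Fin (N + N)) K)ˣ) :
        Matrix (Fin (N + N)) (Fin (N + N)) K) = 1 := M.mul_inv
    have h2 : ((M⁻¹ : (Matrix (Fin (N + N)) (Fin (N + N)) K)ˣ) :
        Matrix (Fin (N + N)) (Fin (N + N)) K)ᴴ *
        (M : Matrix (Fin (N + N)) (Fin (N + N)) K)ᴴ = 1 := by
      rw [← Matrix.conjTranspose_mul, h1, Matrix.conjTranspose_one]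
    refine ⟨m⁻¹, inv_ne_zero hm, ?_, ?_⟩
    · rw [eq_inv_smul_iff₀ hm, ← Matrix.smul_mul, ← Matrix.mul_smul, ← hM]
      calc _ = (((M⁻¹ : (Matrix (Fin (N + N)) (Fin (N + N)) K)ˣ) :
          Matrix (Fin (N + N)) (Fin (N + N)) K)ᴴ *
          (M : Matrix (Fin (N + N)) (Fin (N + N)) K)ᴴ) * σ.J *
          ((M : Matrix (Fin (N + N)) (Fin (N + N)) K) *
          ((M⁻¹ : (Matrix (Fin (N + N)) (Fin (N + N)) K)ˣ) :
            Matrix (Fin (N + N)) (Fin (N + N)) K)) := by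
            simp only [mul_assoc]
        _ = _ := by rw [h1, h2, one_mul, mul_one]
    · have h3 := congrArg Matrix.det h1
      rw [Matrix.det_mul, hM', Matrix.det_one] at h3
      rw [inv_pow]
      exact eq_inv_of_mul_eq_one_right h3

lemma Signs.properGroup_le : σ.properGroup ≤ σ.simGroup K := by
  rintro M ⟨m, hm, hM, -⟩
  exact ⟨m, hm, hM⟩

variable {σ} {v : AddValuation K (WithTop ℤ)}

lemma isSiegelGroup_properGroup (hst : ∀ x : K, star x = x) :
    IsSiegelGroup v σ K σ.properGroup := by
  refine ⟨fun x => by rw [hst], σ.properGroup_le, ?_, fun a u ha hu => ?_⟩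
  · rintro M ⟨m, hm, hM, hM'⟩
    refine ⟨m, hm, ?_, ?_⟩
    · rw [Units.coe_star, Matrix.star_eq_conjTranspose, Matrix.conjTranspose_conjTranspose]
      exact Signs.sim_star hm hM
    · rw [Units.coe_star, Matrix.star_eq_conjTranspose, Matrix.det_conjTranspose, hst, hM']
  · exact ⟨1, one_ne_zero, (σ.siegel_isometry ha hu).trans (one_smul _ _).symm, by
      rw [one_pow]; exact σ.det_siegel a ha⟩

lemma Signs.J_submatrix_swap {K : Type*} [Ring K] {d : ℕ} (σ : Signs K d) (hε : σ.ε = 1)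
    (p : Fin d) : σ.J.submatrix (Equiv.swap p p.rev) (Equiv.swap p p.rev) = σ.J := by
  have hsp : σ.s p.rev = σ.s p := by rw [σ.s_rev, hε, one_mul]
  have hsw : ∀ i, (Equiv.swap p p.rev) i.rev = ((Equiv.swap p p.rev) i).rev := by
    intro i
    by_cases h1 : i = p
    · subst h1; simp
    · by_cases h2 : i = p.rev
      · rw [h2]; simp
      · have h3 : i.rev ≠ p := fun h => h2 (by rw [← h, Fin.rev_rev])
        have h4 : i.rev ≠ p.rev := fun h => h1 (Fin.rev_injective h)
        rw [Equiv.swap_apply_of_ne_of_ne h1 h2, Equiv.swap_apply_of_ne_of_ne h3 h4]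
  have hsws : ∀ i, σ.s ((Equiv.swap p p.rev) i) = σ.s i := by
    intro i
    by_cases h1 : i = p
    · subst h1; simp [hsp]
    · by_cases h2 : i = p.rev
      · rw [h2]; simp [hsp]
      · rw [Equiv.swap_apply_of_ne_of_ne h1 h2]
  ext a b
  simp only [Matrix.submatrix_apply, J, hsws, ← hsw, (Equiv.swap p p.rev).injective.eq_iff]

/-- A proper similitude of a symmetric form that is lower triangular up to the central `2 × 2`
block is lower triangular: otherwise the central block is antidiagonal up to an entry, and swapping
the two central rows gives a lower triangular similitude of the wrong determinant. -/
lemma lower_of_lowerOff [CharZero K] (hN : 0 < N) (hst : ∀ x : K, star x = x) (hε : σ.ε = 1) :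
    ∀ M ∈ σ.properGroup, LowerOff (N - 1) (M : Matrix (Fin (N + N)) (Fin (N + N)) K) →
      M ∈ lowerGroup K (N + N) := by
  rintro ⟨M, M', hMM', hM'M⟩ ⟨m, hm0, hM, hdet⟩ hlow
  simp only at hM hdet hlow
  change IsLower M
  set p : Fin (N + N) := ⟨N - 1, by omega⟩ with hp
  have hpv : (p : ℕ) = N - 1 := rfl
  have hqv : (p.rev : ℕ) = N := by rw [Fin.val_rev]; omega
  have hin : ∀ i : Fin (N + N), Inner (N - 1) i → i = p ∨ i = p.rev := by
    intro i hi
    rw [Fin.ext_iff, Fin.ext_iff, hpv, hqv]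
    simp only [Inner, Fin.val_rev] at hi; omega
  have hout : ∀ i : Fin (N + N), i ≠ p → i ≠ p.rev → i < p ∨ p.rev < i := by
    intro i h1 h2
    rw [Ne, Fin.ext_iff, hpv] at h1
    rw [Ne, Fin.ext_iff, hqv] at h2
    rw [Fin.lt_def, Fin.lt_def, hpv, hqv]; omega
  have hpq : p < p.rev := by rw [Fin.lt_def, hpv, hqv]; omega
  have hsp : σ.s p.rev = σ.s p := by rw [σ.s_rev, hε, one_mul]
  have hs : ∀ i, σ.s i ≠ 0 := fun i hi => by simpa [hi] using σ.s_mul_s i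
  have hz : ∀ i j, i < j → (i < p ∨ p.rev < j) → M i j = 0 := by
    intro i j hij h
    refine hlow i j hij fun h' => ?_
    rcases hin i h'.1 with rfl | rfl <;> rcases hin j h'.2 with rfl | rfl <;>
      rcases h with h | h <;> first | exact lt_irrefl _ h | exact lt_asymm h hpq
  suffices hβ : M p p.rev = 0 by
    intro i j hij
    by_cases h : Inner (N - 1) i ∧ Inner (N - 1) j
    · rcases hin i h.1 with rfl | rfl <;> rcases hin j h.2 with rfl | rfl
      · exact absurd hij (lt_irrefl _)
      · exact hβ
      · exact absurd hij (lt_asymm hpq)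
      · exact absurd hij (lt_irrefl _)
    · exact hlow i j hij h
  by_contra hβ
  have hsum : ∀ j, m * σ.J p.rev j = M p p.rev * σ.s p * M p.rev j +
      M p.rev p.rev * σ.s p * M p j + ∑ i ∈ Finset.univ.filter (fun i => p.rev < i),
        M i p.rev * σ.s i * M i.rev j := by
    intro j
    have h := congrFun (congrFun hM p.rev) j
    rw [σ.conj_J_mul_apply, Signs.form, Matrix.smul_apply, smul_eq_mul] at h
    rw [← h, ← Finset.sum_filter_add_sum_filter_not Finset.univ (fun i => p.rev < i), add_comm]
    simp only [hst]
    congr 1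
    rw [← Finset.sum_subset (s₁ := {p, p.rev}) (fun i hi => by
      simp only [Finset.mem_insert, Finset.mem_singleton] at hi
      simp only [Finset.mem_filter, Finset.mem_univ, true_and, not_lt]
      rcases hi with rfl | rfl
      · exact hpq.le
      · exact le_rfl) (fun i hi hi' => by
      simp only [Finset.mem_insert, Finset.mem_singleton, not_or] at hi'
      simp only [Finset.mem_filter, Finset.mem_univ, true_and, not_lt] at hi
      have h2 := (hout i hi'.1 hi'.2).resolve_right (not_lt.2 hi)
      rw [hz i p.rev (h2.trans hpq) (Or.inl h2), zero_mul, zero_mul]),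
      Finset.sum_pair hpq.ne, Fin.rev_rev, hsp]
  have hrev : ∀ i, p.rev < i → i.rev < p := fun i hi => by
    rw [← Fin.rev_lt_rev, Fin.rev_rev]; exact hi
  have hδ : M p.rev p.rev = 0 := by
    have h := hsum p.rev
    rw [Signs.J, if_neg (by simpa using hpq.ne'), mul_zero, Finset.sum_eq_zero fun i hi => by
      have := hrev i (by simpa using hi)
      rw [hz i.rev p.rev (this.trans hpq) (Or.inl this), mul_zero], add_zero] at h
    have h2 : 2 * (M p p.rev * σ.s p * M p.rev p.rev) = 0 := by rw [h]; ring
    have h3 := (mul_eq_zero.1 h2).resolve_left two_ne_zero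
    exact (mul_eq_zero.1 h3).resolve_left (mul_ne_zero hβ (hs p))
  have h1 : (M.submatrix (Equiv.swap p p.rev) id)ᴴ * σ.J * M.submatrix (Equiv.swap p p.rev) id =
      m • σ.J := by
    rw [← hM, ← σ.J_submatrix_swap hε p, Matrix.conjTranspose_submatrix,
      Matrix.submatrix_mul_equiv, Matrix.submatrix_mul_equiv, σ.J_submatrix_swap hε p,
      Matrix.submatrix_id_id]
  have h2 : IsLower (M.submatrix (Equiv.swap p p.rev) id) := by
    intro i j hij
    rw [Matrix.submatrix_apply, id]
    by_cases hi : i = p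
    · rw [hi, Equiv.swap_apply_left]
      rw [hi] at hij
      by_cases hj : j = p.rev
      · rw [hj, hδ]
      · have := (hout j hij.ne' hj).resolve_left (lt_asymm hij)
        exact hz _ _ this (Or.inr this)
    · by_cases hi' : i = p.rev
      · rw [hi', Equiv.swap_apply_right]
        rw [hi'] at hij
        exact hz _ _ (hpq.trans hij) (Or.inr hij)
      · rw [Equiv.swap_apply_of_ne_of_ne hi hi']
        rcases hout i hi hi' with h | h
        · exact hz _ _ hij (Or.inl h)
        · exact hz _ _ hij (Or.inr (h.trans hij))
  have h3 := σ.det_of_lower hst h1 h2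
  rw [Matrix.det_permute, Equiv.Perm.sign_swap hpq.ne, hdet] at h3
  have h4 : m ^ N = 0 := by
    have : 2 * m ^ N = 0 := by
      have h5 : -m ^ N = m ^ N := by simpa using h3
      linear_combination -h5
    exact (mul_eq_zero.1 this).resolve_left two_ne_zero
  exact hm0 (pow_eq_zero_iff hN.ne' |>.1 h4)

/-- For a symmetric form, the elimination stops at the central pair of indices, where properness
makes the matrix diagonal. -/
lemma symm_elimination [CharZero K] (hN : 0 < N) (hst : ∀ x : K, star x = x) (hε : σ.ε = 1) :
    Elimination v σ.properGroup (N - 1) Inner (fun k => ⟨min k (N + N - 1), by omega⟩) := by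
  have S : IsSiegelGroup v σ K σ.properGroup := isSiegelGroup_properGroup hst
  refine S.elimination hN (Nat.sub_le _ _) (fun k hk => Or.inr (by omega)) fun M hM hoff i j hij => ?_
  rcases lt_or_gt_of_ne hij with h | h
  · exact lower_of_lowerOff hN hst hε M hM (fun i j hij h => hoff i j hij.ne h) i j h
  · have := lower_of_lowerOff hN hst hε (star M) (S.star_mem M hM) (fun i j hij h => by
      rw [Units.coe_star, Matrix.star_apply, hoff j i hij.ne' fun h' => h ⟨h'.2, h'.1⟩, star_zero])
      j i h
    rw [Units.coe_star, Matrix.star_apply] at this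
    exact star_eq_zero.1 this

lemma symm_iwasawa [CharZero K] (hN : 0 < N) (hst : ∀ x : K, star x = x) (hε : σ.ε = 1) :
    ∀ M ∈ σ.properGroup, ∃ g ∈ intGroup v σ.properGroup (fun _ => True),
      g * M ∈ lowerGroup K (N + N) := by
  have S : IsSiegelGroup v σ K σ.properGroup := isSiegelGroup_properGroup hst
  exact S.iwasawa hN (Nat.sub_le _ _) (fun k hk => Or.inr (by omega)) (lower_of_lowerOff hN hst hε)

end symmetric

end LocalHecke

/-! ### Uniqueness of elementary divisors -/

namespace LocalHecke

section exchange

variable {K : Type*} [DivisionRing K] {v : AddValuation K (WithTop ℤ)} {d : ℕ}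

/-- If the entries of an integrally invertible matrix have positive value wherever the vector `x`
and its image are supported, then `x = 0`: applying the inverse does not decrease values. -/
lemma eq_zero_of_vecMul {g g' : Matrix (Fin d) (Fin d) K} (hg : IntMat v g') (hgg : g * g' = 1)
    {x : Fin d → K}
    (h : ∀ b, (x ᵥ* g) b = 0 ∨ ∀ a, x a ≠ 0 → 1 ≤ v (g a b)) : x = 0 := by
  by_contra hx
  obtain ⟨a₀, ha₀⟩ : ∃ a, x a ≠ 0 := by
    by_contra hx'
    push Not at hx'
    exact hx (funext hx')
  obtain ⟨i, -, hmin⟩ := Finset.exists_min_image Finset.univ (fun a => v (x a)) ⟨a₀, by simp⟩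
  have hi : x i ≠ 0 := by
    intro hi
    have := hmin a₀ (Finset.mem_univ _)
    rw [hi, AddValuation.map_zero, top_le_iff] at this
    exact ha₀ ((AddValuation.top_iff v).1 this)
  have h1 : x i = ∑ b, (x ᵥ* g) b * g' b i := by
    change x i = ((x ᵥ* g) ᵥ* g') i
    rw [Matrix.vecMul_vecMul, hgg, Matrix.vecMul_one]
  have h2 : v (x i) + 1 ≤ v (x i) := by
    conv_rhs => rw [h1]
    refine v.map_le_sum fun b _ => ?_
    refine le_trans ?_ (le_v_mul_right v (hg b i))
    rcases h b with hb | hb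
    · rw [hb]; simp
    · rw [Matrix.vecMul, dotProduct]
      refine v.map_le_sum fun a _ => ?_
      by_cases ha : x a = 0
      · simp [ha]
      · rw [AddValuation.map_mul]
        exact add_le_add (hmin a (Finset.mem_univ _)) (hb a ha)
  rw [← coe_ev v hi] at h2
  have h3 : ev v (x i) + 1 ≤ ev v (x i) := by exact_mod_cast h2
  omega

/-- The comparison of elementary divisors: if `D i i` had larger value than `T i i`, then the
entries `g a b` with `b ≤ i ≤ a` would all lie in the maximal ideal, and no integral matrix with
such a block is invertible over the integers. -/
lemma exps_le_of_mul_eq {D T g g' h : Matrix (Fin d) (Fin d) K} (hD : ∀ i j, i ≠ j → D i j = 0)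
    (hT : ∀ i j, i ≠ j → T i j = 0) (hD0 : ∀ i, D i i ≠ 0) (hT0 : ∀ i, T i i ≠ 0)
    (hg : IntMat v g') (hgg : g * g' = 1) (hh : IntMat v h) (heq : D * h = g * T)
    (hDm : ∀ i j, i ≤ j → exps v D i ≤ exps v D j) (hTm : ∀ i j, i ≤ j → exps v T i ≤ exps v T j)
    (i : Fin d) : exps v D i ≤ exps v T i := by
  by_contra hlt
  rw [not_le] at hlt
  have hpos : ∀ a b, i ≤ a → b ≤ i → 1 ≤ v (g a b) := by
    intro a b ha hb
    by_cases h0 : g a b = 0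
    · rw [h0]; simp
    · have h1 := congrFun (congrFun heq a) b
      rw [Matrix.mul_apply, Matrix.mul_apply,
        Finset.sum_eq_single a (fun k _ hk => by rw [hD a k (Ne.symm hk), zero_mul]) (by simp),
        Finset.sum_eq_single b (fun k _ hk => by rw [hT k b hk, mul_zero]) (by simp)] at h1
      have h2 : h a b ≠ 0 := by
        intro h2
        rw [h2, mul_zero, eq_comm] at h1
        exact (mul_ne_zero h0 (hT0 b)) h1
      have h3 := congrArg (ev v) h1
      rw [ev_mul v (hD0 a) h2, ev_mul v h0 (hT0 b)] at h3
      have h4 := (le_v_iff v h2 0).1 (hh a b)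
      have h5 := hDm i a ha
      have h6 := hTm b i hb
      rw [exps_apply, exps_apply] at h5 h6 hlt
      exact (le_v_iff v h0 1).2 (by omega)
  classical
  -- a nonzero combination of the rows from `i` on that vanishes in the columns after `i`
  have hker : LinearMap.ker (Matrix.vecMulLinear (g.submatrix
      (Subtype.val : {a // i ≤ a} → Fin d) (Subtype.val : {b // i < b} → Fin d))) ≠ ⊥ := by
    refine LinearMap.ker_ne_bot_of_finrank_lt ?_
    rw [Module.finrank_fintype_fun_eq_card, Module.finrank_fintype_fun_eq_card]
    exact Fintype.card_lt_of_injective_of_notMem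
      (fun b : {b // i < b} => (⟨b.1, b.2.le⟩ : {a // i ≤ a}))
      (fun b b' h => Subtype.ext (congrArg (fun a : {a // i ≤ a} => a.1) h)) (b := ⟨i, le_rfl⟩)
      (by rintro ⟨b, hb⟩; exact b.2.ne (congrArg (fun a : {a // i ≤ a} => a.1) hb).symm)
  obtain ⟨x, hx, hx0⟩ := (Submodule.ne_bot_iff _).1 hker
  rw [LinearMap.mem_ker] at hx
  apply hx0
  set x' : Fin d → K := fun a => if h : i ≤ a then x ⟨a, h⟩ else 0 with hx'
  have hx'0 : x' = 0 := by
    refine eq_zero_of_vecMul hg hgg fun b => ?_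
    rcases le_or_gt b i with hb | hb
    · refine Or.inr fun a ha => hpos a b ?_ hb
      by_contra hia
      exact ha (dif_neg hia)
    · left
      have := congrFun hx ⟨b, hb⟩
      change ∑ a : {a // i ≤ a}, x a * g a b = 0 at this
      rw [← this]
      change ∑ a, x' a * g a b = _
      have h1 : ∑ a, x' a * g a b = ∑ a ∈ Finset.univ.filter fun a => i ≤ a, x' a * g a b := by
        rw [Finset.sum_filter]
        refine Finset.sum_congr rfl fun a _ => ?_
        by_cases ha : i ≤ a
        · rw [if_pos ha]
        · rw [if_neg ha, hx']
          simp [ha]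
      rw [h1, Finset.sum_subtype _ (p := fun a => i ≤ a) (by simp)]
      refine Finset.sum_congr rfl fun a _ => ?_
      rw [hx']
      simp [a.2]
  funext a
  have := congrFun hx'0 a.1
  simpa [hx', a.2] using this

/-- Diagonal matrices in the same double coset have the same exponents, if these are put in
increasing order. -/
lemma exps_eq_of_double_coset {Γ : Subgroup (Matrix (Fin d) (Fin d) K)ˣ} {P : Fin d → Prop}
    {D T g g' : (Matrix (Fin d) (Fin d) K)ˣ} (hg : g ∈ intGroup v Γ P) (hg' : g' ∈ intGroup v Γ P)
    (heq : D = g * T * g')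
    (hD : ∀ i j, i ≠ j → (D : Matrix (Fin d) (Fin d) K) i j = 0)
    (hT : ∀ i j, i ≠ j → (T : Matrix (Fin d) (Fin d) K) i j = 0) (τ τ' : Equiv.Perm (Fin d))
    (hDm : ∀ i j, i ≤ j → exps v (D : Matrix (Fin d) (Fin d) K) (τ i) ≤
      exps v (D : Matrix (Fin d) (Fin d) K) (τ j))
    (hTm : ∀ i j, i ≤ j → exps v (T : Matrix (Fin d) (Fin d) K) (τ' i) ≤
      exps v (T : Matrix (Fin d) (Fin d) K) (τ' j)) (i : Fin d) :
    exps v (D : Matrix (Fin d) (Fin d) K) (τ i) = exps v (T : Matrix (Fin d) (Fin d) K) (τ' i) := by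
  have hD0 := lowerGroup_diag_ne (IsLower.of_diag hD : D ∈ lowerGroup K d)
  have hT0 := lowerGroup_diag_ne (IsLower.of_diag hT : T ∈ lowerGroup K d)
  have e1 : D * g'⁻¹ = g * T := by rw [heq, mul_inv_cancel_right]
  have e2 : T * g' = g⁻¹ * D := by rw [heq]; group
  have e1' := congrArg (fun M : (Matrix (Fin d) (Fin d) K)ˣ => (M : Matrix (Fin d) (Fin d) K)) e1
  have e2' := congrArg (fun M : (Matrix (Fin d) (Fin d) K)ˣ => (M : Matrix (Fin d) (Fin d) K)) e2
  simp only [Units.val_mul] at e1' e2'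
  have hDτ : ∀ i j, i ≠ j → ((D : Matrix (Fin d) (Fin d) K).submatrix τ τ) i j = 0 :=
    fun i j hij => hD _ _ fun h => hij (τ.injective h)
  have hTτ : ∀ i j, i ≠ j → ((T : Matrix (Fin d) (Fin d) K).submatrix τ' τ') i j = 0 :=
    fun i j hij => hT _ _ fun h => hij (τ'.injective h)
  have hmul : ∀ (A B : Matrix (Fin d) (Fin d) K) (ρ₁ ρ₂ ρ₃ : Equiv.Perm (Fin d)),
      A.submatrix ρ₁ ρ₂ * B.submatrix ρ₂ ρ₃ = (A * B).submatrix ρ₁ ρ₃ := fun A B ρ₁ ρ₂ ρ₃ =>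
    (Matrix.submatrix_mul _ _ _ _ _ ρ₂.bijective).symm
  refine le_antisymm ?_ ?_
  · refine exps_le_of_mul_eq (D := (D : Matrix (Fin d) (Fin d) K).submatrix τ τ)
      (T := (T : Matrix (Fin d) (Fin d) K).submatrix τ' τ')
      (g := (g : Matrix (Fin d) (Fin d) K).submatrix τ τ')
      (g' := ((g⁻¹ : (Matrix (Fin d) (Fin d) K)ˣ) : Matrix (Fin d) (Fin d) K).submatrix τ' τ)
      (h := ((g'⁻¹ : (Matrix (Fin d) (Fin d) K)ˣ) : Matrix (Fin d) (Fin d) K).submatrix τ τ')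
      hDτ hTτ (fun i => hD0 _) (fun i => hT0 _) (fun i j => hg.2.1.2 _ _) ?_
      (fun i j => hg'.2.1.2 _ _) ?_ hDm hTm i
    · rw [hmul, Units.mul_inv]
      exact Matrix.submatrix_one_equiv τ
    · rw [hmul, hmul, e1']
  · refine exps_le_of_mul_eq (T := (D : Matrix (Fin d) (Fin d) K).submatrix τ τ)
      (D := (T : Matrix (Fin d) (Fin d) K).submatrix τ' τ')
      (g := ((g⁻¹ : (Matrix (Fin d) (Fin d) K)ˣ) : Matrix (Fin d) (Fin d) K).submatrix τ' τ)
      (g' := (g : Matrix (Fin d) (Fin d) K).submatrix τ τ')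
      (h := (g' : Matrix (Fin d) (Fin d) K).submatrix τ' τ)
      hTτ hDτ (fun i => hT0 _) (fun i => hD0 _) (fun i j => hg.2.1.1 _ _) ?_
      (fun i j => hg'.2.1.1 _ _) ?_ hTm hDm i
    · rw [hmul, Units.inv_mul]
      exact Matrix.submatrix_one_equiv τ'
    · rw [hmul, hmul, e2']

end exchange

section parity

variable {K : Type*} [Field K] [StarRing K] {N : ℕ} {σ : Signs K (N + N)}

/-- A similitude of a symmetric form with invertible lower right block is proper, since the Schur
complement of this block is, up to the similitude factor, dual to the block. -/
lemma Signs.det_of_block (hst : ∀ x : K, star x = x)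
    {M : Matrix (Fin (N + N)) (Fin (N + N)) K} {m : K} (hM : Mᴴ * σ.J * M = m • σ.J)
    (hblock : (M.submatrix (Fin.natAdd N) (Fin.natAdd N)).det ≠ 0) : M.det = m ^ N := by
  have htr : ∀ {k l : Type} (X : Matrix k l K), Xᴴ = Xᵀ := fun X => by
    ext i j; exact hst _
  set e : Fin N ⊕ Fin N ≃ Fin (N + N) := finSumFinEquiv with he
  set A := M.submatrix (Fin.castAdd N) (Fin.castAdd N)
  set B := M.submatrix (Fin.castAdd N) (Fin.natAdd N)
  set C := M.submatrix (Fin.natAdd N) (Fin.castAdd N)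
  set D := M.submatrix (Fin.natAdd N) (Fin.natAdd N)
  set W := σ.J.submatrix (Fin.castAdd N) (Fin.natAdd N) with hW
  set W' := σ.J.submatrix (Fin.natAdd N) (Fin.castAdd N) with hW'
  have hMe : M.submatrix e e = Matrix.fromBlocks A B C D := by
    ext (i | i) (j | j) <;> rfl
  have hJe : σ.J.submatrix e e = Matrix.fromBlocks 0 W W' 0 := by
    ext (i | i) (j | j)
    · change σ.J (Fin.castAdd N i) (Fin.castAdd N j) = 0
      rw [J, if_neg]
      simp only [Fin.ext_iff, Fin.val_rev, Fin.val_castAdd]; omega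
    · rfl
    · rfl
    · change σ.J (Fin.natAdd N i) (Fin.natAdd N j) = 0
      rw [J, if_neg]
      simp only [Fin.ext_iff, Fin.val_rev, Fin.val_natAdd]; omega
  have hsq := σ.J_mul_J
  have h1 : (M.submatrix e e)ᵀ * σ.J.submatrix e e * M.submatrix e e = m • σ.J.submatrix e e := by
    rw [htr] at hM
    rw [Matrix.transpose_submatrix, Matrix.submatrix_mul_equiv, Matrix.submatrix_mul_equiv, hM]
    rfl
  have h2 : σ.J.submatrix e e * σ.J.submatrix e e = σ.ε • 1 := by
    rw [Matrix.submatrix_mul_equiv, hsq, Matrix.submatrix_smul, Pi.smul_apply, Pi.smul_apply,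
      Matrix.submatrix_one_equiv]
  rw [hMe, hJe, Matrix.fromBlocks_transpose, Matrix.fromBlocks_multiply,
    Matrix.fromBlocks_multiply, Matrix.fromBlocks_smul, Matrix.fromBlocks_inj] at h1
  rw [hJe, Matrix.fromBlocks_multiply, ← Matrix.fromBlocks_one, Matrix.fromBlocks_smul,
    Matrix.fromBlocks_inj] at h2
  obtain ⟨-, h12, -, h22⟩ := h1
  simp only [mul_zero, zero_add, add_zero] at h12 h22 h2
  have hWdet : W.det ≠ 0 := by
    intro h0
    have := congrArg Matrix.det h2.1
    rw [Matrix.det_mul, h0, zero_mul, Matrix.det_smul, Matrix.det_one, mul_one] at this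
    have hε : σ.ε ≠ 0 := fun h => by simpa [h] using σ.ε_mul_ε
    exact pow_ne_zero _ hε this.symm
  have hD : IsUnit D.det := isUnit_iff_ne_zero.2 hblock
  let _ := D.invertibleOfIsUnitDet hD
  have hdet : M.det = D.det * (A - B * ⅟D * C).det := by
    rw [← Matrix.det_submatrix_equiv_self e M, hMe, Matrix.det_fromBlocks₂₂]
  have hS : (A - B * ⅟D * C)ᵀ * W * D = m • W := by
    rw [← h12, Matrix.transpose_sub, Matrix.transpose_mul, Matrix.transpose_mul, Matrix.sub_mul,
      Matrix.sub_mul]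
    have h3 : Bᵀ * W * D = -(Dᵀ * W' * B) := by
      rw [eq_neg_iff_add_eq_zero, add_comm, h22, smul_zero]
    have h4 : Cᵀ * ((⅟D)ᵀ * Bᵀ) * W * D = -(Cᵀ * W' * B) := by
      calc _ = Cᵀ * (⅟D)ᵀ * (Bᵀ * W * D) := by simp only [Matrix.mul_assoc]
        _ = -(Cᵀ * ((D * ⅟D)ᵀ * W' * B)) := by
          rw [h3, Matrix.transpose_mul]; simp only [Matrix.mul_assoc, Matrix.mul_neg]
        _ = _ := by rw [mul_invOf_self, Matrix.transpose_one]; simp only [Matrix.mul_assoc, Matrix.one_mul]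
    rw [h4, sub_neg_eq_add, add_comm]
  have hS' := congrArg Matrix.det hS
  rw [Matrix.det_mul, Matrix.det_mul, Matrix.det_transpose, Matrix.det_smul, Fintype.card_fin] at hS'
  rw [hdet]
  refine mul_right_cancel₀ hWdet ?_
  rw [← hS']; ring

/-- Swapping the exponents of the two central entries changes the proper double coset of a diagonal
matrix with exponents `0, …, 0, 1, …, 1`: the swap is improper, but a similitude connecting the
two would have an integrally invertible lower right block. -/
lemma Signs.not_double_coset_swap [CharZero K] {v : AddValuation K (WithTop ℤ)} (hN : 0 < N)
    (hst : ∀ x : K, star x = x) (hε : σ.ε = 1) {P : Fin (N + N) → Prop}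
    {D T g g' : (Matrix (Fin (N + N)) (Fin (N + N)) K)ˣ} (hg : g ∈ intGroup v σ.properGroup P)
    (hg' : g' ∈ intGroup v σ.properGroup P) (heq : D = g * T * g')
    (hD : ∀ i j, i ≠ j → (D : Matrix (Fin (N + N)) (Fin (N + N)) K) i j = 0)
    (hT : ∀ i j, i ≠ j → (T : Matrix (Fin (N + N)) (Fin (N + N)) K) i j = 0) {p : Fin (N + N)}
    (hDe : ∀ i : Fin (N + N), exps v (D : Matrix (Fin (N + N)) (Fin (N + N)) K) i =
      if (i : ℕ) < N then 0 else 1)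
    (hTe : ∀ i, exps v (T : Matrix (Fin (N + N)) (Fin (N + N)) K) (Equiv.swap p p.rev i) =
      exps v (D : Matrix (Fin (N + N)) (Fin (N + N)) K) i) : False := by
  have hD0 := lowerGroup_diag_ne (IsLower.of_diag hD : D ∈ lowerGroup K (N + N))
  have hT0 := lowerGroup_diag_ne (IsLower.of_diag hT : T ∈ lowerGroup K (N + N))
  obtain ⟨m, hm0, hm, hdet⟩ := hg.1
  set τ := Equiv.swap p p.rev with hτ
  have e1 : D * g'⁻¹ = g * T := by rw [heq, mul_inv_cancel_right]
  have e1' := congrArg (fun M : (Matrix (Fin (N + N)) (Fin (N + N)) K)ˣ =>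
    (M : Matrix (Fin (N + N)) (Fin (N + N)) K)) e1
  simp only [Units.val_mul] at e1'
  have hpos : ∀ a b : Fin (N + N), N ≤ (a : ℕ) → (b : ℕ) < N →
      1 ≤ v ((g : Matrix (Fin (N + N)) (Fin (N + N)) K) a (τ b)) := by
    intro a b ha hb
    by_cases h0 : (g : Matrix (Fin (N + N)) (Fin (N + N)) K) a (τ b) = 0
    · rw [h0]; simp
    · have h1 := congrFun (congrFun e1' a) (τ b)
      rw [Matrix.mul_apply, Matrix.mul_apply,
        Finset.sum_eq_single a (fun k _ hk => by rw [hD a k (Ne.symm hk), zero_mul]) (by simp),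
        Finset.sum_eq_single (τ b) (fun k _ hk => by rw [hT k _ hk, mul_zero]) (by simp)] at h1
      have h2 : ((g'⁻¹ : (Matrix (Fin (N + N)) (Fin (N + N)) K)ˣ) :
          Matrix (Fin (N + N)) (Fin (N + N)) K) a (τ b) ≠ 0 := by
        intro h2
        rw [h2, mul_zero, eq_comm] at h1
        exact (mul_ne_zero h0 (hT0 _)) h1
      have h3 := congrArg (ev v) h1
      rw [ev_mul v (hD0 a) h2, ev_mul v h0 (hT0 _)] at h3
      have h4 := (le_v_iff v h2 0).1 (hg'.2.1.2 a (τ b))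
      have h5 := hDe a
      have h6 := hTe b
      rw [hDe b, if_pos hb, exps_apply] at h6
      rw [if_neg (not_lt.2 ha), exps_apply] at h5
      exact (le_v_iff v h0 1).2 (by omega)
  have hsim : ((g : Matrix (Fin (N + N)) (Fin (N + N)) K).submatrix id τ)ᴴ * σ.J *
      (g : Matrix (Fin (N + N)) (Fin (N + N)) K).submatrix id τ = m • σ.J := by
    have h1 := congrArg (fun M : Matrix (Fin (N + N)) (Fin (N + N)) K => M.submatrix τ τ) hm
    rw [Matrix.submatrix_smul, Pi.smul_apply, Pi.smul_apply, σ.J_submatrix_swap hε p] at h1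
    rw [← h1, Matrix.conjTranspose_submatrix, ← Matrix.submatrix_id_id σ.J,
      ← Matrix.submatrix_mul _ _ _ _ _ Function.bijective_id,
      ← Matrix.submatrix_mul _ _ _ _ _ Function.bijective_id, Matrix.submatrix_id_id]
  have hinv : (g : Matrix (Fin (N + N)) (Fin (N + N)) K).submatrix id τ *
      ((g⁻¹ : (Matrix (Fin (N + N)) (Fin (N + N)) K)ˣ) :
        Matrix (Fin (N + N)) (Fin (N + N)) K).submatrix τ id = 1 := by
    rw [← Matrix.submatrix_mul _ _ _ _ _ τ.bijective, Units.mul_inv, Matrix.submatrix_id_id]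
  have hblock : (((g : Matrix (Fin (N + N)) (Fin (N + N)) K).submatrix id τ).submatrix
      (Fin.natAdd N) (Fin.natAdd N)).det ≠ 0 := by
    intro h0
    obtain ⟨x, hx0, hx⟩ := Matrix.exists_vecMul_eq_zero_iff.2 h0
    apply hx0
    have hx' : (Fin.addCases (fun _ => 0) x : Fin (N + N) → K) = 0 := by
      refine eq_zero_of_vecMul (v := v) (fun i j => hg.2.1.2 _ _) hinv fun b => ?_
      refine Fin.addCases (fun b => ?_) (fun b => ?_) b
      · refine Or.inr fun a ha => hpos a _ ?_ (by simp)
        by_contra h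
        apply ha
        have : a = Fin.castAdd N ⟨a, by omega⟩ := rfl
        rw [this, Fin.addCases_left]
      · left
        refine Eq.trans ?_ (congrFun hx b)
        rw [Matrix.vecMul, dotProduct, Fin.sum_univ_add]
        simp only [Fin.addCases_left, Fin.addCases_right, zero_mul, Finset.sum_const_zero, zero_add]
        rfl
    funext i
    have := congrFun hx' (Fin.natAdd N i)
    rwa [Fin.addCases_right] at this
  have h1 := Signs.det_of_block hst hsim hblock
  have hpp : p ≠ p.rev := (σ.rev_ne p).symm
  rw [Matrix.det_permute', Equiv.Perm.sign_swap hpp, hdet] at h1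
  have h2 : 2 * m ^ N = 0 := by
    have h5 : -m ^ N = m ^ N := by simpa using h1
    linear_combination -h5
  exact hm0 (pow_eq_zero_iff hN.ne' |>.1 ((mul_eq_zero.1 h2).resolve_left two_ne_zero))

end parity

end LocalHecke

/-! ### The valuation of an order with a prime element -/

namespace LocalHecke

section denominators

variable {𝔬 : Type*} [CommRing 𝔬] [IsDomain 𝔬] {F : Type*} [Field F] [Algebra 𝔬 F]
  [IsFractionRing 𝔬 F] {A : Type*} [Ring A] [Algebra F A] [Algebra 𝔬 A] [IsScalarTower 𝔬 F A]
  {Λ : Subalgebra 𝔬 A}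

lemma exists_smul_mem_of_span (hspan : Submodule.span F (Λ : Set A) = ⊤) (x : A) :
    ∃ c : 𝔬, c ≠ 0 ∧ c • x ∈ Λ := by
  have hx : x ∈ Submodule.span F (Λ : Set A) := by rw [hspan]; trivial
  induction hx using Submodule.span_induction with
  | mem x hx => exact ⟨1, one_ne_zero, by simpa using hx⟩
  | zero => exact ⟨1, one_ne_zero, by simp⟩
  | add x y _ _ hx hy =>
    obtain ⟨c, hc, hx⟩ := hx
    obtain ⟨c', hc', hy⟩ := hy
    refine ⟨c * c', mul_ne_zero hc hc', ?_⟩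
    rw [smul_add]
    refine add_mem ?_ ?_
    · rw [mul_comm, mul_smul]; exact Subalgebra.smul_mem _ hx _
    · rw [mul_smul]; exact Subalgebra.smul_mem _ hy _
  | smul r x _ hx =>
    obtain ⟨c, hc, hx⟩ := hx
    obtain ⟨a, b, hb, rfl⟩ := IsFractionRing.div_surjective (A := 𝔬) r
    have hb0 : b ≠ 0 := nonZeroDivisors.ne_zero hb
    have hb0' : algebraMap 𝔬 F b ≠ 0 := fun h0 =>
      hb0 (IsFractionRing.injective 𝔬 F (h0.trans (map_zero _).symm))
    refine ⟨b * c, mul_ne_zero hb0 hc, ?_⟩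
    have : (b * c) • ((algebraMap 𝔬 F a / algebraMap 𝔬 F b) • x) = a • (c • x) := by
      rw [← algebraMap_smul F (b * c), smul_smul, map_mul, ← algebraMap_smul F a,
        ← algebraMap_smul F c, smul_smul]
      congr 1
      field_simp
    rw [this]
    exact Subalgebra.smul_mem _ hx _

end denominators

section valuation

variable {𝔬 : Type*} [CommRing 𝔬] [IsDomain 𝔬] [IsDiscreteValuationRing 𝔬]
variable {F : Type*} [Field F] [Algebra 𝔬 F] [IsFractionRing 𝔬 F]
variable {K : Type*} [DivisionRing K] [Algebra F K] [Algebra 𝔬 K] [IsScalarTower 𝔬 F K]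

/-- An order in a division algebra, together with a prime element. -/
structure IsPrimeOrder (F : Type*) [Field F] [Algebra F K] (O : Subalgebra 𝔬 K) (π : K) : Prop where
  fg : (Subalgebra.toSubmodule O).FG
  span : Submodule.span F (O : Set K) = ⊤
  prime : IsPrimeElement O π

variable (𝔬 K) in
lemma algebraMap_injective_of_tower (F : Type*) [Field F] [Algebra 𝔬 F] [IsFractionRing 𝔬 F]
    [Algebra F K] [IsScalarTower 𝔬 F K] : Function.Injective (algebraMap 𝔬 K) := by
  rw [IsScalarTower.algebraMap_eq 𝔬 F K]
  exact (algebraMap F K).injective.comp (IsFractionRing.injective 𝔬 F)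

variable {O : Subalgebra 𝔬 K} {π : K}

/-- The powers of `z⁻¹` cannot have a common denominator in an order unless `z⁻¹` is a polynomial
in `z`, since the submodules they generate stabilize. -/
lemma inv_mem_adjoin_of_fg (hfg : (Subalgebra.toSubmodule O).FG) {z x : K} (hz : z ≠ 0)
    (hx : x ≠ 0) (h : ∀ k : ℕ, (z⁻¹) ^ k * x ∈ O) : z⁻¹ ∈ Algebra.adjoin 𝔬 {z} := by
  have hN : IsNoetherian 𝔬 (Subalgebra.toSubmodule O) := isNoetherian_of_fg_of_noetherian _ hfg
  let y : ℕ → K := fun k => (z⁻¹) ^ k * x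
  obtain ⟨n, hn⟩ := monotone_stabilizes_iff_noetherian.2 hN
    ⟨fun k => (Submodule.span 𝔬 (y '' Set.Iio k)).comap (Subalgebra.toSubmodule O).subtype,
      fun k l hkl => Submodule.comap_mono
        (Submodule.span_mono (Set.image_mono (Set.Iio_subset_Iio hkl)))⟩
  have h1 : y n ∈ Submodule.span 𝔬 (y '' Set.Iio n) := by
    have h2 : (⟨y n, h n⟩ : Subalgebra.toSubmodule O) ∈
        (Submodule.span 𝔬 (y '' Set.Iio (n + 1))).comap (Subalgebra.toSubmodule O).subtype :=
      Submodule.subset_span ⟨n, Nat.lt_succ_self n, rfl⟩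
    have h3 : (Submodule.span 𝔬 (y '' Set.Iio n)).comap (Subalgebra.toSubmodule O).subtype =
        (Submodule.span 𝔬 (y '' Set.Iio (n + 1))).comap (Subalgebra.toSubmodule O).subtype :=
      hn (n + 1) (Nat.le_succ n)
    rw [← h3] at h2
    exact h2
  have key : Submodule.span 𝔬 (y '' Set.Iio n) ≤
      (Subalgebra.toSubmodule (Algebra.adjoin 𝔬 {z})).comap
        (LinearMap.mulLeft 𝔬 (z ^ n * z⁻¹) ∘ₗ LinearMap.mulRight 𝔬 x⁻¹) := by
    rw [Submodule.span_le]
    rintro _ ⟨k, hk, rfl⟩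
    have hk' : k < n := hk
    obtain ⟨j, rfl⟩ := Nat.exists_eq_add_of_lt hk'
    change z ^ (k + j + 1) * z⁻¹ * ((z⁻¹) ^ k * x * x⁻¹) ∈ Algebra.adjoin 𝔬 {z}
    have : z ^ (k + j + 1) * z⁻¹ * ((z⁻¹) ^ k * x * x⁻¹) = z ^ j := by
      rw [pow_succ, mul_inv_cancel_right₀ hz, mul_inv_cancel_right₀ hx, inv_pow,
        add_comm, pow_add, mul_inv_cancel_right₀ (pow_ne_zero _ hz)]
    rw [this]
    exact pow_mem (Algebra.subset_adjoin (Set.mem_singleton z)) j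
  have h2 : z ^ n * z⁻¹ * ((z⁻¹) ^ n * x * x⁻¹) ∈ Algebra.adjoin 𝔬 {z} := key h1
  rwa [mul_inv_cancel_right₀ hx, mul_assoc, ← pow_succ', pow_succ, inv_pow,
    mul_inv_cancel_left₀ (pow_ne_zero _ hz)] at h2

namespace IsPrimeOrder

variable (h : IsPrimeOrder F O π)
include h

lemma uniformizer_inv_notMem {ϖ : 𝔬} (hϖ : Irreducible ϖ) : (algebraMap 𝔬 K ϖ)⁻¹ ∉ O := by
  intro hmem
  have hinj := algebraMap_injective_of_tower 𝔬 K F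
  have h0 : algebraMap 𝔬 K ϖ ≠ 0 := fun h0 => hϖ.ne_zero (hinj (h0.trans (map_zero _).symm))
  have h1 := inv_mem_adjoin_of_fg h.fg h0 one_ne_zero fun k => by
    rw [mul_one]; exact pow_mem hmem k
  have h2 : Algebra.adjoin 𝔬 {algebraMap 𝔬 K ϖ} ≤ ⊥ :=
    Algebra.adjoin_le (Set.singleton_subset_iff.2 (algebraMap_mem _ ϖ))
  obtain ⟨b, hb⟩ := Algebra.mem_bot.1 (h2 h1)
  apply hϖ.not_isUnit
  refine IsUnit.of_mul_eq_one b (hinj ?_)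
  rw [map_mul, hb, mul_inv_cancel₀ h0, map_one]

lemma mem : π ∈ O := h.prime.1

lemma inv_mem_of_notMem_ideal {x : K} (hx : x ∈ O) (hx' : ¬ ∃ y ∈ O, x = π * y) : x⁻¹ ∈ O := by
  obtain ⟨y, hy, hxy⟩ := not_not.1 (mt (h.prime.2 x hx).1 hx')
  rwa [← eq_inv_of_mul_eq_one_right hxy]

lemma exists_of_inv_notMem {x : K} (hx : x ∈ O) (hx' : x⁻¹ ∉ O) : ∃ y ∈ O, x = π * y :=
  by_contra fun h' => hx' (h.inv_mem_of_notMem_ideal hx h')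

lemma ne_zero : π ≠ 0 := by
  rintro rfl
  obtain ⟨ϖ, hϖ⟩ := IsDiscreteValuationRing.exists_irreducible 𝔬
  obtain ⟨y, -, hy⟩ := h.exists_of_inv_notMem (O.algebraMap_mem ϖ) (h.uniformizer_inv_notMem hϖ)
  rw [zero_mul] at hy
  exact hϖ.ne_zero (algebraMap_injective_of_tower 𝔬 K F (hy.trans (map_zero _).symm))

lemma inv_notMem : π⁻¹ ∉ O := fun h' =>
  ((h.prime.2 π h.mem).2 ⟨1, one_mem _, (mul_one _).symm⟩) ⟨_, h', mul_inv_cancel₀ h.ne_zero⟩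

/-- Conjugation by the prime element preserves the order: the left multiples of `π` are non-units,
hence right multiples. -/
lemma conj_mem {x : K} (hx : x ∈ O) : π⁻¹ * x * π ∈ O := by
  by_cases hx0 : x = 0
  · simp [hx0]
  obtain ⟨y, hy, hxy⟩ := h.exists_of_inv_notMem (mul_mem hx h.mem) fun h' => h.inv_notMem (by
    have := mul_mem h' hx
    rwa [mul_inv_rev, inv_mul_cancel_right₀ hx0] at this)
  rwa [mul_assoc, hxy, inv_mul_cancel_left₀ h.ne_zero]

lemma conj_pow_mem (k : ℕ) {x : K} (hx : x ∈ O) : (π ^ k)⁻¹ * x * π ^ k ∈ O := by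
  induction k generalizing x with
  | zero => simpa
  | succ k ih =>
    have := h.conj_mem (ih hx)
    rwa [pow_succ, mul_inv_rev, ← mul_assoc, mul_assoc π⁻¹, mul_assoc π⁻¹]

/-- Every nonzero element of the order is a power of the prime element times a unit. -/
lemma exists_pow_mul {x : K} (hx : x ∈ O) (hx0 : x ≠ 0) :
    ∃ k : ℕ, ∃ u, (u ∈ O ∧ u⁻¹ ∈ O) ∧ x = π ^ k * u := by
  have hnot : ¬ ∀ k : ℕ, (π⁻¹) ^ k * x ∈ O := fun h' => h.inv_notMem
    ((Algebra.adjoin_le (S := O) (Set.singleton_subset_iff.2 h.mem))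
      (inv_mem_adjoin_of_fg h.fg h.ne_zero hx0 h'))
  classical
  push Not at hnot
  have h0 : Nat.find hnot ≠ 0 := fun h0 => by
    have := Nat.find_spec hnot
    rw [h0, pow_zero, one_mul] at this
    exact this hx
  obtain ⟨k, hk⟩ := Nat.exists_eq_succ_of_ne_zero h0
  have h1 : (π⁻¹) ^ k * x ∈ O := not_not.1 (Nat.find_min hnot (m := k) (by omega))
  have h2 := Nat.find_spec hnot
  rw [hk, Nat.succ_eq_add_one, pow_succ', mul_assoc] at h2
  refine ⟨k, _, ⟨h1, h.inv_mem_of_notMem_ideal h1 ?_⟩, ?_⟩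
  · rintro ⟨y, hy, hxy⟩
    rw [hxy, inv_mul_cancel_left₀ h.ne_zero] at h2
    exact h2 hy
  · rw [inv_pow, mul_inv_cancel_left₀ (pow_ne_zero _ h.ne_zero)]

/-- Together with `conj_mem`: conjugation by the prime element maps the order onto itself. -/
lemma conj_inv_mem {x : K} (hx : x ∈ O) : π * x * π⁻¹ ∈ O := by
  -- a uniformizer `ϖ = π ^ e * u` is central, so conjugation by `π ^ e` is conjugation by `u⁻¹`
  obtain ⟨ϖ, hϖ⟩ := IsDiscreteValuationRing.exists_irreducible 𝔬
  have hinj := algebraMap_injective_of_tower 𝔬 K F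
  have hϖ0 : algebraMap 𝔬 K ϖ ≠ 0 := fun h0 => hϖ.ne_zero (hinj (h0.trans (map_zero _).symm))
  obtain ⟨e, u, ⟨hu, hu'⟩, heu⟩ := h.exists_pow_mul (O.algebraMap_mem ϖ) hϖ0
  have hu0 : u ≠ 0 := by rintro rfl; exact hϖ0 (by rw [heu, mul_zero])
  obtain ⟨e, rfl⟩ : ∃ e', e = e' + 1 := Nat.exists_eq_succ_of_ne_zero (by
    rintro rfl
    rw [pow_zero, one_mul] at heu
    exact h.uniformizer_inv_notMem hϖ (heu ▸ hu'))
  have hπ := h.ne_zero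
  have h1 : ∀ x, algebraMap 𝔬 K ϖ * x = x * algebraMap 𝔬 K ϖ := fun x => Algebra.commutes ϖ x
  have h2 : ∀ y, π ^ (e + 1) * y * (π ^ (e + 1))⁻¹ = u⁻¹ * y * u := by
    intro y
    have hP : π ^ (e + 1) = algebraMap 𝔬 K ϖ * u⁻¹ := by
      rw [heu, mul_inv_cancel_right₀ hu0]
    rw [hP, mul_inv_rev, inv_inv, mul_assoc (algebraMap 𝔬 K ϖ), h1, mul_assoc,
      ← mul_assoc (algebraMap 𝔬 K ϖ), h1, mul_assoc u, mul_inv_cancel₀ hϖ0, mul_one]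
  have h3 := h.conj_pow_mem e (mul_mem (mul_mem hu' hx) hu)
  rw [← h2, pow_succ', mul_inv_rev] at h3
  have h4 : (π ^ e)⁻¹ * (π * π ^ e * x * ((π ^ e)⁻¹ * π⁻¹)) * π ^ e = π * x * π⁻¹ := by
    have hc : π * π ^ e = π ^ e * π := (pow_succ' π e).symm.trans (pow_succ π e)
    have hc' : (π ^ e)⁻¹ * π⁻¹ = π⁻¹ * (π ^ e)⁻¹ := by
      rw [← mul_inv_rev, ← mul_inv_rev, hc]
    rw [hc, hc']
    simp only [mul_assoc, inv_mul_cancel_left₀ (pow_ne_zero e hπ), inv_mul_cancel₀ (pow_ne_zero e hπ),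
      mul_one]
  rwa [h4] at h3

lemma conj_zpow_mem (k : ℤ) {x : K} (hx : x ∈ O) : (π ^ k)⁻¹ * x * π ^ k ∈ O := by
  have hneg : ∀ n : ℕ, π ^ n * x * (π ^ n)⁻¹ ∈ O := by
    intro n
    induction n with
    | zero => simpa
    | succ n ih =>
      have := h.conj_inv_mem ih
      rw [pow_succ', mul_inv_rev]
      simpa only [mul_assoc] using this
  obtain ⟨n, rfl | rfl⟩ := k.eq_nat_or_neg
  · rw [zpow_natCast]; exact h.conj_pow_mem n hx
  · rw [zpow_neg, zpow_natCast, inv_inv]; exact hneg n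

lemma zpow_mem_iff {k : ℤ} : π ^ k ∈ O ↔ 0 ≤ k := by
  constructor
  · intro hk
    by_contra hlt
    obtain ⟨n, hn⟩ : ∃ n : ℕ, k = -(n + 1) := ⟨(-k - 1).toNat, by omega⟩
    refine h.inv_notMem ?_
    have := mul_mem (pow_mem h.mem n) hk
    rwa [hn, ← zpow_natCast, ← zpow_add₀ h.ne_zero, show (n : ℤ) + -(n + 1) = -1 by ring,
      zpow_neg_one] at this
  · intro hk
    obtain ⟨n, rfl⟩ := Int.eq_ofNat_of_zero_le hk
    rw [zpow_natCast]; exact pow_mem h.mem n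

/-- Every nonzero element of the division algebra is a power of the prime element times a unit of
the order. -/
lemma exists_zpow_mul {x : K} (hx0 : x ≠ 0) :
    ∃ k : ℤ, ∃ u, (u ∈ O ∧ u⁻¹ ∈ O) ∧ x = π ^ k * u := by
  have hinj := algebraMap_injective_of_tower 𝔬 K F
  have hπ := h.ne_zero
  obtain ⟨c, hc, hcx⟩ := exists_smul_mem_of_span h.span x
  have hc0 : algebraMap 𝔬 K c ≠ 0 := fun h0 => hc (hinj (h0.trans (map_zero _).symm))
  rw [Algebra.smul_def] at hcx
  obtain ⟨k, u, ⟨hu, hu'⟩, hk⟩ := h.exists_pow_mul hcx (mul_ne_zero hc0 hx0)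
  obtain ⟨l, w, ⟨hw, hw'⟩, hl⟩ := h.exists_pow_mul (O.algebraMap_mem c) hc0
  have hw0 : w ≠ 0 := by rintro rfl; exact hc0 (by rw [hl, mul_zero])
  have hx : x = π ^ ((k : ℤ) - l) * ((π ^ ((k : ℤ) - l))⁻¹ * w⁻¹ * π ^ ((k : ℤ) - l)) * u := by
    rw [mul_assoc _ w⁻¹, mul_inv_cancel_left₀ (zpow_ne_zero _ hπ)]
    have hx : x = (algebraMap 𝔬 K c)⁻¹ * (π ^ k * u) := by
      rw [← hk, inv_mul_cancel_left₀ hc0]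
    conv_lhs => rw [hx, hl, mul_inv_rev]
    rw [sub_eq_neg_add, zpow_add₀ hπ, zpow_neg, zpow_natCast, zpow_natCast]
    simp only [mul_assoc]
  refine ⟨k - l, _, ⟨mul_mem (h.conj_zpow_mem ((k : ℤ) - l) hw') hu, ?_⟩,
    hx.trans (mul_assoc _ _ _)⟩
  rw [mul_inv_rev, mul_inv_rev, mul_inv_rev, inv_inv, inv_inv, ← mul_assoc _ w]
  exact mul_mem hu' (h.conj_zpow_mem _ hw)

lemma zpow_mul_mem_iff {k : ℤ} {u : K} (hu : u ∈ O) (hu' : u⁻¹ ∈ O) (hu0 : u ≠ 0) :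
    π ^ k * u ∈ O ↔ 0 ≤ k := by
  rw [← h.zpow_mem_iff]
  refine ⟨fun h' => ?_, fun h' => mul_mem h' hu⟩
  have := mul_mem h' hu'
  rwa [mul_inv_cancel_right₀ hu0] at this

lemma zpow_mul_unique {k l : ℤ} {u w : K} (hu : u ∈ O ∧ u⁻¹ ∈ O) (hw : w ∈ O ∧ w⁻¹ ∈ O)
    (hu0 : u ≠ 0) (hkl : π ^ k * u = π ^ l * w) : k = l := by
  have hπ := h.ne_zero
  have hw0 : w ≠ 0 := by
    rintro rfl
    rw [mul_zero] at hkl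
    exact mul_ne_zero (zpow_ne_zero _ hπ) hu0 hkl
  have key : ∀ k l : ℤ, ∀ u w : K, u ∈ O ∧ u⁻¹ ∈ O → w ∈ O → u ≠ 0 → π ^ k * u = π ^ l * w →
      l ≤ k := by
    intro k l u w hu hw hu0 hkl
    have h1 : π ^ (k - l) * u = w := by
      rw [sub_eq_neg_add, zpow_add₀ hπ, mul_assoc, hkl, zpow_neg,
        inv_mul_cancel_left₀ (zpow_ne_zero _ hπ)]
    have := (h.zpow_mul_mem_iff hu.1 hu.2 hu0 (k := k - l)).1 (h1 ▸ hw)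
    omega
  exact le_antisymm (key l k w u hw hu.1 hw0 hkl.symm) (key k l u w hu hw.1 hu0 hkl)

/-- The valuation of a division algebra whose valuation ring is an order with prime element. -/
lemma exists_valuation : ∃ v : AddValuation K (WithTop ℤ), (∀ x, 0 ≤ v x ↔ x ∈ O) ∧ v π = 1 := by
  classical
  have hπ := h.ne_zero
  choose! k u hu hk using fun (x : K) (hx : x ≠ 0) => h.exists_zpow_mul hx
  have hu0 : ∀ x, x ≠ 0 → u x ≠ 0 := fun x hx h0 => hx (by
    have := hk x hx
    rwa [h0, mul_zero] at this)
  have hk' : ∀ (x w : K) (l : ℤ), w ∈ O ∧ w⁻¹ ∈ O → x ≠ 0 → x = π ^ l * w → k x = l :=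
    fun x w l hw hx hxl => h.zpow_mul_unique (hu x hx) hw (hu0 x hx) ((hk x hx).symm.trans hxl)
  have hmul : ∀ x y : K, x ≠ 0 → y ≠ 0 → k (x * y) = k x + k y := by
    intro x y hx hy
    refine hk' _ (((π ^ k y)⁻¹ * u x * π ^ k y) * u y) _
      ⟨mul_mem (h.conj_zpow_mem _ (hu x hx).1) (hu y hy).1, ?_⟩ (mul_ne_zero hx hy) ?_
    · rw [mul_inv_rev, mul_inv_rev, mul_inv_rev, inv_inv, ← mul_assoc _ (u x)⁻¹]
      exact mul_mem (hu y hy).2 (h.conj_zpow_mem _ (hu x hx).2)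
    · conv_lhs => rw [hk x hx, hk y hy]
      rw [zpow_add₀ hπ]
      simp only [mul_assoc, mul_inv_cancel_left₀ (zpow_ne_zero (k y) hπ)]
  have hmem : ∀ x, x ≠ 0 → (x ∈ O ↔ 0 ≤ k x) := fun x hx => by
    rw [← h.zpow_mul_mem_iff (hu x hx).1 (hu x hx).2 (hu0 x hx), ← hk x hx]
  have hadd : ∀ x y : K, x ≠ 0 → y ≠ 0 → x + y ≠ 0 → k x ≤ k y → k x ≤ k (x + y) := by
    intro x y hx hy hxy hle
    have h1 : x * (1 + x⁻¹ * y) = x + y := by rw [mul_add, mul_one, mul_inv_cancel_left₀ hx]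
    have h2 : 1 + x⁻¹ * y ≠ 0 := by
      intro h2
      rw [h2, mul_zero] at h1
      exact hxy h1.symm
    have h3 := hmul x (x⁻¹ * y) hx (mul_ne_zero (inv_ne_zero hx) hy)
    rw [mul_inv_cancel_left₀ hx] at h3
    have h4 : x⁻¹ * y ∈ O := (hmem _ (mul_ne_zero (inv_ne_zero hx) hy)).2 (by omega)
    have h5 := (hmem _ h2).1 (add_mem (one_mem O) h4)
    rw [← h1, hmul x _ hx h2]
    omega
  have hone : k 1 = 0 := hk' 1 1 0 (by rw [inv_one]; exact ⟨one_mem _, one_mem _⟩) one_ne_zero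
    (by simp)
  refine ⟨AddValuation.of (fun x => if x = 0 then ⊤ else (k x : WithTop ℤ)) (if_pos rfl)
    ((if_neg one_ne_zero).trans (by rw [hone]; rfl)) (fun x y => ?_) (fun x y => ?_),
    fun x => ?_, ?_⟩
  · by_cases hx : x = 0
    · simp [hx]
    by_cases hy : y = 0
    · simp [hy]
    by_cases hxy : x + y = 0
    · simp [hxy]
    simp only [if_neg hx, if_neg hy, if_neg hxy]
    rw [← WithTop.coe_min, WithTop.coe_le_coe]
    rcases le_total (k x) (k y) with hle | hle
    · exact (min_le_left _ _).trans (hadd x y hx hy hxy hle)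
    · refine (min_le_right _ _).trans ?_
      rw [add_comm]
      exact hadd y x hy hx (by rwa [add_comm]) hle
  · by_cases hx : x = 0
    · simp [hx]
    by_cases hy : y = 0
    · simp [hy]
    simp only [if_neg hx, if_neg hy, if_neg (mul_ne_zero hx hy)]
    rw [hmul x y hx hy, WithTop.coe_add]
  · rw [AddValuation.of_apply]
    by_cases hx : x = 0
    · simp [hx]
    · rw [if_neg hx, hmem x hx]
      exact WithTop.coe_le_coe (b := (0 : ℤ)) (a := k x)
  · rw [AddValuation.of_apply, if_neg hπ,
      hk' π 1 1 (by rw [inv_one]; exact ⟨one_mem _, one_mem _⟩) hπ (by simp)]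
    rfl

lemma isIntegral_of_mem {x : K} (hx : x ∈ O) : IsIntegral 𝔬 x :=
  IsIntegral.of_mem_of_fg O h.fg x hx

/-- The order is integrally closed. -/
lemma mem_iff_isIntegral {v : AddValuation K (WithTop ℤ)} (hv : ∀ x, 0 ≤ v x ↔ x ∈ O) {x : K} :
    x ∈ O ↔ IsIntegral 𝔬 x := by
  refine ⟨h.isIntegral_of_mem, ?_⟩
  rintro ⟨p, hp, hpx⟩
  by_contra hx
  have hx0 : x ≠ 0 := by rintro rfl; exact hx (zero_mem _)
  have hlt : ev v x < 0 := by
    rw [← hv] at hx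
    by_contra h0
    exact hx ((le_v_iff v hx0 0).2 (by omega))
  rw [← Polynomial.aeval_def, Polynomial.aeval_eq_sum_range, Finset.sum_range_succ,
    hp.coeff_natDegree, one_smul, add_eq_zero_iff_eq_neg'] at hpx
  have h1 : ((p.natDegree * ev v x : ℤ) : WithTop ℤ) = v (x ^ p.natDegree) := by
    rw [← ev_pow v hx0, coe_ev v (pow_ne_zero _ hx0)]
  have h2 : ((p.natDegree * ev v x + 1 : ℤ) : WithTop ℤ) ≤ v (x ^ p.natDegree) := by
    rw [hpx, AddValuation.map_neg]
    refine v.map_le_sum fun i hi => ?_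
    rw [Finset.mem_range] at hi
    rw [Algebra.smul_def]
    refine le_trans ?_ (le_v_mul_left v ((hv _).2 (O.algebraMap_mem _)))
    rw [← coe_ev v (pow_ne_zero _ hx0), WithTop.coe_le_coe, ev_pow v hx0]
    have : (i : ℤ) + 1 ≤ p.natDegree := by exact_mod_cast hi
    nlinarith
  rw [← h1, WithTop.coe_le_coe] at h2
  omega

lemma algebraMap_mem_iff (a : F) : algebraMap F K a ∈ O ↔ a ∈ (algebraMap 𝔬 F).range := by
  constructor
  · intro ha
    have h1 := h.isIntegral_of_mem ha
    rw [isIntegral_algebraMap_iff (algebraMap F K).injective] at h1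
    exact IsIntegrallyClosed.isIntegral_iff.1 h1
  · rintro ⟨b, rfl⟩
    rw [← IsScalarTower.algebraMap_apply]
    exact O.algebraMap_mem b

end IsPrimeOrder

section star

variable [StarRing K] {v : AddValuation K (WithTop ℤ)}

/-- An involution that fixes the base field preserves integrality, hence the order. -/
lemma IsPrimeOrder.star_mem (h : IsPrimeOrder F O π) (hv : ∀ x, 0 ≤ v x ↔ x ∈ O)
    (hs : ∀ a : F, star (algebraMap F K a) = algebraMap F K a) {x : K} (hx : x ∈ O) :
    star x ∈ O := by
  rw [h.mem_iff_isIntegral hv] at hx ⊢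
  obtain ⟨p, hp, hpx⟩ := hx
  refine ⟨p, hp, ?_⟩
  rw [← Polynomial.aeval_def, Polynomial.aeval_eq_sum_range] at hpx ⊢
  have h1 := congrArg star hpx
  rw [star_sum, star_zero] at h1
  rw [← h1]
  refine Finset.sum_congr rfl fun i _ => ?_
  rw [Algebra.smul_def, Algebra.smul_def, star_mul, star_pow, IsScalarTower.algebraMap_apply 𝔬 F K,
    hs]
  exact Algebra.commutes _ _

/-- An involution that is trivial on the base field preserves the valuation. -/
lemma IsPrimeOrder.v_star (h : IsPrimeOrder F O π) (hv : ∀ x, 0 ≤ v x ↔ x ∈ O) (hvπ : v π = 1)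
    (hs : ∀ a : F, star (algebraMap F K a) = algebraMap F K a) (x : K) : v (star x) = v x := by
  have hmem : ∀ x, star x ∈ O ↔ x ∈ O := fun x =>
    ⟨fun h' => by simpa using h.star_mem hv hs h', h.star_mem hv hs⟩
  have hle : ∀ x y, y ≠ 0 → v x ≤ v y → v (star x) ≤ v (star y) := by
    intro x y hy hxy
    by_cases hx : x = 0
    · rw [hx, AddValuation.map_zero, top_le_iff] at hxy
      exact absurd ((AddValuation.top_iff v).1 hxy) hy
    have h1 := (hv _).2 ((hmem _).2 ((hv _).1 (v_mul_inv_nonneg v hx hxy)))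
    have h2 : star y = star x * star (y * x⁻¹) := by
      rw [← star_mul, inv_mul_cancel_right₀ hx]
    rw [h2]
    exact le_v_mul_right v h1
  have heq : ∀ x y, x ≠ 0 → y ≠ 0 → v x = v y → v (star x) = v (star y) := fun x y hx hy hxy =>
    le_antisymm (hle x y hy hxy.le) (hle y x hx hxy.ge)
  by_cases hx : x = 0
  · simp [hx]
  have hπ := h.ne_zero
  have hevπ : ev v π = 1 := by rw [ev, hvπ]; rfl
  have hz : ∀ k : ℤ, ev v (π ^ k) = k := by
    intro k
    obtain ⟨n, rfl | rfl⟩ := k.eq_nat_or_neg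
    · rw [zpow_natCast, ev_pow v hπ, hevπ, mul_one]
    · rw [zpow_neg, zpow_natCast, ev_inv v (pow_ne_zero _ hπ), ev_pow v hπ, hevπ, mul_one]
  -- the value of `star π` is a positive integer whose square is `1`
  have hstar : ∀ x : K, x ≠ 0 → ev v (star x) = ev v x * ev v (star π) := by
    intro x hx
    have h1 : v x = v (π ^ ev v x) := by
      rw [← coe_ev v hx, ← coe_ev v (zpow_ne_zero _ hπ), hz]
    have h2 := heq _ _ hx (zpow_ne_zero _ hπ) h1
    rw [ev, h2, ← ev]
    obtain ⟨n, hn | hn⟩ := (ev v x).eq_nat_or_neg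
    · rw [hn, zpow_natCast, star_pow, ev_pow v (star_ne_zero.2 hπ)]
    · rw [hn, zpow_neg, zpow_natCast, star_inv₀, star_pow,
        ev_inv v (pow_ne_zero _ (star_ne_zero.2 hπ)), ev_pow v (star_ne_zero.2 hπ)]
      ring
  have h1 := hstar (star π) (star_ne_zero.2 hπ)
  rw [star_star, hevπ] at h1
  have h2 : 0 ≤ ev v (star π) := (le_v_iff v (star_ne_zero.2 hπ) 0).1 ((hv _).2 ((hmem _).2 h.mem))
  have h3 : ev v (star π) = 1 := by nlinarith
  rw [← coe_ev v hx, ← coe_ev v (star_ne_zero.2 hx), hstar x hx, h3, mul_one]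

end star

end valuation

end LocalHecke

/-! ### Commensurability -/

namespace LocalHecke

open scoped Pointwise in
/-- An element commensurates `G` if it conjugates, in both directions, a subgroup of finite index
into `G`. -/
lemma mem_commensurator_of_le {𝒢 : Type*} [Group 𝒢] {G U : Subgroup 𝒢} {x : 𝒢}
    (hU : U.relIndex G ≠ 0) (h : ∀ u ∈ U, x * u * x⁻¹ ∈ G) (h' : ∀ u ∈ U, x⁻¹ * u * x ∈ G) :
    x ∈ Subgroup.Commensurable.commensurator G := by
  have key : ∀ y : 𝒢, (∀ u ∈ U, y⁻¹ * u * y ∈ G) → (ConjAct.toConjAct y • G).relIndex G ≠ 0 := by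
    intro y hy
    refine fun h0 => hU (Nat.eq_zero_of_zero_dvd (h0 ▸ Subgroup.relIndex_dvd_of_le_left G ?_))
    intro u hu
    rw [Subgroup.mem_pointwise_smul_iff_inv_smul_mem, ← ConjAct.toConjAct_inv,
      ConjAct.toConjAct_smul, inv_inv]
    exact hy u hu
  rw [Subgroup.Commensurable.commensurator_mem_iff]
  refine ⟨key x h', ?_⟩
  have h1 := key x⁻¹ (by simpa using h)
  rwa [← Subgroup.relIndex_pointwise_smul (ConjAct.toConjAct x), smul_smul, ← ConjAct.toConjAct_mul,
    mul_inv_cancel, ConjAct.toConjAct_one, one_smul] at h1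

section

variable {𝔬 : Type*} [CommRing 𝔬] {A : Type*} [Ring A] [Algebra 𝔬 A]

/-- The matrices in `GL(Λ)` that are congruent to `1` modulo `c`. -/
def congruenceSubgroup (Λ : Subalgebra 𝔬 A) (ι : Type*) [Fintype ι] [DecidableEq ι] (c : 𝔬) :
    Subgroup (Matrix ι ι A)ˣ where
  carrier := {g | g ∈ GLn Λ ι ∧ ∃ Y : Matrix ι ι A, (∀ i j, Y i j ∈ Λ) ∧
    (g : Matrix ι ι A) = 1 + c • Y}
  one_mem' := ⟨one_mem _, 0, fun _ _ => zero_mem Λ, by simp⟩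
  mul_mem' := by
    rintro g h ⟨hg, Y, hY, hgY⟩ ⟨hh, Z, hZ, hhZ⟩
    refine ⟨mul_mem hg hh, Z + Y * (h : Matrix ι ι A), fun i j =>
      add_mem (hZ i j) (mul_entries hY hh.1 i j), ?_⟩
    rw [Units.val_mul, hgY, add_mul, one_mul, Matrix.smul_mul, smul_add, ← add_assoc]
    conv_lhs => rw [hhZ]
    rw [← hhZ]
  inv_mem' := by
    rintro g ⟨hg, Y, hY, hgY⟩
    refine ⟨inv_mem hg, -(((g⁻¹ : (Matrix ι ι A)ˣ) : Matrix ι ι A) * Y), fun i j =>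
      neg_mem (mul_entries hg.2 hY i j), ?_⟩
    have h1 : ((g⁻¹ : (Matrix ι ι A)ˣ) : Matrix ι ι A) * (g : Matrix ι ι A) = 1 := g.inv_mul
    rw [hgY, mul_add, mul_one, Matrix.mul_smul] at h1
    rw [smul_neg, ← h1, add_neg_cancel_right]

variable [IsDomain 𝔬] [IsDiscreteValuationRing 𝔬] [Finite (IsLocalRing.ResidueField 𝔬)]

lemma finite_quotient_span {c : 𝔬} (hc : c ≠ 0) : Finite (𝔬 ⧸ Ideal.span {c}) := by
  obtain ⟨ϖ, hϖ⟩ := IsDiscreteValuationRing.exists_irreducible 𝔬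
  obtain ⟨n, hn⟩ := IsDiscreteValuationRing.ideal_eq_span_pow_irreducible
    (s := Ideal.span {c}) (by simpa using hc) hϖ
  rw [hn, ← Ideal.span_singleton_pow, ← (IsDiscreteValuationRing.irreducible_iff_uniformizer ϖ).1 hϖ]
  have : Finite (𝔬 ⧸ IsLocalRing.maximalIdeal 𝔬) :=
    inferInstanceAs (Finite (IsLocalRing.ResidueField 𝔬))
  exact Ideal.finite_quotient_pow (IsNoetherian.noetherian _) n

variable {Λ : Subalgebra 𝔬 A} {ι : Type*} [Fintype ι] [DecidableEq ι]

/-- The congruence subgroups have finite index, since `Λ / c Λ` is finite. -/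
lemma relIndex_congruenceSubgroup_ne_zero (hfg : (Subalgebra.toSubmodule Λ).FG) {c : 𝔬}
    (hc : c ≠ 0) {𝒢 : Type*} [Group 𝒢] (ρ : 𝒢 →* (Matrix ι ι A)ˣ) {G : Subgroup 𝒢}
    (hG : ∀ g ∈ G, ρ g ∈ GLn Λ ι) :
    (((congruenceSubgroup Λ ι c).comap ρ) ⊓ G).relIndex G ≠ 0 := by
  have := finite_quotient_span hc
  have hM : Module.Finite 𝔬 (Subalgebra.toSubmodule Λ) := Module.Finite.iff_fg.2 hfg
  let Q := (Subalgebra.toSubmodule Λ) ⧸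
    (Ideal.span {c} • (⊤ : Submodule 𝔬 (Subalgebra.toSubmodule Λ)))
  have hQ : Finite Q := by
    have : Finite ((Subalgebra.toSubmodule Λ) ⧸ (⊤ : Submodule 𝔬 (Subalgebra.toSubmodule Λ))) :=
      inferInstance
    exact Submodule.finite_quotient_smul _ hM.1
  let f : G → (ι → ι → Q) := fun g i j =>
    Submodule.Quotient.mk ⟨(ρ g : Matrix ι ι A) i j, (hG g g.2).1 i j⟩
  have hf : ∀ g h : G, f g = f h → g⁻¹ * h ∈
      (((congruenceSubgroup Λ ι c).comap ρ) ⊓ G).subgroupOf G := by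
    intro g h hgh
    rw [Subgroup.mem_subgroupOf]
    refine ⟨?_, (g⁻¹ * h).2⟩
    have h1 : ∀ i j, ∃ y ∈ Λ, (ρ h : Matrix ι ι A) i j - (ρ g : Matrix ι ι A) i j = c • y := by
      intro i j
      have := congrFun (congrFun hgh.symm i) j
      rw [Submodule.Quotient.eq, Ideal.span, Submodule.ideal_span_singleton_smul,
        Submodule.mem_smul_pointwise_iff_exists] at this
      obtain ⟨y, -, hy⟩ := this
      exact ⟨y, y.2, (congrArg Subtype.val hy).symm⟩
    choose Y hY hY' using h1
    change ρ ((g : 𝒢)⁻¹ * h) ∈ congruenceSubgroup Λ ι c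
    rw [map_mul, map_inv]
    refine ⟨mul_mem (inv_mem (hG g g.2)) (hG h h.2),
      (((ρ g)⁻¹ : (Matrix ι ι A)ˣ) : Matrix ι ι A) * Matrix.of Y,
      fun i j => mul_entries (hG g g.2).2 hY i j, ?_⟩
    have h2 : (ρ h : Matrix ι ι A) = (ρ g : Matrix ι ι A) + c • Matrix.of Y := by
      ext i j
      rw [Matrix.add_apply, Matrix.smul_apply, Matrix.of_apply, ← hY' i j, add_sub_cancel]
    rw [Units.val_mul, h2, mul_add, Matrix.mul_smul]
    congr 1
    exact (ρ g).inv_mul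
  have hfin : Finite (G ⧸ (((congruenceSubgroup Λ ι c).comap ρ) ⊓ G).subgroupOf G) := by
    refine Finite.of_injective (fun q => f q.out) fun q q' hqq => ?_
    have := hf _ _ hqq
    rw [← QuotientGroup.eq] at this
    exact (QuotientGroup.out_eq' q).symm.trans (this.trans (QuotientGroup.out_eq' q'))
  have := Subgroup.finiteIndex_of_finite_quotient
    (H := (((congruenceSubgroup Λ ι c).comap ρ) ⊓ G).subgroupOf G)
  exact Subgroup.FiniteIndex.index_ne_zero

variable {F : Type*} [Field F] [Algebra 𝔬 F] [IsFractionRing 𝔬 F] [Algebra F A]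
  [IsScalarTower 𝔬 F A]

/-- A matrix over the algebra has a common denominator. -/
lemma exists_smul_entries_mem (hspan : Submodule.span F (Λ : Set A) = ⊤) (M : Matrix ι ι A) :
    ∃ c : 𝔬, c ≠ 0 ∧ ∀ i j, (c • M) i j ∈ Λ := by
  choose c hc hcM using fun i j => exists_smul_mem_of_span hspan (M i j)
  refine ⟨∏ i, ∏ j, c i j, Finset.prod_ne_zero_iff.2 fun i _ =>
    Finset.prod_ne_zero_iff.2 fun j _ => hc i j, fun i j => ?_⟩
  obtain ⟨e, he⟩ : c i j ∣ ∏ i, ∏ j, c i j :=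
    (Finset.dvd_prod_of_mem (fun j => c i j) (Finset.mem_univ j)).trans
      (Finset.dvd_prod_of_mem (fun i => ∏ j, c i j) (Finset.mem_univ i))
  rw [Matrix.smul_apply, he, mul_comm, mul_smul]
  exact Subalgebra.smul_mem _ (hcM i j) e

/-- Subgroups of `GL(Λ)` are commensurable with their conjugates, since conjugation by a fixed
matrix sends a congruence subgroup of sufficiently high level to integral matrices. -/
lemma mem_commensurator (hfg : (Subalgebra.toSubmodule Λ).FG)
    (hspan : Submodule.span F (Λ : Set A) = ⊤) {𝒢 : Type*} [Group 𝒢]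
    (ρ : 𝒢 →* (Matrix ι ι A)ˣ) {G : Subgroup 𝒢} (hG : ∀ g ∈ G, ρ g ∈ GLn Λ ι) {x : 𝒢}
    (hx : ∀ g ∈ G, ρ (x * g * x⁻¹) ∈ GLn Λ ι → x * g * x⁻¹ ∈ G)
    (hx' : ∀ g ∈ G, ρ (x⁻¹ * g * x) ∈ GLn Λ ι → x⁻¹ * g * x ∈ G) :
    x ∈ Subgroup.Commensurable.commensurator G := by
  obtain ⟨c, hc, hcx⟩ := exists_smul_entries_mem hspan (ρ x : Matrix ι ι A)
  obtain ⟨c', hc', hcx'⟩ := exists_smul_entries_mem hspan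
    (((ρ x)⁻¹ : (Matrix ι ι A)ˣ) : Matrix ι ι A)
  have key : ∀ (X : (Matrix ι ι A)ˣ) (a b : 𝔬), (∀ i j, (a • (X : Matrix ι ι A)) i j ∈ Λ) →
      (∀ i j, (b • ((X⁻¹ : (Matrix ι ι A)ˣ) : Matrix ι ι A)) i j ∈ Λ) →
      ∀ g ∈ congruenceSubgroup Λ ι (a * b), X * g * X⁻¹ ∈ Inv Λ ι := by
    rintro X a b ha hb g ⟨-, Y, hY, hgY⟩
    have h1 : ((X * g * X⁻¹ : (Matrix ι ι A)ˣ) : Matrix ι ι A) =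
        1 + (a • (X : Matrix ι ι A)) * Y * (b • ((X⁻¹ : (Matrix ι ι A)ˣ) : Matrix ι ι A)) := by
      rw [Units.val_mul, Units.val_mul, hgY, mul_add, add_mul, mul_one, Units.mul_inv]
      simp only [Matrix.mul_smul, Matrix.smul_mul, smul_smul]
      rw [mul_comm]
    intro i j
    rw [h1]
    exact add_mem (one_entries Λ i j) (mul_entries (mul_entries ha hY) hb i j)
  refine mem_commensurator_of_le
    (relIndex_congruenceSubgroup_ne_zero hfg (mul_ne_zero hc hc') ρ hG) ?_ ?_
  · rintro u ⟨hu, huG⟩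
    refine hx u huG ⟨?_, ?_⟩
    · rw [map_mul, map_mul, map_inv]
      exact key _ _ _ hcx hcx' _ hu
    · rw [← map_inv, mul_inv_rev, mul_inv_rev, inv_inv, ← mul_assoc]
      simpa only [map_mul, map_inv] using key _ _ _ hcx hcx' _ (inv_mem hu)
  · rintro u ⟨hu, huG⟩
    have hu' : ρ u ∈ congruenceSubgroup Λ ι (c' * c) := by rw [mul_comm]; exact hu
    have hcx'' : ∀ i j, (c • ((((ρ x)⁻¹)⁻¹ : (Matrix ι ι A)ˣ) : Matrix ι ι A)) i j ∈ Λ := by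
      rwa [inv_inv]
    refine hx' u huG ⟨?_, ?_⟩
    · have := key _ _ _ hcx' hcx'' _ hu'
      simpa only [map_mul, map_inv, inv_inv] using this
    · have := key _ _ _ hcx' hcx'' _ (inv_mem hu')
      rw [inv_inv] at this
      rw [← map_inv, mul_inv_rev, mul_inv_rev, inv_inv, ← mul_assoc]
      simpa only [map_mul, map_inv] using this

end

end LocalHecke

/-! ### Diagonal matrices and their exponents -/

namespace LocalHecke

section jumps

variable {d : ℕ}

/-- The entry of an exponent at the index `k`, as an additive function. -/
def entry (k : Fin d) : Lex (Fin d → ℤ) →+ ℤ where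
  toFun x := x k
  map_zero' := rfl
  map_add' _ _ := rfl

@[simp] lemma entry_apply (k : Fin d) (x : Lex (Fin d → ℤ)) : entry k x = x k := rfl

/-- The difference between the entry at `k` and the preceding entry, where the entry preceding the
one at `0` is taken to be zero. -/
def jump (k : Fin d) : Lex (Fin d → ℤ) →+ ℤ :=
  if (k : ℕ) = 0 then entry k else entry k - entry ⟨k - 1, by omega⟩

lemma jump_zero {k : Fin d} (hk : (k : ℕ) = 0) (x : Lex (Fin d → ℤ)) : jump k x = x k := by
  rw [jump, if_pos hk, entry_apply]

lemma jump_of_ne {k : Fin d} (hk : (k : ℕ) ≠ 0) (x : Lex (Fin d → ℤ)) :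
    jump k x = x k - x ⟨k - 1, by omega⟩ := by
  rw [jump, if_neg hk]; rfl

lemma eq_zero_of_jump {x : Lex (Fin d → ℤ)} {k : Fin d} (h : ∀ i ≤ k, jump i x = 0) : x k = 0 := by
  obtain ⟨k, hk⟩ := k
  induction k with
  | zero => exact (jump_zero (k := ⟨0, hk⟩) rfl x).symm.trans (h _ le_rfl)
  | succ k ih =>
    have h1 := h ⟨k + 1, hk⟩ le_rfl
    rw [jump_of_ne (Nat.succ_ne_zero k)] at h1
    have h2 := ih (by omega) fun i hi => h i (hi.trans (Fin.mk_le_mk.2 (Nat.le_succ k)))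
    change x ⟨k + 1, hk⟩ - x ⟨k, by omega⟩ = 0 at h1
    omega

lemma jump_nonneg {x : Lex (Fin d → ℤ)} {k : Fin d} (h0 : 0 ≤ x k)
    (h : ∀ i : Fin d, (i : ℕ) + 1 = k → x i ≤ x k) : 0 ≤ jump k x := by
  by_cases hk : (k : ℕ) = 0
  · rwa [jump_zero hk]
  · rw [jump_of_ne hk, sub_nonneg]
    exact h _ (Nat.sub_add_cancel (Nat.one_le_iff_ne_zero.2 hk))

end jumps

section diag

variable {K : Type*} [DivisionRing K] {d : ℕ}

/-- The diagonal matrix with nonzero diagonal entries `f i`, as a unit. -/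
def diagUnit (f : Fin d → K) (hf : ∀ i, f i ≠ 0) : (Matrix (Fin d) (Fin d) K)ˣ where
  val := Matrix.diagonal f
  inv := Matrix.diagonal fun i => (f i)⁻¹
  val_inv := by
    rw [Matrix.diagonal_mul_diagonal, ← Matrix.diagonal_one]
    congr 1; funext i; exact mul_inv_cancel₀ (hf i)
  inv_val := by
    rw [Matrix.diagonal_mul_diagonal, ← Matrix.diagonal_one]
    congr 1; funext i; exact inv_mul_cancel₀ (hf i)

variable {f : Fin d → K} {hf : ∀ i, f i ≠ 0} {v : AddValuation K (WithTop ℤ)}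

@[simp] lemma coe_diagUnit :
    (diagUnit f hf : Matrix (Fin d) (Fin d) K) = Matrix.diagonal f := rfl

lemma diagUnit_apply_ne (i j : Fin d) (hij : i ≠ j) :
    (diagUnit f hf : Matrix (Fin d) (Fin d) K) i j = 0 := Matrix.diagonal_apply_ne _ hij

lemma exps_diagUnit (i : Fin d) :
    exps v (diagUnit f hf : Matrix (Fin d) (Fin d) K) i = ev v (f i) := by
  rw [exps_apply, coe_diagUnit, Matrix.diagonal_apply_eq]

lemma intMat_diagUnit (h : ∀ i, 0 ≤ v (f i)) :
    IntMat v (diagUnit f hf : Matrix (Fin d) (Fin d) K) := by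
  intro i j
  rw [coe_diagUnit, Matrix.diagonal_apply]
  split_ifs
  · exact h i
  · simp

lemma mem_intGroup_true {Γ : Subgroup (Matrix (Fin d) (Fin d) K)ˣ}
    {g : (Matrix (Fin d) (Fin d) K)ˣ} : g ∈ intGroup v Γ (fun _ : Fin d => True) ↔
      g ∈ Γ ∧ IntMat v (g : Matrix (Fin d) (Fin d) K) ∧
        IntMat v ((g⁻¹ : (Matrix (Fin d) (Fin d) K)ˣ) : Matrix (Fin d) (Fin d) K) :=
  ⟨fun h => ⟨h.1, h.2.1⟩, fun h => ⟨h.1, h.2,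
    fun _ _ h' => absurd ⟨trivial, trivial⟩ h', fun _ _ h' => absurd ⟨trivial, trivial⟩ h'⟩⟩

variable {Γ : Subgroup (Matrix (Fin d) (Fin d) K)ˣ} {D : (Matrix (Fin d) (Fin d) K)ˣ}

lemma exps_le_exps_iff (hD : ∀ i j, i ≠ j → (D : Matrix (Fin d) (Fin d) K) i j = 0) {i j : Fin d} :
    exps v (D : Matrix (Fin d) (Fin d) K) i ≤ exps v (D : Matrix (Fin d) (Fin d) K) j ↔
      v ((D : Matrix (Fin d) (Fin d) K) i i) ≤ v ((D : Matrix (Fin d) (Fin d) K) j j) :=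
  have hD := lowerGroup_diag_ne (IsLower.of_diag hD : D ∈ lowerGroup K d)
  (v_le_v_iff v (hD i) (hD j)).symm

lemma exps_nonneg (hD : ∀ i j, i ≠ j → (D : Matrix (Fin d) (Fin d) K) i j = 0)
    (hDI : IntMat v (D : Matrix (Fin d) (Fin d) K)) (i : Fin d) :
    0 ≤ exps v (D : Matrix (Fin d) (Fin d) K) i :=
  (le_v_iff v (lowerGroup_diag_ne (IsLower.of_diag hD : D ∈ lowerGroup K d) i) 0).1 (hDI i i)

/-- Dominant exponents for the general linear group are increasing. -/
lemma DomFrom.exps_le_of_gl (hd : 0 < d)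
    (h : DomFrom v Γ d (fun k i => k ≤ (i : ℕ)) (fun k => ⟨min k (d - 1), by omega⟩) 0 D)
    {i j : Fin d} (hij : i ≤ j) : exps v (D : Matrix (Fin d) (Fin d) K) i ≤
      exps v (D : Matrix (Fin d) (Fin d) K) j := by
  rw [exps_le_exps_iff h.2.1]
  have h1 := h.2.2 i (Nat.zero_le _) i.2 j hij
  have h2 : (⟨min (i : ℕ) (d - 1), by omega⟩ : Fin d) = i := Fin.ext (min_eq_left (by omega))
  simp only [h2] at h1
  exact h1

end diag

lemma getD_replicate_append {R : Type*} (x y z : R) {m a b : ℕ} (hm : m < a + b) :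
    (List.replicate a x ++ List.replicate b y).getD m z = if m < a then x else y := by
  rw [List.getD_eq_getElem?_getD, List.getElem?_append]
  split_ifs with h1 h2 h2
  · rw [List.getElem?_replicate, if_pos (by simpa using h1)]; rfl
  · simp at h1; omega
  · simp at h1; omega
  · rw [List.getElem?_replicate, if_pos (by simp at h1 ⊢; omega)]; rfl

end LocalHecke

/-! ### The unimodular Hecke algebra -/

namespace LocalHecke

section flatten

variable {F : Type*} [Field F] {A : Type*} [Ring A] [Algebra F A] {D : Type*} [Ring D]
  [Algebra F D] {ι : Type*} [Fintype ι] [DecidableEq ι] {r d : ℕ}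

lemma flatten_apply (φ : A ≃ₐ[F] Matrix (Fin r) (Fin r) D) (M : Matrix ι ι A) (i j : ι × Fin r) :
    flatten φ M i j = φ (M i.1 j.1) i.2 j.2 := rfl

/-- Matrices over an algebra of `r × r` matrices, as matrices over `D` with numbered rows. -/
def flattenEquiv (φ : A ≃ₐ[F] Matrix (Fin r) (Fin r) D) (e : ι × Fin r ≃ Fin d) :
    Matrix ι ι A ≃* Matrix (Fin d) (Fin d) D :=
  ((φ.toRingEquiv.mapMatrix.trans (Matrix.compRingEquiv ι (Fin r) D)).trans
    (Matrix.reindexAlgEquiv ℤ D e).toRingEquiv).toMulEquiv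

lemma flattenEquiv_apply (φ : A ≃ₐ[F] Matrix (Fin r) (Fin r) D) (e : ι × Fin r ≃ Fin d)
    (M : Matrix ι ι A) (i j : Fin d) :
    flattenEquiv φ e M i j = flatten φ M (e.symm i) (e.symm j) := rfl

lemma flatten_eq_of_flattenEquiv {φ : A ≃ₐ[F] Matrix (Fin r) (Fin r) D} {e : ι × Fin r ≃ Fin d}
    {M : Matrix ι ι A} {f : Fin d → D} (h : flattenEquiv φ e M = Matrix.diagonal f) :
    flatten φ M = Matrix.diagonal fun j => f (e j) := by
  ext i j
  have h1 := congrFun (congrFun h (e i)) (e j)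
  rw [flattenEquiv_apply, e.symm_apply_apply, e.symm_apply_apply] at h1
  rw [h1, Matrix.diagonal_apply, Matrix.diagonal_apply]
  simp

lemma flattenEquiv_mem_iff {𝔬 : Type*} [CommRing 𝔬] [Algebra 𝔬 A] {Λ : Subalgebra 𝔬 A} {S : Set D}
    {φ : A ≃ₐ[F] Matrix (Fin r) (Fin r) D} (hφ : ∀ a : A, a ∈ Λ ↔ ∀ i j, φ a i j ∈ S)
    (e : ι × Fin r ≃ Fin d) (M : Matrix ι ι A) :
    (∀ i j, flattenEquiv φ e M i j ∈ S) ↔ ∀ i j, M i j ∈ Λ := by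
  constructor
  · intro h i j
    rw [hφ]
    intro k l
    have := h (e (i, k)) (e (j, l))
    rwa [flattenEquiv_apply, e.symm_apply_apply, e.symm_apply_apply] at this
  · intro h i j
    exact (hφ _).1 (h _ _) _ _

end flatten

section gl

variable {K : Type*} [DivisionRing K] {v : AddValuation K (WithTop ℤ)} {N : ℕ}

/-- The exponents `(0, …, 0, 1, …, 1)` with `i` ones. -/
def glWeight (N i : ℕ) : Lex (Fin N → ℤ) := toLex fun j => if (j : ℕ) < N - i then 0 else 1

lemma glWeight_apply (i : ℕ) (j : Fin N) :
    glWeight N i j = if (j : ℕ) < N - i then 0 else 1 := rfl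

lemma jump_glWeight {i j : ℕ} (hi : 1 ≤ i) (hi' : i ≤ N) (hj : j ≤ N) :
    jump ⟨N - i, by omega⟩ (glWeight N j) = if i = j then 1 else 0 := by
  by_cases h : i = N
  · subst h
    rw [jump_zero (by simp), glWeight_apply]
    simp only
    split_ifs <;> omega
  · rw [jump_of_ne (by simp only; omega), glWeight_apply, glWeight_apply]
    simp only
    split_ifs <;> omega

lemma glWeight_mono (i : ℕ) {j k : Fin N} (hjk : j ≤ k) : glWeight N i j ≤ glWeight N i k := by
  have : (j : ℕ) ≤ k := hjk
  rw [glWeight_apply, glWeight_apply]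
  split_ifs <;> omega

/-- In a double coset under the general linear group the exponents of dominant diagonal matrices
agree. -/
lemma exps_eq_of_gl (hN : 0 < N) {D T : (Matrix (Fin N) (Fin N) K)ˣ}
    (hD : DomFrom v ⊤ N (fun k i => k ≤ (i : ℕ)) (fun k => ⟨min k (N - 1), by omega⟩) 0 D)
    (hT : ∀ i j, i ≠ j → (T : Matrix (Fin N) (Fin N) K) i j = 0)
    (hTm : ∀ i j, i ≤ j → exps v (T : Matrix (Fin N) (Fin N) K) i ≤
      exps v (T : Matrix (Fin N) (Fin N) K) j)
    (h : ∃ g ∈ intGroup v ⊤ (fun _ : Fin N => True), ∃ g' ∈ intGroup v ⊤ (fun _ : Fin N => True),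
      D = g * T * g') :
    exps v (D : Matrix (Fin N) (Fin N) K) = exps v (T : Matrix (Fin N) (Fin N) K) := by
  obtain ⟨g, hg, g', hg', h⟩ := h
  exact funext fun i => exps_eq_of_double_coset hg hg' h hD.2.1 hT 1 1
    (fun i j hij => hD.exps_le_of_gl hN hij) hTm i

/-- The Hecke algebra of a general linear group is a polynomial ring in the elementary diagonal
matrices. -/
theorem gl_isAlgIndepGenerators (hN : 0 < N) {𝒢 : Type*} [Group 𝒢] {Δ : Submonoid 𝒢}
    {G : Subgroup 𝒢} [IsHeckeTriple Δ G G] (ρ : 𝒢 ≃* (Matrix (Fin N) (Fin N) K)ˣ)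
    (hG : ∀ x, x ∈ G ↔ ρ x ∈ intGroup v ⊤ (fun _ : Fin N => True))
    (hΔ : ∀ x, x ∈ Δ ↔ IntMat v (ρ x : Matrix (Fin N) (Fin N) K))
    (T : Set.Icc 1 N → Δ)
    (hTd : ∀ l, ∀ i j, i ≠ j → (ρ (T l) : Matrix (Fin N) (Fin N) K) i j = 0)
    (hTw : ∀ l, exps v (ρ (T l) : Matrix (Fin N) (Fin N) K) = glWeight N l) :
    HeckeAlg.IsAlgIndepGenerators fun i => HeckeAlg.dcoset G (T i) := by
  refine (gl_elimination v hN).isAlgIndepGenerators (fun M _ => gl_iwasawa v M) ρ hG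
    (fun x => by simp [hΔ]) T (fun l => glWeight N l) hTd hTw (fun l D hD h _ => ?_)
    (fun l => jump ⟨N - l, by have := l.2.1; omega⟩) (fun _ => 1) (fun _ => one_ne_zero)
    (fun i j => ?_) ⊤ (fun _ => trivial) (fun _ _ _ => trivial) (fun x _ hx => ?_)
    (fun D hD hDI i => ?_) ⟨N - 1, by omega⟩ (fun i j => ?_) (fun i => ?_)
  · rw [← hTw l]
    refine exps_eq_of_gl hN hD (hTd l) (fun i j hij => ?_) h
    rw [hTw]
    exact glWeight_mono l hij
  · rw [jump_glWeight i.2.1 i.2.2 j.2.2]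
    simp only [Subtype.ext_iff]
  · funext k
    refine eq_zero_of_jump fun i _ => ?_
    have h1 := hx ⟨N - i, ⟨by omega, by omega⟩⟩
    have h2 : (⟨N - (N - i : ℕ), by omega⟩ : Fin N) = i := Fin.ext (by simp only; omega)
    simp only [h2] at h1
    exact h1
  · obtain ⟨k, hk⟩ := Int.eq_ofNat_of_zero_le (jump_nonneg
      (k := (⟨N - (i : ℕ), by have := i.2.1; omega⟩ : Fin N)) (exps_nonneg hD.2.1 hDI _)
      fun j hj => hD.exps_le_of_gl hN (by rw [Fin.le_def]; omega))
    exact ⟨k, by rw [hk, mul_one]⟩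
  · exact glWeight_mono _ (by rw [Fin.le_def]; simp only; omega)
  · have := i.2.1
    rw [glWeight_apply, if_neg (by simp only; omega)]
    exact one_pos

end gl

end LocalHecke

namespace LocalHecke

section

variable {𝔬 : Type*} [CommRing 𝔬] [IsDomain 𝔬] [IsDiscreteValuationRing 𝔬]
  [Finite (IsLocalRing.ResidueField 𝔬)] {F : Type*} [Field F] [Algebra 𝔬 F] [IsFractionRing 𝔬 F]

lemma IsMaximalOrder.isPrimeOrder {K : Type*} [DivisionRing K] [Algebra F K] [Algebra 𝔬 K]
    {O : Subalgebra 𝔬 K} (hO : IsMaximalOrder F O) {π : K} (hπ : IsPrimeElement O π) :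
    IsPrimeOrder F O π := ⟨hO.1.1, hO.1.2, hπ⟩

variable {A : Type*} [Ring A] [Algebra F A] [Algebra 𝔬 A] [IsScalarTower 𝔬 F A]

/-- The commensurability condition for the unimodular group. -/
lemma isHeckeTriple_inv {Λ : Subalgebra 𝔬 A} (hfg : (Subalgebra.toSubmodule Λ).FG)
    (hspan : Submodule.span F (Λ : Set A) = ⊤) (ι : Type*) [Fintype ι] [DecidableEq ι] :
    IsHeckeTriple (Inv Λ ι) (GLn Λ ι) (GLn Λ ι) :=
  IsHeckeTriple.of_diagonal (fun _ hg => hg.1) fun _ _ =>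
    mem_commensurator hfg hspan (MonoidHom.id _) (fun _ hg => hg) (fun _ _ h => h) fun _ _ h => h

/-- The local Hecke algebra of the unimodular group of a maximal order. -/
theorem unimodular [IsSimpleRing A] {D : Type*} [DivisionRing D] [Algebra F D] [Algebra 𝔬 D]
    [IsScalarTower 𝔬 F D] {n : ℕ} (hn : 1 ≤ n) (Λ : Subalgebra 𝔬 A) (hΛ : IsMaximalOrder F Λ)
    (O : Subalgebra 𝔬 D) (hO : IsMaximalOrder F O) (r : ℕ)
    (φ : A ≃ₐ[F] Matrix (Fin r) (Fin r) D) (hφ : ∀ a : A, a ∈ Λ ↔ ∀ i j, φ a i j ∈ O)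
    (π : D) (hπ : IsPrimeElement O π) :
    ∃ (_ : IsHeckeTriple (Inv Λ (Fin n)) (GLn Λ (Fin n)) (GLn Λ (Fin n)))
      (T : Set.Icc 1 (n * r) → Inv Λ (Fin n)),
      (∀ i, flatten φ ((T i : (Matrix (Fin n) (Fin n) A)ˣ) : Matrix (Fin n) (Fin n) A) =
        blockDiag (prodPos Fin.val r) (List.replicate (n * r - i) 1 ++ List.replicate i π)) ∧
      HeckeAlg.IsAlgIndepGenerators (fun i => HeckeAlg.dcoset (GLn Λ (Fin n)) (T i)) := by
  have hr : 0 < r := by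
    rcases Nat.eq_zero_or_pos r with rfl | h
    · have : Subsingleton A := φ.toEquiv.subsingleton
      exact absurd this (not_subsingleton A)
    · exact h
  have hN : 0 < n * r := Nat.mul_pos hn hr
  have hP := hO.isPrimeOrder hπ
  obtain ⟨v, hv, hvπ⟩ := hP.exists_valuation
  have hevπ : ev v π = 1 := by rw [ev, hvπ]; rfl
  have hT := isHeckeTriple_inv hΛ.1.1 hΛ.1.2 (Fin n)
  let ρ : (Matrix (Fin n) (Fin n) A)ˣ ≃* (Matrix (Fin (n * r)) (Fin (n * r)) D)ˣ :=
    Units.mapEquiv (flattenEquiv φ finProdFinEquiv)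
  have hint : ∀ x : (Matrix (Fin n) (Fin n) A)ˣ,
      IntMat v (ρ x : Matrix (Fin (n * r)) (Fin (n * r)) D) ↔ x ∈ Inv Λ (Fin n) := fun x =>
    (forall_congr' fun i => forall_congr' fun j => hv _).trans
      (flattenEquiv_mem_iff (S := (O : Set D)) hφ finProdFinEquiv (x : Matrix (Fin n) (Fin n) A))
  have hf : ∀ (i : Set.Icc 1 (n * r)) (j : Fin (n * r)),
      (if (j : ℕ) < n * r - i then 1 else π) ≠ 0 := fun i j => by
    split_ifs
    exacts [one_ne_zero, hP.ne_zero]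
  let T : Set.Icc 1 (n * r) → Inv Λ (Fin n) := fun i => ⟨ρ.symm (diagUnit _ (hf i)), by
    rw [← hint, MulEquiv.apply_symm_apply]
    refine intMat_diagUnit fun j => ?_
    split_ifs
    · simp
    · rw [hvπ]; exact zero_le_one⟩
  have hρT : ∀ i, ρ (T i) = diagUnit _ (hf i) := fun i => ρ.apply_symm_apply _
  refine ⟨hT, T, fun i => ?_, gl_isAlgIndepGenerators (v := v) hN ρ (fun x => ?_)
    (fun x => (hint x).symm) T (fun l => ?_) fun l => ?_⟩
  · rw [flatten_eq_of_flattenEquiv (congrArg Units.val (hρT i)), blockDiag]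
    congr 1
    funext j
    have h1 : ((finProdFinEquiv j : Fin (n * r)) : ℕ) = prodPos Fin.val r j := by
      rw [prodPos, add_comm]; rfl
    have h2 := i.2.2
    have h3 := (finProdFinEquiv j).2
    rw [h1] at h3 ⊢
    rw [getD_replicate_append _ _ _ (by omega)]
  · rw [mem_intGroup_true, ← map_inv, hint, hint]
    exact ⟨fun h => ⟨trivial, h⟩, fun h => h.2⟩
  · rw [hρT]
    exact diagUnit_apply_ne
  · funext j
    rw [hρT, exps_diagUnit, glWeight_apply]
    split_ifs
    exacts [ev_one v, hevπ]

end

end LocalHecke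

/-! ### The restricted unimodular Hecke algebra -/

namespace HeckeAlg

variable {𝒢 : Type*} [Group 𝒢] {Δ : Submonoid 𝒢} {G : Subgroup 𝒢}

lemma rc_prod {Z : Type*} [Group Z] {x y : 𝒢 × Z} (h : rc G x.1 = rc G y.1) (h' : x.2 = y.2) :
    rc (G.prod (⊥ : Subgroup Z)) x = rc (G.prod (⊥ : Subgroup Z)) y := by
  rw [rc_eq] at h ⊢
  exact ⟨h, by simp [h']⟩

/-- Triangularity persists after adding a grading. -/
lemma Triangular.prod {X : Type*} [AddCommGroup X] [LinearOrder X] [IsOrderedAddMonoid X]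
    {B : Subgroup 𝒢} {e : 𝒢 → X} {Dom : 𝒢 → Prop} (hT : Triangular Δ G B e Dom)
    {Δ' : Submonoid (𝒢 × Multiplicative ℤ)} (hΔ' : ∀ x ∈ Δ', x.1 ∈ Δ) :
    Triangular Δ' (G.prod (⊥ : Subgroup (Multiplicative ℤ))) (B.prod ⊤)
      (fun x => (toLex (x.2.toAdd, e x.1) : ℤ ×ₗ X)) (fun x => Dom x.1) := by
  refine ⟨fun b hb c hc => ?_, fun b hb hbG => ?_, fun x hx => ?_, fun d hd => ?_,
    fun b hb hbΔ => ?_, fun d d' hd hd' hdΔ hdΔ' h => ?_⟩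
  · rw [Prod.fst_mul, hT.e_mul _ hb.1 _ hc.1, Prod.snd_mul, toAdd_mul]; rfl
  · have h2 : b.2 = 1 := hbG.2
    rw [hT.e_unit _ hb.1 hbG.1, h2]; rfl
  · obtain ⟨b, hb, h⟩ := hT.iwasawa _ (hΔ' x hx)
    exact ⟨(b, x.2), ⟨hb, trivial⟩, rc_prod h rfl⟩
  · exact ⟨hT.dom_mem _ hd, trivial⟩
  · obtain ⟨d, hd, ⟨g, hg, g', hg', h⟩, hle, heq⟩ := hT.tri _ hb.1 (hΔ' b hbΔ)
    refine ⟨(d, b.2), hd, ⟨(g, 1), ⟨hg, rfl⟩, (g', 1), ⟨hg', rfl⟩, ?_⟩, ?_, fun h => ?_⟩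
    · ext <;> simp [h]
    · exact Prod.Lex.toLex_le_toLex.2 (Or.inr ⟨rfl, hle⟩)
    · exact rc_prod (heq (congrArg (fun z : ℤ ×ₗ X => (ofLex z).2) h)) rfl
  · exact rc_prod (hT.dom_inj _ _ hd hd' (hΔ' _ hdΔ) (hΔ' _ hdΔ')
      (congrArg (fun z : ℤ ×ₗ X => (ofLex z).2) h))
      (congrArg (fun z : ℤ ×ₗ X => (ofLex z).1) h)

end HeckeAlg

namespace LocalHecke

section

variable {𝔬 : Type*} [CommRing 𝔬] [IsDomain 𝔬] [IsDiscreteValuationRing 𝔬]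
  [Finite (IsLocalRing.ResidueField 𝔬)] {F : Type*} [Field F] [Algebra 𝔬 F] [IsFractionRing 𝔬 F]

/-- The discrete valuation ring is an order with prime element in its own field of fractions. -/
lemma isPrimeOrder_bot {π : 𝔬} (hπ : Irreducible π) :
    IsPrimeOrder F (⊥ : Subalgebra 𝔬 F) (algebraMap 𝔬 F π) := by
  have hinj := IsFractionRing.injective 𝔬 F
  refine ⟨Subalgebra.fg_bot_toSubmodule, ?_, algebraMap_mem _ π, ?_⟩
  · rw [eq_top_iff]
    intro x _
    rw [← mul_one x, ← smul_eq_mul]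
    exact Submodule.smul_mem _ _ (Submodule.subset_span (one_mem _))
  · intro x hx
    obtain ⟨x, rfl⟩ := Algebra.mem_bot.1 hx
    have h1 : (∃ y ∈ (⊥ : Subalgebra 𝔬 F), algebraMap 𝔬 F x * y = 1) ↔ IsUnit x := by
      constructor
      · rintro ⟨y, hy, h⟩
        obtain ⟨y, rfl⟩ := Algebra.mem_bot.1 hy
        exact IsUnit.of_mul_eq_one y (hinj (by rw [map_mul, h, map_one]))
      · intro h
        obtain ⟨y, hy⟩ := h.exists_right_inv
        exact ⟨_, algebraMap_mem _ y, by rw [← map_mul, hy, map_one]⟩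
    rw [h1, ← mem_nonunits_iff, ← IsLocalRing.mem_maximalIdeal,
      (IsDiscreteValuationRing.irreducible_iff_uniformizer π).1 hπ, Ideal.mem_span_singleton]
    constructor
    · rintro ⟨y, rfl⟩
      exact ⟨_, algebraMap_mem _ y, map_mul _ _ _⟩
    · rintro ⟨y, hy, h⟩
      obtain ⟨y, rfl⟩ := Algebra.mem_bot.1 hy
      exact ⟨y, hinj (by rw [h, map_mul])⟩

/-- The commensurability condition for the restricted monoid. The second component is central and
contributes nothing. -/
lemma isHeckeTriple_rinv (ι : Type*) [Fintype ι] [DecidableEq ι] :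
    IsHeckeTriple (RInv (⊥ : Subalgebra 𝔬 F) ι) ((GLn (⊥ : Subalgebra 𝔬 F) ι).prod ⊥)
      ((GLn (⊥ : Subalgebra 𝔬 F) ι).prod ⊥) := by
  obtain ⟨π, hπ⟩ := IsDiscreteValuationRing.exists_irreducible 𝔬
  have hP := isPrimeOrder_bot (F := F) hπ
  refine IsHeckeTriple.of_diagonal ?_ fun x _ => ?_
  · rintro ⟨g, l⟩ ⟨hg, hl⟩
    obtain rfl : l = 1 := hl
    exact ⟨hg.1, 0, rfl, fun c _ i j => Subalgebra.smul_mem _ (hg.2 i j) c⟩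
  · refine mem_commensurator hP.fg hP.span (MonoidHom.fst _ _)
      (G := (GLn (⊥ : Subalgebra 𝔬 F) ι).prod ⊥) (fun g hg => hg.1)
      (fun g hg h => ⟨h, ?_⟩) (fun g hg h => ⟨h, ?_⟩)
    · have h2 : g.2 = 1 := hg.2
      simp [h2]
    · have h2 : g.2 = 1 := hg.2
      simp [h2]

/-- The local Hecke algebra of the split hermitian modular group. -/
theorem splitHermitian {N : ℕ} (hN : 0 < N) {π : 𝔬} (hπ : Irreducible π) :
    ∃ (_ : IsHeckeTriple (RInv (⊥ : Subalgebra 𝔬 F) (Fin N))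
          ((GLn (⊥ : Subalgebra 𝔬 F) (Fin N)).prod ⊥) ((GLn (⊥ : Subalgebra 𝔬 F) (Fin N)).prod ⊥))
      (T : Fin (N + 1) → RInv (⊥ : Subalgebra 𝔬 F) (Fin N)),
      (∀ i : Fin (N + 1),
        (((T i : (Matrix (Fin N) (Fin N) F)ˣ × Multiplicative ℤ).1 :
            (Matrix (Fin N) (Fin N) F)ˣ) : Matrix (Fin N) (Fin N) F) =
          blockDiag Fin.val (List.replicate (N - i) 1 ++ List.replicate i (algebraMap 𝔬 F π)) ∧
        (T i : (Matrix (Fin N) (Fin N) F)ˣ × Multiplicative ℤ).2 = Multiplicative.ofAdd 1) ∧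
      HeckeAlg.IsAlgIndepGenerators
        (fun i => HeckeAlg.dcoset ((GLn (⊥ : Subalgebra 𝔬 F) (Fin N)).prod ⊥) (T i)) := by
  have hP := isPrimeOrder_bot (F := F) hπ
  obtain ⟨v, hv, hvπ⟩ := hP.exists_valuation
  have hπ0 := hP.ne_zero
  have hevπ : ev v (algebraMap 𝔬 F π) = 1 := by rw [ev, hvπ]; rfl
  have hT' := isHeckeTriple_inv hP.fg hP.span (Fin N)
  have hT := isHeckeTriple_rinv (𝔬 := 𝔬) (F := F) (Fin N)
  have hint : ∀ x : (Matrix (Fin N) (Fin N) F)ˣ,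
      IntMat v (x : Matrix (Fin N) (Fin N) F) ↔ x ∈ Inv (⊥ : Subalgebra 𝔬 F) (Fin N) :=
    fun x => forall_congr' fun i => forall_congr' fun j => hv _
  have hG : ∀ x, x ∈ GLn (⊥ : Subalgebra 𝔬 F) (Fin N) ↔
      x ∈ intGroup v ⊤ (fun _ : Fin N => True) := fun x => by
    rw [mem_intGroup_true, hint, hint]
    exact ⟨fun h => ⟨trivial, h⟩, fun h => h.2⟩
  have hf : ∀ (i : Fin (N + 1)) (j : Fin N),
      (if (j : ℕ) < N - i then 1 else algebraMap 𝔬 F π) ≠ 0 := fun i j => by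
    split_ifs
    exacts [one_ne_zero, hπ0]
  have hexps : ∀ i : Fin (N + 1),
      exps v (diagUnit _ (hf i) : Matrix (Fin N) (Fin N) F) = glWeight N i := fun i => by
    funext j
    rw [exps_diagUnit, glWeight_apply]
    split_ifs
    exacts [ev_one v, hevπ]
  let T : Fin (N + 1) → RInv (⊥ : Subalgebra 𝔬 F) (Fin N) := fun i =>
    ⟨(diagUnit _ (hf i), Multiplicative.ofAdd 1), by
      refine ⟨(hint _).1 (intMat_diagUnit (hf := hf i) fun j => ?_), 1, rfl, fun c hc j k => ?_⟩
      · split_ifs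
        · simp
        · rw [hvπ]; exact zero_le_one
      · rw [pow_one, (IsDiscreteValuationRing.irreducible_iff_uniformizer π).1 hπ,
          Ideal.mem_span_singleton] at hc
        obtain ⟨c, rfl⟩ := hc
        rw [Matrix.smul_apply, inv_apply_of_diag diagUnit_apply_ne, mul_comm π, mul_smul]
        refine Subalgebra.smul_mem _ ?_ c
        rw [← hv, Algebra.smul_def]
        split_ifs
        · rw [coe_diagUnit, Matrix.diagonal_apply_eq]
          split_ifs
          · rw [inv_one, mul_one, hvπ]; exact zero_le_one
          · rw [mul_inv_cancel₀ hπ0]; simp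
        · simp⟩
  have htri := ((gl_elimination v hN).triangular (fun M _ => gl_iwasawa v M) (MulEquiv.refl _) hG
    (fun x => by simpa using (hint x).symm)).prod
    (Δ' := RInv (⊥ : Subalgebra 𝔬 F) (Fin N)) fun x hx => hx.1
  let fst : ℤ ×ₗ Lex (Fin N → ℤ) →+ ℤ := ⟨⟨fun x => (ofLex x).1, rfl⟩, fun _ _ => rfl⟩
  let snd : ℤ ×ₗ Lex (Fin N → ℤ) →+ Lex (Fin N → ℤ) :=
    ⟨⟨fun x => (ofLex x).2, rfl⟩, fun _ _ => rfl⟩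
  let w : Fin (N + 1) → ℤ ×ₗ Lex (Fin N → ℤ) := fun i => toLex (1, glWeight N i)
  let last : Fin N := ⟨N - 1, by omega⟩
  let coord : Fin (N + 1) → (ℤ ×ₗ Lex (Fin N → ℤ) →+ ℤ) := fun i =>
    if h : (i : ℕ) = 0 then fst - (entry last).comp snd
    else (jump ⟨N - i, by omega⟩).comp snd
  have hc0 : ∀ x, coord 0 x = fst x - snd x last := fun x => rfl
  have hc1 : ∀ (i : Fin (N + 1)) (h : (i : ℕ) ≠ 0) x,
      coord i x = jump ⟨N - i, by omega⟩ (snd x) := fun i h x => by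
    simp only [coord, dif_neg h]; rfl
  have hi0 : ∀ {i : Fin (N + 1)}, i ≠ 0 → (i : ℕ) ≠ 0 := fun h => Fin.val_ne_iff.2 h
  have hdual : ∀ i j, coord i (w j) = if i = j then 1 else 0 := by
    intro i j
    rcases eq_or_ne i 0 with rfl | hi
    · rw [hc0]
      change 1 - glWeight N j last = _
      rw [glWeight_apply]
      have : (last : ℕ) = N - 1 := rfl
      simp only [Fin.ext_iff, Fin.val_zero]
      split_ifs <;> omega
    · rw [hc1 i (hi0 hi)]
      change jump _ (glWeight N j) = _
      rw [jump_glWeight (Nat.one_le_iff_ne_zero.2 (hi0 hi)) (by omega) (by omega)]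
      simp only [Fin.ext_iff]
  have hinj : ∀ x ∈ (⊤ : AddSubgroup (ℤ ×ₗ Lex (Fin N → ℤ))), (∀ i, coord i x = 0) → x = 0 := by
    intro x _ hx
    have h1 : snd x = 0 := by
      funext k
      refine eq_zero_of_jump fun i _ => ?_
      have h1 := hx ⟨N - i, by omega⟩
      rw [hc1 _ (by simp only; omega)] at h1
      have h2 : (⟨N - (N - i : ℕ), by omega⟩ : Fin N) = i := Fin.ext (by simp only; omega)
      simp only [h2] at h1
      exact h1
    have h2 : fst x = 0 := by
      have := hx 0
      rw [hc0, h1] at this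
      exact (sub_zero _).symm.trans this
    exact congrArg toLex (Prod.ext h2 h1)
  refine ⟨hT, T, fun i => ⟨?_, rfl⟩, htri.isAlgIndepGenerators T w (fun i D hD hDT _ => ?_)
    (sum_injective_of_coord (nz := fun _ => 1) (coord := coord) hdual fun _ => one_ne_zero)
    (fun D hD hDΔ => exists_sum_of_coord (nz := fun _ => 1) (coord := coord) hdual ⊤
      (fun _ => trivial) hinj trivial fun i => ?_)
    (fun k => {x | x.2.toAdd ≤ k}) (fun k l hkl x hx => ?_) (fun k l x hx y hy => ?_)
    (fun x => ⟨x.1.2.toAdd.toNat, Int.self_le_toNat _⟩) (fun g hg => ?_) (fun _ => 1)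
    (fun _ => one_pos) (fun i => le_refl (1 : ℤ)) fun k D hD hDΔ hDk c hc => ?_⟩
  · change Matrix.diagonal _ = Matrix.diagonal _
    congr 1
    funext j
    rw [getD_replicate_append _ _ _ (by omega)]
  · obtain ⟨hDΔ, hmk⟩ := HeckeAlg.rc_mem.1 hDT
    rw [eq_comm, HeckeAlg.mk_eq] at hmk
    obtain ⟨⟨a, a'⟩, ⟨ha, ha'⟩, ⟨b, b'⟩, ⟨hb, hb'⟩, h⟩ := hmk
    obtain rfl : a' = 1 := ha'
    obtain rfl : b' = 1 := hb'
    have h1 : D.1 = a * diagUnit _ (hf i) * b := congrArg Prod.fst h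
    have h2 : D.2 = Multiplicative.ofAdd 1 := (congrArg Prod.snd h).trans (by simp [T])
    refine congrArg toLex (Prod.ext (by simp [h2]) ?_)
    refine (exps_eq_of_gl hN hD diagUnit_apply_ne (fun j k hjk => ?_)
      ⟨a, (hG a).1 ha, b, (hG b).1 hb, h1⟩).trans (hexps i)
    rw [hexps]
    exact glWeight_mono _ hjk
  · have hDd : ∀ i j, i ≠ j → (D.1 : Matrix (Fin N) (Fin N) F) i j = 0 := hD.2.1
    have hDm : ∀ i j, i ≤ j → exps v (D.1 : Matrix (Fin N) (Fin N) F) i ≤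
        exps v (D.1 : Matrix (Fin N) (Fin N) F) j := fun i j hij => hD.exps_le_of_gl hN hij
    rcases eq_or_ne i 0 with rfl | hi
    · obtain ⟨l, hl, hlD⟩ := hDΔ.2
      have h1 := hlD (π ^ l) (Ideal.pow_mem_pow
        ((IsDiscreteValuationRing.irreducible_iff_uniformizer π).1 hπ ▸
          Ideal.mem_span_singleton_self π) l) last last
      have hne := lowerGroup_diag_ne (IsLower.of_diag hDd : D.1 ∈ lowerGroup F N) last
      rw [Matrix.smul_apply, inv_apply_of_diag hDd, if_pos rfl, Algebra.smul_def, map_pow,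
        ← hv] at h1
      have h2 := (le_v_iff v (mul_ne_zero (pow_ne_zero l hπ0) (inv_ne_zero hne)) 0).1 h1
      rw [ev_mul v (pow_ne_zero l hπ0) (inv_ne_zero hne), ev_pow v hπ0, hevπ, ev_inv v hne] at h2
      obtain ⟨m, hm⟩ := Int.eq_ofNat_of_zero_le (show 0 ≤ (l : ℤ) -
        exps v (D.1 : Matrix (Fin N) (Fin N) F) last by rw [exps_apply]; exact (by linarith))
      refine ⟨m, ?_⟩
      rw [hc0, mul_one, ← hm]
      change D.2.toAdd - exps v (D.1 : Matrix (Fin N) (Fin N) F) last = _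
      rw [hl]; rfl
    · obtain ⟨k, hk⟩ := Int.eq_ofNat_of_zero_le (jump_nonneg
        (k := (⟨N - (i : ℕ), by have := hi0 hi; omega⟩ : Fin N))
        (exps_nonneg hD.2.1 ((hint _).2 hDΔ.1) _) fun j hj => hDm _ _ (by rw [Fin.le_def]; omega))
      exact ⟨k, by rw [hc1 i (hi0 hi), mul_one]; exact hk⟩
  · exact le_trans (show x.2.toAdd ≤ (k : ℤ) from hx) (Nat.cast_le.2 hkl)
  · change (x.2 * y.2).toAdd ≤ _
    rw [toAdd_mul, Nat.cast_add]
    exact add_le_add hx hy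
  · have h2 : g.2 = 1 := hg.2
    simp [h2]
  · have h1 := congrArg fst hc
    change D.2.toAdd = _ at h1
    rw [Finsupp.sum, map_sum] at h1
    simp only [map_nsmul] at h1
    have h2 : D.2.toAdd ≤ k := hDk
    rw [h1] at h2
    have h3 : ∀ i, fst (w i) = 1 := fun _ => rfl
    simp only [h3, nsmul_eq_mul, mul_one] at h2
    rw [Finsupp.sum]
    simp only [mul_one]
    exact_mod_cast h2

end

end LocalHecke

/-! ### The Hecke algebra of a group of similitudes of a skew-hermitian form -/

namespace LocalHecke

section skew

variable {K : Type*} [DivisionRing K] {N : ℕ} {v : AddValuation K (WithTop ℤ)}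

/-- The exponent at a pivot is at most those at the indices between it and its partner. -/
lemma DomFrom.exps_le_of_inner {Γ : Subgroup (Matrix (Fin (N + N)) (Fin (N + N)) K)ˣ} {t : ℕ}
    {D : (Matrix (Fin (N + N)) (Fin (N + N)) K)ˣ} (hN : 0 < N)
    (h : DomFrom v Γ t Inner (fun k => ⟨min k (N + N - 1), by omega⟩) 0 D)
    {i j : Fin (N + N)} (hi : (i : ℕ) < t) (hij : i ≤ j) (hji : j ≤ i.rev) :
    exps v (D : Matrix (Fin (N + N)) (Fin (N + N)) K) i ≤
      exps v (D : Matrix (Fin (N + N)) (Fin (N + N)) K) j := by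
  rw [exps_le_exps_iff h.2.1]
  have h1 := h.2.2 i (Nat.zero_le _) hi j ⟨hij, Fin.le_rev_iff.1 hji⟩
  have h2 : (⟨min (i : ℕ) (N + N - 1), by omega⟩ : Fin (N + N)) = i :=
    Fin.ext (min_eq_left (by omega))
  simp only [h2] at h1
  exact h1

/-- Dominant exponents for a skew form are increasing. -/
lemma DomFrom.exps_le_of_skew {Γ : Subgroup (Matrix (Fin (N + N)) (Fin (N + N)) K)ˣ}
    {D : (Matrix (Fin (N + N)) (Fin (N + N)) K)ˣ} (hN : 0 < N)
    (h : DomFrom v Γ N Inner (fun k => ⟨min k (N + N - 1), by omega⟩) 0 D)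
    (hp : exps v (D : Matrix (Fin (N + N)) (Fin (N + N)) K) ∈ pairedExps (N + N))
    {i j : Fin (N + N)} (hij : i ≤ j) :
    exps v (D : Matrix (Fin (N + N)) (Fin (N + N)) K) i ≤
      exps v (D : Matrix (Fin (N + N)) (Fin (N + N)) K) j := by
  obtain ⟨c, hc⟩ := hp
  by_cases hi : (i : ℕ) < N ∧ j ≤ i.rev
  · exact h.exps_le_of_inner hN hi.1 hij hi.2
  · have h1 := hc i
    have h2 := hc j
    have h3 := h.exps_le_of_inner hN (i := j.rev) (j := i.rev)
      (by simp only [Fin.le_def, Fin.val_rev] at hi hij ⊢; omega) (Fin.rev_le_rev.2 hij)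
      (by simp only [Fin.le_def, Fin.val_rev] at hi hij ⊢; omega)
    omega

/-- The exponents `(0, …, 0, e, …, e)` for `i = 0`, and the exponents
`(0, …, 0, 1, …, 1, 2, …, 2)`, with `2 i` ones in the middle, for `i ≠ 0`. -/
def skewWeight (N : ℕ) (e : ℤ) (i : ℕ) : Lex (Fin (N + N) → ℤ) := toLex fun j =>
  if i = 0 then (if (j : ℕ) < N then 0 else e)
  else if (j : ℕ) < N - i then 0 else if (j : ℕ) < N + i then 1 else 2

lemma skewWeight_apply (e : ℤ) (i : ℕ) (j : Fin (N + N)) : skewWeight N e i j =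
    if i = 0 then (if (j : ℕ) < N then 0 else e)
    else if (j : ℕ) < N - i then 0 else if (j : ℕ) < N + i then 1 else 2 := rfl

lemma skewWeight_mono {e : ℤ} (he : 0 < e) (i : ℕ) {j k : Fin (N + N)} (hjk : j ≤ k) :
    skewWeight N e i j ≤ skewWeight N e i k := by
  have : (j : ℕ) ≤ k := hjk
  rw [skewWeight_apply, skewWeight_apply]
  split_ifs <;> omega

lemma skewWeight_mem_pairedExps (e : ℤ) {i : ℕ} (hi : i ≤ N) :
    skewWeight N e i ∈ pairedExps (N + N) := by
  refine ⟨if i = 0 then e else 2, fun j => ?_⟩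
  rw [skewWeight_apply, skewWeight_apply, Fin.val_rev]
  split_ifs <;> omega

/-- The additive functions dual to the exponents `skewWeight N e i`. -/
def skewCoord (hN : 0 < N) (i : ℕ) : Lex (Fin (N + N) → ℤ) →+ ℤ :=
  if i = 0 then jump ⟨N, by omega⟩ else jump ⟨N - i, by omega⟩

lemma skewCoord_zero (hN : 0 < N) (x : Lex (Fin (N + N) → ℤ)) :
    skewCoord hN 0 x = x ⟨N, by omega⟩ - x ⟨N - 1, by omega⟩ := by
  rw [skewCoord, if_pos rfl, jump_of_ne hN.ne']

lemma skewCoord_of_ne (hN : 0 < N) {i : ℕ} (hi : i ≠ 0) (x : Lex (Fin (N + N) → ℤ)) :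
    skewCoord hN i x = jump ⟨N - i, by omega⟩ x := by
  rw [skewCoord, if_neg hi]

lemma skewCoord_skewWeight (hN : 0 < N) (e : ℤ) {i j : ℕ} (hi : i ≤ N) (hj : j ≤ N) :
    skewCoord hN i (skewWeight N e j) = if i = j then (if i = 0 then e else 1) else 0 := by
  rcases Nat.eq_zero_or_pos i with rfl | h0
  · rw [skewCoord_zero, skewWeight_apply, skewWeight_apply]
    simp only
    split_ifs <;> omega
  · rw [skewCoord_of_ne hN h0.ne']
    by_cases h : i = N
    · subst h
      rw [jump_zero (by simp), skewWeight_apply]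
      simp only
      split_ifs <;> omega
    · rw [jump_of_ne (by simp only; omega), skewWeight_apply, skewWeight_apply]
      simp only
      split_ifs <;> omega

/-- The coordinates separate the paired exponents. -/
lemma eq_zero_of_skewCoord (hN : 0 < N) {x : Lex (Fin (N + N) → ℤ)} (hx : x ∈ pairedExps (N + N))
    (h : ∀ i ≤ N, skewCoord hN i x = 0) : x = 0 := by
  have h1 : ∀ k : Fin (N + N), (k : ℕ) < N → x k = 0 := fun k hk => eq_zero_of_jump fun i hi => by
    have hi' : (i : ℕ) < N := lt_of_le_of_lt hi hk
    have h1 := h (N - i) (Nat.sub_le _ _)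
    rw [skewCoord_of_ne hN (by omega)] at h1
    have h2 : (⟨N - (N - i : ℕ), by omega⟩ : Fin (N + N)) = i := Fin.ext (by simp only; omega)
    simp only [h2] at h1
    exact h1
  obtain ⟨c, hc⟩ := hx
  have h2 := h 0 (Nat.zero_le _)
  rw [skewCoord_zero, h1 ⟨N - 1, by omega⟩ (by simp only; omega), sub_zero] at h2
  have h3 := hc ⟨N, by omega⟩
  rw [h2, h1 _ (by rw [Fin.val_rev]; simp only; omega)] at h3
  funext k
  change x k = 0
  by_cases hk : (k : ℕ) < N
  · exact h1 k hk
  · have h4 := hc k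
    rw [h1 k.rev (by rw [Fin.val_rev]; omega)] at h4
    omega

variable [StarRing K] {σ : Signs K (N + N)} {F : Type*} [Field F] [Algebra F K]

/-- The Hecke algebra of a group of similitudes of a skew-hermitian form is a polynomial ring. The
number `e` generates the possible differences between the middle exponents. -/
theorem skew_isAlgIndepGenerators (hN : 0 < N) (hε : σ.ε = -1) (hv : ∀ x, v (star x) = v x)
    {𝒢 : Type*} [Group 𝒢] {Δ : Submonoid 𝒢} {G : Subgroup 𝒢} [IsHeckeTriple Δ G G]
    (ρ : 𝒢 ≃* (Matrix (Fin (N + N)) (Fin (N + N)) K)ˣ)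
    (hG : ∀ x, x ∈ G ↔ ρ x ∈ intGroup v (σ.simGroup F) (fun _ : Fin (N + N) => True))
    (hΔ : ∀ x, x ∈ Δ ↔ ρ x ∈ σ.simGroup F ∧
      IntMat v (ρ x : Matrix (Fin (N + N)) (Fin (N + N)) K))
    {e : ℤ} (he : 0 < e) (hdvd : ∀ D ∈ σ.simGroup F,
      (∀ i j, i ≠ j → (D : Matrix (Fin (N + N)) (Fin (N + N)) K) i j = 0) → ∀ i,
        e ∣ exps v (D : Matrix (Fin (N + N)) (Fin (N + N)) K) i.rev -
          exps v (D : Matrix (Fin (N + N)) (Fin (N + N)) K) i)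
    (T : Fin (N + 1) → Δ)
    (hTd : ∀ l, ∀ i j, i ≠ j → (ρ (T l) : Matrix (Fin (N + N)) (Fin (N + N)) K) i j = 0)
    (hTw : ∀ l, exps v (ρ (T l) : Matrix (Fin (N + N)) (Fin (N + N)) K) = skewWeight N e l) :
    HeckeAlg.IsAlgIndepGenerators fun i => HeckeAlg.dcoset G (T i) := by
  have hDm : ∀ D, DomFrom v (σ.simGroup F) N Inner (fun k => ⟨min k (N + N - 1), by omega⟩) 0 D →
      ∀ i j, i ≤ j → exps v (D : Matrix (Fin (N + N)) (Fin (N + N)) K) i ≤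
        exps v (D : Matrix (Fin (N + N)) (Fin (N + N)) K) j := fun D hD i j hij =>
    hD.exps_le_of_skew hN (Signs.exps_mem_pairedExps hv hD.1 hD.2.1) hij
  refine (skew_elimination F hN hε hv).isAlgIndepGenerators (skew_iwasawa F hN hε hv) ρ hG hΔ T
    (fun l => skewWeight N e l) hTd hTw (fun l D hD h _ => ?_)
    (fun l => skewCoord hN l) (fun l => if (l : ℕ) = 0 then e else 1) (fun l => ?_)
    (fun i j => ?_) (pairedExps (N + N)) (fun l => skewWeight_mem_pairedExps e (by omega))
    (fun D hD hDd => Signs.exps_mem_pairedExps hv hD hDd)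
    (fun x hx hx' => eq_zero_of_skewCoord hN hx fun i hi => hx' ⟨i, by omega⟩)
    (fun D hD hDI i => ?_) ⟨N + N - 1, by omega⟩ (fun i j => ?_) (fun i => ?_)
  · obtain ⟨g, hg, g', hg', h⟩ := h
    rw [← hTw l]
    refine funext fun i => exps_eq_of_double_coset hg hg' h hD.2.1 (hTd l) 1 1 (hDm D hD)
      (fun i j hij => ?_) i
    rw [hTw]
    exact skewWeight_mono he l hij
  · split_ifs <;> omega
  · rw [skewCoord_skewWeight hN e (by omega) (by omega)]
    simp only [Fin.ext_iff]
  · rcases Nat.eq_zero_or_pos (i : ℕ) with h0 | h0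
    · rw [h0, skewCoord_zero, if_pos rfl]
      obtain ⟨k, hk⟩ := hdvd D hD.1 hD.2.1 ⟨N - 1, by omega⟩
      have h1 : (⟨N - 1, by omega⟩ : Fin (N + N)).rev = ⟨N, by omega⟩ :=
        Fin.ext (by rw [Fin.val_rev]; simp only; omega)
      rw [h1] at hk
      have h2 := hDm D hD ⟨N - 1, by omega⟩ ⟨N, by omega⟩ (Fin.mk_le_mk.2 (Nat.sub_le _ _))
      obtain ⟨m, rfl⟩ := Int.eq_ofNat_of_zero_le (show 0 ≤ k by
        by_contra hk0
        have : e * k < 0 := mul_neg_of_pos_of_neg he (by omega)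
        omega)
      exact ⟨m, by rw [hk, mul_comm]⟩
    · rw [skewCoord_of_ne hN h0.ne', if_neg h0.ne']
      obtain ⟨k, hk⟩ := Int.eq_ofNat_of_zero_le (jump_nonneg
        (k := (⟨N - (i : ℕ), by omega⟩ : Fin (N + N))) (exps_nonneg hD.2.1 hDI _)
        fun j hj => hDm D hD _ _ (by rw [Fin.le_def]; omega))
      exact ⟨k, by rw [hk, mul_one]⟩
  · exact skewWeight_mono he _ (by rw [Fin.le_def]; simp only; omega)
  · rw [skewWeight_apply]
    simp only
    split_ifs <;> omega

end skew

end LocalHecke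

/-! ### The modular groups over an order with involution -/

namespace LocalHecke

section similitudes

variable {𝔬 : Type*} [CommRing 𝔬] [IsDomain 𝔬] {F : Type*} [Field F] [Algebra 𝔬 F]
  [IsFractionRing 𝔬 F] {A : Type*} [Ring A] [StarRing A] [Algebra F A] [Algebra 𝔬 A]
  [IsScalarTower 𝔬 F A] {n : ℕ} {M : Matrix (Fin n ⊕ Fin n) (Fin n ⊕ Fin n) A}

lemma hasSimilitude_algebraMap {m : 𝔬} :
    HasSimilitude M (algebraMap 𝔬 F m) ↔ HasSimilitude M m := by
  unfold HasSimilitude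
  rw [algebraMap_smul]

lemma HasSimilitude.apply {c : F} (h : HasSimilitude M c) (i : Fin n) :
    (Mᴴ * J A n * M) (Sum.inl i) (Sum.inr i) = algebraMap F A c := by
  rw [h, Matrix.smul_apply, J, Matrix.fromBlocks_apply₁₂, Matrix.one_apply_eq,
    Algebra.algebraMap_eq_smul_one]

/-- An involution stable order that meets the base field in its valuation ring. -/
structure IsStarOrder (F : Type*) [Field F] [Algebra 𝔬 F] [Algebra F A] (Λ : Subalgebra 𝔬 A) :
    Prop where
  fg : (Subalgebra.toSubmodule Λ).FG
  span : Submodule.span F (Λ : Set A) = ⊤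
  star_mem : ∀ x ∈ Λ, star x ∈ Λ
  mem_range : ∀ a : F, algebraMap F A a ∈ Λ → a ∈ (algebraMap 𝔬 F).range

variable {Λ : Subalgebra 𝔬 A} (h : IsStarOrder F Λ)
include h

/-- The similitude of a matrix over the order lies in the valuation ring of the base field. -/
lemma IsStarOrder.exists_similitude (hn : 0 < n) (hM : ∀ i j, M i j ∈ Λ) {c : F} (hc : c ≠ 0)
    (hMc : HasSimilitude M c) : ∃ m : 𝔬, m ≠ 0 ∧ HasSimilitude M m ∧ algebraMap 𝔬 F m = c := by
  obtain ⟨m, hm⟩ := h.mem_range c (by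
    rw [← hMc.apply ⟨0, hn⟩]
    refine mul_entries (mul_entries (fun i j => ?_) fun i j => ?_) hM _ _
    · rw [Matrix.conjTranspose_apply]; exact h.star_mem _ (hM j i)
    · rcases i with i | i <;> rcases j with j | j
      · exact zero_mem Λ
      · exact one_entries Λ i j
      · exact neg_mem (one_entries Λ i j)
      · exact zero_mem Λ)
  refine ⟨m, ?_, ?_, hm⟩
  · rintro rfl
    exact hc (hm.symm.trans (map_zero _))
  · rwa [← hm, hasSimilitude_algebraMap] at hMc

/-- The similitude of a matrix that is invertible over the order is a unit. -/
lemma IsStarOrder.exists_unit_similitude (hn : 0 < n)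
    {M : (Matrix (Fin n ⊕ Fin n) (Fin n ⊕ Fin n) A)ˣ} (hM : M ∈ GLn Λ (Fin n ⊕ Fin n)) {c : F}
    (hc : c ≠ 0) (hMc : HasSimilitude (M : Matrix (Fin n ⊕ Fin n) (Fin n ⊕ Fin n) A) c) :
    ∃ m : 𝔬ˣ, HasSimilitude (M : Matrix (Fin n ⊕ Fin n) (Fin n ⊕ Fin n) A) (m : 𝔬) ∧
      algebraMap 𝔬 F m = c := by
  obtain ⟨m, -, hm, hmc⟩ := h.exists_similitude hn hM.1 hc hMc
  obtain ⟨m', -, -, hmc'⟩ := h.exists_similitude hn hM.2 (inv_ne_zero hc)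
    (HasSimilitude.inv (m := Units.mk0 c hc) hMc)
  have h1 : m * m' = 1 := IsFractionRing.injective 𝔬 F (by
    rw [map_mul, hmc, hmc', mul_inv_cancel₀ hc, map_one])
  exact ⟨⟨m, m', h1, by rw [mul_comm, h1]⟩, hm, hmc⟩

omit h in
/-- Conjugation by a similitude preserves similitudes. -/
lemma HasSimilitude.conj {x g : (Matrix (Fin n ⊕ Fin n) (Fin n ⊕ Fin n) A)ˣ} {m u : F} (hm : m ≠ 0)
    (hx : HasSimilitude (x : Matrix (Fin n ⊕ Fin n) (Fin n ⊕ Fin n) A) m)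
    (hg : HasSimilitude (g : Matrix (Fin n ⊕ Fin n) (Fin n ⊕ Fin n) A) u) :
    HasSimilitude ((x * g * x⁻¹ : (Matrix (Fin n ⊕ Fin n) (Fin n ⊕ Fin n) A)ˣ) :
        Matrix (Fin n ⊕ Fin n) (Fin n ⊕ Fin n) A) u ∧
      HasSimilitude ((x⁻¹ * g * x : (Matrix (Fin n ⊕ Fin n) (Fin n ⊕ Fin n) A)ˣ) :
        Matrix (Fin n ⊕ Fin n) (Fin n ⊕ Fin n) A) u := by
  have hx' := HasSimilitude.inv (m := Units.mk0 m hm) hx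
  have h1 := (hx.mul hg).mul hx'
  have h2 := (hx'.mul hg).mul hx
  rw [Units.val_inv_eq_inv_val, Units.val_mk0] at h1 h2
  rw [mul_comm m, mul_inv_cancel_right₀ hm] at h1
  rw [mul_comm m⁻¹, inv_mul_cancel_right₀ hm] at h2
  exact ⟨h1, h2⟩

variable [IsDiscreteValuationRing 𝔬] [Finite (IsLocalRing.ResidueField 𝔬)]

/-- The commensurability condition for the modular groups. -/
lemma IsStarOrder.isHeckeTriple (n : ℕ) :
    IsHeckeTriple (Delta Λ n) (Spn Λ n) (Spn Λ n) := by
  refine IsHeckeTriple.of_diagonal ?_ fun x hx => ?_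
  · rintro g ⟨hg, m, hm⟩
    exact ⟨hg.1, m, m.ne_zero, hm⟩
  · obtain ⟨-, m, hm, hxm⟩ := hx
    have hm' : algebraMap 𝔬 F m ≠ 0 := fun h0 =>
      hm (IsFractionRing.injective 𝔬 F (h0.trans (map_zero _).symm))
    rw [← hasSimilitude_algebraMap (F := F)] at hxm
    refine mem_commensurator h.fg h.span (MonoidHom.id _) (G := Spn Λ n) (fun g hg => hg.1)
      (fun g hg hc => ⟨hc, ?_⟩) (fun g hg hc => ⟨hc, ?_⟩)
    · obtain ⟨u, hu⟩ := hg.2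
      rw [← hasSimilitude_algebraMap (F := F)] at hu
      exact ⟨u, hasSimilitude_algebraMap.1 (hxm.conj hm' hu).1⟩
    · obtain ⟨u, hu⟩ := hg.2
      rw [← hasSimilitude_algebraMap (F := F)] at hu
      exact ⟨u, hasSimilitude_algebraMap.1 (hxm.conj hm' hu).2⟩

end similitudes

section index

/-- The numbering of the indices for which the form `J` pairs the index `i` with `Fin.rev i`. -/
def modIndex (n : ℕ) : Fin n ⊕ Fin n ≃ Fin (n + n) :=
  (Equiv.sumCongr (Equiv.refl _) Fin.revPerm).trans finSumFinEquiv

lemma modIndex_inl {n : ℕ} (i : Fin n) : (modIndex n (Sum.inl i) : ℕ) = i := rfl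

lemma modIndex_inr {n : ℕ} (i : Fin n) : (modIndex n (Sum.inr i) : ℕ) = n + n - 1 - i := by
  change n + (i.rev : ℕ) = _
  rw [Fin.val_rev]
  omega

lemma rev_modIndex_inl {n : ℕ} (i : Fin n) :
    (modIndex n (Sum.inl i)).rev = modIndex n (Sum.inr i) :=
  Fin.ext (by rw [Fin.val_rev, modIndex_inl, modIndex_inr]; omega)

lemma rev_modIndex_inr {n : ℕ} (i : Fin n) :
    (modIndex n (Sum.inr i)).rev = modIndex n (Sum.inl i) := by
  rw [← rev_modIndex_inl, Fin.rev_rev]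

/-- The signs of the form `J`. -/
def skewSigns (K : Type*) [Ring K] (n : ℕ) : Signs K (n + n) where
  s i := if (i : ℕ) < n then 1 else -1
  ε := -1
  s_eq i := by split_ifs <;> simp
  ε_eq := Or.inr rfl
  s_rev i := by
    rw [Fin.val_rev]
    split_ifs <;> first | omega | simp
  rev_ne i h := by
    have := congrArg Fin.val h
    rw [Fin.val_rev] at this
    omega

variable {K : Type*} [Ring K] {n : ℕ}

lemma skewSigns_J : (skewSigns K n).J = Matrix.reindexAlgEquiv ℤ K (modIndex n) (J K n) := by
  ext i j
  obtain ⟨i, rfl⟩ := (modIndex n).surjective i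
  obtain ⟨j, rfl⟩ := (modIndex n).surjective j
  rw [Matrix.coe_reindexAlgEquiv, Matrix.reindex_apply, Matrix.submatrix_apply,
    Equiv.symm_apply_apply, Equiv.symm_apply_apply, Signs.J]
  rcases i with i | i <;> rcases j with j | j
  · rw [rev_modIndex_inl, if_neg (by simp)]; rfl
  · rw [rev_modIndex_inl]
    change _ = (1 : Matrix (Fin n) (Fin n) K) i j
    simp only [skewSigns, modIndex_inl, i.2, if_true, Matrix.one_apply, (modIndex n).apply_eq_iff_eq,
      Sum.inr.injEq, eq_comm]
  · rw [rev_modIndex_inr]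
    change _ = -(1 : Matrix (Fin n) (Fin n) K) i j
    have : ¬ (n + n - 1 - (i : ℕ) < n) := by omega
    simp only [skewSigns, modIndex_inr, this, if_false, Matrix.one_apply, (modIndex n).apply_eq_iff_eq,
      Sum.inl.injEq, eq_comm]
    split_ifs <;> simp
  · rw [rev_modIndex_inr, if_neg (by simp)]; rfl

/-- In the ordering `modIndex`, similitudes are those of the form with the signs `skewSigns`. -/
lemma sim_reindex [StarRing K] {F : Type*} [Field F] [Algebra F K]
    (M : Matrix (Fin n ⊕ Fin n) (Fin n ⊕ Fin n) K) (c : F) :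
    (Matrix.reindexAlgEquiv ℤ K (modIndex n) M)ᴴ * (skewSigns K n).J *
      Matrix.reindexAlgEquiv ℤ K (modIndex n) M = c • (skewSigns K n).J ↔ HasSimilitude M c := by
  have h1 : (Matrix.reindexAlgEquiv ℤ K (modIndex n) M)ᴴ =
      Matrix.reindexAlgEquiv ℤ K (modIndex n) Mᴴ := rfl
  have h2 : c • Matrix.reindexAlgEquiv ℤ K (modIndex n) (J K n) =
      Matrix.reindexAlgEquiv ℤ K (modIndex n) (c • J K n) := rfl
  rw [skewSigns_J, h1, h2, ← map_mul, ← map_mul]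
  exact (Matrix.reindexAlgEquiv ℤ K (modIndex n)).injective.eq_iff

/-- A diagonal matrix whose paired entries have product `m` has similitude `m`. -/
lemma hasSimilitude_diagonal [StarRing K] {𝔬 : Type*} [CommRing 𝔬] [Algebra 𝔬 K]
    {f : Fin n ⊕ Fin n → K} {m : 𝔬}
    (h : ∀ i, star (f (Sum.inl i)) * f (Sum.inr i) = algebraMap 𝔬 K m)
    (h' : ∀ i, star (f (Sum.inr i)) * f (Sum.inl i) = algebraMap 𝔬 K m) :
    HasSimilitude (Matrix.diagonal f) m := by
  unfold HasSimilitude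
  ext i j
  rw [Matrix.diagonal_conjTranspose, Matrix.mul_diagonal, Matrix.diagonal_mul, Pi.star_apply,
    Matrix.smul_apply]
  have h1 : ∀ i j, (1 : Matrix (Fin n) (Fin n) K) i j ≠ 0 → i = j := fun i j hij =>
    by_contra fun h => hij (Matrix.one_apply_ne h)
  rcases i with i | i <;> rcases j with j | j
  · simp [J]
  · by_cases hij : i = j
    · subst hij
      simp [J, h, Algebra.algebraMap_eq_smul_one]
    · simp [J, hij]
  · by_cases hij : i = j
    · subst hij
      simp [J, h', Algebra.algebraMap_eq_smul_one]
    · simp [J, hij]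
  · simp [J]

end index

section modular

variable {𝔬 : Type*} [CommRing 𝔬] [IsDomain 𝔬] [IsDiscreteValuationRing 𝔬]
  [Finite (IsLocalRing.ResidueField 𝔬)] {F : Type*} [Field F] [Algebra 𝔬 F] [IsFractionRing 𝔬 F]
  {K : Type*} [DivisionRing K] [StarRing K] [Algebra F K] [Algebra 𝔬 K] [IsScalarTower 𝔬 F K]
  {O : Subalgebra 𝔬 K} {π : K} {v : AddValuation K (WithTop ℤ)}

lemma IsPrimeOrder.isStarOrder (hP : IsPrimeOrder F O π) (hv : ∀ x, 0 ≤ v x ↔ x ∈ O)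
    (hs : ∀ a : F, star (algebraMap F K a) = algebraMap F K a) : IsStarOrder F O :=
  ⟨hP.fg, hP.span, fun _ => hP.star_mem hv hs, fun a => (hP.algebraMap_mem_iff a).1⟩

/-- The local Hecke algebra of the modular group of a valuation ring with involution, with
generators given by their lists of diagonal entries. -/
theorem modular_of_list (hP : IsPrimeOrder F O π) (hv : ∀ x, 0 ≤ v x ↔ x ∈ O) (hvπ : v π = 1)
    (hs : ∀ a : F, star (algebraMap F K a) = algebraMap F K a) {n : ℕ} (hn : 0 < n) {e : ℤ}
    (he : 0 < e) (he2 : e ∣ 2) (hdvd : ∀ a : F, a ≠ 0 → e ∣ ev v (algebraMap F K a))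
    (L : Fin (n + 1) → List K) (hL : ∀ l j, (L l).getD (sumPos n j) 0 ≠ 0)
    (hLe : ∀ l j, ev v ((L l).getD (sumPos n j) 0) = skewWeight n e l (modIndex n j))
    (hLm : ∀ l, ∃ a : F, ∀ j : Fin n,
      star ((L l).getD (sumPos n (Sum.inl j)) 0) * (L l).getD (sumPos n (Sum.inr j)) 0 =
        algebraMap F K a) :
    ∃ (_ : IsHeckeTriple (Delta O n) (Spn O n) (Spn O n)) (T : Fin (n + 1) → Delta O n),
      (∀ i, ((T i : (Matrix (Fin n ⊕ Fin n) (Fin n ⊕ Fin n) K)ˣ) : Matrix _ _ K) =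
        blockDiag (sumPos n) (L i)) ∧
      HeckeAlg.IsAlgIndepGenerators (fun i => HeckeAlg.dcoset (Spn O n) (T i)) := by
  have hO := hP.isStarOrder hv hs
  have hT := hO.isHeckeTriple n
  let ρ : (Matrix (Fin n ⊕ Fin n) (Fin n ⊕ Fin n) K)ˣ ≃*
      (Matrix (Fin (n + n)) (Fin (n + n)) K)ˣ :=
    Units.mapEquiv (Matrix.reindexAlgEquiv ℤ K (modIndex n)).toMulEquiv
  have hρ : ∀ x i j, (ρ x : Matrix (Fin (n + n)) (Fin (n + n)) K) i j =
      (x : Matrix (Fin n ⊕ Fin n) (Fin n ⊕ Fin n) K) ((modIndex n).symm i) ((modIndex n).symm j) :=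
    fun x i j => rfl
  have hint : ∀ x : (Matrix (Fin n ⊕ Fin n) (Fin n ⊕ Fin n) K)ˣ,
      IntMat v (ρ x : Matrix (Fin (n + n)) (Fin (n + n)) K) ↔ x ∈ Inv O (Fin n ⊕ Fin n) := by
    intro x
    refine ⟨fun h i j => ?_, fun h i j => (hv _).2 (h _ _)⟩
    have := (hv _).1 (h (modIndex n i) (modIndex n j))
    rwa [hρ, Equiv.symm_apply_apply, Equiv.symm_apply_apply] at this
  have hsim : ∀ x : (Matrix (Fin n ⊕ Fin n) (Fin n ⊕ Fin n) K)ˣ, ρ x ∈ (skewSigns K n).simGroup F ↔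
      ∃ c : F, c ≠ 0 ∧ HasSimilitude (x : Matrix (Fin n ⊕ Fin n) (Fin n ⊕ Fin n) K) c := fun x =>
    exists_congr fun c => and_congr_right fun _ => sim_reindex _ c
  have hne : ∀ m : 𝔬, m ≠ 0 → algebraMap 𝔬 F m ≠ 0 := fun m hm h0 =>
    hm (IsFractionRing.injective 𝔬 F (h0.trans (map_zero _).symm))
  have hΔ : ∀ x, x ∈ Delta O n ↔ ρ x ∈ (skewSigns K n).simGroup F ∧
      IntMat v (ρ x : Matrix (Fin (n + n)) (Fin (n + n)) K) := by
    intro x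
    rw [hint, hsim]
    constructor
    · rintro ⟨hx, m, hm, hxm⟩
      exact ⟨⟨_, hne m hm, hasSimilitude_algebraMap.2 hxm⟩, hx⟩
    · rintro ⟨⟨c, hc, hxc⟩, hx⟩
      obtain ⟨m, hm, hxm, -⟩ := hO.exists_similitude hn hx hc hxc
      exact ⟨hx, m, hm, hxm⟩
  have hG : ∀ x, x ∈ Spn O n ↔
      ρ x ∈ intGroup v ((skewSigns K n).simGroup F) (fun _ : Fin (n + n) => True) := by
    intro x
    rw [mem_intGroup_true, ← map_inv, hint, hint, hsim]
    constructor
    · rintro ⟨hx, m, hxm⟩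
      exact ⟨⟨_, hne _ m.ne_zero, hasSimilitude_algebraMap.2 hxm⟩, hx⟩
    · rintro ⟨⟨c, hc, hxc⟩, hx⟩
      obtain ⟨m, hxm, -⟩ := hO.exists_unit_similitude hn hx hc hxc
      exact ⟨hx, m, hxm⟩
  let D : Fin (n + 1) → (Matrix (Fin (n + n)) (Fin (n + n)) K)ˣ := fun l =>
    diagUnit (fun j => (L l).getD (sumPos n ((modIndex n).symm j)) 0) fun j => hL l _
  have hDw : ∀ l, exps v (D l : Matrix (Fin (n + n)) (Fin (n + n)) K) = skewWeight n e l := by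
    intro l
    funext j
    rw [exps_diagUnit, hLe, Equiv.apply_symm_apply]
  have hDT : ∀ l, ((ρ.symm (D l) : (Matrix (Fin n ⊕ Fin n) (Fin n ⊕ Fin n) K)ˣ) :
      Matrix (Fin n ⊕ Fin n) (Fin n ⊕ Fin n) K) = blockDiag (sumPos n) (L l) := by
    intro l
    ext i j
    have h1 := hρ (ρ.symm (D l)) (modIndex n i) (modIndex n j)
    rw [Equiv.symm_apply_apply, Equiv.symm_apply_apply, MulEquiv.apply_symm_apply] at h1
    rw [← h1, coe_diagUnit, blockDiag, Matrix.diagonal_apply, Matrix.diagonal_apply]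
    simp
  have hmem : ∀ l, ρ.symm (D l) ∈ Delta O n := by
    intro l
    rw [hΔ, hsim, MulEquiv.apply_symm_apply, hDT]
    refine ⟨?_, intMat_diagUnit fun j => (le_v_iff v (hL l _) 0).2 ?_⟩
    · obtain ⟨a, ha⟩ := hLm l
      refine ⟨a, ?_, hasSimilitude_diagonal ha fun j => ?_⟩
      · rintro rfl
        have := ha ⟨0, hn⟩
        rw [map_zero] at this
        exact mul_ne_zero (star_ne_zero.2 (hL l _)) (hL l _) this
      · rw [← hs, ← ha j, star_mul, star_star]
    · rw [hLe, skewWeight_apply]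
      split_ifs <;> omega
  refine ⟨hT, fun l => ⟨ρ.symm (D l), hmem l⟩, hDT, skew_isAlgIndepGenerators (F := F)
    (σ := skewSigns K n) hn rfl (hP.v_star hv hvπ hs) ρ hG hΔ he ?_ _ (fun l => ?_) fun l => ?_⟩
  · rintro E ⟨m, hm, hE⟩ hEd i
    have h1 := Signs.exps_add_rev (hP.v_star hv hvπ hs) hE hEd i
    have h2 := hdvd m hm
    rw [← h1] at h2
    have h3 := dvd_sub h2 (he2.mul_right (exps v (E : Matrix (Fin (n + n)) (Fin (n + n)) K) i))
    rwa [show ∀ a b : ℤ, a + b - 2 * a = b - a by intro a b; ring] at h3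
  · change ∀ i j, i ≠ j → (ρ (ρ.symm (D l)) : Matrix (Fin (n + n)) (Fin (n + n)) K) i j = 0
    rw [MulEquiv.apply_symm_apply]
    exact diagUnit_apply_ne
  · change exps v (ρ (ρ.symm (D l)) : Matrix (Fin (n + n)) (Fin (n + n)) K) = _
    rw [MulEquiv.apply_symm_apply, hDw]

end modular

end LocalHecke

/-! ### The hermitian modular groups -/

namespace LocalHecke

lemma getD_append_replicate {R : Type*} (l : List R) (y z : R) {m b : ℕ} (hm : m < l.length + b) :
    (l ++ List.replicate b y).getD m z = if m < l.length then l.getD m z else y := by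
  rw [List.getD_eq_getElem?_getD, List.getElem?_append]
  split_ifs with h
  · rw [List.getD_eq_getElem?_getD]
  · rw [List.getElem?_replicate, if_pos (by omega)]; rfl

section fixed

variable {F : Type*} [Field F] {E : Type*} [Field E] [Algebra F E] [StarRing E]

/-- The fixed field of the nontrivial automorphism of a quadratic extension is the base field. -/
lemma StarIsConj.exists_algebraMap (h2 : Module.finrank F E = 2) (hs : StarIsConj F E) {x : E}
    (hx : star x = x) : ∃ a : F, x = algebraMap F E a := by
  have hfin : FiniteDimensional F E := Module.finite_of_finrank_eq_succ h2
  let S : Submodule F E :=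
    { carrier := {y | star y = y}
      add_mem' := fun {a b} ha hb => by
        change star (a + b) = a + b
        rw [star_add, show star a = a from ha, show star b = b from hb]
      zero_mem' := star_zero E
      smul_mem' := fun c y hy => by
        change star (c • y) = c • y
        rw [Algebra.smul_def, star_mul, hs.1, show star y = y from hy, mul_comm] }
  have hS : Module.finrank F S < 2 := by
    rw [← h2]
    refine Submodule.finrank_lt fun htop => ?_
    obtain ⟨y, hy⟩ := hs.2
    have : y ∈ S := htop ▸ Submodule.mem_top
    exact hy this
  have h1 : Submodule.span F {(1 : E)} ≤ S := by
    rw [Submodule.span_singleton_le_iff_mem]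
    exact star_one E
  have h3 : Submodule.span F {(1 : E)} = S := by
    refine Submodule.eq_of_le_of_finrank_le h1 ?_
    rw [finrank_span_singleton one_ne_zero]
    omega
  have hxS : x ∈ S := hx
  rw [← h3, Submodule.mem_span_singleton] at hxS
  obtain ⟨a, rfl⟩ := hxS
  exact ⟨a, (Algebra.algebraMap_eq_smul_one a).symm⟩

lemma StarIsConj.exists_norm (h2 : Module.finrank F E = 2) (hs : StarIsConj F E) (x : E) :
    ∃ a : F, x * star x = algebraMap F E a :=
  hs.exists_algebraMap h2 (by rw [star_mul, star_star])

end fixed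

section

variable {𝔬 : Type*} [CommRing 𝔬] [IsDomain 𝔬] [IsDiscreteValuationRing 𝔬]
  {F : Type*} [Field F] [Algebra 𝔬 F] [IsFractionRing 𝔬 F]
  {K : Type*} [DivisionRing K] [Algebra F K] [Algebra 𝔬 K] [IsScalarTower 𝔬 F K]
  {O : Subalgebra 𝔬 K} {v : AddValuation K (WithTop ℤ)}

lemma algebraMap_ne_zero_of_tower (F : Type*) [Field F] [Algebra 𝔬 F] [IsFractionRing 𝔬 F]
    [Algebra F K] [IsScalarTower 𝔬 F K] {m : 𝔬} (hm : m ≠ 0) : algebraMap 𝔬 K m ≠ 0 := fun h0 =>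
  hm (algebraMap_injective_of_tower 𝔬 K F (h0.trans (map_zero _).symm))

lemma ev_algebraMap_of_isUnit (F : Type*) [Field F] [Algebra 𝔬 F] [IsFractionRing 𝔬 F]
    [Algebra F K] [IsScalarTower 𝔬 F K] (hv : ∀ x, 0 ≤ v x ↔ x ∈ O) {u : 𝔬} (hu : IsUnit u) :
    ev v (algebraMap 𝔬 K u) = 0 := by
  obtain ⟨w, hw⟩ := hu.exists_right_inv
  have hu0 := algebraMap_ne_zero_of_tower (K := K) F hu.ne_zero
  have hw0 := algebraMap_ne_zero_of_tower (K := K) F (right_ne_zero_of_mul_eq_one hw)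
  have h1 := (le_v_iff v hu0 0).1 ((hv _).2 (O.algebraMap_mem u))
  have h2 := (le_v_iff v hw0 0).1 ((hv _).2 (O.algebraMap_mem w))
  have h3 := ev_mul v hu0 hw0
  rw [← map_mul, hw, map_one, ev_one] at h3
  omega

/-- The values of the elements of the base field are multiples of the value of a uniformizer. -/
lemma ev_dvd_ev_algebraMap (hv : ∀ x, 0 ≤ v x ↔ x ∈ O) {ϖ : 𝔬} (hϖ : Irreducible ϖ) {a : F}
    (ha : a ≠ 0) : ev v (algebraMap 𝔬 K ϖ) ∣ ev v (algebraMap F K a) := by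
  have key : ∀ x : 𝔬, x ≠ 0 → ev v (algebraMap 𝔬 K ϖ) ∣ ev v (algebraMap 𝔬 K x) := by
    intro x hx
    obtain ⟨k, u, hu⟩ := IsDiscreteValuationRing.associated_pow_irreducible hx hϖ
    have h1 := congrArg (fun z => ev v (algebraMap 𝔬 K z)) hu
    simp only [map_mul, map_pow] at h1
    have h3 := algebraMap_ne_zero_of_tower (K := K) F hϖ.ne_zero
    rw [ev_mul v (algebraMap_ne_zero_of_tower F hx) (algebraMap_ne_zero_of_tower F u.ne_zero),
      ev_algebraMap_of_isUnit F hv u.isUnit, add_zero, ev_pow v h3] at h1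
    exact ⟨k, h1.trans (mul_comm _ _)⟩
  obtain ⟨x, y, hy, rfl⟩ := IsFractionRing.div_surjective (A := 𝔬) a
  have hy0 : y ≠ 0 := nonZeroDivisors.ne_zero hy
  have hx0 : x ≠ 0 := by
    rintro rfl
    exact ha (by rw [map_zero, zero_div])
  rw [map_div₀, div_eq_mul_inv, ← IsScalarTower.algebraMap_apply, ← IsScalarTower.algebraMap_apply,
    ev_mul v (algebraMap_ne_zero_of_tower F hx0) (inv_ne_zero (algebraMap_ne_zero_of_tower F hy0)),
    ev_inv v (algebraMap_ne_zero_of_tower F hy0)]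
  exact dvd_add (key x hx0) ((dvd_neg).2 (key y hy0))

end

section

variable {𝔬 : Type*} [CommRing 𝔬] [IsDomain 𝔬] [IsDiscreteValuationRing 𝔬]
  [Finite (IsLocalRing.ResidueField 𝔬)] {F : Type*} [Field F] [Algebra 𝔬 F] [IsFractionRing 𝔬 F]
  {K : Type*} [DivisionRing K] [StarRing K] [Algebra F K] [Algebra 𝔬 K] [IsScalarTower 𝔬 F K]
  {O : Subalgebra 𝔬 K} {π : K} {v : AddValuation K (WithTop ℤ)}

/-- The local Hecke algebra of the modular group of a valuation ring with involution. -/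
theorem modular_of_norm (hP : IsPrimeOrder F O π) (hv : ∀ x, 0 ≤ v x ↔ x ∈ O) (hvπ : v π = 1)
    (hs : ∀ a : F, star (algebraMap F K a) = algebraMap F K a)
    (hnorm : ∀ x : K, ∃ a : F, x * star x = algebraMap F K a) {n : ℕ} (hn : 0 < n) {e : ℤ}
    (he : 0 < e) (he2 : e ∣ 2) (hdvd : ∀ a : F, a ≠ 0 → e ∣ ev v (algebraMap F K a))
    (z : Fin (n + 1) → K) (hze : ev v (z 0) = e) (hzF : ∃ a : F, z 0 = algebraMap F K a)
    (hzπ : ∀ l ≠ 0, z l = star π * π) :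
    ∃ (_ : IsHeckeTriple (Delta O n) (Spn O n) (Spn O n)) (T : Fin (n + 1) → Delta O n),
      (∀ i, ((T i : (Matrix (Fin n ⊕ Fin n) (Fin n ⊕ Fin n) K)ˣ) : Matrix _ _ K) =
        blockDiag (sumPos n) (List.replicate (n - i) 1 ++ List.replicate i π ++
          List.replicate (n - i) (z i) ++ List.replicate i π)) ∧
      HeckeAlg.IsAlgIndepGenerators (fun i => HeckeAlg.dcoset (Spn O n) (T i)) := by
  have hπ0 := hP.ne_zero
  have hevπ : ev v π = 1 := by rw [ev, hvπ]; rfl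
  have hz : ∀ l, ev v (z l) = if l = 0 then e else 2 := by
    intro l
    split_ifs with h
    · rw [h, hze]
    · have h1 : ev v (star π) = 1 := by rw [ev, hP.v_star hv hvπ hs, hvπ]; rfl
      rw [hzπ l h, ev_mul v (star_ne_zero.2 hπ0) hπ0, h1, hevπ]
      rfl
  have hz0 : ∀ l, z l ≠ 0 := by
    intro l h0
    have h1 := hz l
    rw [h0, ev, AddValuation.map_zero] at h1
    change (0 : ℤ) = _ at h1
    split_ifs at h1 <;> omega
  set L : Fin (n + 1) → List K := fun i => List.replicate (n - i) 1 ++ List.replicate i π ++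
    List.replicate (n - i) (z i) ++ List.replicate i π with hL
  have hinl : ∀ l (j : Fin n), (L l).getD (sumPos n (Sum.inl j)) 0 =
      if (j : ℕ) < n - l then 1 else π := by
    intro l j
    have hj : sumPos n (Sum.inl j) = j := rfl
    have := l.2
    rw [hj, hL]
    simp only
    rw [getD_append_replicate _ _ _ (by simp; omega), if_pos (by simp; omega),
      getD_append_replicate _ _ _ (by simp; omega), if_pos (by simp; omega),
      getD_replicate_append _ _ _ (by omega)]
  have hinr : ∀ l (j : Fin n), (L l).getD (sumPos n (Sum.inr j)) 0 =
      if (j : ℕ) < n - l then z l else π := by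
    intro l j
    have hj : sumPos n (Sum.inr j) = n + j := rfl
    have := l.2
    have hlen : (List.replicate (n - l) (1 : K) ++ List.replicate l π ++
      List.replicate (n - l) (z l)).length = n + (n - l) := by simp; omega
    have hlen' : (List.replicate (n - l) (1 : K) ++ List.replicate l π).length = n := by
      simp; omega
    rw [hj, hL]
    simp only
    rw [getD_append_replicate _ _ _ (by rw [hlen]; omega), hlen]
    by_cases h : (j : ℕ) < n - l
    · rw [if_pos h, if_pos (by omega), getD_append_replicate _ _ _ (by rw [hlen']; omega), hlen',
        if_neg (by omega)]
    · rw [if_neg h, if_neg (by omega)]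
  refine modular_of_list hP hv hvπ hs hn he he2 hdvd L (fun l j => ?_) (fun l j => ?_) fun l => ?_
  · rcases j with j | j
    · rw [hinl]; split_ifs; exacts [one_ne_zero, hπ0]
    · rw [hinr]; split_ifs; exacts [hz0 l, hπ0]
  · have h1 := hz l
    simp only [Fin.ext_iff, Fin.val_zero] at h1
    rcases j with j | j
    · rw [hinl, skewWeight_apply, modIndex_inl, apply_ite (ev v), ev_one, hevπ]
      have := j.2
      split_ifs <;> omega
    · rw [hinr, skewWeight_apply, modIndex_inr, apply_ite (ev v), hevπ, h1]
      have := j.2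
      split_ifs <;> omega
  · rcases eq_or_ne l 0 with rfl | h
    · obtain ⟨a, ha⟩ := hzF
      refine ⟨a, fun j => ?_⟩
      have h1 : (j : ℕ) < n - (0 : Fin (n + 1)) := by simp
      rw [hinl, hinr, if_pos h1, if_pos h1, star_one, one_mul, ha]
    · obtain ⟨a, ha⟩ := hnorm (star π)
      rw [star_star] at ha
      refine ⟨a, fun j => ?_⟩
      rw [hinl, hinr, hzπ l h, ← ha]
      split_ifs
      · rw [star_one, one_mul]
      · rfl

/-- The local Hecke algebra of the inert hermitian modular group. -/
theorem inertHermitian {E : Type*} [Field E] [Algebra F E] [Algebra 𝔬 E] [IsScalarTower 𝔬 F E]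
    [StarRing E] {n : ℕ} (hn : 1 ≤ n) (h2 : Module.finrank F E = 2) (hs : StarIsConj F E)
    (Λ : Subalgebra 𝔬 E) (hΛ : IsMaximalOrder F Λ) (π : E) (hπ : IsPrimeElement Λ π)
    (hsπ : star π = π) :
    ∃ (_ : IsHeckeTriple (Delta Λ n) (Spn Λ n) (Spn Λ n)) (T : Fin (n + 1) → Delta Λ n),
      (((T 0 : (Matrix (Fin n ⊕ Fin n) (Fin n ⊕ Fin n) E)ˣ) : Matrix _ _ E) =
        blockDiag (sumPos n) (List.replicate n 1 ++ List.replicate n π)) ∧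
      (∀ i : Fin (n + 1), i ≠ 0 →
        ((T i : (Matrix (Fin n ⊕ Fin n) (Fin n ⊕ Fin n) E)ˣ) : Matrix _ _ E) =
        blockDiag (sumPos n) (List.replicate (n - i) 1 ++ List.replicate i π ++
          List.replicate (n - i) (π ^ 2) ++ List.replicate i π)) ∧
      HeckeAlg.IsAlgIndepGenerators (fun i => HeckeAlg.dcoset (Spn Λ n) (T i)) := by
  have hP := hΛ.isPrimeOrder hπ
  obtain ⟨v, hv, hvπ⟩ := hP.exists_valuation
  have hevπ : ev v π = 1 := by rw [ev, hvπ]; rfl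
  obtain ⟨hT, T, hTe, hTi⟩ := modular_of_norm hP hv hvπ hs.1 (hs.exists_norm h2) hn one_pos
    (one_dvd 2) (fun _ _ => one_dvd _) (fun l => if l = 0 then π else π ^ 2)
    (by rw [if_pos rfl, hevπ]) (by rw [if_pos rfl]; exact hs.exists_algebraMap h2 hsπ)
    (fun l hl => by rw [if_neg hl, hsπ, pow_two])
  refine ⟨hT, T, ?_, fun i hi => ?_, hTi⟩
  · rw [hTe, if_pos rfl]
    simp
  · rw [hTe, if_neg hi]

/-- The local Hecke algebra of the modular groups that are ramified in the sense that the values of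
elements of the base field are even. -/
theorem modular_of_even (hP : IsPrimeOrder F O π) (hv : ∀ x, 0 ≤ v x ↔ x ∈ O) (hvπ : v π = 1)
    (hs : ∀ a : F, star (algebraMap F K a) = algebraMap F K a)
    (hnorm : ∀ x : K, ∃ a : F, x * star x = algebraMap F K a) {n : ℕ} (hn : 1 ≤ n)
    (hdvd : ∀ a : F, a ≠ 0 → 2 ∣ ev v (algebraMap F K a)) :
    ∃ (_ : IsHeckeTriple (Delta O n) (Spn O n) (Spn O n)) (T : Fin (n + 1) → Delta O n),
      (∀ i, ((T i : (Matrix (Fin n ⊕ Fin n) (Fin n ⊕ Fin n) K)ˣ) : Matrix _ _ K) =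
        blockDiag (sumPos n) (List.replicate (n - i) 1 ++ List.replicate i π ++
          List.replicate (n - i) (π * star π) ++ List.replicate i π)) ∧
      HeckeAlg.IsAlgIndepGenerators (fun i => HeckeAlg.dcoset (Spn O n) (T i)) := by
  have hπ0 := hP.ne_zero
  have hevπ : ev v π = 1 := by rw [ev, hvπ]; rfl
  have hevπ' : ev v (star π) = 1 := by rw [ev, hP.v_star hv hvπ hs, hvπ]; rfl
  obtain ⟨a, ha⟩ := hnorm π
  refine modular_of_norm hP hv hvπ hs hnorm hn two_pos dvd_rfl hdvd (fun _ => π * star π) ?_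
    (hnorm π) fun l _ => ?_
  · rw [ev_mul v hπ0 (star_ne_zero.2 hπ0), hevπ, hevπ']; rfl
  · -- the norm is central, so that `π` commutes with `star π`
    refine mul_left_cancel₀ hπ0 ?_
    rw [← mul_assoc π (star π), ha]
    exact (Algebra.commutes a π).symm

/-- The local Hecke algebra of the ramified hermitian modular group. -/
theorem ramifiedHermitian {E : Type*} [Field E] [Algebra F E] [Algebra 𝔬 E] [IsScalarTower 𝔬 F E]
    [StarRing E] {n : ℕ} (hn : 1 ≤ n) (h2 : Module.finrank F E = 2) (hs : StarIsConj F E)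
    (Λ : Subalgebra 𝔬 E) (hΛ : IsMaximalOrder F Λ) (hr : IsRamified Λ) (π : E)
    (hπ : IsPrimeElement Λ π) :
    ∃ (_ : IsHeckeTriple (Delta Λ n) (Spn Λ n) (Spn Λ n)) (T : Fin (n + 1) → Delta Λ n),
      (∀ i, ((T i : (Matrix (Fin n ⊕ Fin n) (Fin n ⊕ Fin n) E)ˣ) : Matrix _ _ E) =
        blockDiag (sumPos n) (List.replicate (n - i) 1 ++ List.replicate i π ++
          List.replicate (n - i) (π * star π) ++ List.replicate i π)) ∧
      HeckeAlg.IsAlgIndepGenerators (fun i => HeckeAlg.dcoset (Spn Λ n) (T i)) := by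
  have hP := hΛ.isPrimeOrder hπ
  obtain ⟨v, hv, hvπ⟩ := hP.exists_valuation
  have hevπ : ev v π = 1 := by rw [ev, hvπ]; rfl
  refine modular_of_even hP hv hvπ hs.1 (hs.exists_norm h2) hn fun a ha => ?_
  obtain ⟨ϖ, hϖ⟩ := IsDiscreteValuationRing.exists_irreducible 𝔬
  obtain ⟨u, hu, ⟨w, hw, huw⟩, h⟩ := hr ϖ π hϖ hπ
  refine dvd_trans ?_ (ev_dvd_ev_algebraMap hv hϖ ha)
  have hu0 := left_ne_zero_of_mul_eq_one huw
  have hw0 := right_ne_zero_of_mul_eq_one huw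
  have h1 := (le_v_iff v hu0 0).1 ((hv _).2 hu)
  have h2 := (le_v_iff v hw0 0).1 ((hv _).2 hw)
  have h3 := ev_mul v hu0 hw0
  rw [huw, ev_one] at h3
  rw [h, ev_mul v (pow_ne_zero 2 hP.ne_zero) hu0, ev_pow v hP.ne_zero, hevπ]
  exact ⟨1, by push_cast; omega⟩

end

end LocalHecke

/-! ### Ramification of quaternion division algebras -/

namespace LocalHecke

section

variable {𝔬 : Type*} [CommRing 𝔬] [IsDomain 𝔬] [IsDiscreteValuationRing 𝔬]
  [Finite (IsLocalRing.ResidueField 𝔬)] {F : Type*} [Field F] [Algebra 𝔬 F] [IsFractionRing 𝔬 F]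
  {K : Type*} [DivisionRing K] [Algebra F K] [Algebra 𝔬 K] [IsScalarTower 𝔬 F K]
  {O : Subalgebra 𝔬 K} {π : K} {v : AddValuation K (WithTop ℤ)}

/-- In a domain that is finite modulo a central prime element, the quotient is generated by a
single element: it is a finite field, whose group of units is cyclic. -/
lemma exists_powers_generator {R : Type*} [Ring R] (I : Ideal R) [I.IsTwoSided] [Finite (R ⧸ I)]
    (h1 : (1 : R) ∉ I) (hI : ∀ x y : R, x * y ∈ I → x ∈ I ∨ y ∈ I) :
    ∃ θ : R, ∀ x : R, x ∉ I → ∃ k : ℕ, x - θ ^ k ∈ I := by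
  have hnt : Nontrivial (R ⧸ I) := ⟨⟨0, 1, fun h => h1 ((Ideal.Quotient.eq_zero_iff_mem).1 h.symm)⟩⟩
  have hnz : NoZeroDivisors (R ⧸ I) := ⟨by
    intro a b hab
    obtain ⟨a, rfl⟩ := Ideal.Quotient.mk_surjective a
    obtain ⟨b, rfl⟩ := Ideal.Quotient.mk_surjective b
    rw [← map_mul, Ideal.Quotient.eq_zero_iff_mem] at hab
    rw [Ideal.Quotient.eq_zero_iff_mem, Ideal.Quotient.eq_zero_iff_mem]
    exact hI a b hab⟩
  have hdom : IsDomain (R ⧸ I) := NoZeroDivisors.to_isDomain _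
  have hf := Finite.isDomain_to_isField (R ⧸ I)
  let _ : CommRing (R ⧸ I) := { (inferInstance : Ring (R ⧸ I)) with mul_comm := hf.mul_comm }
  obtain ⟨g, hg⟩ := IsCyclic.exists_monoid_generator (α := (R ⧸ I)ˣ)
  obtain ⟨θ, hθ⟩ := Ideal.Quotient.mk_surjective (g : R ⧸ I)
  refine ⟨θ, fun x hx => ?_⟩
  have hx0 : Ideal.Quotient.mk I x ≠ 0 := fun h => hx (Ideal.Quotient.eq_zero_iff_mem.1 h)
  obtain ⟨y, hy⟩ := hf.mul_inv_cancel hx0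
  obtain ⟨k, hk⟩ := hg ⟨Ideal.Quotient.mk I x, y, hy, (hf.mul_comm _ _).trans hy⟩
  refine ⟨k, ?_⟩
  rw [← Ideal.Quotient.eq, map_pow, hθ]
  have h2 := congrArg (fun u : (R ⧸ I)ˣ => (u : R ⧸ I)) hk
  exact h2.symm.trans (Units.val_pow_eq_pow_val g k)

/-- If a uniformizer stays prime in an order all of whose elements are quadratic over the valuation
ring, then the order is generated by `1` and a single element. -/
lemma finrank_le_two_of_unramified (hP : IsPrimeOrder F O π) (hv : ∀ x, 0 ≤ v x ↔ x ∈ O) {ϖ : 𝔬}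
    (hϖ : Irreducible ϖ) (he : ev v (algebraMap 𝔬 K ϖ) = 1)
    (hquad : ∀ x ∈ O, ∃ s t : 𝔬, x * x = s • x + t • 1) : Module.finrank F K ≤ 2 := by
  have hϖ0 := algebraMap_ne_zero_of_tower (K := K) F hϖ.ne_zero
  have hM : Module.Finite 𝔬 O := Module.Finite.iff_fg.2 hP.fg
  let c : O := algebraMap 𝔬 O ϖ
  have hcc : ∀ x : O, c * x = x * c := fun x => Algebra.commutes ϖ x
  let I : Ideal O := Ideal.span {c}
  have hmemI : ∀ x : O, x ∈ I ↔ ∃ y : O, y * c = x := fun x => Ideal.mem_span_singleton'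
  have hI2 : I.IsTwoSided := ⟨fun {a} b ha => by
    obtain ⟨y, rfl⟩ := (hmemI a).1 ha
    exact (hmemI _).2 ⟨y * b, by rw [mul_assoc, ← hcc, mul_assoc]⟩⟩
  have hmemI' : ∀ x : O, x ∈ I ↔ 1 ≤ v (x : K) := by
    intro x
    rw [hmemI]
    constructor
    · rintro ⟨y, rfl⟩
      refine le_trans ?_ (le_v_mul_left v ((hv _).2 y.2))
      exact (le_v_iff v hϖ0 1).2 he.ge
    · intro h
      refine ⟨⟨x * (algebraMap 𝔬 K ϖ)⁻¹, (hv _).1 (v_mul_inv_nonneg v hϖ0 ?_)⟩, Subtype.ext ?_⟩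
      · rwa [← coe_ev v hϖ0, he]
      · exact inv_mul_cancel_right₀ hϖ0 _
  have hfin : Finite (O ⧸ I) := by
    have := finite_quotient_span hϖ.ne_zero
    have h1 : Finite (O ⧸ (Ideal.span {ϖ} • (⊤ : Submodule 𝔬 O))) :=
      Submodule.finite_quotient_smul _ hM.1
    refine Finite.of_surjective (α := O ⧸ (Ideal.span {ϖ} • (⊤ : Submodule 𝔬 O)))
      (Quotient.map' id fun x y hxy => ?_) fun q => ?_
    · rw [Submodule.quotientRel_def, Ideal.span, Submodule.ideal_span_singleton_smul,
        Submodule.mem_smul_pointwise_iff_exists] at hxy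
      obtain ⟨z, -, hz⟩ := hxy
      rw [Submodule.quotientRel_def, id, id, ← hz, hmemI]
      exact ⟨z, by rw [← hcc, Algebra.smul_def]⟩
    · obtain ⟨x, rfl⟩ := Quotient.exists_rep q
      exact ⟨Submodule.Quotient.mk x, rfl⟩
  obtain ⟨θ, hθ⟩ := exists_powers_generator I (by rw [hmemI']; simp) fun x y hxy => by
    rw [hmemI', hmemI']
    rw [hmemI'] at hxy
    by_contra hcon
    push Not at hcon
    have hx0 : (x : K) ≠ 0 := fun h => by simp [h] at hcon
    have hy0 : (y : K) ≠ 0 := fun h => by simp [h] at hcon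
    have h1 := (le_v_iff v (mul_ne_zero hx0 hy0) 1).1 hxy
    have h2 := mt (le_v_iff v hx0 1).2 hcon.1.not_ge
    have h3 := mt (le_v_iff v hy0 1).2 hcon.2.not_ge
    rw [ev_mul v hx0 hy0] at h1
    omega
  let S : Submodule 𝔬 O := Submodule.span 𝔬 {1, θ}
  have h1S : (1 : O) ∈ S := Submodule.subset_span (by simp)
  have hθS : θ ∈ S := Submodule.subset_span (by simp)
  have hpow : ∀ k, θ ^ k ∈ S := by
    intro k
    induction k with
    | zero => rw [pow_zero]; exact h1S
    | succ k ih =>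
      obtain ⟨a, b, hab⟩ := Submodule.mem_span_pair.1 ih
      obtain ⟨s, t, hst⟩ := hquad θ θ.2
      have hst' : θ * θ = s • θ + t • 1 := Subtype.ext hst
      rw [pow_succ, ← hab, add_mul, Algebra.smul_mul_assoc, one_mul, Algebra.smul_mul_assoc, hst']
      exact add_mem (S.smul_mem _ hθS) (S.smul_mem _ (add_mem (S.smul_mem _ hθS) (S.smul_mem _ h1S)))
  have hle : (⊤ : Submodule 𝔬 O) ≤ S ⊔ IsLocalRing.maximalIdeal 𝔬 • (⊤ : Submodule 𝔬 O) := by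
    intro x _
    have hIm : ∀ y ∈ I, y ∈ IsLocalRing.maximalIdeal 𝔬 • (⊤ : Submodule 𝔬 O) := by
      intro y hy
      obtain ⟨z, rfl⟩ := (hmemI y).1 hy
      rw [← hcc, ← Algebra.smul_def]
      exact Submodule.smul_mem_smul ((IsLocalRing.mem_maximalIdeal _).2 hϖ.not_isUnit) trivial
    by_cases hx : x ∈ I
    · exact Submodule.mem_sup_right (hIm x hx)
    · obtain ⟨k, hk⟩ := hθ x hx
      rw [← add_sub_cancel (θ ^ k) x]
      exact add_mem (Submodule.mem_sup_left (hpow k)) (Submodule.mem_sup_right (hIm _ hk))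
  have htop : (⊤ : Submodule 𝔬 O) ≤ S :=
    Submodule.le_of_le_smul_of_le_jacobson_bot hM.1 (IsLocalRing.maximalIdeal_le_jacobson _) hle
  have hspan : Submodule.span F {(1 : K), (θ : K)} = ⊤ := by
    rw [eq_top_iff, ← hP.span, Submodule.span_le]
    intro x hx
    obtain ⟨a, b, hab⟩ := Submodule.mem_span_pair.1 (htop (show (⟨x, hx⟩ : O) ∈ _ from trivial))
    have h1 : a • (1 : K) + b • (θ : K) = x := congrArg Subtype.val hab
    rw [← h1, ← algebraMap_smul F a, ← algebraMap_smul F b]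
    exact Submodule.mem_span_pair.2 ⟨_, _, rfl⟩
  rw [← finrank_top F K, ← hspan]
  classical
  have h2 := finrank_span_finset_le_card (R := F) ({(1 : K), (θ : K)} : Finset K)
  have h3 := Finset.card_le_two (a := (1 : K)) (b := (θ : K))
  rw [Set.finrank, Finset.coe_insert, Finset.coe_singleton] at h2
  exact h2.trans h3

end

section

variable {𝔬 : Type*} [CommRing 𝔬] [IsDomain 𝔬] [IsDiscreteValuationRing 𝔬]
  [Finite (IsLocalRing.ResidueField 𝔬)] {F : Type*} [Field F] [Algebra 𝔬 F] [IsFractionRing 𝔬 F]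

/-- The trace of the canonical involution, polarized from the norms of `x` and `x + 1`. -/
lemma StarIsCanonical.exists_trace {A : Type*} [Ring A] [Algebra F A] [StarRing A]
    (hs : StarIsCanonical F A) (x : A) : ∃ t : F, x + star x = algebraMap F A t := by
  obtain ⟨a, ha⟩ := hs.2 (x + 1)
  obtain ⟨b, hb⟩ := hs.2 x
  refine ⟨a - b - 1, ?_⟩
  rw [map_sub, map_sub, ← ha, ← hb, map_one, star_add, star_one]
  noncomm_ring

/-- The local Hecke algebra of the ramified quaternionic modular group. -/
theorem ramifiedQuaternionic {D : Type*} [DivisionRing D] [Algebra F D] [Algebra 𝔬 D]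
    [IsScalarTower 𝔬 F D] [StarRing D] {n : ℕ} (hn : 1 ≤ n) (h4 : Module.finrank F D = 4)
    (hs : StarIsCanonical F D) (Λ : Subalgebra 𝔬 D) (hΛ : IsMaximalOrder F Λ) (π : D)
    (hπ : IsPrimeElement Λ π) :
    ∃ (_ : IsHeckeTriple (Delta Λ n) (Spn Λ n) (Spn Λ n)) (T : Fin (n + 1) → Delta Λ n),
      (∀ i, ((T i : (Matrix (Fin n ⊕ Fin n) (Fin n ⊕ Fin n) D)ˣ) : Matrix _ _ D) =
        blockDiag (sumPos n) (List.replicate (n - i) 1 ++ List.replicate i π ++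
          List.replicate (n - i) (π * star π) ++ List.replicate i π)) ∧
      HeckeAlg.IsAlgIndepGenerators (fun i => HeckeAlg.dcoset (Spn Λ n) (T i)) := by
  have hP := hΛ.isPrimeOrder hπ
  obtain ⟨v, hv, hvπ⟩ := hP.exists_valuation
  have hπ0 := hP.ne_zero
  have hevπ : ev v π = 1 := by rw [ev, hvπ]; rfl
  have hevπ' : ev v (star π) = 1 := by rw [ev, hP.v_star hv hvπ hs.1, hvπ]; rfl
  refine modular_of_even hP hv hvπ hs.1 hs.2 hn fun a ha => ?_
  obtain ⟨ϖ, hϖ⟩ := IsDiscreteValuationRing.exists_irreducible 𝔬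
  have hϖ0 := algebraMap_ne_zero_of_tower (K := D) F hϖ.ne_zero
  refine dvd_trans ?_ (ev_dvd_ev_algebraMap hv hϖ ha)
  -- the norm of `π` has value `2`, so that the value of a uniformizer is `1` or `2`
  obtain ⟨b, hb⟩ := hs.2 π
  have hb0 : b ≠ 0 := by
    rintro rfl
    rw [map_zero] at hb
    exact mul_ne_zero hπ0 (star_ne_zero.2 hπ0) hb
  have h1 := ev_dvd_ev_algebraMap (K := D) hv hϖ hb0
  rw [← hb, ev_mul v hπ0 (star_ne_zero.2 hπ0), hevπ, hevπ'] at h1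
  have h2 : 0 ≤ ev v (algebraMap 𝔬 D ϖ) := (le_v_iff v hϖ0 0).1 ((hv _).2 (Λ.algebraMap_mem ϖ))
  have h3 := Int.le_of_dvd two_pos h1
  have h5 : ev v (algebraMap 𝔬 D ϖ) ≠ 1 := by
    intro h1
    have := finrank_le_two_of_unramified hP hv hϖ h1 fun x hx => ?_
    · omega
    obtain ⟨t, ht⟩ := hs.exists_trace x
    obtain ⟨m, hm⟩ := hs.2 x
    have hx' := hP.star_mem hv hs.1 hx
    obtain ⟨t, rfl⟩ := (hP.algebraMap_mem_iff t).1 (ht ▸ add_mem hx hx')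
    obtain ⟨m, rfl⟩ := (hP.algebraMap_mem_iff m).1 (hm ▸ mul_mem hx hx')
    rw [← IsScalarTower.algebraMap_apply] at ht hm
    refine ⟨t, -m, ?_⟩
    rw [Algebra.smul_def, ← ht, neg_smul, ← Algebra.algebraMap_eq_smul_one, ← hm, ht,
      Algebra.commutes, ← ht, mul_add, add_neg_cancel_right]
  interval_cases h : ev v (algebraMap 𝔬 D ϖ)
  · exact absurd (zero_dvd_iff.1 h1) (by norm_num)
  · exact absurd rfl h5
  · exact dvd_rfl

end

end LocalHecke

/-! ### The Hecke algebra of a group of proper similitudes of a symmetric form -/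

namespace LocalHecke

section weights

variable {N : ℕ}

/-- The transposition of the two central indices. -/
def centralSwap (hN : 0 < N) : Equiv.Perm (Fin (N + N)) :=
  Equiv.swap ⟨N - 1, by omega⟩ (Fin.rev ⟨N - 1, by omega⟩)

lemma centralSwap_val (hN : 0 < N) (j : Fin (N + N)) :
    (centralSwap hN j : ℕ) = if (j : ℕ) = N - 1 then N else if (j : ℕ) = N then N - 1 else j := by
  have h1 : N + N - (N - 1 + 1) = N := by omega
  rw [centralSwap, Equiv.swap_apply_def]
  simp only [Fin.ext_iff, Fin.val_rev, h1]
  split_ifs <;> simp [Fin.val_rev, h1]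

lemma centralSwap_centralSwap (hN : 0 < N) (j : Fin (N + N)) :
    centralSwap hN (centralSwap hN j) = j := by
  rw [centralSwap, ← Equiv.Perm.mul_apply, Equiv.swap_mul_self]
  rfl

/-- The exponents of the generators for a symmetric form. -/
def symmWeight (hN : 0 < N) : Fin 2 ⊕ Set.Icc 2 N → Lex (Fin (N + N) → ℤ) :=
  Sum.elim ![skewWeight N 1 0, toLex fun j => skewWeight N 1 0 (centralSwap hN j)]
    fun k => skewWeight N 1 k

/-- The additive functions dual to the exponents of the generators. -/
def symmCoord (hN : 2 ≤ N) : Fin 2 ⊕ Set.Icc 2 N → (Lex (Fin (N + N) → ℤ) →+ ℤ) :=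
  Sum.elim ![entry ⟨N, by omega⟩ - entry ⟨N - 2, by omega⟩,
    entry ⟨N - 1, by omega⟩ - entry ⟨N - 2, by omega⟩] fun k => skewCoord (by omega) k

lemma symmCoord_zero (hN : 2 ≤ N) (x : Lex (Fin (N + N) → ℤ)) :
    symmCoord hN (Sum.inl 0) x = x ⟨N, by omega⟩ - x ⟨N - 2, by omega⟩ := rfl

lemma symmCoord_one (hN : 2 ≤ N) (x : Lex (Fin (N + N) → ℤ)) :
    symmCoord hN (Sum.inl 1) x = x ⟨N - 1, by omega⟩ - x ⟨N - 2, by omega⟩ := rfl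

lemma symmWeight_one (hN : 0 < N) (j : Fin (N + N)) : symmWeight hN (Sum.inl 1) j =
    if (j : ℕ) < N - 1 ∨ (j : ℕ) = N then 0 else 1 := by
  change skewWeight N 1 0 (centralSwap hN j) = _
  rw [skewWeight_apply, if_pos rfl, centralSwap_val]
  split_ifs <;> omega

/-- The coordinates are dual to the weights of the generators. -/
lemma symmCoord_symmWeight (hN : 2 ≤ N) (i j : Fin 2 ⊕ Set.Icc 2 N) :
    symmCoord hN i (symmWeight (by omega) j) = if i = j then 1 else 0 := by
  have hN0 : 0 < N := by omega
  rcases i with i | i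
  · have key : ∀ a : Fin (N + N), (a = ⟨N, by omega⟩ ∨ a = ⟨N - 1, by omega⟩) →
        ∀ k : Set.Icc 2 N, skewWeight N 1 k a - skewWeight N 1 k ⟨N - 2, by omega⟩ = 0 := by
      rintro a ha k
      have h1 := k.2.1
      have h2 : (a : ℕ) = N ∨ (a : ℕ) = N - 1 := by
        rcases ha with rfl | rfl
        exacts [Or.inl rfl, Or.inr rfl]
      rw [skewWeight_apply, skewWeight_apply]
      simp only
      split_ifs <;> omega
    fin_cases i
    · change symmCoord hN (Sum.inl 0) _ = _
      rcases j with j | j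
      · fin_cases j
        · change symmCoord hN (Sum.inl 0) (skewWeight N 1 0) = 1
          rw [symmCoord_zero, skewWeight_apply, skewWeight_apply, if_pos rfl, if_pos rfl]
          simp only
          split_ifs <;> omega
        · change symmCoord hN (Sum.inl 0) (symmWeight hN0 (Sum.inl 1)) = 0
          rw [symmCoord_zero, symmWeight_one, symmWeight_one, if_pos (Or.inr rfl),
            if_pos (Or.inl (by simp only; omega)), sub_zero]
      · exact key _ (Or.inl rfl) j
    · change symmCoord hN (Sum.inl 1) _ = _
      rcases j with j | j
      · fin_cases j
        · change symmCoord hN (Sum.inl 1) (skewWeight N 1 0) = 0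
          rw [symmCoord_one, skewWeight_apply, skewWeight_apply, if_pos rfl, if_pos rfl]
          simp only
          split_ifs <;> omega
        · change symmCoord hN (Sum.inl 1) (symmWeight hN0 (Sum.inl 1)) = 1
          rw [symmCoord_one, symmWeight_one, symmWeight_one]
          simp only
          split_ifs <;> omega
      · exact key _ (Or.inr rfl) j
  · have h1 := i.2.1
    have h1' := i.2.2
    change skewCoord hN0 i _ = _
    rcases j with j | j
    · fin_cases j
      · change skewCoord hN0 i (skewWeight N 1 0) = 0
        rw [skewCoord_skewWeight hN0 1 h1' (Nat.zero_le _), if_neg (by omega)]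
      · change skewCoord hN0 i (symmWeight hN0 (Sum.inl 1)) = 0
        rw [skewCoord_of_ne hN0 (by omega)]
        by_cases h : (i : ℕ) = N
        · rw [jump_zero (by simp only; omega), symmWeight_one]
          simp only
          split_ifs <;> omega
        · rw [jump_of_ne (by simp only; omega), symmWeight_one, symmWeight_one]
          simp only
          split_ifs <;> omega
    · change skewCoord hN0 i (skewWeight N 1 j) = _
      rw [skewCoord_skewWeight hN0 1 h1' j.2.2, if_neg (show ¬ (i : ℕ) = 0 by omega)]
      simp only [Sum.inr.injEq, Subtype.ext_iff]

lemma symmWeight_mem_pairedExps (hN : 2 ≤ N) (i : Fin 2 ⊕ Set.Icc 2 N) :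
    symmWeight (by omega) i ∈ pairedExps (N + N) := by
  rcases i with i | i
  · fin_cases i
    · exact skewWeight_mem_pairedExps 1 (Nat.zero_le _)
    · refine ⟨1, fun j => ?_⟩
      change symmWeight (by omega) (Sum.inl 1) j + symmWeight (by omega) (Sum.inl 1) j.rev = 1
      rw [symmWeight_one, symmWeight_one, Fin.val_rev]
      split_ifs <;> omega
  · exact skewWeight_mem_pairedExps 1 i.2.2

/-- The coordinates separate the paired exponents. -/
lemma eq_zero_of_symmCoord (hN : 2 ≤ N) {x : Lex (Fin (N + N) → ℤ)} (hx : x ∈ pairedExps (N + N))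
    (h : ∀ i, symmCoord hN i x = 0) : x = 0 := by
  have hN0 : 0 < N := by omega
  have h1 : ∀ k : Fin (N + N), (k : ℕ) ≤ N - 2 → x k = 0 := fun k hk => eq_zero_of_jump fun i hi => by
    have hi' : (i : ℕ) ≤ N - 2 := le_trans hi hk
    have h1 : skewCoord hN0 (N - i) x = 0 := h (Sum.inr ⟨N - i, by omega, Nat.sub_le _ _⟩)
    rw [skewCoord_of_ne hN0 (by omega)] at h1
    have h2 : (⟨N - (N - i : ℕ), by omega⟩ : Fin (N + N)) = i := Fin.ext (by simp only; omega)
    simp only [h2] at h1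
    exact h1
  have h2 := h (Sum.inl 0)
  have h3 := h (Sum.inl 1)
  rw [symmCoord_zero, h1 ⟨N - 2, by omega⟩ le_rfl, sub_zero] at h2
  rw [symmCoord_one, h1 ⟨N - 2, by omega⟩ le_rfl, sub_zero] at h3
  obtain ⟨c, hc⟩ := hx
  have h4 := hc ⟨N, by omega⟩
  rw [h2, show (⟨N, by omega⟩ : Fin (N + N)).rev = ⟨N - 1, by omega⟩ from
    Fin.ext (by rw [Fin.val_rev]; simp only; omega), h3] at h4
  have h5 : ∀ k : Fin (N + N), (k : ℕ) < N → x k = 0 := fun k hk => by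
    by_cases hk' : (k : ℕ) = N - 1
    · rw [← h3]; congr 1; exact Fin.ext hk'
    · exact h1 k (by omega)
  funext k
  change x k = 0
  by_cases hk : (k : ℕ) < N
  · exact h5 k hk
  · have h6 := hc k
    rw [h5 k.rev (by rw [Fin.val_rev]; omega)] at h6
    omega

end weights

section symmetric

variable {K : Type*} [Field K] [StarRing K] {N : ℕ} {σ : Signs K (N + N)}
  {v : AddValuation K (WithTop ℤ)}

/-- Dominant exponents for a symmetric form are increasing up to the order of the central entries. -/
lemma DomFrom.exps_le_of_symm {Γ : Subgroup (Matrix (Fin (N + N)) (Fin (N + N)) K)ˣ}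
    {D : (Matrix (Fin (N + N)) (Fin (N + N)) K)ˣ} (hN : 0 < N)
    (h : DomFrom v Γ (N - 1) Inner (fun k => ⟨min k (N + N - 1), by omega⟩) 0 D)
    (hp : exps v (D : Matrix (Fin (N + N)) (Fin (N + N)) K) ∈ pairedExps (N + N))
    {i j : Fin (N + N)} (hij : i ≤ j) (hc : ¬ ((i : ℕ) = N - 1 ∧ (j : ℕ) = N)) :
    exps v (D : Matrix (Fin (N + N)) (Fin (N + N)) K) i ≤
      exps v (D : Matrix (Fin (N + N)) (Fin (N + N)) K) j := by
  rcases eq_or_lt_of_le hij with rfl | hlt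
  · exact le_rfl
  obtain ⟨c, hc'⟩ := hp
  by_cases hi : (i : ℕ) < N - 1 ∧ j ≤ i.rev
  · exact h.exps_le_of_inner hN hi.1 hij hi.2
  · have h1 := hc' i
    have h2 := hc' j
    have h3 := h.exps_le_of_inner hN (i := j.rev) (j := i.rev)
      (by simp only [Fin.le_def, Fin.lt_def, Fin.val_rev] at hi hlt hc ⊢; omega)
      (Fin.rev_le_rev.2 hij)
      (by simp only [Fin.le_def, Fin.lt_def, Fin.val_rev] at hi hlt hc ⊢; omega)
    omega

/-- Dominant exponents for a symmetric form are increasing, possibly after the transposition of the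
central entries. -/
lemma DomFrom.exists_perm_of_symm {Γ : Subgroup (Matrix (Fin (N + N)) (Fin (N + N)) K)ˣ}
    {D : (Matrix (Fin (N + N)) (Fin (N + N)) K)ˣ} (hN : 0 < N)
    (h : DomFrom v Γ (N - 1) Inner (fun k => ⟨min k (N + N - 1), by omega⟩) 0 D)
    (hp : exps v (D : Matrix (Fin (N + N)) (Fin (N + N)) K) ∈ pairedExps (N + N)) :
    ∃ τ : Equiv.Perm (Fin (N + N)), (τ = 1 ∨ τ = centralSwap hN) ∧ ∀ i j, i ≤ j →
      exps v (D : Matrix (Fin (N + N)) (Fin (N + N)) K) (τ i) ≤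
        exps v (D : Matrix (Fin (N + N)) (Fin (N + N)) K) (τ j) := by
  rcases le_total (exps v (D : Matrix (Fin (N + N)) (Fin (N + N)) K) ⟨N - 1, by omega⟩)
    (exps v (D : Matrix (Fin (N + N)) (Fin (N + N)) K) ⟨N, by omega⟩) with hle | hle
  · refine ⟨1, Or.inl rfl, fun i j hij => ?_⟩
    by_cases hc : (i : ℕ) = N - 1 ∧ (j : ℕ) = N
    · have hi : i = ⟨N - 1, by omega⟩ := Fin.ext hc.1
      have hj : j = ⟨N, by omega⟩ := Fin.ext hc.2
      rw [← hi, ← hj] at hle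
      exact hle
    · exact h.exps_le_of_symm hN hp hij hc
  · refine ⟨centralSwap hN, Or.inr rfl, fun i j hij => ?_⟩
    rcases eq_or_lt_of_le hij with rfl | hlt
    · exact le_rfl
    have hi := centralSwap_val hN i
    have hj := centralSwap_val hN j
    rw [Fin.lt_def] at hlt
    by_cases hc : (i : ℕ) = N - 1 ∧ (j : ℕ) = N
    · rw [show centralSwap hN i = ⟨N, by omega⟩ from Fin.ext (by rw [hi, if_pos hc.1]),
        show centralSwap hN j = ⟨N - 1, by omega⟩ from
          Fin.ext (by rw [hj, if_neg (by omega), if_pos hc.2])]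
      exact hle
    · refine h.exps_le_of_symm hN hp ?_ ?_
      · rw [Fin.le_def, hi, hj]
        split_ifs <;> omega
      · rw [hi, hj]
        split_ifs <;> omega

/-- In a double coset under the group of proper similitudes, the exponents of dominant diagonal
matrices agree with those of the listed generators. -/
lemma exps_eq_symmWeight [CharZero K] (hN : 2 ≤ N) (hst : ∀ x : K, star x = x) (hε : σ.ε = 1)
    (l : Fin 2 ⊕ Set.Icc 2 N) {D T : (Matrix (Fin (N + N)) (Fin (N + N)) K)ˣ}
    (hD : DomFrom v σ.properGroup (N - 1) Inner (fun k => ⟨min k (N + N - 1), by omega⟩) 0 D)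
    (hTd : ∀ i j, i ≠ j → (T : Matrix (Fin (N + N)) (Fin (N + N)) K) i j = 0)
    (hTw : exps v (T : Matrix (Fin (N + N)) (Fin (N + N)) K) = symmWeight (by omega) l)
    (h : ∃ g ∈ intGroup v σ.properGroup (fun _ : Fin (N + N) => True),
      ∃ g' ∈ intGroup v σ.properGroup (fun _ : Fin (N + N) => True), D = g * T * g') :
    exps v (D : Matrix (Fin (N + N)) (Fin (N + N)) K) = symmWeight (by omega) l := by
  have hN0 : 0 < N := by omega
  obtain ⟨g, hg, g', hg', h⟩ := h
  have h' : T = g⁻¹ * D * g'⁻¹ := by rw [h]; group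
  obtain ⟨τ, hτ, hτm⟩ := hD.exists_perm_of_symm hN0
    (Signs.exps_mem_pairedExps (fun x => by rw [hst]) (σ.properGroup_le hD.1) hD.2.1)
  have hS : ∀ i : Fin (N + N), skewWeight N 1 0 i = if (i : ℕ) < N then 0 else 1 := fun i => by
    rw [skewWeight_apply, if_pos rfl]
  rcases l with l | k
  · fin_cases l
    · change exps v (T : Matrix (Fin (N + N)) (Fin (N + N)) K) = skewWeight N 1 0 at hTw
      have h1 := exps_eq_of_double_coset hg hg' h hD.2.1 hTd τ 1 hτm fun i j hij => by
        rw [hTw]; exact skewWeight_mono one_pos 0 hij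
      rcases hτ with rfl | rfl
      · rw [hTw] at h1
        exact funext h1
      · exact (Signs.not_double_coset_swap (v := v) hN0 hst hε (inv_mem hg) (inv_mem hg') h' hTd
          hD.2.1 (p := ⟨N - 1, by omega⟩) (fun i => by rw [hTw, hS]) h1).elim
    · have hTw' : ∀ i, exps v (T : Matrix (Fin (N + N)) (Fin (N + N)) K) (centralSwap hN0 i) =
          skewWeight N 1 0 i := fun i => by
        rw [hTw]
        change skewWeight N 1 0 (centralSwap hN0 (centralSwap hN0 i)) = _
        rw [centralSwap_centralSwap]
      have h1 := exps_eq_of_double_coset hg hg' h hD.2.1 hTd τ (centralSwap hN0) hτm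
        fun i j hij => by rw [hTw', hTw']; exact skewWeight_mono one_pos 0 hij
      rcases hτ with rfl | rfl
      · exact (Signs.not_double_coset_swap (v := v) hN0 hst hε hg hg' h hD.2.1 hTd
          (p := ⟨N - 1, by omega⟩) (fun i => by rw [← hS, ← hTw', ← h1]; rfl)
          fun i => (h1 i).symm).elim
      · rw [← hTw]
        funext i
        have h2 := h1 (centralSwap hN0 i)
        rwa [centralSwap_centralSwap] at h2
  · change exps v (T : Matrix (Fin (N + N)) (Fin (N + N)) K) = skewWeight N 1 k at hTw
    have h1 := exps_eq_of_double_coset hg hg' h hD.2.1 hTd τ 1 hτm fun i j hij => by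
      rw [hTw]; exact skewWeight_mono one_pos k hij
    rw [hTw] at h1
    rcases hτ with rfl | rfl
    · exact funext h1
    · funext i
      have h2 := h1 (centralSwap hN0 i)
      rw [centralSwap_centralSwap] at h2
      rw [h2]
      change skewWeight N 1 k (centralSwap hN0 i) = skewWeight N 1 k i
      have h3 := k.2.1
      rw [skewWeight_apply, skewWeight_apply, centralSwap_val]
      split_ifs <;> omega

/-- The Hecke algebra of a group of proper similitudes of a symmetric form is a polynomial ring. -/
theorem symm_isAlgIndepGenerators [CharZero K] (hN : 2 ≤ N) (hst : ∀ x : K, star x = x)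
    (hε : σ.ε = 1) {𝒢 : Type*} [Group 𝒢] {Δ : Submonoid 𝒢} {G : Subgroup 𝒢} [IsHeckeTriple Δ G G]
    (ρ : 𝒢 ≃* (Matrix (Fin (N + N)) (Fin (N + N)) K)ˣ)
    (hG : ∀ x, x ∈ G ↔ ρ x ∈ intGroup v σ.properGroup (fun _ : Fin (N + N) => True))
    (hΔ : ∀ x, x ∈ Δ ↔ ρ x ∈ σ.properGroup ∧
      IntMat v (ρ x : Matrix (Fin (N + N)) (Fin (N + N)) K))
    (T : Fin 2 ⊕ Set.Icc 2 N → Δ)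
    (hTd : ∀ l, ∀ i j, i ≠ j → (ρ (T l) : Matrix (Fin (N + N)) (Fin (N + N)) K) i j = 0)
    (hTw : ∀ l, exps v (ρ (T l) : Matrix (Fin (N + N)) (Fin (N + N)) K) =
      symmWeight (by omega) l) :
    HeckeAlg.IsAlgIndepGenerators fun i => HeckeAlg.dcoset G (T i) := by
  have hN0 : 0 < N := by omega
  have hv : ∀ x : K, v (star x) = v x := fun x => by rw [hst]
  have hpe : ∀ D ∈ σ.properGroup,
      (∀ i j, i ≠ j → (D : Matrix (Fin (N + N)) (Fin (N + N)) K) i j = 0) →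
      exps v (D : Matrix (Fin (N + N)) (Fin (N + N)) K) ∈ pairedExps (N + N) := fun D hD hDd =>
    Signs.exps_mem_pairedExps hv (σ.properGroup_le hD) hDd
  refine (symm_elimination hN0 hst hε).isAlgIndepGenerators (symm_iwasawa hN0 hst hε) ρ hG hΔ T
    (fun l => symmWeight hN0 l) hTd hTw
    (fun l D hD h _ => exps_eq_symmWeight hN hst hε l hD (hTd l) (hTw l) h)
    (symmCoord hN) (fun _ => 1) (fun _ => one_ne_zero) (symmCoord_symmWeight hN)
    (pairedExps (N + N)) (symmWeight_mem_pairedExps hN) hpe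
    (fun x hx hx' => eq_zero_of_symmCoord hN hx hx') (fun D hD hDI i => ?_)
    ⟨N + N - 1, by omega⟩ (fun i j => ?_) (fun i => ?_)
  · have hDm := fun {i j} => hD.exps_le_of_symm hN0 (hpe D hD.1 hD.2.1) (i := i) (j := j)
    have key : 0 ≤ symmCoord hN i (exps v (D : Matrix (Fin (N + N)) (Fin (N + N)) K)) := by
      rcases i with i | i
      · fin_cases i
        · exact sub_nonneg.2 (hDm (by rw [Fin.le_def]; simp only; omega) (by simp only; omega))
        · exact sub_nonneg.2 (hDm (by rw [Fin.le_def]; simp only; omega) (by simp only; omega))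
      · have h1 := i.2.1
        change 0 ≤ skewCoord hN0 i _
        rw [skewCoord_of_ne hN0 (by omega)]
        refine jump_nonneg (exps_nonneg hD.2.1 hDI _) fun j hj => hDm ?_ ?_
        · rw [Fin.le_def]; omega
        · simp only at hj ⊢; omega
    obtain ⟨k, hk⟩ := Int.eq_ofNat_of_zero_le key
    exact ⟨k, by rw [hk, mul_one]⟩
  · rcases i with i | i
    · fin_cases i
      · exact skewWeight_mono one_pos 0 (by rw [Fin.le_def]; simp only; omega)
      · change symmWeight hN0 (Sum.inl 1) j ≤ symmWeight hN0 (Sum.inl 1) _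
        rw [symmWeight_one, symmWeight_one]
        simp only
        split_ifs <;> omega
    · exact skewWeight_mono one_pos _ (by rw [Fin.le_def]; simp only; omega)
  · rcases i with i | i
    · fin_cases i
      · change 0 < skewWeight N 1 0 _
        rw [skewWeight_apply]
        simp only
        split_ifs <;> omega
      · change 0 < symmWeight hN0 (Sum.inl 1) _
        rw [symmWeight_one]
        simp only
        split_ifs <;> omega
    · change 0 < skewWeight N 1 i _
      rw [skewWeight_apply]
      simp only
      split_ifs <;> omega

end symmetric

end LocalHecke

/-! ### The split quaternionic Hecke algebra -/

namespace LocalHecke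

section index

/-- The numbering of the rows of a matrix of `2 × 2` matrices for which the form of the split
quaternionic modular group pairs the index `i` with `Fin.rev i`. -/
def splitIndex (n : ℕ) : (Fin n ⊕ Fin n) × Fin 2 ≃ Fin (2 * n + 2 * n) :=
  (Equiv.sumProdDistrib _ _ _).trans
    ((Equiv.sumCongr (finProdFinEquiv.trans (finCongr (mul_comm n 2)))
      ((Equiv.prodCongr (Equiv.refl _) Fin.revPerm).trans
        (finProdFinEquiv.trans (finCongr (mul_comm n 2))))).trans (modIndex (2 * n)))

variable {n : ℕ}

lemma splitIndex_inl (i : Fin n) (x : Fin 2) :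
    (splitIndex n (Sum.inl i, x) : ℕ) = 2 * i + x :=
  add_comm (x : ℕ) (2 * i)

lemma splitIndex_inr (i : Fin n) (x : Fin 2) :
    (splitIndex n (Sum.inr i, x) : ℕ) = 2 * n + 2 * n - 2 - 2 * i + x := by
  have h : (splitIndex n (Sum.inr i, x) : ℕ) = 2 * n + 2 * n - 1 - (x.rev + 2 * i : ℕ) :=
    modIndex_inr _
  rw [h, Fin.val_rev]
  omega

lemma rev_splitIndex (j : (Fin n ⊕ Fin n) × Fin 2) :
    (splitIndex n j).rev = splitIndex n (j.1.swap, j.2.rev) := by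
  obtain ⟨i | i, x⟩ := j <;> refine Fin.ext ?_ <;>
    simp only [Fin.val_rev, splitIndex_inl, splitIndex_inr, Sum.swap_inl, Sum.swap_inr] <;> omega

/-- The sign of the pairing of a row with its partner. -/
def splitSign (K : Type*) [Ring K] (j : (Fin n ⊕ Fin n) × Fin 2) : K :=
  Sum.elim (fun _ => 1) (fun _ => -1) j.1 * ![1, -1] j.2

/-- The signs of the symmetric form of the split quaternionic modular group. -/
def splitSigns (K : Type*) [Ring K] (n : ℕ) : Signs K (2 * n + 2 * n) where
  s i := splitSign K ((splitIndex n).symm i)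
  ε := 1
  s_eq i := by
    obtain ⟨⟨i | i, x⟩, rfl⟩ := (splitIndex n).surjective i <;> fin_cases x <;> simp [splitSign]
  ε_eq := Or.inl rfl
  s_rev i := by
    obtain ⟨j, rfl⟩ := (splitIndex n).surjective i
    rw [rev_splitIndex, Equiv.symm_apply_apply, Equiv.symm_apply_apply]
    obtain ⟨i | i, x⟩ := j <;> fin_cases x <;> simp [splitSign]
  rev_ne i h := by
    have := congrArg Fin.val h
    rw [Fin.val_rev] at this
    omega

end index

section split

variable {F : Type*} [Field F] {A : Type*} [Ring A] [StarRing A] [Algebra F A] {n : ℕ}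
  {φ : A ≃ₐ[F] Matrix (Fin 2) (Fin 2) F}

/-- The canonical involution of a split quaternion algebra is the adjugate: an element that is not
in the center satisfies only one quadratic equation. -/
lemma StarIsCanonical.map_star (hs : StarIsCanonical F A) (x : A) :
    φ (star x) = !![φ x 1 1, -φ x 0 1; -φ x 1 0, φ x 0 0] := by
  obtain ⟨t, ht⟩ := hs.exists_trace x
  obtain ⟨a, ha⟩ := hs.2 x
  have ht' := congrArg φ ht
  have ha' := congrArg φ ha
  rw [map_add, AlgEquiv.commutes] at ht'
  rw [map_mul, AlgEquiv.commutes] at ha'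
  have t00 := congrFun (congrFun ht' 0) 0
  have t01 := congrFun (congrFun ht' 0) 1
  have t10 := congrFun (congrFun ht' 1) 0
  have t11 := congrFun (congrFun ht' 1) 1
  have a00 := congrFun (congrFun ha' 0) 0
  have a01 := congrFun (congrFun ha' 0) 1
  have a10 := congrFun (congrFun ha' 1) 0
  have a11 := congrFun (congrFun ha' 1) 1
  simp only [Matrix.add_apply, Matrix.algebraMap_matrix_apply, Matrix.mul_apply, Fin.sum_univ_two,
    if_true, zero_ne_one, one_ne_zero, if_false, Algebra.algebraMap_self_apply]
    at t00 t01 t10 t11 a00 a01 a10 a11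
  have y00 := eq_sub_of_add_eq' t00
  have y01 := eq_neg_of_add_eq_zero_right t01
  have y10 := eq_neg_of_add_eq_zero_right t10
  have y11 := eq_sub_of_add_eq' t11
  by_cases h : t = φ x 0 0 + φ x 1 1
  · ext i j
    fin_cases i <;> fin_cases j
    · change φ (star x) 0 0 = φ x 1 1
      rw [y00, h]; ring
    · exact y01
    · exact y10
    · change φ (star x) 1 1 = φ x 0 0
      rw [y11, h]; ring
  · have h' : t - φ x 0 0 - φ x 1 1 ≠ 0 := fun h0 => h (by linear_combination h0)
    have e01 : φ x 0 1 = 0 := (mul_eq_zero.1 (show φ x 0 1 * (t - φ x 0 0 - φ x 1 1) = 0 by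
      linear_combination a01 - φ x 0 0 * t01 - φ x 0 1 * t11)).resolve_right h'
    have e10 : φ x 1 0 = 0 := (mul_eq_zero.1 (show φ x 1 0 * (t - φ x 0 0 - φ x 1 1) = 0 by
      linear_combination a10 - φ x 1 0 * t00 - φ x 1 1 * t10)).resolve_right h'
    have e11 : φ x 1 1 = φ x 0 0 := sub_eq_zero.1 ((mul_eq_zero.1
      (show (φ x 1 1 - φ x 0 0) * (t - φ x 0 0 - φ x 1 1) = 0 by
        linear_combination a11 - φ x 1 0 * t01 - φ x 1 1 * t11 - a00 + φ x 0 0 * t00 +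
          φ x 0 1 * t10)).resolve_right h')
    have hx : φ x = algebraMap F _ (φ x 0 0) := by
      ext i j
      fin_cases i <;> fin_cases j <;> simp [Matrix.algebraMap_matrix_apply, e01, e10, e11]
    have hx' : x = algebraMap F A (φ x 0 0) := φ.injective (by rw [AlgEquiv.commutes, ← hx])
    rw [hx', hs.1, ← hx']
    ext i j
    fin_cases i <;> fin_cases j <;> simp [e01, e10, e11]

/-- Over `Mat₂` the canonical involution is transposition conjugated by the alternating form of size
two, so that the skew-hermitian form becomes symmetric. -/
lemma StarIsCanonical.flatten_conj_J [StarRing F] (hst : ∀ x : F, star x = x)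
    (hs : StarIsCanonical F A) (M : Matrix (Fin n ⊕ Fin n) (Fin n ⊕ Fin n) A)
    (a b : (Fin n ⊕ Fin n) × Fin 2) :
    ((flattenEquiv φ (splitIndex n) M)ᴴ * (splitSigns F n).J * flattenEquiv φ (splitIndex n) M)
      (splitIndex n a) (splitIndex n b) =
      ![1, -1] a.2 * flatten φ (Mᴴ * J A n * M) (a.1, a.2.rev) b := by
  have h1 : (Mᴴ * J A n * M) a.1 b.1 = ∑ j : Fin n,
      (star (M (Sum.inl j) a.1) * M (Sum.inr j) b.1 - star (M (Sum.inr j) a.1) * M (Sum.inl j) b.1) := by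
    rw [mul_assoc, Matrix.mul_apply, Fintype.sum_sum_type, ← Finset.sum_add_distrib]
    refine Finset.sum_congr rfl fun j _ => ?_
    rw [Matrix.conjTranspose_apply, Matrix.conjTranspose_apply, sub_eq_add_neg, ← mul_neg]
    congr 2
    · simp [J, Matrix.mul_apply, Matrix.one_apply]
    · simp [J, Matrix.mul_apply, Matrix.one_apply]
  rw [Signs.conj_J_mul_apply, Signs.form, ← (splitIndex n).sum_comp, flatten_apply, h1, map_sum,
    Matrix.sum_apply, Finset.mul_sum, Fintype.sum_prod_type, Fintype.sum_sum_type,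
    ← Finset.sum_add_distrib]
  refine Finset.sum_congr rfl fun j _ => ?_
  obtain ⟨i, x⟩ := a
  obtain ⟨l, y⟩ := b
  simp only [hst, rev_splitIndex, flattenEquiv_apply, Equiv.symm_apply_apply, flatten_apply,
    splitSigns, splitSign, map_sub, map_mul, Matrix.sub_apply, Matrix.mul_apply, Fin.sum_univ_two,
    hs.map_star]
  fin_cases x <;> simp <;> ring

/-- Similitudes of the split quaternionic form `J` are similitudes of a symmetric form. -/
lemma StarIsCanonical.sim_flattenEquiv [StarRing F] (hst : ∀ x : F, star x = x)
    (hs : StarIsCanonical F A) (M : Matrix (Fin n ⊕ Fin n) (Fin n ⊕ Fin n) A) (c : F) :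
    (flattenEquiv φ (splitIndex n) M)ᴴ * (splitSigns F n).J * flattenEquiv φ (splitIndex n) M =
      c • (splitSigns F n).J ↔ HasSimilitude M c := by
  have h1 : ∀ a b, (splitSigns F n).J (splitIndex n a) (splitIndex n b) =
      ![1, -1] a.2 * flatten φ (J A n) (a.1, a.2.rev) b := fun a b => by
    have := hs.flatten_conj_J (φ := φ) hst (1 : Matrix (Fin n ⊕ Fin n) (Fin n ⊕ Fin n) A) a b
    simpa using this
  have h2 : ∀ a b, flatten φ (c • J A n) a b = c * flatten φ (J A n) a b := fun a b => by
    rw [flatten_apply, Matrix.smul_apply, map_smul]; rfl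
  have h3 : ∀ x : Fin 2, (![1, -1] x : F) ≠ 0 := fun x => by fin_cases x <;> simp
  constructor
  · intro h
    ext i l
    refine φ.injective ?_
    ext x y
    have := congrFun (congrFun h (splitIndex n (i, x.rev))) (splitIndex n (l, y))
    rw [hs.flatten_conj_J hst, Matrix.smul_apply, h1, smul_eq_mul, mul_left_comm, ← h2] at this
    have h4 := mul_left_cancel₀ (h3 _) this
    rwa [Fin.rev_rev] at h4
  · intro h
    ext i j
    obtain ⟨i, rfl⟩ := (splitIndex n).surjective i
    obtain ⟨j, rfl⟩ := (splitIndex n).surjective j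
    rw [hs.flatten_conj_J hst, Matrix.smul_apply, h1, smul_eq_mul, mul_left_comm, ← h2, h]

lemma det_flattenEquiv {ι : Type*} [Fintype ι] [DecidableEq ι] {r d : ℕ}
    (φ : A ≃ₐ[F] Matrix (Fin r) (Fin r) F) (e : ι × Fin r ≃ Fin d) (M : Matrix ι ι A) :
    (flattenEquiv φ e M).det = redNorm φ M :=
  Matrix.det_reindex_self e (flatten φ M)

lemma redNorm_conj {ι : Type*} [Fintype ι] [DecidableEq ι] {r : ℕ}
    (φ : A ≃ₐ[F] Matrix (Fin r) (Fin r) F) (x g : (Matrix ι ι A)ˣ) :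
    redNorm φ ((x * g * x⁻¹ : (Matrix ι ι A)ˣ) : Matrix ι ι A) = redNorm φ (g : Matrix ι ι A) := by
  rw [Units.val_mul, Units.val_mul, map_mul, map_mul, mul_comm, ← mul_assoc, ← map_mul,
    Units.inv_mul, map_one, one_mul]

variable {𝔬 : Type*} [CommRing 𝔬] [IsDomain 𝔬] [IsDiscreteValuationRing 𝔬]
  [Finite (IsLocalRing.ResidueField 𝔬)] [Algebra 𝔬 F] [IsFractionRing 𝔬 F]
  [Algebra 𝔬 A] [IsScalarTower 𝔬 F A] {Λ : Subalgebra 𝔬 A}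

/-- The adjugate preserves the order `Mat₂(𝔬)`. -/
lemma StarIsCanonical.isStarOrder (hs : StarIsCanonical F A) (hΛ : IsMaximalOrder F Λ)
    (hφ : ∀ a : A, a ∈ Λ ↔ ∀ i j, φ a i j ∈ (⊥ : Subalgebra 𝔬 F)) : IsStarOrder F Λ := by
  refine ⟨hΛ.1.1, hΛ.1.2, fun x hx => ?_, fun a ha => ?_⟩
  · rw [hφ] at hx ⊢
    rw [hs.map_star]
    intro i j
    fin_cases i <;> fin_cases j
    exacts [hx 1 1, neg_mem (hx 0 1), neg_mem (hx 1 0), hx 0 0]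
  · have h1 := (hφ _).1 ha 0 0
    rw [AlgEquiv.commutes, Matrix.algebraMap_matrix_apply, if_pos rfl] at h1
    exact Algebra.mem_bot.1 h1

/-- The commensurability condition for the proper modular groups. -/
lemma IsStarOrder.isHeckeTriple_proper (h : IsStarOrder F Λ)
    (φ : A ≃ₐ[F] Matrix (Fin 2) (Fin 2) F) (n : ℕ) :
    IsHeckeTriple (properDelta Λ φ n) (properSp Λ φ n) (properSp Λ φ n) := by
  refine IsHeckeTriple.of_diagonal ?_ fun x hx => ?_
  · rintro g ⟨hg, m, hm⟩
    exact ⟨hg.1, m, m.ne_zero, hm⟩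
  · obtain ⟨-, m, hm, hxm, -⟩ := hx
    have hm' : algebraMap 𝔬 F m ≠ 0 := fun h0 =>
      hm (IsFractionRing.injective 𝔬 F (h0.trans (map_zero _).symm))
    rw [← hasSimilitude_algebraMap (F := F)] at hxm
    refine mem_commensurator h.fg h.span (MonoidHom.id _) (G := properSp Λ φ n) (fun g hg => hg.1)
      (fun g hg hc => ⟨hc, ?_⟩) (fun g hg hc => ⟨hc, ?_⟩)
    · obtain ⟨u, hu, hd⟩ := hg.2
      rw [← hasSimilitude_algebraMap (F := F)] at hu
      exact ⟨u, hasSimilitude_algebraMap.1 (hxm.conj hm' hu).1, by rw [redNorm_conj, hd]⟩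
    · obtain ⟨u, hu, hd⟩ := hg.2
      rw [← hasSimilitude_algebraMap (F := F)] at hu
      refine ⟨u, hasSimilitude_algebraMap.1 (hxm.conj hm' hu).2, ?_⟩
      have := redNorm_conj φ x⁻¹ g
      rw [inv_inv] at this
      rw [this, hd]

end split

end LocalHecke

namespace LocalHecke

lemma Signs.diagUnit_mem_properGroup {K : Type*} [Field K] [StarRing K] {N : ℕ}
    {σ : Signs K (N + N)} (hst : ∀ x : K, star x = x) {f : Fin (N + N) → K} (hf : ∀ j, f j ≠ 0)
    {m : K} (hm : m ≠ 0) (h : ∀ j, f j * f j.rev = m) : diagUnit f hf ∈ σ.properGroup := by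
  have h1 : (diagUnit f hf : Matrix (Fin (N + N)) (Fin (N + N)) K)ᴴ * σ.J *
      (diagUnit f hf : Matrix (Fin (N + N)) (Fin (N + N)) K) = m • σ.J := by
    ext i j
    rw [coe_diagUnit, Matrix.diagonal_conjTranspose, Matrix.mul_diagonal, Matrix.diagonal_mul,
      Pi.star_apply, hst, Matrix.smul_apply, Signs.J, smul_eq_mul]
    split_ifs with hij
    · rw [hij, ← h i]; ring
    · simp
  exact ⟨m, hm, h1, σ.det_of_lower hst h1 fun i j hij => diagUnit_apply_ne i j (ne_of_lt hij)⟩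

lemma symmWeight_nonneg {N : ℕ} (hN : 0 < N) (l : Fin 2 ⊕ Set.Icc 2 N) (j : Fin (N + N)) :
    0 ≤ symmWeight hN l j := by
  have h : ∀ (k : ℕ) (j : Fin (N + N)), 0 ≤ skewWeight N 1 k j := fun k j => by
    rw [skewWeight_apply]
    split_ifs <;> norm_num
  rcases l with l | k
  · fin_cases l
    exacts [h 0 j, h 0 _]
  · exact h k j

lemma getD_append {R : Type*} (l l' : List R) (m : ℕ) (z : R) :
    (l ++ l').getD m z = if m < l.length then l.getD m z else l'.getD (m - l.length) z := by
  split_ifs with h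
  · exact List.getD_append _ _ _ _ h
  · exact List.getD_append_right _ _ _ _ (not_lt.1 h)

lemma getD_replicate {R : Type*} (b m : ℕ) (y z : R) :
    (List.replicate b y).getD m z = if m < b then y else z := by
  rw [List.getD_eq_getElem?_getD, List.getElem?_replicate]
  split_ifs <;> rfl

section lists

variable {R : Type*} [Semiring R] (π : R) {n : ℕ}

lemma prodPos_inl (i : Fin n) (x : Fin 2) : prodPos (sumPos n) 2 (Sum.inl i, x) = 2 * i + x := rfl

lemma prodPos_inr (i : Fin n) (x : Fin 2) :
    prodPos (sumPos n) 2 (Sum.inr i, x) = 2 * (n + i) + x := rfl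

/-- The diagonal entries of the generator `S`. -/
lemma getD_S (j : (Fin n ⊕ Fin n) × Fin 2) :
    π ^ (skewWeight (2 * n) 1 0 (splitIndex n j)).toNat =
      (List.replicate (2 * n) 1 ++ List.replicate (2 * n) π).getD (prodPos (sumPos n) 2 j) 0 := by
  rw [skewWeight_apply, if_pos rfl]
  obtain ⟨a | a, x⟩ := j
  · rw [splitIndex_inl, prodPos_inl, getD_replicate_append _ _ _ (by omega)]
    split_ifs <;> simp
  · rw [splitIndex_inr, prodPos_inr, getD_replicate_append _ _ _ (by omega), if_neg (by omega),
      if_neg (by omega)]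
    simp

/-- The diagonal entries of the generator `S'`. -/
lemma getD_S' (hn : 0 < 2 * n) (j : (Fin n ⊕ Fin n) × Fin 2) :
    π ^ (symmWeight hn (Sum.inl 1) (splitIndex n j)).toNat =
      (List.replicate (2 * n - 1) 1 ++ [π] ++ List.replicate (2 * n - 2) π ++ [1, π]).getD
        (prodPos (sumPos n) 2 j) 0 := by
  have h1 : [1, π] = List.replicate 1 1 ++ List.replicate 1 π := rfl
  have h2 : [π] = List.replicate 1 π := rfl
  rw [symmWeight_one, h1, h2]
  simp only [getD_append, getD_replicate, List.length_append, List.length_replicate]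
  obtain ⟨a | a, x⟩ := j
  · rw [splitIndex_inl, prodPos_inl]
    split_ifs <;> first | (exfalso; omega) | simp
  · rw [splitIndex_inr, prodPos_inr]
    split_ifs <;> first | (exfalso; omega) | simp

/-- The diagonal entries of the generators `R` of even index. -/
lemma getD_even {i : ℕ} (hi : 1 ≤ i) (hin : i ≤ n) (j : (Fin n ⊕ Fin n) × Fin 2) :
    π ^ (skewWeight (2 * n) 1 (2 * i) (splitIndex n j)).toNat =
      (List.replicate (2 * n - 2 * i) 1 ++ List.replicate (2 * i) π ++
        List.replicate (2 * n - 2 * i) (π ^ 2) ++ List.replicate (2 * i) π).getD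
          (prodPos (sumPos n) 2 j) 0 := by
  rw [skewWeight_apply, if_neg (by omega)]
  simp only [getD_append, getD_replicate, List.length_append, List.length_replicate]
  obtain ⟨a | a, x⟩ := j
  · rw [splitIndex_inl, prodPos_inl]
    split_ifs <;> first | (exfalso; omega) | simp
  · rw [splitIndex_inr, prodPos_inr]
    split_ifs <;> first | (exfalso; omega) | simp

/-- The diagonal entries of the generators `R` of odd index. -/
lemma getD_odd {i : ℕ} (hi : 2 ≤ i) (hin : i ≤ n) (j : (Fin n ⊕ Fin n) × Fin 2) :
    π ^ (skewWeight (2 * n) 1 (2 * i - 1) (splitIndex n j)).toNat =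
      (List.replicate (2 * n - 2 * i + 1) 1 ++ List.replicate (2 * i - 1) π ++
        List.replicate (2 * n - 2 * i) (π ^ 2) ++ [π, π ^ 2] ++
        List.replicate (2 * i - 2) π).getD (prodPos (sumPos n) 2 j) 0 := by
  have h1 : [π, π ^ 2] = List.replicate 1 π ++ List.replicate 1 (π ^ 2) := rfl
  rw [skewWeight_apply, if_neg (by omega), h1]
  simp only [getD_append, getD_replicate, List.length_append, List.length_replicate]
  obtain ⟨a | a, x⟩ := j
  · rw [splitIndex_inl, prodPos_inl]
    split_ifs <;> first | (exfalso; omega) | simp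
  · rw [splitIndex_inr, prodPos_inr]
    split_ifs <;> first | (exfalso; omega) | simp

end lists

section

variable {𝔬 : Type*} [CommRing 𝔬] [IsDomain 𝔬] [IsDiscreteValuationRing 𝔬]
  [Finite (IsLocalRing.ResidueField 𝔬)] [CharZero 𝔬] {F : Type*} [Field F] [Algebra 𝔬 F]
  [IsFractionRing 𝔬 F] {A : Type*} [Ring A] [Algebra F A] [Algebra 𝔬 A] [IsScalarTower 𝔬 F A]
  [StarRing A]

/-- The local Hecke algebra of the split quaternionic modular group. -/
theorem splitQuaternionic {n : ℕ} (hn : 1 ≤ n) (hs : StarIsCanonical F A) (Λ : Subalgebra 𝔬 A)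
    (hΛ : IsMaximalOrder F Λ) (φ : A ≃ₐ[F] Matrix (Fin 2) (Fin 2) F)
    (hφ : ∀ a : A, a ∈ Λ ↔ ∀ i j, φ a i j ∈ (⊥ : Subalgebra 𝔬 F))
    (p : 𝔬) (hp : Irreducible p) (π : F) (hπ : π = algebraMap 𝔬 F p) :
    ∃ (_ : IsHeckeTriple (properDelta Λ φ n) (properSp Λ φ n) (properSp Λ φ n))
      (S S' : properDelta Λ φ n) (R : Set.Icc 2 (2 * n) → properDelta Λ φ n),
      flatten φ ((S : (Matrix (Fin n ⊕ Fin n) (Fin n ⊕ Fin n) A)ˣ) : Matrix _ _ A) =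
        blockDiag (prodPos (sumPos n) 2) (List.replicate (2 * n) 1 ++ List.replicate (2 * n) π) ∧
      flatten φ ((S' : (Matrix (Fin n ⊕ Fin n) (Fin n ⊕ Fin n) A)ˣ) : Matrix _ _ A) =
        blockDiag (prodPos (sumPos n) 2) (List.replicate (2 * n - 1) 1 ++ [π] ++
          List.replicate (2 * n - 2) π ++ [1, π]) ∧
      (∀ (k : Set.Icc 2 (2 * n)) (i : ℕ), (k : ℕ) = 2 * i →
        flatten φ ((R k : (Matrix (Fin n ⊕ Fin n) (Fin n ⊕ Fin n) A)ˣ) : Matrix _ _ A) =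
        blockDiag (prodPos (sumPos n) 2)
          (List.replicate (2 * n - 2 * i) 1 ++ List.replicate (2 * i) π ++
            List.replicate (2 * n - 2 * i) (π ^ 2) ++ List.replicate (2 * i) π)) ∧
      (∀ (k : Set.Icc 2 (2 * n)) (i : ℕ), (k : ℕ) + 1 = 2 * i →
        flatten φ ((R k : (Matrix (Fin n ⊕ Fin n) (Fin n ⊕ Fin n) A)ˣ) : Matrix _ _ A) =
        blockDiag (prodPos (sumPos n) 2)
          (List.replicate (2 * n - 2 * i + 1) 1 ++ List.replicate (2 * i - 1) π ++
            List.replicate (2 * n - 2 * i) (π ^ 2) ++ [π, π ^ 2] ++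
            List.replicate (2 * i - 2) π)) ∧
      HeckeAlg.IsAlgIndepGenerators
        (Sum.elim ![HeckeAlg.dcoset (properSp Λ φ n) S, HeckeAlg.dcoset (properSp Λ φ n) S']
          (fun k => HeckeAlg.dcoset (properSp Λ φ n) (R k))) := by
  have hN : 2 ≤ 2 * n := by omega
  have hN0 : 0 < 2 * n := by omega
  have hchar : CharZero F := charZero_of_injective_algebraMap (IsFractionRing.injective 𝔬 F)
  let _ : StarRing F := starRingOfComm
  have hst : ∀ x : F, star x = x := fun _ => rfl
  have hP : IsPrimeOrder F (⊥ : Subalgebra 𝔬 F) π := hπ ▸ isPrimeOrder_bot hp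
  obtain ⟨v, hv, hvπ⟩ := hP.exists_valuation
  have hevπ : ev v π = 1 := by rw [ev, hvπ]; rfl
  have hπ0 := hP.ne_zero
  have hO := hs.isStarOrder hΛ hφ
  have hT := hO.isHeckeTriple_proper φ n
  let ρ : (Matrix (Fin n ⊕ Fin n) (Fin n ⊕ Fin n) A)ˣ ≃*
      (Matrix (Fin (2 * n + 2 * n)) (Fin (2 * n + 2 * n)) F)ˣ :=
    Units.mapEquiv (flattenEquiv φ (splitIndex n))
  have hint : ∀ x : (Matrix (Fin n ⊕ Fin n) (Fin n ⊕ Fin n) A)ˣ,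
      IntMat v (ρ x : Matrix (Fin (2 * n + 2 * n)) (Fin (2 * n + 2 * n)) F) ↔
        x ∈ Inv Λ (Fin n ⊕ Fin n) := fun x =>
    (forall_congr' fun i => forall_congr' fun j => hv _).trans
      (flattenEquiv_mem_iff (S := ((⊥ : Subalgebra 𝔬 F) : Set F)) hφ (splitIndex n)
        (x : Matrix (Fin n ⊕ Fin n) (Fin n ⊕ Fin n) A))
  have hprop : ∀ x : (Matrix (Fin n ⊕ Fin n) (Fin n ⊕ Fin n) A)ˣ,
      ρ x ∈ (splitSigns F n).properGroup ↔ ∃ c : F, c ≠ 0 ∧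
        HasSimilitude (x : Matrix (Fin n ⊕ Fin n) (Fin n ⊕ Fin n) A) c ∧
        redNorm φ (x : Matrix (Fin n ⊕ Fin n) (Fin n ⊕ Fin n) A) = c ^ (2 * n) := fun x =>
    exists_congr fun c => and_congr_right fun _ => and_congr (hs.sim_flattenEquiv hst _ c)
      (by rw [← det_flattenEquiv φ (splitIndex n)]; rfl)
  have hne : ∀ m : 𝔬, m ≠ 0 → algebraMap 𝔬 F m ≠ 0 := fun m hm h0 =>
    hm (IsFractionRing.injective 𝔬 F (h0.trans (map_zero _).symm))
  have hΔ : ∀ x, x ∈ properDelta Λ φ n ↔ ρ x ∈ (splitSigns F n).properGroup ∧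
      IntMat v (ρ x : Matrix (Fin (2 * n + 2 * n)) (Fin (2 * n + 2 * n)) F) := by
    intro x
    rw [hint, hprop]
    constructor
    · rintro ⟨hx, m, hm, hxm, hd⟩
      exact ⟨⟨_, hne m hm, hasSimilitude_algebraMap.2 hxm, hd⟩, hx⟩
    · rintro ⟨⟨c, hc, hxc, hd⟩, hx⟩
      obtain ⟨m, hm, hxm, rfl⟩ := hO.exists_similitude hn hx hc hxc
      exact ⟨hx, m, hm, hxm, hd⟩
  have hG : ∀ x, x ∈ properSp Λ φ n ↔ ρ x ∈ intGroup v (splitSigns F n).properGroup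
      (fun _ : Fin (2 * n + 2 * n) => True) := by
    intro x
    rw [mem_intGroup_true, ← map_inv, hint, hint, hprop]
    constructor
    · rintro ⟨hx, m, hxm, hd⟩
      exact ⟨⟨_, hne _ m.ne_zero, hasSimilitude_algebraMap.2 hxm, hd⟩, hx⟩
    · rintro ⟨⟨c, hc, hxc, hd⟩, hx⟩
      obtain ⟨m, hxm, rfl⟩ := hO.exists_unit_similitude hn hx hc hxc
      exact ⟨hx, m, hxm, hd⟩
  let f : Fin 2 ⊕ Set.Icc 2 (2 * n) → Fin (2 * n + 2 * n) → F := fun l j =>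
    π ^ (symmWeight hN0 l j).toNat
  have hf : ∀ l j, f l j ≠ 0 := fun l j => pow_ne_zero _ hπ0
  have hfw : ∀ l j, ev v (f l j) = symmWeight hN0 l j := fun l j => by
    rw [ev_pow v hπ0, hevπ, mul_one, Int.toNat_of_nonneg (symmWeight_nonneg hN0 l j)]
  let T : Fin 2 ⊕ Set.Icc 2 (2 * n) → properDelta Λ φ n := fun l =>
    ⟨ρ.symm (diagUnit (f l) (hf l)), by
      rw [hΔ, MulEquiv.apply_symm_apply]
      refine ⟨?_, intMat_diagUnit fun j => (le_v_iff v (hf l _) 0).2 ?_⟩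
      · obtain ⟨c, hc⟩ := symmWeight_mem_pairedExps hN l
        refine Signs.diagUnit_mem_properGroup hst (hf l) (pow_ne_zero c.toNat hπ0) fun j => ?_
        rw [← hc j, Int.toNat_add (symmWeight_nonneg hN0 l j) (symmWeight_nonneg hN0 l _), pow_add]
      · rw [hfw]
        exact symmWeight_nonneg hN0 l j⟩
  have hρT : ∀ l, ρ (T l) = diagUnit (f l) (hf l) := fun l => ρ.apply_symm_apply _
  have hTf : ∀ (l : Fin 2 ⊕ Set.Icc 2 (2 * n)) (L : List F),
      (∀ j, f l (splitIndex n j) = L.getD (prodPos (sumPos n) 2 j) 0) →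
      flatten φ ((T l : (Matrix (Fin n ⊕ Fin n) (Fin n ⊕ Fin n) A)ˣ) : Matrix _ _ A) =
        blockDiag (prodPos (sumPos n) 2) L := fun l L h => by
    rw [flatten_eq_of_flattenEquiv (congrArg Units.val (hρT l)), blockDiag]
    exact congrArg _ (funext h)
  have hgen := symm_isAlgIndepGenerators (v := v) hN hst rfl ρ hG hΔ T
    (fun l => by rw [hρT]; exact diagUnit_apply_ne)
    (fun l => funext fun j => by rw [hρT, exps_diagUnit, hfw])
  refine ⟨hT, T (Sum.inl 0), T (Sum.inl 1), fun k => T (Sum.inr k), hTf _ _ ?_, hTf _ _ ?_,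
    fun k i hk => hTf _ _ ?_, fun k i hk => hTf _ _ ?_, ?_⟩
  · exact getD_S π
  · exact getD_S' π hN0
  · intro j
    change π ^ (skewWeight (2 * n) 1 k (splitIndex n j)).toNat = _
    rw [hk]
    exact getD_even π (by have := k.2.1; omega) (by have := k.2.2; omega) j
  · intro j
    change π ^ (skewWeight (2 * n) 1 k (splitIndex n j)).toNat = _
    rw [show (k : ℕ) = 2 * i - 1 by omega]
    exact getD_odd π (by have := k.2.1; omega) (by have := k.2.2; omega) j
  · convert hgen using 1
    funext l
    rcases l with l | k
    · fin_cases l <;> rfl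
    · rfl

end

end LocalHecke

/-! ### The five local Hecke algebras -/

theorem mainTheorem3
    -- `𝔬` is the valuation ring of a nonarchimedean local field `F` of characteristic zero
    {𝔬 : Type*} [CommRing 𝔬] [IsDomain 𝔬] [IsDiscreteValuationRing 𝔬]
    [IsAdicComplete (IsLocalRing.maximalIdeal 𝔬) 𝔬] [Finite (IsLocalRing.ResidueField 𝔬)]
    [CharZero 𝔬]
    {F : Type*} [Field F] [Algebra 𝔬 F] [IsFractionRing 𝔬 F]
    (n : ℕ) (hn : 1 ≤ n) :
    -- A) the unimodular case
    (∀ {A : Type*} [Ring A] [Algebra F A] [Algebra 𝔬 A] [IsScalarTower 𝔬 F A]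
        [Algebra.IsCentral F A] [IsSimpleRing A] [FiniteDimensional F A]
        {D : Type*} [DivisionRing D] [Algebra F D] [Algebra 𝔬 D] [IsScalarTower 𝔬 F D]
        (Λ : Subalgebra 𝔬 A) (_ : LocalHecke.IsMaximalOrder F Λ)
        (O : Subalgebra 𝔬 D) (_ : LocalHecke.IsMaximalOrder F O)
        (r : ℕ) (φ : A ≃ₐ[F] Matrix (Fin r) (Fin r) D)
        (_ : ∀ a : A, a ∈ Λ ↔ ∀ i j, φ a i j ∈ O)
        (π : D) (_ : LocalHecke.IsPrimeElement O π),
      ∃ (_ : IsHeckeTriple (LocalHecke.Inv Λ (Fin n)) (LocalHecke.GLn Λ (Fin n))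
            (LocalHecke.GLn Λ (Fin n)))
        (T : Set.Icc 1 (n * r) → LocalHecke.Inv Λ (Fin n)),
        (∀ i, LocalHecke.flatten φ ((T i : (Matrix (Fin n) (Fin n) A)ˣ) : Matrix (Fin n) (Fin n) A) =
          LocalHecke.blockDiag (LocalHecke.prodPos Fin.val r)
            (List.replicate (n * r - i) 1 ++ List.replicate i π)) ∧
        HeckeAlg.IsAlgIndepGenerators
          (fun i => HeckeAlg.dcoset (LocalHecke.GLn Λ (Fin n)) (T i))) ∧
    -- B) the inert hermitian modular case
    (∀ {E : Type*} [Field E] [Algebra F E] [Algebra 𝔬 E] [IsScalarTower 𝔬 F E] [StarRing E]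
        (_ : Module.finrank F E = 2) (_ : LocalHecke.StarIsConj F E)
        (Λ : Subalgebra 𝔬 E) (_ : LocalHecke.IsMaximalOrder F Λ) (_ : LocalHecke.IsInert Λ)
        (π : E) (_ : LocalHecke.IsPrimeElement Λ π) (_ : star π = π),
      ∃ (_ : IsHeckeTriple (LocalHecke.Delta Λ n) (LocalHecke.Spn Λ n) (LocalHecke.Spn Λ n))
        (T : Fin (n + 1) → LocalHecke.Delta Λ n),
        (((T 0 : (Matrix (Fin n ⊕ Fin n) (Fin n ⊕ Fin n) E)ˣ) : Matrix _ _ E) =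
          LocalHecke.blockDiag (LocalHecke.sumPos n)
            (List.replicate n 1 ++ List.replicate n π)) ∧
        (∀ i : Fin (n + 1), i ≠ 0 →
          ((T i : (Matrix (Fin n ⊕ Fin n) (Fin n ⊕ Fin n) E)ˣ) : Matrix _ _ E) =
          LocalHecke.blockDiag (LocalHecke.sumPos n)
            (List.replicate (n - i) 1 ++ List.replicate i π ++
              List.replicate (n - i) (π ^ 2) ++ List.replicate i π)) ∧
        HeckeAlg.IsAlgIndepGenerators
          (fun i => HeckeAlg.dcoset (LocalHecke.Spn Λ n) (T i))) ∧
    -- C) the ramified hermitian modular case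
    (∀ {E : Type*} [Field E] [Algebra F E] [Algebra 𝔬 E] [IsScalarTower 𝔬 F E] [StarRing E]
        (_ : Module.finrank F E = 2) (_ : LocalHecke.StarIsConj F E)
        (Λ : Subalgebra 𝔬 E) (_ : LocalHecke.IsMaximalOrder F Λ) (_ : LocalHecke.IsRamified Λ)
        (π : E) (_ : LocalHecke.IsPrimeElement Λ π),
      ∃ (_ : IsHeckeTriple (LocalHecke.Delta Λ n) (LocalHecke.Spn Λ n) (LocalHecke.Spn Λ n))
        (T : Fin (n + 1) → LocalHecke.Delta Λ n),
        (∀ i : Fin (n + 1),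
          ((T i : (Matrix (Fin n ⊕ Fin n) (Fin n ⊕ Fin n) E)ˣ) : Matrix _ _ E) =
          LocalHecke.blockDiag (LocalHecke.sumPos n)
            (List.replicate (n - i) 1 ++ List.replicate i π ++
              List.replicate (n - i) (π * star π) ++ List.replicate i π)) ∧
        HeckeAlg.IsAlgIndepGenerators
          (fun i => HeckeAlg.dcoset (LocalHecke.Spn Λ n) (T i))) ∧
    -- C) the ramified quaternionic modular case
    (∀ {D : Type*} [DivisionRing D] [Algebra F D] [Algebra 𝔬 D] [IsScalarTower 𝔬 F D] [StarRing D]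
        [Algebra.IsCentral F D] (_ : Module.finrank F D = 4) (_ : LocalHecke.StarIsCanonical F D)
        (Λ : Subalgebra 𝔬 D) (_ : LocalHecke.IsMaximalOrder F Λ)
        (π : D) (_ : LocalHecke.IsPrimeElement Λ π),
      ∃ (_ : IsHeckeTriple (LocalHecke.Delta Λ n) (LocalHecke.Spn Λ n) (LocalHecke.Spn Λ n))
        (T : Fin (n + 1) → LocalHecke.Delta Λ n),
        (∀ i : Fin (n + 1),
          ((T i : (Matrix (Fin n ⊕ Fin n) (Fin n ⊕ Fin n) D)ˣ) : Matrix _ _ D) =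
          LocalHecke.blockDiag (LocalHecke.sumPos n)
            (List.replicate (n - i) 1 ++ List.replicate i π ++
              List.replicate (n - i) (π * star π) ++ List.replicate i π)) ∧
        HeckeAlg.IsAlgIndepGenerators
          (fun i => HeckeAlg.dcoset (LocalHecke.Spn Λ n) (T i))) ∧
    -- D) the split hermitian modular case
    (∀ (π : 𝔬) (_ : Irreducible π),
      ∃ (_ : IsHeckeTriple (LocalHecke.RInv (⊥ : Subalgebra 𝔬 F) (Fin (2 * n)))
            ((LocalHecke.GLn (⊥ : Subalgebra 𝔬 F) (Fin (2 * n))).prod ⊥)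
            ((LocalHecke.GLn (⊥ : Subalgebra 𝔬 F) (Fin (2 * n))).prod ⊥))
        (T : Fin (2 * n + 1) → LocalHecke.RInv (⊥ : Subalgebra 𝔬 F) (Fin (2 * n))),
        (∀ i : Fin (2 * n + 1),
          (((T i : (Matrix (Fin (2 * n)) (Fin (2 * n)) F)ˣ × Multiplicative ℤ).1 :
              (Matrix (Fin (2 * n)) (Fin (2 * n)) F)ˣ) : Matrix (Fin (2 * n)) (Fin (2 * n)) F) =
            LocalHecke.blockDiag Fin.val
              (List.replicate (2 * n - i) 1 ++ List.replicate i (algebraMap 𝔬 F π)) ∧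
          (T i : (Matrix (Fin (2 * n)) (Fin (2 * n)) F)ˣ × Multiplicative ℤ).2 =
            Multiplicative.ofAdd 1) ∧
        HeckeAlg.IsAlgIndepGenerators
          (fun i => HeckeAlg.dcoset
            ((LocalHecke.GLn (⊥ : Subalgebra 𝔬 F) (Fin (2 * n))).prod ⊥) (T i))) ∧
    -- E) the split quaternionic modular case
    (∀ {A : Type*} [Ring A] [Algebra F A] [Algebra 𝔬 A] [IsScalarTower 𝔬 F A] [StarRing A]
        (_ : LocalHecke.StarIsCanonical F A)
        (Λ : Subalgebra 𝔬 A) (_ : LocalHecke.IsMaximalOrder F Λ)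
        (φ : A ≃ₐ[F] Matrix (Fin 2) (Fin 2) F)
        (_ : ∀ a : A, a ∈ Λ ↔ ∀ i j, φ a i j ∈ (⊥ : Subalgebra 𝔬 F))
        (p : 𝔬) (_ : Irreducible p) (π : F) (_ : π = algebraMap 𝔬 F p),
      ∃ (_ : IsHeckeTriple (LocalHecke.properDelta Λ φ n) (LocalHecke.properSp Λ φ n)
            (LocalHecke.properSp Λ φ n))
        (S S' : LocalHecke.properDelta Λ φ n)
        (R : Set.Icc 2 (2 * n) → LocalHecke.properDelta Λ φ n),
        LocalHecke.flatten φ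
            ((S : (Matrix (Fin n ⊕ Fin n) (Fin n ⊕ Fin n) A)ˣ) : Matrix _ _ A) =
          LocalHecke.blockDiag (LocalHecke.prodPos (LocalHecke.sumPos n) 2)
            (List.replicate (2 * n) 1 ++ List.replicate (2 * n) π) ∧
        LocalHecke.flatten φ
            ((S' : (Matrix (Fin n ⊕ Fin n) (Fin n ⊕ Fin n) A)ˣ) : Matrix _ _ A) =
          LocalHecke.blockDiag (LocalHecke.prodPos (LocalHecke.sumPos n) 2)
            (List.replicate (2 * n - 1) 1 ++ [π] ++ List.replicate (2 * n - 2) π ++ [1, π]) ∧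
        (∀ (k : Set.Icc 2 (2 * n)) (i : ℕ), (k : ℕ) = 2 * i →
          LocalHecke.flatten φ
            ((R k : (Matrix (Fin n ⊕ Fin n) (Fin n ⊕ Fin n) A)ˣ) : Matrix _ _ A) =
          LocalHecke.blockDiag (LocalHecke.prodPos (LocalHecke.sumPos n) 2)
            (List.replicate (2 * n - 2 * i) 1 ++ List.replicate (2 * i) π ++
              List.replicate (2 * n - 2 * i) (π ^ 2) ++ List.replicate (2 * i) π)) ∧
        (∀ (k : Set.Icc 2 (2 * n)) (i : ℕ), (k : ℕ) + 1 = 2 * i →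
          LocalHecke.flatten φ
            ((R k : (Matrix (Fin n ⊕ Fin n) (Fin n ⊕ Fin n) A)ˣ) : Matrix _ _ A) =
          LocalHecke.blockDiag (LocalHecke.prodPos (LocalHecke.sumPos n) 2)
            (List.replicate (2 * n - 2 * i + 1) 1 ++ List.replicate (2 * i - 1) π ++
              List.replicate (2 * n - 2 * i) (π ^ 2) ++ [π, π ^ 2] ++
              List.replicate (2 * i - 2) π)) ∧
        HeckeAlg.IsAlgIndepGenerators
          (Sum.elim ![HeckeAlg.dcoset (LocalHecke.properSp Λ φ n) S,
              HeckeAlg.dcoset (LocalHecke.properSp Λ φ n) S']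
            (fun k => HeckeAlg.dcoset (LocalHecke.properSp Λ φ n) (R k)))) := by
  refine ⟨?_, ?_, ?_, ?_, ?_, ?_⟩
  · intro A _ _ _ _ _ _ _ D _ _ _ _ Λ hΛ O hO r φ hφ π hπ
    exact LocalHecke.unimodular hn Λ hΛ O hO r φ hφ π hπ
  · intro E _ _ _ _ _ h2 hs Λ hΛ _ π hπ hsπ
    exact LocalHecke.inertHermitian hn h2 hs Λ hΛ π hπ hsπ
  · intro E _ _ _ _ _ h2 hs Λ hΛ hr π hπ
    exact LocalHecke.ramifiedHermitian hn h2 hs Λ hΛ hr π hπ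
  · intro D _ _ _ _ _ _ h4 hs Λ hΛ π hπ
    exact LocalHecke.ramifiedQuaternionic hn h4 hs Λ hΛ π hπ
  · intro π hπ
    exact LocalHecke.splitHermitian (by omega) hπ
  · intro A _ _ _ _ _ hs Λ hΛ φ hφ p hp π hπ
    exact LocalHecke.splitQuaternionic hn hs Λ hΛ φ hφ p hp π hπ
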